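/- Let $k$ be a commutative ring. **Diagrams.** An oriented tangle diagram in a disk is recorded by its combinatorial data: a finite ordered set of signed crossings, numbered boundary points (each one the beginning or the end of a strand), the oriented edges joining crossings and boundary points, and the closed components without crossings. At a crossing $x$ let $i,j$ be the left and right outgoing and $k,\ell$ the right and left incoming edges. The diagram is *acyclic* if it has no closed component without crossings and its oriented graph $\mathcal G(T)$ (vertices: crossings and boundary points) has no oriented cycle. Let $\tilde{\mathcal S}_T$ be the polynomial ring over $k$ with one variable $t_{x,e}$ of degree $2$ for each flag $(x,e)$ of $\mathcal G(T)$, and one for each closed component without crossings. **The bicomplex $\mathcal R_0(T)$.** It is the tensor product over $\tilde{\mathcal S}_T$ of the horizontal Koszul complexes of $t_a-t_b$ (for each edge, directed from flag $a$ to flag $b$), of $0$ (for each closed component without crossings), and, for each crossing $x$, of the vertical two-term complex $L'_x\to L''_x$ ($x$ positive) or $L''_x\to L'_x\{-2\}$ ($x$ negative), with $L''_x$ in cohomological degree $0$. Here $L'_x$ and $L''_x$ are the Koszul complexes of $(t_i+t_j-t_k-t_\ell,\ t_it_j-t_kt_\ell)$ and of $(t_i-t_\ell,\ t_j-t_k)$,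 and the vertical maps are chain maps that lift the projection, respectively multiplication by $t_i-t_k$, on the quotient rings. The Koszul differentials have internal degree $2$, the vertical maps internal degree $0$, $\{-2\}$ lowers the internal degree of each element by $2$, and the horizontal degree-$0$ part of a Koszul complex is the unshifted ring. The terms of $\mathcal R_0(T)$ are indexed by the smoothings $s$, i.e. the choices of $L'_x$ or $L''_x$ at every crossing; write $\mathcal R_0(T)_s$ for the corresponding Koszul complex. $\mathcal K_0^i(T)$ denotes the $i$-th horizontal (Koszul) homology of $\mathcal R_0(T)$; it is a complex for the vertical differential. **The naive complex $\mathcal N(T)$.** It is the complex with terms $\mathcal N(T)_s=\tilde{\mathcal S}_T/(\text{the Koszul sequence of } s)$, with the same internal shifts, and with differential induced by the projections at positive crossings and by multiplication by $t_i-t_k$ at negative crossings. **Statement.** Let $\eta$ be an oriented planar arc diagram with $m$ ordered holes and no endpoints on its outer circle (only the combinatorial pairing of endpoints by arcs matters, so planarity is not needed), let $\mathcal A(\eta)$ be its set of arcs, and let $T_1,\dots,T_m$ be acyclic oriented tangle diagrams whose boundaries match the holes of $\eta$. Let $T$ be the closed diagram obtained by pasting the $T_j$ into $\eta$. Let $\mathcal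 U=k[\mathcal A(\eta)]$ act on $\bigotimes_j\mathcal N(T_j)$ (tensor product over $k$) from the left by letting $t_\alpha$ act as $t_{\alpha_+}$ and from the right by letting $t_\alpha$ act as $t_{\alpha_-}$, where $\alpha_+$ and $\alpha_-$ are the endpoints of the tangles $T_j$ at which the arc $\alpha$ ends and begins. Then for every $i\ge 0$ the complex $\mathcal K_0^i(T)$ is naturally isomorphic to the complex obtained by applying the Hochschild homology functor $H\!H_i^{\mathcal U}(-)$ term-wise to the complex of $\mathcal U$-bimodules $\bigotimes_j\mathcal N(T_j)$. More precisely, there are isomorphisms of $\tilde{\mathcal S}_T$-modules $$H_i\big(\mathcal R_0(T)_s\big)\;\cong\; H\!H_i^{\mathcal U}\Big(\bigotimes_j\mathcal N(T_j)_{s_j}\Big),$$ one for each smoothing $s$ of $T$ (with restrictions $s_j$ to the $T_j$), which commute with the structure maps of all crossings, which match internal degree $d$ on the left with internal degree $d+2i$ on the right (for the usual grading of Hochschild homology, by a complex with differential of internal degree $0$), and which are the components of an isomorphism $\mathcal K_0^i(T)\cong H\!H_i^{\mathcal U}\big(\bigotimes_j\mathcal N(T_j)\big)$ of complexes of $\tilde{\mathcal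 S}_T$-modules. Here $\tilde{\mathcal S}_T$ acts on the right-hand side through the variables of the same flags in the $T_j$, and the variable of a closed component without crossings that arises by pasting acts as that of an arc of $\eta$ on it. -/

import Mathlib

open CategoryTheory CategoryTheory.Limits
open scoped TensorProduct

universe u v w

set_option linter.unusedSectionVars false

namespace KhR

/-! ### Cubes of resolutions and their total complexes -/

section Cubes

variable {C : Type} [Fintype C] [LinearOrder C]

/-- `Step pos x s s'`: the smoothing `s'` is obtained from `s` by applying the structure map of the
crossing `x`.  A smoothing `s` selects at each crossing the oriented resolution (`true`, the terms
`L''`) or the other one (`false`, the terms `L'`).  The structure map goes from `false` to `true`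
at a positive crossing and from `true` to `false` at a negative one. -/
def Step (pos : C → Bool) (x : C) (s s' : C → Bool) : Prop :=
  s x = !pos x ∧ s' = Function.update s x (pos x)

/-- Cohomological degree of a smoothing: the oriented resolution sits in degree `0`, the other one
in degree `-1` (positive crossing) or `1` (negative crossing). -/
def vdeg (pos : C → Bool) (s : C → Bool) : ℤ :=
  ∑ x, if s x then 0 else if pos x then -1 else 1

/-- The Koszul sign `(-1)^(sum of the degrees of the tensor factors before x)`. -/
def cubeSign (s : C → Bool) (x : C) : ℤ :=
  (-1) ^ (Finset.univ.filter fun y => y < x ∧ s y = false).card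

/-- A commutative cube indexed by the smoothings of a set of crossings. -/
structure Cube (pos : C → Bool) (V : Type v) [Category.{w} V] where
  obj : (C → Bool) → V
  map : ∀ {x : C} {s s' : C → Bool}, Step pos x s s' → (obj s ⟶ obj s')
  comm : ∀ {x y : C} {s s₁ s₂ s' : C → Bool}, x ≠ y →
    ∀ (h₁ : Step pos x s s₁) (h₂ : Step pos y s₁ s') (h₃ : Step pos y s s₂)
      (h₄ : Step pos x s₂ s'), map h₁ ≫ map h₂ = map h₃ ≫ map h₄

open Classical in
/-- The component `s → s'` of the total differential. -/
noncomputable def Cube.entry {pos : C → Bool} {V : Type v} [Category.{w} V] [Preadditive V]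
    (F : Cube pos V) (s s' : C → Bool) : F.obj s ⟶ F.obj s' :=
  ∑ x : C, if h : Step pos x s s' then cubeSign s x • F.map h else 0

lemma Step.vdeg_eq {pos : C → Bool} {x : C} {s s' : C → Bool} (h : Step pos x s s') :
    vdeg pos s' = vdeg pos s + 1 := by
  obtain ⟨h1, rfl⟩ := h
  unfold vdeg
  rw [← Finset.add_sum_erase _ _ (Finset.mem_univ x),
    ← Finset.add_sum_erase (a := x) Finset.univ (fun y => if s y then (0 : ℤ) else _)
      (Finset.mem_univ x)]
  have : ∀ y ∈ Finset.univ.erase x,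
      (if Function.update s x (pos x) y = true then (0 : ℤ) else if pos y then -1 else 1) =
      if s y then 0 else if pos y then -1 else 1 := by
    intro y hy
    rw [Function.update_of_ne (Finset.ne_of_mem_erase hy)]
  rw [Finset.sum_congr rfl this, h1]
  cases hp : pos x <;> simp [hp]
  ring

lemma Step.cubeSign_lt {pos : C → Bool} {x y : C} {s s' : C → Bool} (h : Step pos x s s')
    (hxy : x < y) : cubeSign s' y = - cubeSign s y := by
  obtain ⟨h1, rfl⟩ := h
  unfold cubeSign
  cases hp : pos x
  · have : (Finset.univ.filter fun z => z < y ∧ Function.update s x false z = false) =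
        insert x (Finset.univ.filter fun z => z < y ∧ s z = false) := by
      ext z
      by_cases hz : z = x
      · subst hz; simp [hxy]
      · simp [hz]
    rw [this, Finset.card_insert_of_notMem (by simp [h1, hp]), pow_succ]
    ring
  · have : (Finset.univ.filter fun z => z < y ∧ s z = false) =
        insert x (Finset.univ.filter fun z => z < y ∧ Function.update s x true z = false) := by
      ext z
      by_cases hz : z = x
      · subst hz; simp [hxy, h1, hp]
      · simp [hz]
    rw [this, Finset.card_insert_of_notMem (by simp), pow_succ]
    ring

lemma Step.cubeSign_gt {pos : C → Bool} {x y : C} {s s' : C → Bool} (h : Step pos x s s')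
    (hxy : y < x) : cubeSign s' y = cubeSign s y := by
  obtain ⟨h1, rfl⟩ := h
  unfold cubeSign
  congr 2
  ext z
  have : z < y → z ≠ x := fun h h' => absurd (h.trans hxy) (by simp [h'])
  simp only [Finset.mem_filter, Finset.mem_univ, true_and, and_congr_right_iff]
  intro hz
  rw [Function.update_of_ne (this hz)]

lemma Step.unique {pos : C → Bool} {x y : C} {s s' : C → Bool} (h : Step pos x s s')
    (h' : Step pos y s s') : x = y := by
  by_contra hxy
  have h1 : s' x = pos x := by rw [h.2]; simp
  have h2 : s' x = s x := by rw [h'.2, Function.update_of_ne hxy]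
  have h3 := h.1
  rw [← h2, h1] at h3
  cases hp : pos x <;> simp [hp] at h3

lemma Step.swap {pos : C → Bool} {x y : C} {s s₁ s' : C → Bool} (h : Step pos x s s₁)
    (h' : Step pos y s₁ s') :
    x ≠ y ∧ Step pos y s (Function.update s y (pos y)) ∧
      Step pos x (Function.update s y (pos y)) s' := by
  have hxy : x ≠ y := by
    rintro rfl
    have h1 : s₁ x = pos x := by rw [h.2]; simp
    have h2 := h'.1
    rw [h1] at h2
    cases hp : pos x <;> simp [hp] at h2
  refine ⟨hxy, ⟨?_, rfl⟩, ?_, ?_⟩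
  · rw [← h'.1, h.2, Function.update_of_ne hxy.symm]
  · rw [Function.update_of_ne hxy, h.1]
  · rw [h'.2, h.2, Function.update_comm hxy]

section Total

variable {pos : C → Bool} {V : Type v} [Category.{w} V] [Preadditive V]

lemma Cube.entry_eq_of_step (F : Cube pos V) {x : C} {s s' : C → Bool} (h : Step pos x s s') :
    F.entry s s' = cubeSign s x • F.map h := by
  unfold Cube.entry
  rw [Finset.sum_eq_single x]
  · rw [dif_pos h]
  · intro y _ hy
    rw [dif_neg]
    exact fun h' => hy (h'.unique h)
  · simp

lemma Cube.entry_eq_zero (F : Cube pos V) {s s' : C → Bool} (h : ∀ x, ¬ Step pos x s s') :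
    F.entry s s' = 0 := by
  unfold Cube.entry
  exact Finset.sum_eq_zero fun x _ => dif_neg (h x)

lemma Cube.sum_entry_comp (F : Cube pos V) (s s' : C → Bool) :
    ∑ t : C → Bool, F.entry s t ≫ F.entry t s' = 0 := by
  by_cases hex : ∃ x y t, Step pos x s t ∧ Step pos y t s'
  · obtain ⟨x, y, t, h1, h2⟩ := hex
    obtain ⟨hxy, h3, h4⟩ := h1.swap h2
    have hne : t ≠ Function.update s y (pos y) := by
      intro h
      rw [← h] at h3
      exact hxy (h1.unique h3)
    rw [Finset.sum_eq_add t (Function.update s y (pos y)) hne]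
    · rw [F.entry_eq_of_step h1, F.entry_eq_of_step h2, F.entry_eq_of_step h3,
        F.entry_eq_of_step h4]
      simp only [Preadditive.zsmul_comp, Preadditive.comp_zsmul, F.comm hxy h1 h2 h3 h4,
        smul_smul, ← add_smul]
      rcases lt_or_gt_of_ne hxy with h | h
      · rw [h1.cubeSign_lt h, h3.cubeSign_gt h]
        convert zero_smul ℤ _ using 2
        ring
      · rw [h1.cubeSign_gt h, h3.cubeSign_lt h]
        convert zero_smul ℤ _ using 2
        ring
    · rintro t' - ⟨hn1, hn2⟩
      by_cases h5 : ∃ z, Step pos z s t'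
      · obtain ⟨z, h5⟩ := h5
        by_cases h6 : ∃ z', Step pos z' t' s'
        · exfalso
          obtain ⟨z', h6⟩ := h6
          have key : ∀ c, s' c ≠ s c ↔ (c = x ∨ c = y) := by
            intro c
            rw [h2.2, h1.2]
            have hx := h1.1
            have hy := h2.1
            rw [h1.2, Function.update_of_ne hxy.symm] at hy
            by_cases hcy : c = y
            · subst hcy
              simp [hy]
            · rw [Function.update_of_ne hcy]
              by_cases hcx : c = x
              · subst hcx; simp [hx]
              · simp [hcx, hcy]
          have hz : s' z ≠ s z := by
            have hzz := (h5.swap h6).1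
            rw [h6.2, h5.2, Function.update_of_ne hzz]
            simp [h5.1]
          rcases (key z).1 hz with rfl | rfl
          · exact hn1 (h5.2.trans h1.2.symm)
          · exact hn2 h5.2
        · rw [F.entry_eq_zero (s := t') (fun z' hz' => h6 ⟨z', hz'⟩), comp_zero]
      · rw [F.entry_eq_zero (s := s) (fun z' hz' => h5 ⟨z', hz'⟩), zero_comp]
    · simp
    · simp
  · apply Finset.sum_eq_zero
    intro t _
    by_cases h5 : ∃ z, Step pos z s t
    · obtain ⟨z, h5⟩ := h5
      rw [F.entry_eq_zero (s := t) (fun z' hz' => hex ⟨z, z', t, h5, hz'⟩), comp_zero]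
    · rw [F.entry_eq_zero (s := s) (fun z' hz' => h5 ⟨z', hz'⟩), zero_comp]

variable [HasFiniteBiproducts V]

/-- The total complex of a cube: in degree `j` the direct sum of the terms of all smoothings of
degree `j`, with the differential given by the signed sum of the structure maps. -/
noncomputable def Cube.total (F : Cube pos V) : CochainComplex V ℤ :=
  CochainComplex.of (fun j => ⨁ fun s : {s : C → Bool // vdeg pos s = j} => F.obj s.1)
    (fun _ => biproduct.matrix fun s s' => F.entry s.1 s'.1)
    (by
      intro j
      ext s s'
      simp only [Category.assoc, biproduct.matrix_π, biproduct.ι_matrix_assoc, comp_zero,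
        zero_comp]
      rw [biproduct.lift_desc, ← F.sum_entry_comp s'.1 s.1]
      classical
      rw [← Finset.sum_subtype (Finset.univ.filter fun t => vdeg pos t = j + 1) (by simp)
        (fun t => F.entry s'.1 t ≫ F.entry t s.1)]
      refine Finset.sum_subset (Finset.filter_subset _ _) fun t _ ht => ?_
      rw [F.entry_eq_zero (s := s'.1), zero_comp]
      intro x hx
      exact ht (by simp [hx.vdeg_eq, s'.2]))

/-- Projection of the total complex to the term of one smoothing. -/
noncomputable def Cube.proj (F : Cube pos V) {j : ℤ} (s : {s : C → Bool // vdeg pos s = j}) :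
    F.total.X j ⟶ F.obj s.1 :=
  biproduct.π (fun s : {s : C → Bool // vdeg pos s = j} => F.obj s.1) s

end Total

end Cubes

/-! ### Koszul complexes -/

section Koszul

variable {R : Type u} [CommRing R] {I : Type}

/-- The exterior algebra of the free `R`-module with basis `I`. -/
abbrev ExtAlg (R : Type u) [CommRing R] (I : Type) := ExteriorAlgebra R (I →₀ R)

/-- Contraction of the exterior algebra of the free module on `I` with the linear form `φ`. -/
noncomputable def contr (φ : Module.Dual R (I →₀ R)) : ExtAlg R I →ₗ[R] ExtAlg R I :=
  CliffordAlgebra.contractLeft φ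

lemma contr_ι_mul (φ : Module.Dual R (I →₀ R)) (a : I →₀ R) (b : ExtAlg R I) :
    contr φ (ExteriorAlgebra.ι R a * b) = φ a • b - ExteriorAlgebra.ι R a * contr φ b :=
  CliffordAlgebra.contractLeft_ι_mul φ a b

lemma contr_algebraMap (φ : Module.Dual R (I →₀ R)) (r : R) :
    contr φ (algebraMap R (ExtAlg R I) r) = 0 :=
  CliffordAlgebra.contractLeft_algebraMap _ φ r

lemma contr_contr (φ : Module.Dual R (I →₀ R)) (ω : ExtAlg R I) : contr φ (contr φ ω) = 0 :=
  CliffordAlgebra.contractLeft_contractLeft φ ω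

lemma contr_comm (φ ψ : Module.Dual R (I →₀ R)) (ω : ExtAlg R I) :
    contr φ (contr ψ ω) = - contr ψ (contr φ ω) :=
  CliffordAlgebra.contractLeft_comm φ ψ ω

/-- Induction on the exterior algebra: scalars and left multiplication by vectors. -/
lemma ext_induction {P : ExtAlg R I → Prop} (h0 : ∀ r, P (algebraMap R (ExtAlg R I) r))
    (hadd : ∀ a b, P a → P b → P (a + b))
    (hmul : ∀ (v : I →₀ R) (a : ExtAlg R I), P a → P (ExteriorAlgebra.ι R v * a)) (ω : ExtAlg R I) : P ω :=
  CliffordAlgebra.left_induction (Q := (0 : QuadraticForm R (I →₀ R))) h0 hadd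
    (fun a v h => hmul v a h) ω

lemma contr_mem_zero (φ : Module.Dual R (I →₀ R)) {ω : ExtAlg R I} (h : ω ∈ ⋀[R]^0 (I →₀ R)) :
    contr φ ω = 0 := by
  rw [ExteriorAlgebra.exteriorPower, pow_zero, Submodule.mem_one] at h
  obtain ⟨r, rfl⟩ := h
  exact contr_algebraMap φ r

lemma contr_mem_succ (φ : Module.Dual R (I →₀ R)) (n : ℕ) {ω : ExtAlg R I}
    (h : ω ∈ ⋀[R]^(n + 1) (I →₀ R)) : contr φ ω ∈ ⋀[R]^n (I →₀ R) := by
  induction n generalizing ω with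
  | zero =>
    rw [ExteriorAlgebra.exteriorPower, pow_succ', pow_zero, mul_one] at h
    obtain ⟨v, rfl⟩ := h
    rw [ExteriorAlgebra.exteriorPower, pow_zero, Submodule.mem_one]
    refine ⟨φ v, ?_⟩
    exact (CliffordAlgebra.contractLeft_ι _ φ v).symm
  | succ n ih =>
    rw [ExteriorAlgebra.exteriorPower, pow_succ'] at h
    induction h using Submodule.mul_induction_on' with
    | mem_mul_mem a ha b hb =>
      obtain ⟨v, rfl⟩ := ha
      rw [contr_ι_mul]
      refine Submodule.sub_mem _ (Submodule.smul_mem _ _ hb) ?_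
      rw [ExteriorAlgebra.exteriorPower, pow_succ']
      exact Submodule.mul_mem_mul ⟨v, rfl⟩ (ih hb)
    | add a _ b _ ha hb => rw [map_add]; exact Submodule.add_mem _ ha hb

lemma map_mem {f : (I →₀ R) →ₗ[R] (I →₀ R)} (n : ℕ) {ω : ExtAlg R I} (h : ω ∈ ⋀[R]^n (I →₀ R)) :
    ExteriorAlgebra.map f ω ∈ ⋀[R]^n (I →₀ R) := by
  have := Submodule.mem_map_of_mem (f := (ExteriorAlgebra.map f).toLinearMap) h
  rw [ExteriorAlgebra.exteriorPower, Submodule.map_pow, ExteriorAlgebra.ι_range_map_map] at this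
  exact pow_le_pow_left' LinearMap.map_le_range n this

lemma contr_map (φ : Module.Dual R (I →₀ R)) (f : (I →₀ R) →ₗ[R] (I →₀ R)) (ω : ExtAlg R I) :
    contr φ (ExteriorAlgebra.map f ω) = ExteriorAlgebra.map f (contr (φ ∘ₗ f) ω) := by
  induction ω using ext_induction with
  | h0 r => rw [AlgHom.commutes, contr_algebraMap, contr_algebraMap, map_zero]
  | hadd a b ha hb => simp only [map_add, ha, hb]
  | hmul v a ha =>
    rw [map_mul, ExteriorAlgebra.map_apply_ι, contr_ι_mul, contr_ι_mul, ha, map_sub, map_smul,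
      map_mul, ExteriorAlgebra.map_apply_ι]
    rfl

/-- The linear form `e_a ↦ x a` attached to a family `x` of ring elements. -/
noncomputable def koszulForm (x : I → R) : Module.Dual R (I →₀ R) :=
  Finsupp.linearCombination R x

/-- The Koszul differential `e_{a₀} ∧ ⋯ ∧ e_{aₙ} ↦ ∑ (-1)^l x_{a_l} e_{a₀} ∧ ⋯ ê_{a_l} ⋯ ∧ e_{aₙ}`. -/
noncomputable def koszulD (x : I → R) (n : ℕ) :
    ⋀[R]^(n + 1) (I →₀ R) →ₗ[R] ⋀[R]^n (I →₀ R) :=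
  (contr (koszulForm x)).restrict fun _ h => contr_mem_succ _ n h

/-- The Koszul complex of the family `x : I → R`, that is, the tensor product over `a : I` of the
two-term complexes `R --x a--> R`, realised on the exterior powers of the free module on `I`. -/
noncomputable def koszul (x : I → R) : ChainComplex (ModuleCat.{u} R) ℕ :=
  ChainComplex.of (fun n => ModuleCat.of R (⋀[R]^n (I →₀ R)))
    (fun n => ModuleCat.ofHom (koszulD x n))
    (fun n => by
      refine ModuleCat.hom_ext (LinearMap.ext fun ω => ?_)
      exact Subtype.ext (contr_contr (koszulForm x) ω.1))

/-- A degree preserving endomorphism of the exterior algebra that intertwines the Koszul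
differentials of `x` and `y` is a chain map. -/
noncomputable def koszulHom (x y : I → R) (f : ExtAlg R I →ₗ[R] ExtAlg R I)
    (hdeg : ∀ n, ∀ ω ∈ ⋀[R]^n (I →₀ R), f ω ∈ ⋀[R]^n (I →₀ R))
    (hd : ∀ ω, contr (koszulForm y) (f ω) = f (contr (koszulForm x) ω)) :
    koszul x ⟶ koszul y :=
  ChainComplex.ofHom (fun n => ModuleCat.ofHom (f.restrict (hdeg n)))
    (fun n => by
      simp only [koszul, ChainComplex.of_d]
      refine ModuleCat.hom_ext (LinearMap.ext fun ω => ?_)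
      exact Subtype.ext (hd ω.1))

/-! The two maps attached to a crossing.  `a` and `b` are the two Koszul generators of the crossing;
the other generators are left alone. -/

section Crossing

open Classical in
/-- The map on generators `e_a ↦ e_a + e_b`, `e_b ↦ tj • e_a + tl • e_b`. -/
noncomputable def posVec (a b : I) (tj tl : R) : (I →₀ R) →ₗ[R] (I →₀ R) :=
  Finsupp.linearCombination R fun c =>
    if c = a then Finsupp.single a 1 + Finsupp.single b 1
    else if c = b then Finsupp.single a tj + Finsupp.single b tl
    else Finsupp.single c 1

/-- The lift to Koszul complexes of the projection
`R / (ti + tj - tk - tl, ti tj - tk tl) → R / (ti - tl, tj - tk)`. -/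
noncomputable def rhoPos (a b : I) (tj tl : R) : ExtAlg R I →ₗ[R] ExtAlg R I :=
  (ExteriorAlgebra.map (posVec a b tj tl)).toLinearMap

open Classical in
/-- The map on generators `e_a ↦ ti • e_a - e_b`, `e_a + e_b ↦ e_a`. -/
noncomputable def negVec (a b : I) (ti : R) : (I →₀ R) →ₗ[R] (I →₀ R) :=
  Finsupp.linearCombination R fun c =>
    if c = a then Finsupp.single a ti - Finsupp.single b 1
    else if c = b then Finsupp.single a (1 - ti) + Finsupp.single b 1
    else Finsupp.single c 1

open Classical in
/-- The linear form `e_a ↦ 1`, `e_b ↦ -1`, all other generators to `0`. -/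
noncomputable def negForm (a b : I) : Module.Dual R (I →₀ R) :=
  Finsupp.linearCombination R fun c => if c = a then 1 else if c = b then -1 else 0

/-- `ω ↦ v ω + (1 - v) e_a ∧ (negForm ⌟ ω)`: multiplication by `v` on the part free of `e_a` in
the basis `e_a, e_a + e_b, …`, and the identity on multiples of `e_a`. -/
noncomputable def negScale (a b : I) (w : R) : ExtAlg R I →ₗ[R] ExtAlg R I :=
  w • LinearMap.id + (1 - w) •
    (LinearMap.mulLeft R (ExteriorAlgebra.ι R (Finsupp.single a (1 : R))) ∘ₗ contr (negForm a b))

/-- The lift to Koszul complexes of multiplication by `ti - tk`,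
`R / (ti - tl, tj - tk) → R / (ti + tj - tk - tl, ti tj - tk tl)`.  On the four basis elements of
the crossing it is `1 ↦ ti - tk`, `e_a ↦ ti e_a - e_b`, `e_b ↦ - tk e_a + e_b`,
`e_a ∧ e_b ↦ e_a ∧ e_b`, see the lemmas below. -/
noncomputable def rhoNeg (a b : I) (ti tk : R) : ExtAlg R I →ₗ[R] ExtAlg R I :=
  (ExteriorAlgebra.map (negVec a b ti)).toLinearMap ∘ₗ negScale a b (ti - tk)

variable {a b c d : I}

lemma negScale_apply (w : R) (ω : ExtAlg R I) : negScale a b w ω = w • ω +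
    (1 - w) • (ExteriorAlgebra.ι R (Finsupp.single a (1 : R)) * contr (negForm a b) ω) := rfl

lemma rhoNeg_apply (ti tk : R) (ω : ExtAlg R I) : rhoNeg a b ti tk ω =
    ExteriorAlgebra.map (negVec a b ti) (negScale a b (ti - tk) ω) := rfl

lemma rhoPos_mem (tj tl : R) (n : ℕ) (ω : ExtAlg R I) (h : ω ∈ ⋀[R]^n (I →₀ R)) :
    rhoPos a b tj tl ω ∈ ⋀[R]^n (I →₀ R) := map_mem n h

lemma negScale_mem (w : R) (n : ℕ) (ω : ExtAlg R I) (h : ω ∈ ⋀[R]^n (I →₀ R)) :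
    negScale a b w ω ∈ ⋀[R]^n (I →₀ R) := by
  rw [negScale_apply]
  refine Submodule.add_mem _ (Submodule.smul_mem _ _ h) (Submodule.smul_mem _ _ ?_)
  cases n with
  | zero => rw [contr_mem_zero _ h, mul_zero]; exact Submodule.zero_mem _
  | succ n =>
    rw [ExteriorAlgebra.exteriorPower, pow_succ']
    exact Submodule.mul_mem_mul ⟨_, rfl⟩ (contr_mem_succ _ _ h)

lemma rhoNeg_mem (ti tk : R) (n : ℕ) (ω : ExtAlg R I) (h : ω ∈ ⋀[R]^n (I →₀ R)) :
    rhoNeg a b ti tk ω ∈ ⋀[R]^n (I →₀ R) := map_mem n (negScale_mem _ n ω h)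

lemma rhoPos_contr (hab : a ≠ b) {x y : I → R} {ti tj tk tl : R}
    (hxa : x a = ti + tj - tk - tl) (hxb : x b = ti * tj - tk * tl)
    (hya : y a = ti - tl) (hyb : y b = tj - tk) (hxy : ∀ c, c ≠ a → c ≠ b → x c = y c)
    (ω : ExtAlg R I) :
    contr (koszulForm y) (rhoPos a b tj tl ω) = rhoPos a b tj tl (contr (koszulForm x) ω) := by
  have : koszulForm y ∘ₗ posVec a b tj tl = koszulForm x := by
    ext c
    by_cases hca : c = a
    · subst hca
      simp [koszulForm, posVec, hya, hyb, hxa]; ring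
    · by_cases hcb : c = b
      · subst hcb
        simp [koszulForm, posVec, hya, hyb, hxb, hca]; ring
      · simp [koszulForm, posVec, hca, hcb, hxy c hca hcb]
  simp only [rhoPos, AlgHom.toLinearMap_apply]
  rw [contr_map, this]

lemma rhoNeg_contr (hab : a ≠ b) {x y : I → R} {ti tj tk tl : R}
    (hxa : x a = ti + tj - tk - tl) (hxb : x b = ti * tj - tk * tl)
    (hya : y a = ti - tl) (hyb : y b = tj - tk) (hxy : ∀ c, c ≠ a → c ≠ b → x c = y c)
    (ω : ExtAlg R I) :
    contr (koszulForm x) (rhoNeg a b ti tk ω) = rhoNeg a b ti tk (contr (koszulForm y) ω) := by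
  have h1 : koszulForm x ∘ₗ negVec a b ti =
      koszulForm y + ((ti - tk - 1) * (ti - tl)) • negForm a b := by
    ext c
    by_cases hca : c = a
    · subst hca
      simp [koszulForm, negVec, negForm, hya, hxb, hxa]; ring
    · by_cases hcb : c = b
      · subst hcb
        simp [koszulForm, negVec, negForm, hyb, hxa, hxb, hca]; ring
      · simp [koszulForm, negVec, negForm, hca, hcb, hxy c hca hcb]
  have hcontr : ∀ ω', contr (koszulForm x ∘ₗ negVec a b ti) ω' = contr (koszulForm y) ω' +
      ((ti - tk - 1) * (ti - tl)) • contr (negForm a b) ω' := by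
    intro ω'
    rw [h1]
    simp [contr]
  have hn : negForm a b (Finsupp.single a (1 : R)) = 1 := by simp [negForm]
  have hy : koszulForm y (Finsupp.single a (1 : R)) = ti - tl := by simp [koszulForm, hya]
  rw [rhoNeg_apply, contr_map, rhoNeg_apply]
  congr 1
  rw [hcontr, negScale_apply, negScale_apply]
  simp only [map_add, map_smul, contr_ι_mul, hn, hy, contr_contr, mul_zero, sub_zero, one_smul,
    contr_comm (negForm a b) (koszulForm y) ω, mul_neg]
  module

lemma rhoNeg_one (ti tk : R) : rhoNeg a b ti tk 1 = algebraMap R _ (ti - tk) := by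
  rw [rhoNeg_apply, negScale_apply, show (1 : ExtAlg R I) = algebraMap R _ 1 by simp,
    contr_algebraMap, mul_zero, smul_zero, add_zero, map_smul, AlgHom.commutes,
    Algebra.algebraMap_eq_smul_one, Algebra.algebraMap_eq_smul_one (ti - tk), one_smul]

lemma rhoNeg_a (ti tk : R) :
    rhoNeg a b ti tk (ExteriorAlgebra.ι R (Finsupp.single a 1)) =
      ExteriorAlgebra.ι R (Finsupp.single a ti - Finsupp.single b 1) := by
  have h1 : negForm a b (Finsupp.single a (1 : R)) = 1 := by simp [negForm]
  have h2 := contr_ι_mul (negForm a b) (Finsupp.single a (1 : R)) 1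
  rw [mul_one, show (1 : ExtAlg R I) = algebraMap R _ 1 by simp, contr_algebraMap, h1] at h2
  rw [rhoNeg_apply, negScale_apply, h2]
  have : negVec a b ti (Finsupp.single a 1) = Finsupp.single a ti - Finsupp.single b 1 := by
    simp [negVec]
  rw [← this, ← ExteriorAlgebra.map_apply_ι]
  congr 1
  simp only [one_smul, mul_zero, sub_zero, map_one, mul_one]
  module

lemma rhoNeg_b (hab : a ≠ b) (ti tk : R) :
    rhoNeg a b ti tk (ExteriorAlgebra.ι R (Finsupp.single b 1)) =
      ExteriorAlgebra.ι R (Finsupp.single a (-tk) + Finsupp.single b 1) := by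
  have h1 : negForm a b (Finsupp.single b (1 : R)) = -1 := by simp [negForm, hab.symm]
  have h2 := contr_ι_mul (negForm a b) (Finsupp.single b (1 : R)) 1
  rw [mul_one, show (1 : ExtAlg R I) = algebraMap R _ 1 by simp, contr_algebraMap, h1] at h2
  rw [rhoNeg_apply, negScale_apply, h2]
  have hva : negVec a b ti (Finsupp.single a 1) = Finsupp.single a ti - Finsupp.single b 1 := by
    simp [negVec]
  have hvb : negVec a b ti (Finsupp.single b 1) =
      Finsupp.single a (1 - ti) + Finsupp.single b 1 := by
    simp [negVec, hab.symm]
  simp only [map_add, map_smul, mul_zero, sub_zero, map_one, neg_smul, one_smul, mul_neg, mul_one,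
    map_neg, ExteriorAlgebra.map_apply_ι, hva, hvb]
  rw [show (Finsupp.single a ti : I →₀ R) = ti • Finsupp.single a 1 by simp,
    show (Finsupp.single a (1 - ti) : I →₀ R) = (1 - ti) • Finsupp.single a 1 by simp,
    show (Finsupp.single a (-tk) : I →₀ R) = (-tk) • Finsupp.single a 1 by simp]
  simp only [map_sub, map_smul]
  module

lemma rhoNeg_ab (hab : a ≠ b) (ti tk : R) :
    rhoNeg a b ti tk
      (ExteriorAlgebra.ι R (Finsupp.single a 1) * ExteriorAlgebra.ι R (Finsupp.single b 1)) =
      ExteriorAlgebra.ι R (Finsupp.single a 1) * ExteriorAlgebra.ι R (Finsupp.single b 1) := by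
  set ea : ExtAlg R I := ExteriorAlgebra.ι R (Finsupp.single a 1) with hea
  set eb : ExtAlg R I := ExteriorAlgebra.ι R (Finsupp.single b 1) with heb
  have haa : ea * ea = 0 := ExteriorAlgebra.ι_sq_zero _
  have hbb : eb * eb = 0 := ExteriorAlgebra.ι_sq_zero _
  have hba : eb * ea = - (ea * eb) := eq_neg_of_add_eq_zero_left (ExteriorAlgebra.ι_add_mul_swap _ _)
  have h1 : negForm a b (Finsupp.single b (1 : R)) = -1 := by simp [negForm, hab.symm]
  have h1' : negForm a b (Finsupp.single a (1 : R)) = 1 := by simp [negForm]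
  have h2 := contr_ι_mul (negForm a b) (Finsupp.single b (1 : R)) 1
  rw [mul_one, show (1 : ExtAlg R I) = algebraMap R _ 1 by simp, contr_algebraMap, h1] at h2
  have h3 := contr_ι_mul (negForm a b) (Finsupp.single a (1 : R)) eb
  rw [← hea, h1', heb, h2, ← heb] at h3
  have hva : negVec a b ti (Finsupp.single a 1) =
      ti • Finsupp.single a 1 - Finsupp.single b 1 := by
    simp [negVec]
  have hvb : negVec a b ti (Finsupp.single b 1) =
      (1 - ti) • Finsupp.single a 1 + Finsupp.single b 1 := by
    simp [negVec, hab.symm]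
  rw [rhoNeg_apply, negScale_apply, h3]
  simp only [map_add, map_smul, map_mul, mul_zero, sub_zero, map_one, neg_smul, one_smul, mul_neg,
    mul_one, hea, heb, ExteriorAlgebra.map_apply_ι, hva, hvb, map_sub, mul_add, mul_sub,
    sub_neg_eq_add]
  simp only [← hea, ← heb, sub_mul, smul_mul_assoc, mul_smul_comm, haa, hbb, hba]
  module

/-! Maps attached to different crossings commute. -/

lemma posVec_comm (hac : a ≠ c) (had : a ≠ d) (hbc : b ≠ c) (hbd : b ≠ d) (tj tl uj ul : R) :
    posVec a b tj tl ∘ₗ posVec c d uj ul = posVec c d uj ul ∘ₗ posVec a b tj tl := by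
  refine Finsupp.lhom_ext' fun z => LinearMap.ext_ring ?_
  simp only [posVec, LinearMap.comp_apply, Finsupp.lsingle_apply, Finsupp.linearCombination_single,
    one_smul]
  split_ifs <;> simp_all [Ne.symm]

lemma posVec_negVec_comm (hac : a ≠ c) (had : a ≠ d) (hbc : b ≠ c) (hbd : b ≠ d) (tj tl ui : R) :
    posVec a b tj tl ∘ₗ negVec c d ui = negVec c d ui ∘ₗ posVec a b tj tl := by
  refine Finsupp.lhom_ext' fun z => LinearMap.ext_ring ?_
  simp only [posVec, negVec, LinearMap.comp_apply, Finsupp.lsingle_apply,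
    Finsupp.linearCombination_single, one_smul]
  split_ifs <;> simp_all [Ne.symm]

lemma negVec_comm (hac : a ≠ c) (had : a ≠ d) (hbc : b ≠ c) (hbd : b ≠ d) (ti ui : R) :
    negVec a b ti ∘ₗ negVec c d ui = negVec c d ui ∘ₗ negVec a b ti := by
  refine Finsupp.lhom_ext' fun z => LinearMap.ext_ring ?_
  simp only [negVec, LinearMap.comp_apply, Finsupp.lsingle_apply,
    Finsupp.linearCombination_single, one_smul]
  split_ifs <;> simp_all [Ne.symm]

lemma negScale_map (w : R) (g : (I →₀ R) →ₗ[R] (I →₀ R))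
    (hg : g (Finsupp.single a 1) = Finsupp.single a 1) (hf : negForm a b ∘ₗ g = negForm a b)
    (ω : ExtAlg R I) :
    negScale a b w (ExteriorAlgebra.map g ω) = ExteriorAlgebra.map g (negScale a b w ω) := by
  rw [negScale_apply, negScale_apply, contr_map, hf]
  simp only [map_add, map_smul, map_mul, ExteriorAlgebra.map_apply_ι, hg]

lemma negScale_comm (hac : a ≠ c) (had : a ≠ d) (hbc : b ≠ c) (v w : R) (ω : ExtAlg R I) :
    negScale a b v (negScale c d w ω) = negScale c d w (negScale a b v ω) := by
  have h1 : negForm a b (Finsupp.single c (1 : R)) = 0 := by simp [negForm, hac.symm, hbc.symm]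
  have h2 : negForm c d (Finsupp.single a (1 : R)) = 0 := by simp [negForm, hac, had]
  have h3 : ExteriorAlgebra.ι R (Finsupp.single c (1 : R)) * (ExteriorAlgebra.ι R
      (Finsupp.single a (1 : R)) * contr (negForm c d) (contr (negForm a b) ω)) =
      - (ExteriorAlgebra.ι R (Finsupp.single a (1 : R)) * (ExteriorAlgebra.ι R
      (Finsupp.single c (1 : R)) * contr (negForm c d) (contr (negForm a b) ω))) := by
    rw [← mul_assoc, ← mul_assoc, ← neg_mul]
    congr 1
    exact eq_neg_of_add_eq_zero_left (ExteriorAlgebra.ι_add_mul_swap _ _)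
  simp only [negScale_apply, map_add, map_smul, contr_ι_mul, h1, h2, zero_smul, zero_sub,
    mul_neg, contr_comm (negForm a b) (negForm c d) ω, h3]
  module

lemma negForm_posVec (hac : a ≠ c) (had : a ≠ d) (hbc : b ≠ c) (hbd : b ≠ d) (tj tl : R) :
    negForm c d ∘ₗ posVec a b tj tl = negForm (R := R) c d := by
  refine Finsupp.lhom_ext' fun z => LinearMap.ext_ring ?_
  simp only [posVec, negForm, LinearMap.comp_apply, Finsupp.lsingle_apply,
    Finsupp.linearCombination_single, one_smul]
  split_ifs <;> simp_all [Ne.symm]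

lemma negForm_negVec (hac : a ≠ c) (had : a ≠ d) (hbc : b ≠ c) (hbd : b ≠ d) (ti : R) :
    negForm c d ∘ₗ negVec a b ti = negForm (R := R) c d := by
  refine Finsupp.lhom_ext' fun z => LinearMap.ext_ring ?_
  simp only [negVec, negForm, LinearMap.comp_apply, Finsupp.lsingle_apply,
    Finsupp.linearCombination_single, one_smul]
  split_ifs <;> simp_all [Ne.symm]

lemma rhoPos_comm (hac : a ≠ c) (had : a ≠ d) (hbc : b ≠ c) (hbd : b ≠ d) (tj tl uj ul : R)
    (ω : ExtAlg R I) :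
    rhoPos a b tj tl (rhoPos c d uj ul ω) = rhoPos c d uj ul (rhoPos a b tj tl ω) := by
  simp only [rhoPos, AlgHom.toLinearMap_apply, ← AlgHom.comp_apply, ExteriorAlgebra.map_comp_map,
    posVec_comm hac had hbc hbd]

lemma rhoPos_rhoNeg_comm (hac : a ≠ c) (had : a ≠ d) (hbc : b ≠ c) (hbd : b ≠ d)
    (tj tl ui uk : R) (ω : ExtAlg R I) :
    rhoPos a b tj tl (rhoNeg c d ui uk ω) = rhoNeg c d ui uk (rhoPos a b tj tl ω) := by
  have hg : posVec a b tj tl (Finsupp.single c 1) = Finsupp.single c 1 := by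
    simp [posVec, hac.symm, hbc.symm]
  simp only [rhoNeg_apply, rhoPos, AlgHom.toLinearMap_apply,
    negScale_map _ _ hg (negForm_posVec hac had hbc hbd tj tl)]
  simp only [← AlgHom.comp_apply, ExteriorAlgebra.map_comp_map,
    posVec_negVec_comm hac had hbc hbd]

lemma rhoNeg_comm (hac : a ≠ c) (had : a ≠ d) (hbc : b ≠ c) (hbd : b ≠ d)
    (ti tk ui uk : R) (ω : ExtAlg R I) :
    rhoNeg a b ti tk (rhoNeg c d ui uk ω) = rhoNeg c d ui uk (rhoNeg a b ti tk ω) := by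
  have hg : negVec a b ti (Finsupp.single c 1) = Finsupp.single c 1 := by
    simp [negVec, hac.symm, hbc.symm]
  have hg' : negVec c d ui (Finsupp.single a 1) = Finsupp.single a 1 := by
    simp [negVec, hac, had]
  simp only [rhoNeg_apply, negScale_map _ _ hg (negForm_negVec hac had hbc hbd ti),
    negScale_map _ _ hg' (negForm_negVec hac.symm hbc.symm had.symm hbd.symm ui),
    negScale_comm hac had hbc]
  simp only [← AlgHom.comp_apply, ExteriorAlgebra.map_comp_map, negVec_comm hac had hbc hbd]

end Crossing

end Koszul

/-! ### Hochschild homology -/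

section Hochschild

variable (k : Type u) [CommRing k] {U : Type u} [CommRing U] [Algebra k U]
  {R : Type u} [CommRing R] [Algebra k R]

section Unbundled

lemma contractNth_update {n : ℕ} (j : Fin n) (u : Fin (n + 1) → U) (a : Fin (n + 1)) :
    ∃ (l : Fin n) (c : U), ∀ x, Fin.contractNth j.castSucc (· * ·) (Function.update u a x) =
      Function.update (Fin.contractNth j.castSucc (· * ·) u) l (c * x) := by
  rcases lt_trichotomy (a : ℕ) (j : ℕ) with h | h | h
  · refine ⟨⟨a, by omega⟩, 1, fun x => ?_⟩
    ext l
    simp only [Fin.contractNth, Function.update_apply, Fin.ext_iff, Fin.val_castSucc,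
      Fin.val_succ]
    grind
  · refine ⟨⟨a, by omega⟩, u j.succ, fun x => ?_⟩
    ext l
    simp only [Fin.contractNth, Function.update_apply, Fin.ext_iff, Fin.val_castSucc,
      Fin.val_succ]
    have : l = j → l.succ = j.succ := fun h => by rw [h]
    grind
  · by_cases h' : (a : ℕ) = j + 1
    · refine ⟨j, u j.castSucc, fun x => ?_⟩
      ext l
      simp only [Fin.contractNth, Function.update_apply, Fin.ext_iff, Fin.val_castSucc,
        Fin.val_succ]
      grind
    · refine ⟨⟨a - 1, by omega⟩, 1, fun x => ?_⟩
      ext l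
      simp only [Fin.contractNth, Function.update_apply, Fin.ext_iff, Fin.val_castSucc,
        Fin.val_succ]
      grind

variable {M : Type u} [AddCommGroup M] [Module k M] [Module R M] [IsScalarTower k R M]

/-- `u ↦ u₀ ⊗ ⋯ ⊗ u_j u_{j+1} ⊗ ⋯ ⊗ uₙ` as a multilinear map. -/
noncomputable def contractTensor (U : Type u) [CommRing U] [Algebra k U] {n : ℕ} (j : Fin n) :
    MultilinearMap k (fun _ : Fin (n + 1) => U) (⨂[k]^n U) :=
  MultilinearMap.mk' (fun u => PiTensorProduct.tprod k (Fin.contractNth j.castSucc (· * ·) u))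
    (fun u a x y => by
      obtain ⟨l, c, h⟩ := contractNth_update j u a
      simp only [h, mul_add, MultilinearMap.map_update_add])
    (fun u a r x => by
      obtain ⟨l, c, h⟩ := contractNth_update j u a
      simp only [h, mul_smul_comm, MultilinearMap.map_update_smul])

/-- `u ↦ u₀ m ⊗ (u₁ ⊗ ⋯ ⊗ uₙ)`, where `U` acts on the module through `f : U → R`. -/
noncomputable def faceFirst (f : U →ₐ[k] R) (n : ℕ) (m : M) :
    MultilinearMap k (fun _ : Fin (n + 1) => U) (M ⊗[k] ⨂[k]^n U) :=
  MultilinearMap.mk' (fun u => (f (u 0) • m) ⊗ₜ[k] PiTensorProduct.tprod k (Fin.tail u))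
    (fun u a x y => by
      cases a using Fin.cases with
      | zero => simp [add_smul, TensorProduct.add_tmul]
      | succ a =>
        simp [Fin.tail_update_succ, TensorProduct.tmul_add,
          Function.update_of_ne (Fin.succ_ne_zero a).symm])
    (fun u a r x => by
      cases a using Fin.cases with
      | zero => simp [TensorProduct.smul_tmul']
      | succ a =>
        simp [Fin.tail_update_succ, Function.update_of_ne (Fin.succ_ne_zero a).symm])

/-- `u ↦ uₙ m ⊗ (u₀ ⊗ ⋯ ⊗ uₙ₋₁)`, where `U` acts on the module through `f : U → R`. -/
noncomputable def faceLast (f : U →ₐ[k] R) (n : ℕ) (m : M) :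
    MultilinearMap k (fun _ : Fin (n + 1) => U) (M ⊗[k] ⨂[k]^n U) :=
  MultilinearMap.mk' (fun u => (f (u (Fin.last n)) • m) ⊗ₜ[k] PiTensorProduct.tprod k (Fin.init u))
    (fun u a x y => by
      cases a using Fin.lastCases with
      | last => simp [add_smul, TensorProduct.add_tmul]
      | cast a =>
        simp [Fin.init_update_castSucc, TensorProduct.tmul_add,
          Function.update_of_ne (Fin.castSucc_ne_last a).symm])
    (fun u a r x => by
      cases a using Fin.lastCases with
      | last => simp [TensorProduct.smul_tmul']
      | cast a =>
        simp [Fin.init_update_castSucc, Function.update_of_ne (Fin.castSucc_ne_last a).symm])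

/-- For fixed `m`, the Hochschild differential as a multilinear map in `u₀, …, uₙ`:
`m u₀ ⊗ u₁ ⋯ uₙ + ∑ (-1)^(j+1) m ⊗ u₀ ⋯ u_j u_{j+1} ⋯ uₙ + (-1)^(n+1) uₙ m ⊗ u₀ ⋯ uₙ₋₁`. -/
noncomputable def barMulti (lact ract : U →ₐ[k] R) (n : ℕ) (m : M) :
    MultilinearMap k (fun _ : Fin (n + 1) => U) (M ⊗[k] ⨂[k]^n U) :=
  faceFirst k ract n m +
    ∑ j : Fin n, (-1 : ℤ) ^ ((j : ℕ) + 1) •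
      (TensorProduct.mk k M (⨂[k]^n U) m).compMultilinearMap (contractTensor k U j) +
    (-1 : ℤ) ^ (n + 1) • faceLast k lact n m

lemma barMulti_apply (lact ract : U →ₐ[k] R) (n : ℕ) (m : M) (u : Fin (n + 1) → U) :
    barMulti k lact ract n m u =
      (ract (u 0) • m) ⊗ₜ[k] PiTensorProduct.tprod k (Fin.tail u) +
      ∑ j : Fin n, (-1 : ℤ) ^ ((j : ℕ) + 1) • (m ⊗ₜ[k] PiTensorProduct.tprod k
        (Fin.contractNth j.castSucc (· * ·) u)) +
      (-1 : ℤ) ^ (n + 1) •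
        ((lact (u (Fin.last n)) • m) ⊗ₜ[k] PiTensorProduct.tprod k (Fin.init u)) := by
  simp [barMulti]
  rfl

/-- The Hochschild differential `M ⊗ U^{⊗(n+1)} → M ⊗ U^{⊗n}`.  The left and the right action of
`U` on the `R`-module `M` are given by the two homomorphisms `lact, ract : U → R`. -/
noncomputable def barD (lact ract : U →ₐ[k] R) (M : Type u) [AddCommGroup M] [Module k M]
    [Module R M] [IsScalarTower k R M] (n : ℕ) :
    (M ⊗[k] ⨂[k]^(n + 1) U) →ₗ[R] (M ⊗[k] ⨂[k]^n U) :=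
  TensorProduct.AlgebraTensorModule.lift
    { toFun := fun m => PiTensorProduct.lift (barMulti k lact ract n m)
      map_add' := fun m m' => by
        ext u
        simp only [LinearMap.compMultilinearMap_apply, LinearMap.add_apply,
          PiTensorProduct.lift.tprod, barMulti_apply, smul_add, TensorProduct.add_tmul,
          Finset.sum_add_distrib]
        abel
      map_smul' := fun r m => by
        ext u
        simp only [LinearMap.compMultilinearMap_apply, LinearMap.smul_apply, RingHom.id_apply,
          PiTensorProduct.lift.tprod, barMulti_apply, smul_add, Finset.smul_sum,
          smul_comm r (_ : ℤ), TensorProduct.smul_tmul', smul_comm r (_ : R)] }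

lemma barD_tmul (lact ract : U →ₐ[k] R) (n : ℕ) (m : M) (u : Fin (n + 1) → U) :
    barD k lact ract M n (m ⊗ₜ PiTensorProduct.tprod k u) =
      (ract (u 0) • m) ⊗ₜ[k] PiTensorProduct.tprod k (Fin.tail u) +
      ∑ j : Fin n, (-1 : ℤ) ^ ((j : ℕ) + 1) • (m ⊗ₜ[k] PiTensorProduct.tprod k
        (Fin.contractNth j.castSucc (· * ·) u)) +
      (-1 : ℤ) ^ (n + 1) •
        ((lact (u (Fin.last n)) • m) ⊗ₜ[k] PiTensorProduct.tprod k (Fin.init u)) := by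
  rw [← barMulti_apply]
  simp [barD]

/-- Ring factor of the `i`-th face of the Hochschild complex. -/
def faceCoeff (lact ract : U →ₐ[k] R) {n : ℕ} (i : ℕ) (u : Fin (n + 1) → U) : R :=
  if i = 0 then ract (u 0) else if i = n + 1 then lact (u (Fin.last n)) else 1

/-- Tensor factors of the `i`-th face of the Hochschild complex. -/
def faceVec {n : ℕ} (i : ℕ) (u : Fin (n + 1) → U) (l : Fin n) : U :=
  if (l : ℕ) + 1 < i then u l.castSucc
  else if (l : ℕ) + 1 = i then u l.castSucc * u l.succ else u l.succ

lemma barD_tmul' (lact ract : U →ₐ[k] R) (n : ℕ) (m : M) (u : Fin (n + 1) → U) :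
    barD k lact ract M n (m ⊗ₜ PiTensorProduct.tprod k u) =
      ∑ i ∈ Finset.range (n + 2), (-1 : ℤ) ^ i •
        ((faceCoeff k lact ract i u • m) ⊗ₜ[k] PiTensorProduct.tprod k (faceVec i u)) := by
  rw [barD_tmul, Finset.sum_range_succ, Finset.sum_range_succ', add_comm _ ((-1 : ℤ) ^ 0 • _)]
  congr 1
  · congr 1
    · rw [pow_zero, one_smul]
      congr 1
    · rw [Finset.sum_range]
      refine Finset.sum_congr rfl fun j _ => ?_
      congr 2
      · have hj := j.2
        simp [faceCoeff, hj.ne]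
      · congr 1
        ext l
        simp [Fin.contractNth, faceVec]
  · congr 2
    · simp [faceCoeff]
    · congr 1
      ext l
      have hl := l.2
      simp [faceVec, Fin.init, hl]

lemma faceVec_faceVec {n : ℕ} (u : Fin (n + 2) → U) {i j : ℕ} (hij : i < j) :
    faceVec i (faceVec j u) = faceVec (j - 1) (faceVec i u) := by
  ext l
  simp only [faceVec, Fin.val_castSucc, Fin.val_succ, Fin.succ_castSucc]
  grind

lemma faceCoeff_faceCoeff (lact ract : U →ₐ[k] R) {n : ℕ} (u : Fin (n + 2) → U) {i j : ℕ}
    (hij : i < j) (hj : j < n + 3) :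
    faceCoeff k lact ract i (faceVec j u) * faceCoeff k lact ract j u =
      faceCoeff k lact ract (j - 1) (faceVec i u) * faceCoeff k lact ract i u := by
  have e1 : Fin.succ (Fin.last n) = Fin.last (n + 1) := rfl
  rcases Nat.eq_zero_or_pos i with rfl | hi
  · rcases eq_or_ne j 1 with rfl | hj1
    · simp [faceCoeff, faceVec, mul_comm]
    · rcases eq_or_ne j (n + 2) with rfl | hj2
      · simp [faceCoeff, faceVec, e1, mul_comm]
      · have h1 : 1 < j := by omega
        have h2 : j - 1 ≠ 0 := by omega
        have h3 : j - 1 ≠ n + 1 := by omega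
        have h4 : j ≠ 0 := by omega
        simp [faceCoeff, faceVec, h1, h2, h3, h4, hj2]
  · rcases eq_or_ne j (n + 2) with rfl | hj2
    · rcases eq_or_ne i (n + 1) with rfl | hi1
      · simp [faceCoeff, faceVec, e1, mul_comm]
      · have h1 : i < n + 1 := by omega
        have h2 : ¬ (n + 1 < i) := by omega
        have h3 : i ≠ n + 2 := by omega
        simp [faceCoeff, faceVec, e1, hi.ne', hi1, hi1.symm, h2, h3]
    · have h1 : j ≠ 0 := by omega
      have h2 : j - 1 ≠ 0 := by omega
      have h3 : j - 1 ≠ n + 1 := by omega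
      have h4 : i ≠ n + 1 := by omega
      have h5 : i ≠ n + 2 := by omega
      simp [faceCoeff, hi.ne', h1, h2, h3, h4, h5, hj2]

lemma barD_barD (lact ract : U →ₐ[k] R) (n : ℕ) (z : M ⊗[k] ⨂[k]^(n + 2) U) :
    barD k lact ract M n (barD k lact ract M (n + 1) z) = 0 := by
  induction z using TensorProduct.induction_on with
  | zero => simp
  | add x y hx hy => rw [map_add, map_add, hx, hy, add_zero]
  | tmul m w =>
    induction w using PiTensorProduct.induction_on with
    | add x y hx hy => rw [TensorProduct.tmul_add, map_add, map_add, hx, hy, add_zero]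
    | smul_tprod r u =>
      rw [TensorProduct.tmul_smul, TensorProduct.smul_tmul', barD_tmul', map_sum]
      simp only [map_zsmul, barD_tmul', Finset.smul_sum, smul_smul]
      rw [Finset.sum_sigma']
      refine Finset.sum_involution
        (fun p _ => if p.2 < p.1 then ⟨p.2, p.1 - 1⟩ else ⟨p.2 + 1, p.1⟩) ?_ ?_ ?_ ?_
      · rintro ⟨j, i⟩ hp
        simp only [Finset.mem_sigma, Finset.mem_range] at hp
        by_cases hij : i < j
        · simp only [hij, if_true]
          rw [faceVec_faceVec u hij, faceCoeff_faceCoeff k lact ract u hij (by omega), ← add_smul]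
          convert zero_smul ℤ _
          obtain ⟨j, rfl⟩ : ∃ j', j = j' + 1 := ⟨j - 1, by omega⟩
          rw [Nat.add_sub_cancel, pow_succ]
          ring
        · have hji : j < i + 1 := by omega
          simp only [hij, if_false]
          rw [faceVec_faceVec u hji, faceCoeff_faceCoeff k lact ract u hji (by omega),
            Nat.add_sub_cancel, ← add_smul]
          convert zero_smul ℤ _
          rw [pow_succ]
          ring
      · rintro ⟨j, i⟩ hp - heq
        simp only [Finset.mem_sigma, Finset.mem_range] at hp
        by_cases hij : i < j
        · simp only [hij, if_true, Sigma.mk.injEq, heq_eq_eq] at heq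
          omega
        · simp only [hij, if_false, Sigma.mk.injEq, heq_eq_eq] at heq
          omega
      · rintro ⟨j, i⟩ hp
        simp only [Finset.mem_sigma, Finset.mem_range] at hp ⊢
        split_ifs with hij
        · simp only; omega
        · simp only; omega
      · rintro ⟨j, i⟩ hp
        simp only [Finset.mem_sigma, Finset.mem_range] at hp
        by_cases hij : i < j
        · have h1 : ¬ (j - 1 < i) := by omega
          have h2 : j - 1 + 1 = j := by omega
          simp [hij, h1, h2]
        · have : j < i + 1 := by omega
          simp [hij, this]

end Unbundled

/-- An `R`-module is a `k`-module by restriction of scalars. -/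
@[reducible] def baseModule (M : ModuleCat.{u} R) : Module k M :=
  Module.compHom M (algebraMap k R)

attribute [local instance] baseModule

lemma baseModule_tower (M : ModuleCat.{u} R) : IsScalarTower k R M :=
  ⟨fun a r m => by rw [Algebra.smul_def, mul_smul]; rfl⟩

attribute [local instance] baseModule_tower

/-- The Hochschild complex `M ⊗ U^{⊗n}` of the `k`-algebra `U` with coefficients in the
`U`-bimodule `M`, for an `R`-module `M` on which `U` acts from the left through `lact : U → R` and
from the right through `ract : U → R`. -/
noncomputable def barComplex (lact ract : U →ₐ[k] R) (M : ModuleCat.{u} R) :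
    ChainComplex (ModuleCat.{u} R) ℕ :=
  ChainComplex.of (fun n => ModuleCat.of R (M ⊗[k] ⨂[k]^n U))
    (fun n => ModuleCat.ofHom (barD k lact ract M n))
    (fun n => ModuleCat.hom_ext (LinearMap.ext fun z => barD_barD k lact ract n z))

/-- The map `f ⊗ id : M ⊗ U^{⊗n} → N ⊗ U^{⊗n}` induced by a bimodule map `f : M → N`. -/
noncomputable def barMap (U : Type u) [CommRing U] [Algebra k U] {M N : ModuleCat.{u} R}
    (f : M ⟶ N) (n : ℕ) : (M ⊗[k] ⨂[k]^n U) →ₗ[R] (N ⊗[k] ⨂[k]^n U) :=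
  TensorProduct.AlgebraTensorModule.map f.hom LinearMap.id

lemma barMap_tmul {M N : ModuleCat.{u} R} (f : M ⟶ N) (n : ℕ) (m : M) (w : ⨂[k]^n U) :
    barMap k U f n (m ⊗ₜ w) = f.hom m ⊗ₜ w := rfl

lemma barMap_id (M : ModuleCat.{u} R) (n : ℕ) : barMap k U (𝟙 M) n = LinearMap.id := by
  refine LinearMap.ext fun z => ?_
  induction z using TensorProduct.induction_on with
  | zero => simp
  | add x y hx hy => rw [map_add, hx, hy, map_add]
  | tmul m w => rfl

lemma barMap_comp {M N P : ModuleCat.{u} R} (f : M ⟶ N) (g : N ⟶ P) (n : ℕ) :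
    barMap k U (f ≫ g) n = barMap k U g n ∘ₗ barMap k U f n := by
  refine LinearMap.ext fun z => ?_
  induction z using TensorProduct.induction_on with
  | zero => simp
  | add x y hx hy => rw [map_add, hx, hy, map_add]
  | tmul m w => rfl

lemma barMap_add {M N : ModuleCat.{u} R} (f g : M ⟶ N) (n : ℕ) :
    barMap k U (f + g) n = barMap k U f n + barMap k U g n := by
  refine LinearMap.ext fun z => ?_
  induction z using TensorProduct.induction_on with
  | zero => simp
  | add x y hx hy => rw [map_add, hx, hy, map_add]
  | tmul m w =>
    rw [LinearMap.add_apply, barMap_tmul, barMap_tmul, barMap_tmul, ← TensorProduct.add_tmul]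
    rfl

lemma barD_natural (lact ract : U →ₐ[k] R) {M N : ModuleCat.{u} R} (f : M ⟶ N) (n : ℕ)
    (z : M ⊗[k] ⨂[k]^(n + 1) U) :
    barD k lact ract N n (barMap k U f (n + 1) z) = barMap k U f n (barD k lact ract M n z) := by
  induction z using TensorProduct.induction_on with
  | zero => simp
  | add x y hx hy => simp only [map_add, hx, hy]
  | tmul m w =>
    induction w using PiTensorProduct.induction_on with
    | add x y hx hy => simp only [TensorProduct.tmul_add, map_add, hx, hy]
    | smul_tprod r u =>
      rw [TensorProduct.tmul_smul, TensorProduct.smul_tmul']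
      simp only [barMap_tmul, barD_tmul', map_sum, map_zsmul, map_smul]

/-- The Hochschild complex as a functor of the bimodule. -/
noncomputable def barFunctor (lact ract : U →ₐ[k] R) :
    ModuleCat.{u} R ⥤ ChainComplex (ModuleCat.{u} R) ℕ where
  obj M := barComplex k lact ract M
  map {M N} f := ChainComplex.ofHom (fun n => ModuleCat.ofHom (barMap k U f n))
    (fun n => by
      simp only [barComplex, ChainComplex.of_d]
      exact ModuleCat.hom_ext (LinearMap.ext fun z => barD_natural k lact ract f n z))
  map_id M := by
    ext n : 1
    exact ModuleCat.hom_ext (barMap_id k M n)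
  map_comp f g := by
    ext n : 1
    exact ModuleCat.hom_ext (barMap_comp k f g n)

/-- Hochschild homology `M ↦ HH_i(U; M)`. -/
noncomputable def hochschild (lact ract : U →ₐ[k] R) (i : ℕ) :
    ModuleCat.{u} R ⥤ ModuleCat.{u} R :=
  barFunctor k lact ract ⋙ HomologicalComplex.homologyFunctor _ _ i

instance (lact ract : U →ₐ[k] R) : (barFunctor k lact ract).Additive where
  map_add {M N f g} := by
    ext n : 1
    exact ModuleCat.hom_ext (barMap_add k f g n)

instance (lact ract : U →ₐ[k] R) (i : ℕ) : (hochschild k lact ract i).Additive := by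
  unfold hochschild
  infer_instance

end Hochschild

/-! ### Tangle diagrams and arc diagrams -/

/-- The boundary of a disk: `num` points, numbered from the distinguished point, with `out p` telling
whether the strand of the tangle in the disk ends at `p` (leaves the disk) or begins there. -/
structure Boundary where
  num : ℕ
  out : Fin num → Bool

/-- The points where a strand enters the disk. -/
abbrev Boundary.In (b : Boundary) : Type := {p : Fin b.num // b.out p = false}

/-- The points where a strand leaves the disk. -/
abbrev Boundary.Out (b : Boundary) : Type := {p : Fin b.num // b.out p = true}

/-- The boundary without endpoints, for closed diagrams. -/
def Boundary.empty : Boundary := ⟨0, fun _ => false⟩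

/-- The combinatorial data of an oriented tangle diagram in a disk with boundary `b`.

At a crossing `x`, with both strands pointing up, the two edges leaving `x` are the left one
`(x, false)` and the right one `(x, true)`, and the two edges entering `x` are the left one
`(x, false)` and the right one `(x, true)`.  An edge begins at a crossing or at a boundary point
where a strand enters, and ends at a crossing or at a boundary point where a strand leaves; the
bijection `edge` sends the beginning of each edge to its end.  `Circ` is the set of closed components without
crossings.  The crossings are ordered in order to fix the signs in the complexes below.
Planarity of the drawing is not recorded: all constructions only depend on these data. -/
structure TangleDiagram (b : Boundary) where
  Xing : Type
  [fintypeXing : Fintype Xing]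
  [orderXing : LinearOrder Xing]
  positive : Xing → Bool
  Circ : Type
  [finiteCirc : Finite Circ]
  edge : (Xing × Bool) ⊕ b.In ≃ (Xing × Bool) ⊕ b.Out

attribute [instance] TangleDiagram.fintypeXing TangleDiagram.orderXing TangleDiagram.finiteCirc

namespace TangleDiagram

variable {b : Boundary} (T : TangleDiagram b)

/-- The beginnings of the edges.  They also index the edges. -/
abbrev Tail : Type := (T.Xing × Bool) ⊕ b.In

/-- The ends of the edges. -/
abbrev Head : Type := (T.Xing × Bool) ⊕ b.Out

/-- The vertices of the graph of `T`: the crossings and the end points. -/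
abbrev Vertex : Type := T.Xing ⊕ Fin b.num

/-- The vertex at which an edge begins. -/
def tailVertex : T.Tail → T.Vertex
  | Sum.inl (x, _) => Sum.inl x
  | Sum.inr p => Sum.inr p.1

/-- The vertex at which an edge ends. -/
def headVertex : T.Head → T.Vertex
  | Sum.inl (x, _) => Sum.inl x
  | Sum.inr p => Sum.inr p.1

/-- There is an edge from `v` to `w`. -/
def Adj (v w : T.Vertex) : Prop :=
  ∃ e : T.Tail, T.tailVertex e = v ∧ T.headVertex (T.edge e) = w

/-- The diagram has no oriented cycles (in particular no closed components). -/
def IsAcyclic : Prop :=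
  IsEmpty T.Circ ∧ ∀ v, ¬ Relation.TransGen T.Adj v v

end TangleDiagram

/-- An oriented arc diagram whose outer boundary has no endpoints: an ordered set of holes, with
boundary points, and arcs joining the endpoints.  An arc begins where a strand of the tangle in some
hole ends and ends where a strand of the tangle in some hole begins. -/
structure ClosedArcDiagram where
  holes : ℕ
  bdry : Fin holes → Boundary
  arcEnd : (Σ j, (bdry j).Out) ≃ Σ j, (bdry j).In

namespace ClosedArcDiagram

variable (η : ClosedArcDiagram)

/-- The arcs of `η`, indexed by the point where they begin. -/
abbrev Arc : Type := Σ j, (η.bdry j).Out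

end ClosedArcDiagram

/-! #### First returns of a permutation -/

section FirstReturn

variable {A B : Type} [Finite A] [Finite B] (p : Equiv.Perm (A ⊕ B))

lemma exists_return (a : A) : ∃ n, 0 < n ∧ ((p ^ n) (Sum.inl a)).isLeft = true :=
  ⟨orderOf p, orderOf_pos p, by rw [pow_orderOf_eq_one]; rfl⟩

/-- The first time at which the orbit of `a : A` under `p` returns to `A`. -/
def returnTime (a : A) : ℕ := Nat.find (exists_return p a)

/-- The first point at which the orbit of `a : A` under `p` returns to `A`. -/
def firstReturn (a : A) : A :=
  ((p ^ returnTime p a) (Sum.inl a)).getLeft (Nat.find_spec (exists_return p a)).2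

lemma inl_firstReturn (a : A) :
    (Sum.inl (firstReturn p a) : A ⊕ B) = (p ^ returnTime p a) (Sum.inl a) :=
  Sum.inl_getLeft _ _

lemma firstReturn_injective : Function.Injective (firstReturn p) := by
  have key : ∀ a a' : A, firstReturn p a = firstReturn p a' →
      returnTime p a ≤ returnTime p a' → a = a' := by
    intro a a' h hle
    have h1 : (p ^ returnTime p a) (Sum.inl a) = (p ^ returnTime p a') (Sum.inl a') := by
      rw [← inl_firstReturn, ← inl_firstReturn, h]
    obtain ⟨d, hd⟩ := Nat.exists_eq_add_of_le hle
    rw [hd, pow_add, Equiv.Perm.mul_apply, EmbeddingLike.apply_eq_iff_eq] at h1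
    rcases Nat.eq_zero_or_pos d with rfl | hpos
    · simpa using h1
    · exfalso
      have hlt : d < returnTime p a' := by
        have := (Nat.find_spec (exists_return p a)).1
        change 0 < returnTime p a at this
        omega
      exact Nat.find_min (exists_return p a') hlt ⟨hpos, by rw [← h1]; rfl⟩
  intro a a' h
  rcases le_total (returnTime p a) (returnTime p a') with hle | hle
  · exact key a a' h hle
  · exact (key a' a h.symm hle).symm

/-- The first return map of a permutation of `A ⊕ B` to `A`. -/
noncomputable def firstReturnPerm : Equiv.Perm A :=
  Equiv.ofBijective (firstReturn p)
    (Finite.injective_iff_bijective.1 (firstReturn_injective p))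

/-- The orbits of a permutation of `A ⊕ B` which are contained in `B`. -/
def ClosedOrbit : Type :=
  Quotient ((Equiv.Perm.SameCycle.setoid p).comap
    fun y : {y : B // ∀ n : ℕ, ((p ^ n) (Sum.inr y)).isRight = true} => Sum.inr y.1)

instance : Finite (ClosedOrbit p) := by unfold ClosedOrbit; infer_instance

/-- A point on an orbit. -/
noncomputable def ClosedOrbit.out {p : Equiv.Perm (A ⊕ B)} (c : ClosedOrbit p) : B :=
  (Quotient.out c).1

end FirstReturn

/-! #### The action of arc diagrams on tangle diagrams -/

namespace ClosedArcDiagram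

variable (η : ClosedArcDiagram) (T : ∀ j, TangleDiagram (η.bdry j))

/-- The crossings of the tangles in all the holes, ordered lexicographically. -/
abbrev AllXing : Type := Σₗ j, (T j).Xing

/-- Regrouping of crossing flags and endpoints. -/
def regroup (Y : Fin η.holes → Type) :
    (Σ j, ((T j).Xing × Bool) ⊕ Y j) ≃ (η.AllXing T × Bool) ⊕ Σ j, Y j where
  toFun
    | ⟨j, Sum.inl (x, c)⟩ => Sum.inl (toLex ⟨j, x⟩, c)
    | ⟨j, Sum.inr y⟩ => Sum.inr ⟨j, y⟩
  invFun
    | Sum.inl (x, c) => ⟨(ofLex x).1, Sum.inl ((ofLex x).2, c)⟩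
    | Sum.inr y => ⟨y.1, Sum.inr y.2⟩
  left_inv := by rintro ⟨j, ⟨x, c⟩ | y⟩ <;> rfl
  right_inv := by rintro (⟨x, c⟩ | ⟨j, y⟩) <;> rfl

/-- From an outgoing crossing flag, or from the end of an arc of `η`, follow the tangle diagrams in
the holes until the next crossing or the beginning of the next arc of `η`. -/
def follow : Equiv.Perm ((η.AllXing T × Bool) ⊕ η.Arc) :=
  (Equiv.sumCongr (Equiv.refl _) η.arcEnd).trans <|
    (η.regroup T fun j => (η.bdry j).In).symm.trans <|
      (Equiv.sigmaCongrRight fun j => (T j).edge).trans (η.regroup T fun j => (η.bdry j).Out)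

/-- The signs of all the crossings. -/
def allPositive (x : η.AllXing T) : Bool := (T (ofLex x).1).positive (ofLex x).2

/-- The closed diagram obtained by pasting the tangle diagrams `T j` into the holes of `η`.
Its edges run from crossing to crossing along edges of the `T j` and arcs of `η`; the strands which
close up without meeting a crossing are its circles. -/
noncomputable def paste : TangleDiagram Boundary.empty where
  Xing := η.AllXing T
  positive := η.allPositive T
  Circ := (Σ j, (T j).Circ) ⊕ ClosedOrbit (η.follow T)
  edge := Equiv.sumCongr (firstReturnPerm (η.follow T))
    (@Equiv.equivOfIsEmpty _ _ ⟨fun p => p.1.elim0⟩ ⟨fun p => p.1.elim0⟩)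

end ClosedArcDiagram

/-! ### The complexes of a tangle diagram -/

section Complexes

variable (k : Type u) [CommRing k]

namespace TangleDiagram

variable {b : Boundary} (T : TangleDiagram b)

/-- The variables: one for each flag of the graph of `T` (the beginning and the end of each edge),
and one for each circle. -/
inductive Var
  | tail (e : T.Tail)
  | head (e : T.Head)
  | circ (c : T.Circ)

/-- The polynomial ring in the variables `t_{x,e}`. -/
abbrev Poly : Type u := MvPolynomial T.Var k

/-- The variable of the left outgoing edge of a crossing. -/
noncomputable def ti (x : T.Xing) : T.Poly k := MvPolynomial.X (Var.tail (Sum.inl (x, false)))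

/-- The variable of the right outgoing edge of a crossing. -/
noncomputable def tj (x : T.Xing) : T.Poly k := MvPolynomial.X (Var.tail (Sum.inl (x, true)))

/-- The variable of the right incoming edge of a crossing. -/
noncomputable def tk (x : T.Xing) : T.Poly k := MvPolynomial.X (Var.head (Sum.inl (x, true)))

/-- The variable of the left incoming edge of a crossing. -/
noncomputable def tl (x : T.Xing) : T.Poly k := MvPolynomial.X (Var.head (Sum.inl (x, false)))

/-- The Koszul generators: one for each edge and each circle, two for each crossing. -/
inductive Gen
  | edge (e : T.Tail)
  | circ (c : T.Circ)
  | fst (x : T.Xing)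
  | snd (x : T.Xing)

/-- The sequence whose Koszul complex is the term of the smoothing `s`: `t_a - t_b` for an edge from
`a` to `b`, `0 = t_c - t_c` for a circle, and at a crossing `ti - tl, tj - tk` for the oriented
resolution and `ti + tj - tk - tl, ti tj - tk tl` for the other one. -/
noncomputable def seq (s : T.Xing → Bool) : T.Gen → T.Poly k
  | Gen.edge e => MvPolynomial.X (Var.tail e) - MvPolynomial.X (Var.head (T.edge e))
  | Gen.circ _ => 0
  | Gen.fst x => if s x then T.ti k x - T.tl k x else T.ti k x + T.tj k x - T.tk k x - T.tl k x
  | Gen.snd x => if s x then T.tj k x - T.tk k x else T.ti k x * T.tj k x - T.tk k x * T.tl k x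

/-- The endomorphism of the exterior algebra attached to a crossing. -/
noncomputable def rho (x : T.Xing) : ExtAlg (T.Poly k) T.Gen →ₗ[T.Poly k] ExtAlg (T.Poly k) T.Gen :=
  if T.positive x then rhoPos (Gen.fst x) (Gen.snd x) (T.tj k x) (T.tl k x)
  else rhoNeg (Gen.fst x) (Gen.snd x) (T.ti k x) (T.tk k x)

lemma rho_mem (x : T.Xing) (n : ℕ) (ω : ExtAlg (T.Poly k) T.Gen)
    (h : ω ∈ ⋀[T.Poly k]^n (T.Gen →₀ T.Poly k)) :
    T.rho k x ω ∈ ⋀[T.Poly k]^n (T.Gen →₀ T.Poly k) := by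
  unfold rho
  split_ifs
  · exact rhoPos_mem _ _ n ω h
  · exact rhoNeg_mem _ _ n ω h

lemma seq_congr {x : T.Xing} {s s' : T.Xing → Bool} (h : Step T.positive x s s') (c : T.Gen)
    (h1 : c ≠ Gen.fst x) (h2 : c ≠ Gen.snd x) : T.seq k s c = T.seq k s' c := by
  obtain ⟨-, rfl⟩ := h
  cases c with
  | edge e => rfl
  | circ c => rfl
  | fst y =>
    have : y ≠ x := fun h => h1 (by rw [h])
    simp [seq, Function.update_of_ne this]
  | snd y =>
    have : y ≠ x := fun h => h2 (by rw [h])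
    simp [seq, Function.update_of_ne this]

lemma rho_contr {x : T.Xing} {s s' : T.Xing → Bool} (h : Step T.positive x s s')
    (ω : ExtAlg (T.Poly k) T.Gen) :
    contr (koszulForm (T.seq k s')) (T.rho k x ω) =
      T.rho k x (contr (koszulForm (T.seq k s)) ω) := by
  have hne : (Gen.fst x : T.Gen) ≠ Gen.snd x := by simp
  have hs := h.1
  have hs' : s' x = T.positive x := by rw [h.2]; simp
  unfold rho
  cases hp : T.positive x
  · rw [hp] at hs hs'
    simp only [Bool.false_eq_true, if_false]
    refine rhoNeg_contr (tj := T.tj k x) (tl := T.tl k x) hne ?_ ?_ ?_ ?_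
      (fun c h1 h2 => (T.seq_congr k h c h1 h2).symm) ω <;> simp [seq, hs, hs']
  · rw [hp] at hs hs'
    simp only [if_true]
    refine rhoPos_contr (ti := T.ti k x) (tk := T.tk k x) hne ?_ ?_ ?_ ?_
      (fun c h1 h2 => T.seq_congr k h c h1 h2) ω <;> simp [seq, hs, hs']

lemma rho_comm {x y : T.Xing} (hxy : x ≠ y) (ω : ExtAlg (T.Poly k) T.Gen) :
    T.rho k x (T.rho k y ω) = T.rho k y (T.rho k x ω) := by
  have h1 : (Gen.fst x : T.Gen) ≠ Gen.fst y := by simpa using hxy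
  have h2 : (Gen.fst x : T.Gen) ≠ Gen.snd y := by simp
  have h3 : (Gen.snd x : T.Gen) ≠ Gen.fst y := by simp
  have h4 : (Gen.snd x : T.Gen) ≠ Gen.snd y := by simpa using hxy
  unfold rho
  split_ifs
  · exact rhoPos_comm h1 h2 h3 h4 _ _ _ _ ω
  · exact rhoPos_rhoNeg_comm h1 h2 h3 h4 _ _ _ _ ω
  · exact (rhoPos_rhoNeg_comm h1.symm h3.symm h2.symm h4.symm _ _ _ _ ω).symm
  · exact rhoNeg_comm h1 h2 h3 h4 _ _ _ _ ω

/-- The cube of Koszul complexes of `T`. -/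
noncomputable def krCube : Cube T.positive (ChainComplex (ModuleCat.{u} (T.Poly k)) ℕ) where
  obj s := koszul (T.seq k s)
  map {x s s'} h := koszulHom (T.seq k s) (T.seq k s') (T.rho k x) (T.rho_mem k x) (T.rho_contr k h)
  comm {x y s s₁ s₂ s'} hxy h₁ h₂ h₃ h₄ := by
    ext n : 1
    exact ModuleCat.hom_ext (LinearMap.ext fun ω => Subtype.ext (T.rho_comm k hxy.symm ω.1))

/-- The ideal generated by the sequence of a smoothing. -/
noncomputable def ideal (s : T.Xing → Bool) : Ideal (T.Poly k) := Ideal.span (Set.range (T.seq k s))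

/-- The term of the naive complex: the top homology `S / (seq)` of the Koszul complex. -/
abbrev Naive (s : T.Xing → Bool) : Type u := T.Poly k ⧸ T.ideal k s

/-- The coefficient of the structure map at a crossing: `1` (the projection) at a positive crossing,
multiplication by `ti - tk` at a negative one. -/
noncomputable def naiveCoeff (x : T.Xing) : T.Poly k :=
  if T.positive x then 1 else T.ti k x - T.tk k x

lemma naiveCoeff_mem {x : T.Xing} {s s' : T.Xing → Bool} (h : Step T.positive x s s')
    {p : T.Poly k} (hp : p ∈ T.ideal k s) : T.naiveCoeff k x * p ∈ T.ideal k s' := by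
  have hgen : ∀ c, T.seq k s' c ∈ T.ideal k s' := fun c => Ideal.subset_span ⟨c, rfl⟩
  have hs := h.1
  have hs' : s' x = T.positive x := by rw [h.2]; simp
  have h1 := hgen (Gen.fst x)
  have h2 := hgen (Gen.snd x)
  induction hp using Submodule.span_induction with
  | zero => rw [mul_zero]; exact Ideal.zero_mem _
  | add a b _ _ ha hb => rw [mul_add]; exact Ideal.add_mem _ ha hb
  | smul r a _ ha =>
    rw [smul_eq_mul, mul_left_comm]
    exact Ideal.mul_mem_left _ r ha
  | mem p hp =>
    obtain ⟨c, rfl⟩ := hp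
    by_cases hc1 : c = Gen.fst x
    · subst hc1
      cases hpx : T.positive x
      · rw [hpx] at hs hs'
        simp only [seq, hs', hs, naiveCoeff, hpx, Bool.not_false, Bool.false_eq_true, if_true,
          if_false] at h1 h2 ⊢
        convert Ideal.sub_mem _ (Ideal.mul_mem_left _ (T.ti k x) h1) h2 using 1
        ring
      · rw [hpx] at hs hs'
        simp only [seq, hs', hs, naiveCoeff, hpx, Bool.not_true, Bool.false_eq_true, if_true,
          if_false] at h1 h2 ⊢
        convert Ideal.add_mem _ h1 h2 using 1
        ring
    · by_cases hc2 : c = Gen.snd x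
      · subst hc2
        cases hpx : T.positive x
        · rw [hpx] at hs hs'
          simp only [seq, hs', hs, naiveCoeff, hpx, Bool.not_false, Bool.false_eq_true, if_true,
            if_false] at h1 h2 ⊢
          convert Ideal.sub_mem _ h2 (Ideal.mul_mem_left _ (T.tk k x) h1) using 1
          ring
        · rw [hpx] at hs hs'
          simp only [seq, hs', hs, naiveCoeff, hpx, Bool.not_true, Bool.false_eq_true, if_true,
            if_false] at h1 h2 ⊢
          convert Ideal.add_mem _ (Ideal.mul_mem_left _ (T.tj k x) h1)
            (Ideal.mul_mem_left _ (T.tl k x) h2) using 1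
          ring
      · rw [T.seq_congr k h c hc1 hc2]
        exact Ideal.mul_mem_left _ _ (hgen c)

/-- Multiplication by `c` as a map between the terms of two smoothings. -/
noncomputable def naiveMap {s s' : T.Xing → Bool} (c : T.Poly k)
    (h : ∀ p ∈ T.ideal k s, c * p ∈ T.ideal k s') : T.Naive k s →ₗ[T.Poly k] T.Naive k s' :=
  Submodule.mapQ (T.ideal k s) (T.ideal k s') (LinearMap.mulLeft (T.Poly k) c) h

lemma naiveMap_mk {s s' : T.Xing → Bool} (c : T.Poly k)
    (h : ∀ p ∈ T.ideal k s, c * p ∈ T.ideal k s') (p : T.Poly k) :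
    T.naiveMap k c h (Ideal.Quotient.mk _ p) = Ideal.Quotient.mk _ (c * p) := rfl

/-- The internal shift of the term of a smoothing: `-2` for each negative crossing with the
non-oriented resolution. -/
def shift (s : T.Xing → Bool) : ℤ :=
  ∑ x, if T.positive x = false ∧ s x = false then -2 else 0

/-- The internal degree of a Koszul generator.  The variables have degree `2` and the Koszul
differential is of degree `2`, so the generator of an element of degree `d` has degree `d - 2`. -/
def genDeg (s : T.Xing → Bool) : T.Gen → ℤ
  | Gen.edge _ => 0
  | Gen.circ _ => 0
  | Gen.fst _ => 0
  | Gen.snd x => if s x then 0 else 2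

end TangleDiagram

namespace ClosedArcDiagram

variable (η : ClosedArcDiagram) (T : ∀ j, TangleDiagram (η.bdry j))

/-- The polynomial ring in the variables of all the tangles in the holes. -/
abbrev AllPoly : Type u := MvPolynomial (Σ j, (T j).Var) k

variable {η T} in
/-- The part of a smoothing in one hole. -/
def part (s : η.AllXing T → Bool) (j : Fin η.holes) : (T j).Xing → Bool :=
  fun x => s (toLex ⟨j, x⟩)

/-- The term `⨂ j, N(T j)_{s_j}` of the tensor product over `k` of the naive complexes. -/
def NaiveTensor (s : η.AllXing T → Bool) : Type u :=
  ⨂[k] j, (T j).Naive k (part s j)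

noncomputable instance (s : η.AllXing T → Bool) : CommRing (η.NaiveTensor k T s) :=
  inferInstanceAs (CommRing (⨂[k] j, (T j).Naive k (part s j)))

noncomputable instance (s : η.AllXing T → Bool) : Algebra k (η.NaiveTensor k T s) :=
  inferInstanceAs (Algebra k (⨂[k] j, (T j).Naive k (part s j)))

variable {η T} in
/-- Pure tensors. -/
noncomputable def pure (s : η.AllXing T → Bool) (z : ∀ j, (T j).Naive k (part s j)) :
    η.NaiveTensor k T s :=
  PiTensorProduct.tprod k z

lemma pure_mul (s : η.AllXing T → Bool) (y z : ∀ j, (T j).Naive k (part s j)) :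
    pure k s y * pure k s z = pure k s (y * z) :=
  PiTensorProduct.tprod_mul_tprod _ _

lemma pure_induction {s : η.AllXing T → Bool} {P : η.NaiveTensor k T s → Prop}
    (h : ∀ (r : k) z, P (r • pure k s z)) (hadd : ∀ x y, P x → P y → P (x + y))
    (z : η.NaiveTensor k T s) : P z :=
  PiTensorProduct.induction_on (motive := P) z h hadd

/-- The inclusion of the `j`-th tensor factor, `a ↦ 1 ⊗ ⋯ ⊗ a ⊗ ⋯ ⊗ 1`. -/
noncomputable def single (s : η.AllXing T → Bool) (j : Fin η.holes) :
    (T j).Naive k (part s j) →ₐ[k] η.NaiveTensor k T s :=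
  PiTensorProduct.singleAlgHom (R := k) (A := fun j => (T j).Naive k (part s j)) j

lemma single_eq (s : η.AllXing T → Bool) (j : Fin η.holes) (a : (T j).Naive k (part s j)) :
    η.single k T s j a = pure k s (Pi.mulSingle j a) := rfl

/-- The variable of a flag of `T j` acts on the `j`-th tensor factor. -/
noncomputable def actHom (s : η.AllXing T → Bool) : η.AllPoly k T →ₐ[k] η.NaiveTensor k T s :=
  MvPolynomial.aeval fun v => η.single k T s v.1 (Ideal.Quotient.mk _ (MvPolynomial.X v.2))

noncomputable instance (s : η.AllXing T → Bool) : Module (η.AllPoly k T) (η.NaiveTensor k T s) :=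
  Module.compHom _ (η.actHom k T s).toRingHom

lemma smul_eq (s : η.AllXing T → Bool) (r : η.AllPoly k T) (z : η.NaiveTensor k T s) :
    r • z = η.actHom k T s r * z := rfl

lemma actHom_X (s : η.AllXing T → Bool) (v : Σ j, (T j).Var) :
    η.actHom k T s (MvPolynomial.X v) =
      pure k s (Pi.mulSingle v.1 (Ideal.Quotient.mk _ (MvPolynomial.X v.2))) := by
  unfold actHom
  rw [MvPolynomial.aeval_X, single_eq]

/-- The tensor product of linear maps between the tensor factors, as a `k`-linear map. -/
noncomputable def tensorMapAux {s s' : η.AllXing T → Bool}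
    (f : ∀ j, (T j).Naive k (part s j) →ₗ[(T j).Poly k] (T j).Naive k (part s' j)) :
    η.NaiveTensor k T s →ₗ[k] η.NaiveTensor k T s' :=
  PiTensorProduct.map fun j => (f j).restrictScalars k

lemma tensorMapAux_pure {s s' : η.AllXing T → Bool}
    (f : ∀ j, (T j).Naive k (part s j) →ₗ[(T j).Poly k] (T j).Naive k (part s' j))
    (z : ∀ j, (T j).Naive k (part s j)) :
    η.tensorMapAux k T f (pure k s z) = pure k s' fun j => f j (z j) :=
  PiTensorProduct.map_tprod _ _

lemma tensorMapAux_X {s s' : η.AllXing T → Bool}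
    (f : ∀ j, (T j).Naive k (part s j) →ₗ[(T j).Poly k] (T j).Naive k (part s' j))
    (v : Σ j, (T j).Var) (z : η.NaiveTensor k T s) :
    η.tensorMapAux k T f (η.actHom k T s (MvPolynomial.X v) * z) =
      η.actHom k T s' (MvPolynomial.X v) * η.tensorMapAux k T f z := by
  induction z using η.pure_induction k T with
  | hadd x y hx hy => rw [mul_add, map_add, map_add, mul_add, hx, hy]
  | h r z =>
    rw [mul_smul_comm, map_smul, map_smul, mul_smul_comm, actHom_X, actHom_X, pure_mul,
      tensorMapAux_pure, tensorMapAux_pure, pure_mul]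
    congr 2
    ext j
    obtain ⟨i, v⟩ := v
    by_cases hj : j = i
    · subst hj
      simp only [Pi.mul_apply, Pi.mulSingle_eq_same]
      exact map_smul (f j) (MvPolynomial.X v : (T j).Poly k) (z j)
    · simp [Pi.mulSingle_eq_of_ne hj]

/-- The tensor product of linear maps between the tensor factors. -/
noncomputable def tensorMap {s s' : η.AllXing T → Bool}
    (f : ∀ j, (T j).Naive k (part s j) →ₗ[(T j).Poly k] (T j).Naive k (part s' j)) :
    η.NaiveTensor k T s →ₗ[η.AllPoly k T] η.NaiveTensor k T s' where
  toFun := η.tensorMapAux k T f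
  map_add' := map_add _
  map_smul' r z := by
    simp only [smul_eq, RingHom.id_apply]
    induction r using MvPolynomial.induction_on generalizing z with
    | C r =>
      rw [← MvPolynomial.algebraMap_eq, AlgHom.commutes, AlgHom.commutes, ← Algebra.smul_def,
        ← Algebra.smul_def, map_smul]
    | add p q hp hq => rw [map_add, add_mul, map_add, hp, hq, map_add, add_mul]
    | mul_X p v hp =>
      rw [map_mul (η.actHom k T s), mul_assoc, hp, tensorMapAux_X, map_mul (η.actHom k T s'),
        mul_assoc]

open Classical in
/-- The coefficient on the `j`-th tensor factor of the structure map at the crossing `x`. -/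
noncomputable def factorCoeff (x : η.AllXing T) (j : Fin η.holes) : (T j).Poly k :=
  if h : (ofLex x).1 = j then (T j).naiveCoeff k (h ▸ (ofLex x).2) else 1

lemma factorCoeff_mem {x : η.AllXing T} {s s' : η.AllXing T → Bool}
    (h : Step (η.allPositive T) x s s') (j : Fin η.holes) :
    ∀ p ∈ (T j).ideal k (part s j), η.factorCoeff k T x j * p ∈ (T j).ideal k (part s' j) := by
  intro p hp
  obtain ⟨h1, h2⟩ := h
  obtain ⟨i, x, rfl⟩ : ∃ i y, x = toLex ⟨i, y⟩ := ⟨(ofLex x).1, (ofLex x).2, rfl⟩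
  by_cases hij : i = j
  · subst hij
    have : Step (T i).positive x (part s i) (part s' i) := by
      refine ⟨h1, ?_⟩
      subst h2
      funext y
      by_cases hy : y = x
      · subst hy
        simp [part, allPositive]
      · have : (toLex ⟨i, y⟩ : η.AllXing T) ≠ toLex ⟨i, x⟩ := by
          intro hh
          apply hy
          simpa using hh
        rw [Function.update_of_ne hy]
        exact Function.update_of_ne this _ _
    simpa [factorCoeff] using (T i).naiveCoeff_mem k this hp
  · have : part s' j = part s j := by
      subst h2
      funext y
      have : (toLex ⟨j, y⟩ : η.AllXing T) ≠ toLex ⟨i, x⟩ := by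
        intro hh
        exact hij (congrArg Sigma.fst (toLex.injective hh)).symm
      exact Function.update_of_ne this _ _
    rw [this]
    simpa [factorCoeff, hij] using hp

/-- The cube of the tensor product over `k` of the naive complexes of the `T j`.  The structure map of
a crossing of `T j` is its structure map on the `j`-th tensor factor and the identity on the others. -/
noncomputable def naiveCube : Cube (η.allPositive T) (ModuleCat.{u} (η.AllPoly k T)) where
  obj s := ModuleCat.of _ (η.NaiveTensor k T s)
  map {x s s'} h := ModuleCat.ofHom (η.tensorMap k T fun j =>
    (T j).naiveMap k (η.factorCoeff k T x j) (η.factorCoeff_mem k T h j))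
  comm {x y s s₁ s₂ s'} hxy h₁ h₂ h₃ h₄ := by
    refine ModuleCat.hom_ext (LinearMap.ext fun z => ?_)
    change η.tensorMapAux k T _ (η.tensorMapAux k T _ z) =
      η.tensorMapAux k T _ (η.tensorMapAux k T _ z)
    induction z using η.pure_induction k T with
    | hadd a b ha hb => simp only [map_add, ha, hb]
    | h r z =>
      simp only [map_smul, tensorMapAux_pure]
      congr 2
      ext j
      obtain ⟨p, hp⟩ := Ideal.Quotient.mk_surjective (z j)
      rw [← hp]
      simp only [TangleDiagram.naiveMap_mk]
      rw [mul_left_comm]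

end ClosedArcDiagram
end Complexes

/-! ### Horizontal homology and Hochschild homology -/

instance chainComplex_hasFiniteBiproducts (R : Type u) [CommRing R] :
    HasFiniteBiproducts (ChainComplex (ModuleCat.{u} R) ℕ) :=
  HasFiniteBiproducts.of_hasFiniteProducts

/-- The part of the homology of a complex that is represented by cycles in `G`. -/
noncomputable def homologyPart {R : Type u} [CommRing R] (K : ChainComplex (ModuleCat.{u} R) ℕ)
    (i : ℕ) (G : AddSubgroup (K.X i)) : AddSubgroup (K.homology i) :=
  (G.comap (K.iCycles i).hom.toAddMonoidHom).map (K.homologyπ i).hom.toAddMonoidHom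

section Main

variable (k : Type u) [CommRing k]

namespace TangleDiagram

variable {b : Boundary} (T : TangleDiagram b)

/-- The bicomplex of `T`: vertically (cohomologically) the total complex of the cube of resolutions,
horizontally Koszul complexes. -/
noncomputable def bicomplex : CochainComplex (ChainComplex (ModuleCat.{u} (T.Poly k)) ℕ) ℤ :=
  (T.krCube k).total

/-- The `i`-th horizontal homology of the term of a smoothing. -/
noncomputable def termHomology (i : ℕ) (s : T.Xing → Bool) : ModuleCat.{u} (T.Poly k) :=
  (HomologicalComplex.homologyFunctor _ _ i).obj ((T.krCube k).obj s)

/-- The `i`-th horizontal homology of the bicomplex, a complex for the vertical differential. -/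
noncomputable def horizontalHomology (i : ℕ) : CochainComplex (ModuleCat.{u} (T.Poly k)) ℤ :=
  ((HomologicalComplex.homologyFunctor _ _ i).mapHomologicalComplex _).obj (T.bicomplex k)

/-- The elements of internal degree `d` in `⋀^n` of the Koszul complex of a smoothing: sums of
`p e_{a₁} ∧ ⋯ ∧ e_{aₙ}` with `p` homogeneous and total degree `d`. -/
noncomputable def koszulPart (s : T.Xing → Bool) (n : ℕ) (d : ℤ) :
    AddSubgroup (⋀[T.Poly k]^n (T.Gen →₀ T.Poly k)) :=
  AddSubgroup.closure {ω | ∃ (p : T.Poly k) (e : ℕ) (a : Fin n → T.Gen), p.IsHomogeneous e ∧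
    2 * (e : ℤ) + ∑ l, T.genDeg s (a l) + T.shift s = d ∧
    ω = p • exteriorPower.ιMulti (T.Poly k) n fun l => Finsupp.single (a l) (1 : T.Poly k)}

/-- The internal degree `d` part of the `i`-th horizontal homology of the term of a smoothing. -/
noncomputable def termHomologyPart (i : ℕ) (s : T.Xing → Bool) (d : ℤ) :
    AddSubgroup (T.termHomology k i s) :=
  homologyPart ((T.krCube k).obj s) i (T.koszulPart k s i d)

end TangleDiagram

namespace ClosedArcDiagram

variable (η : ClosedArcDiagram) (T : ∀ j, TangleDiagram (η.bdry j))

/-- The ring `U` of polynomials in the arcs of `η`. -/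
abbrev ArcPoly : Type u := MvPolynomial η.Arc k

/-- The left action of `U`: the variable of an arc acts as the variable at its end. -/
noncomputable def leftAct : η.ArcPoly k →ₐ[k] η.AllPoly k T :=
  MvPolynomial.rename fun α =>
    ⟨(η.arcEnd α).1, TangleDiagram.Var.tail (Sum.inr (η.arcEnd α).2)⟩

/-- The right action of `U`: the variable of an arc acts as the variable at its beginning. -/
noncomputable def rightAct : η.ArcPoly k →ₐ[k] η.AllPoly k T :=
  MvPolynomial.rename fun α => ⟨α.1, TangleDiagram.Var.head (Sum.inr α.2)⟩

/-- The complex of `U`-bimodules `⨂ j, N(T j)`. -/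
noncomputable def naiveComplex : CochainComplex (ModuleCat.{u} (η.AllPoly k T)) ℤ :=
  (η.naiveCube k T).total

/-- `HH_i` over `U = k[arcs]` as a functor of the bimodule. -/
noncomputable def HH (i : ℕ) : ModuleCat.{u} (η.AllPoly k T) ⥤ ModuleCat.{u} (η.AllPoly k T) :=
  hochschild k (η.leftAct k T) (η.rightAct k T) i

instance (i : ℕ) : (η.HH k T i).Additive := by
  unfold HH
  infer_instance

/-- Each flag of the pasted diagram is a flag of one of the `T j`.  A circle that arises from pasting
is marked by one of the arcs of `η` on it. -/
noncomputable def pasteVar : (η.paste T).Var → Σ j, (T j).Var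
  | TangleDiagram.Var.tail (Sum.inl (x, c)) =>
      ⟨(ofLex (x : η.AllXing T)).1, TangleDiagram.Var.tail (Sum.inl ((ofLex (x : η.AllXing T)).2, c))⟩
  | TangleDiagram.Var.tail (Sum.inr p) => p.1.elim0
  | TangleDiagram.Var.head (Sum.inl (x, c)) =>
      ⟨(ofLex (x : η.AllXing T)).1, TangleDiagram.Var.head (Sum.inl ((ofLex (x : η.AllXing T)).2, c))⟩
  | TangleDiagram.Var.head (Sum.inr p) => p.1.elim0
  | TangleDiagram.Var.circ (Sum.inl c) => ⟨c.1, TangleDiagram.Var.circ c.2⟩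
  | TangleDiagram.Var.circ (Sum.inr o) => ⟨(ClosedOrbit.out o).1,
      TangleDiagram.Var.head (Sum.inr (ClosedOrbit.out o).2)⟩

/-- The polynomial ring of the pasted diagram acts on everything defined over `AllPoly`. -/
noncomputable def pasteHom : (η.paste T).Poly k →ₐ[k] η.AllPoly k T :=
  MvPolynomial.rename (η.pasteVar T)

/-- Restriction of scalars to the polynomial ring of the pasted diagram. -/
noncomputable abbrev restrict :
    ModuleCat.{u} (η.AllPoly k T) ⥤ ModuleCat.{u} ((η.paste T).Poly k) :=
  ModuleCat.restrictScalars (η.pasteHom k T).toRingHom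

/-- `HH_i` of the term of a smoothing. -/
noncomputable def termHH (i : ℕ) (s : η.AllXing T → Bool) :
    ModuleCat.{u} ((η.paste T).Poly k) :=
  (η.restrict k T).obj ((η.HH k T i).obj ((η.naiveCube k T).obj s))

/-- `HH_i` applied term-wise to the complex `⨂ j, N(T j)`. -/
noncomputable def hochschildComplex (i : ℕ) :
    CochainComplex (ModuleCat.{u} ((η.paste T).Poly k)) ℤ :=
  ((η.HH k T i ⋙ η.restrict k T).mapHomologicalComplex _).obj (η.naiveComplex k T)

/-- The elements of internal degree `d` in the term of a smoothing. -/
noncomputable def naivePart (s : η.AllXing T → Bool) (d : ℤ) : AddSubgroup (η.NaiveTensor k T s) :=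
  AddSubgroup.closure {z | ∃ (c : k) (p : ∀ j, (T j).Poly k) (e : Fin η.holes → ℕ),
    (∀ j, (p j).IsHomogeneous (e j)) ∧
    ∑ j, (2 * (e j : ℤ) + (T j).shift (part s j)) = d ∧
    z = c • pure k s fun j => Ideal.Quotient.mk _ (p j)}

attribute [local instance] baseModule baseModule_tower

/-- The elements of internal degree `d` in the `n`-th term of the Hochschild complex. -/
noncomputable def barPart (s : η.AllXing T → Bool) (n : ℕ) (d : ℤ) :
    AddSubgroup ((barComplex k (η.leftAct k T) (η.rightAct k T) ((η.naiveCube k T).obj s)).X n) :=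
  AddSubgroup.closure {z | ∃ (m : (η.naiveCube k T).obj s) (a : ℤ) (u : Fin n → η.ArcPoly k)
    (e : Fin n → ℕ), m ∈ η.naivePart k T s a ∧ (∀ l, (u l).IsHomogeneous (e l)) ∧
    a + ∑ l, 2 * (e l : ℤ) = d ∧ z = m ⊗ₜ[k] PiTensorProduct.tprod k u}

/-- The internal degree `d` part of `HH_i` of the term of a smoothing. -/
noncomputable def termHHPart (i : ℕ) (s : η.AllXing T → Bool) (d : ℤ) :
    AddSubgroup (η.termHH k T i s) :=
  homologyPart (barComplex k (η.leftAct k T) (η.rightAct k T) ((η.naiveCube k T).obj s)) i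
    (η.barPart k T s i d)

end ClosedArcDiagram

end Main

end KhR

open KhR

/-! Let `P` be the polynomial ring of the pasted diagram, `S` the ring `AllPoly`, `U` the ring of
the arcs and `𝔞 ⊆ S` the ideal generated by the sequences of all the tangles. For a fixed smoothing
one side is the Koszul complex over `P` of the sequence of the pasted diagram. The other is the
Hochschild complex of `U` with coefficients in `S / 𝔞`, which is the tensor product of the naive
terms (`actHom_eq_zero_iff`). Between them stands the Koszul complex over `S` of the family
`allSeq`: the sequences of the tangles together with the difference of the right and the left action
of `t_α` for every arc `α`.

From the middle to the Hochschild side. Signed insertion of `c : U` into a tensor is a null-homotopy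
of `ract c - lact c` (`barD_sh_succ`) and squares to zero. These are the relations of left
multiplication by a Koszul generator, so sending the generator of `α` to the shuffle with `t_α`
defines a map `koszulToBar`. With coefficients in `S` and only the arcs as generators it is a
quasi-isomorphism, because both complexes resolve the same quotient of `S`: the arcs form a regular
sequence, and the Hochschild complex contracts because the variables of the right action split off
from `S` (`barD_barContraction`). Next the generators of the tangles join the Koszul side one at a
time, while the corresponding elements are killed on the Hochschild side. A quasi-isomorphism
survives each step in which the element is regular modulo the previous ones (`IsQuasi.insert`).
Acyclicity supplies the order: rank the vertices so that edges go up, and at each vertex take the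
edges that end there, then the two generators of the crossing. Modulo the earlier elements, each new
one is then monic, up to sign, in a fresh variable, of degree one or two (`mem_of_allSeq_mul_mem`).
The outcome is `isQuasi_all`.

From the pasted diagram to the middle. A strand of the pasted diagram is a chain of edges of the
tangles and arcs. The sum of their generators has a telescoping image under the Koszul form, namely
the difference of the variables at the two ends (`koszulForm_strandVec`), so the generators of the
pasted diagram embed as such sums (`pasteExt`). A strand that closes up without crossings keeps one
arc as the generator of its circle. All other edges that begin at the boundary of a hole, and all
other arcs, serve to eliminate the superfluous variables along the strands. Injectivity on homology
follows from a retraction (`exists_of_extMap_eq_contr`), surjectivity from regularity of the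
eliminated elements (`exists_sub_extMap_eq_contr`).

The composite commutes with the structure maps of the crossings already on chains: the lifts change
only the two Koszul generators of a crossing, which are sent to zero, so that only the scalar `1` or
`ti - tk` is left (`pasteToBar_rho`). Hence the isomorphisms on homology are natural on the cube and
assemble to the total complexes (`exists_total_iso`).

For the internal degrees, each Koszul generator that survives has degree `0` and becomes a shuffle
with an element of degree `2`, which accounts for the shift `2i`. Both complexes are spanned by
homogeneous parts whose sum is direct, so homogeneous classes correspond in both directions
(`mem_termHomologyPart_iff`). -/

namespace KhR

/-! ### Koszul complexes on subfamilies and successive quotients -/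

section ExtAlgTools

variable {R : Type u} [CommRing R] {I : Type}

/-- The coordinate form of the free module on `I`. -/
noncomputable def coordForm (R : Type u) [CommRing R] {I : Type} (c : I) :
    Module.Dual R (I →₀ R) := Finsupp.lapply c

/-- The generator `e_c` of the exterior algebra. -/
noncomputable def gen (R : Type u) [CommRing R] {I : Type} (c : I) : ExtAlg R I :=
  ExteriorAlgebra.ι R (Finsupp.single c (1 : R))

lemma contr_gen_mul (φ : Module.Dual R (I →₀ R)) (c : I) (ω : ExtAlg R I) :
    contr φ (gen R c * ω) = φ (Finsupp.single c 1) • ω - gen R c * contr φ ω :=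
  contr_ι_mul φ _ ω

lemma koszulForm_single (x : I → R) (c : I) : koszulForm x (Finsupp.single c 1) = x c := by
  simp [koszulForm]

/-- Induction on the exterior algebra along left multiplication by generators. -/
lemma ext_gen_induction {P : ExtAlg R I → Prop} (h0 : ∀ r, P (algebraMap R (ExtAlg R I) r))
    (hadd : ∀ a b, P a → P b → P (a + b)) (hsmul : ∀ (r : R) a, P a → P (r • a))
    (hmul : ∀ (c : I) (a : ExtAlg R I), P a → P (gen R c * a)) (ω : ExtAlg R I) : P ω := by
  induction ω using ext_induction with
  | h0 r => exact h0 r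
  | hadd a b ha hb => exact hadd a b ha hb
  | hmul v a ha =>
    induction v using Finsupp.induction_linear with
    | zero =>
      rw [map_zero, zero_mul, ← map_zero (algebraMap R (ExtAlg R I))]
      exact h0 0
    | add f g hf hg => rw [map_add, add_mul]; exact hadd _ _ hf hg
    | single c r =>
      have : (Finsupp.single c r : I →₀ R) = r • Finsupp.single c 1 := by simp
      rw [this, map_smul, smul_mul_assoc]
      exact hsmul _ _ (hmul c a ha)


lemma gen_mul_gen (c : I) : gen R c * gen R c = 0 := ExteriorAlgebra.ι_sq_zero _

lemma gen_mul_swap (c d : I) : gen R c * gen R d = - (gen R d * gen R c) :=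
  eq_neg_of_add_eq_zero_left (ExteriorAlgebra.ι_add_mul_swap _ _)

/-- The elements of the exterior algebra which only involve the generators in `J`. -/
inductive InSupp (R : Type u) [CommRing R] {I : Type} (J : Set I) : ExtAlg R I → Prop
  | scalar (r : R) : InSupp R J (algebraMap R (ExtAlg R I) r)
  | add {a b : ExtAlg R I} : InSupp R J a → InSupp R J b → InSupp R J (a + b)
  | smul (r : R) {a : ExtAlg R I} : InSupp R J a → InSupp R J (r • a)
  | mul {c : I} (hc : c ∈ J) {a : ExtAlg R I} : InSupp R J a → InSupp R J (gen R c * a)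

/-- The submodule of the elements which only involve the generators in `J`. -/
def supp (R : Type u) [CommRing R] {I : Type} (J : Set I) : Submodule R (ExtAlg R I) where
  carrier := {ω | InSupp R J ω}
  add_mem' := InSupp.add
  zero_mem' := by
    have := InSupp.scalar (R := R) (J := J) 0
    rwa [map_zero] at this
  smul_mem' r _ h := InSupp.smul r h

lemma algebraMap_mem_supp (J : Set I) (r : R) : algebraMap R (ExtAlg R I) r ∈ supp R J :=
  InSupp.scalar r

lemma gen_mul_mem_supp {J : Set I} {c : I} (hc : c ∈ J) {ω : ExtAlg R I} (h : ω ∈ supp R J) :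
    gen R c * ω ∈ supp R J := InSupp.mul hc h

lemma supp_induction {J : Set I} {P : (ω : ExtAlg R I) → ω ∈ supp R J → Prop}
    (h0 : ∀ r, P (algebraMap R (ExtAlg R I) r) (InSupp.scalar r))
    (hadd : ∀ a b (ha : a ∈ supp R J) (hb : b ∈ supp R J), P a ha → P b hb →
      P (a + b) (InSupp.add ha hb))
    (hsmul : ∀ (r : R) a (ha : a ∈ supp R J), P a ha → P (r • a) (InSupp.smul r ha))
    (hmul : ∀ c (hc : c ∈ J) a (ha : a ∈ supp R J), P a ha →
      P (gen R c * a) (InSupp.mul hc ha)) {ω : ExtAlg R I}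
    (h : ω ∈ supp R J) : P ω h := by
  change InSupp R J ω at h
  induction h with
  | scalar r => exact h0 r
  | add h1 h2 ha hb => exact hadd _ _ h1 h2 ha hb
  | smul r h1 ha => exact hsmul r _ h1 ha
  | mul hc h' ha => exact hmul _ hc _ h' ha

lemma supp_mono {J J' : Set I} (h : J ⊆ J') : supp R J ≤ supp R J' := by
  intro ω hω
  induction hω using supp_induction with
  | h0 r => exact algebraMap_mem_supp _ r
  | hadd a b _ _ ha hb => exact Submodule.add_mem _ ha hb
  | hsmul r a _ ha => exact Submodule.smul_mem _ r ha
  | hmul c hc a _ ha => exact gen_mul_mem_supp (h hc) ha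

lemma mem_supp_univ (ω : ExtAlg R I) : ω ∈ supp R (Set.univ : Set I) := by
  induction ω using ext_gen_induction with
  | h0 r => exact algebraMap_mem_supp _ r
  | hadd a b ha hb => exact Submodule.add_mem _ ha hb
  | hsmul r a ha => exact Submodule.smul_mem _ r ha
  | hmul c a ha => exact gen_mul_mem_supp (Set.mem_univ _) ha

lemma mem_supp_empty {ω : ExtAlg R I} (h : ω ∈ supp R (∅ : Set I)) :
    ∃ r, ω = algebraMap R (ExtAlg R I) r := by
  induction h using supp_induction with
  | h0 r => exact ⟨r, rfl⟩
  | hadd a b _ _ ha hb =>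
    obtain ⟨r, rfl⟩ := ha
    obtain ⟨s, rfl⟩ := hb
    exact ⟨r + s, (map_add _ _ _).symm⟩
  | hsmul r a _ ha =>
    obtain ⟨s, rfl⟩ := ha
    exact ⟨r * s, by rw [map_mul, Algebra.smul_def]⟩
  | hmul c hc => exact absurd hc (by simp)

lemma contr_mem_supp {J : Set I} (φ : Module.Dual R (I →₀ R)) {ω : ExtAlg R I}
    (h : ω ∈ supp R J) : contr φ ω ∈ supp R J := by
  induction h using supp_induction with
  | h0 r => rw [contr_algebraMap]; exact Submodule.zero_mem _
  | hadd a b _ _ ha hb => rw [map_add]; exact Submodule.add_mem _ ha hb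
  | hsmul r a _ ha => rw [map_smul]; exact Submodule.smul_mem _ r ha
  | hmul c hc a ha' ha =>
    rw [contr_gen_mul]
    exact Submodule.sub_mem _ (Submodule.smul_mem _ _ ha') (gen_mul_mem_supp hc ha)

/-- Splitting `ω = a + e_c b` with `a` and `b` free of `e_c`: contraction with the coordinate of `c`
produces `b`, and the remainder is `a`. No ordering of the generators is needed. -/
lemma contr_coord_mem_supp {J : Set I} {c : I} {ω : ExtAlg R I} (h : ω ∈ supp R (insert c J)) :
    contr (coordForm R c) ω ∈ supp R J ∧
      ω - gen R c * contr (coordForm R c) ω ∈ supp R J := by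
  induction h using supp_induction with
  | h0 r =>
    rw [contr_algebraMap, mul_zero, sub_zero]
    exact ⟨Submodule.zero_mem _, algebraMap_mem_supp _ r⟩
  | hadd a b _ _ ha hb =>
    rw [map_add, mul_add, add_sub_add_comm]
    exact ⟨Submodule.add_mem _ ha.1 hb.1, Submodule.add_mem _ ha.2 hb.2⟩
  | hsmul r a _ ha =>
    rw [map_smul, mul_smul_comm, ← smul_sub]
    exact ⟨Submodule.smul_mem _ r ha.1, Submodule.smul_mem _ r ha.2⟩
  | hmul d hd a ha' ha =>
    by_cases hdc : d = c
    · subst hdc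
      rw [contr_gen_mul, mul_sub, ← mul_assoc, gen_mul_gen, zero_mul, sub_zero]
      simp only [coordForm, Finsupp.lapply_apply, Finsupp.single_eq_same, one_smul, sub_self]
      exact ⟨ha.2, Submodule.zero_mem _⟩
    · have hdJ : d ∈ J := hd.resolve_left hdc
      have hz : coordForm R c (Finsupp.single d 1) = 0 := by simp [coordForm, Ne.symm hdc]
      rw [contr_gen_mul, hz, zero_smul, zero_sub, mul_neg, sub_neg_eq_add, ← mul_assoc,
        gen_mul_swap c d, neg_mul, ← sub_eq_add_neg, mul_assoc, ← mul_sub]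
      exact ⟨Submodule.neg_mem _ (gen_mul_mem_supp hdJ ha.1), gen_mul_mem_supp hdJ ha.2⟩

/-- The uniqueness half of the splitting `a + e_c b`: contracting an equation with this form
isolates the part that contains `e_c`. -/
lemma contr_coord_eq_zero {J : Set I} {c : I} (hc : c ∉ J) {ω : ExtAlg R I}
    (h : ω ∈ supp R J) : contr (coordForm R c) ω = 0 := by
  induction h using supp_induction with
  | h0 r => exact contr_algebraMap _ r
  | hadd a b _ _ ha hb => rw [map_add, ha, hb, add_zero]
  | hsmul r a _ ha => rw [map_smul, ha, smul_zero]
  | hmul d hd a _ ha =>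
    have hdc : d ≠ c := fun h => hc (h ▸ hd)
    have hz : coordForm R c (Finsupp.single d 1) = 0 := by simp [coordForm, Ne.symm hdc]
    rw [contr_gen_mul, ha, hz, zero_smul, mul_zero, sub_zero]

/-! Homogeneous components for the exterior degree. -/

/-- The component of exterior degree `n`. -/
noncomputable def extProj (R : Type u) [CommRing R] (I : Type) (n : ℕ) :
    ExtAlg R I →ₗ[R] ExtAlg R I :=
  GradedAlgebra.proj (fun i : ℕ => ⋀[R]^i (I →₀ R)) n

lemma extProj_mem (n : ℕ) (ω : ExtAlg R I) : extProj R I n ω ∈ ⋀[R]^n (I →₀ R) :=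
  SetLike.coe_mem _

lemma extProj_same {n : ℕ} {ω : ExtAlg R I} (h : ω ∈ ⋀[R]^n (I →₀ R)) : extProj R I n ω = ω :=
  DirectSum.decompose_of_mem_same (fun i : ℕ => ⋀[R]^i (I →₀ R)) h

lemma extProj_ne {m n : ℕ} {ω : ExtAlg R I} (h : ω ∈ ⋀[R]^m (I →₀ R)) (hmn : m ≠ n) :
    extProj R I n ω = 0 :=
  DirectSum.decompose_of_mem_ne (fun i : ℕ => ⋀[R]^i (I →₀ R)) h hmn

/-- Additive properties of elements of the exterior algebra may be checked on homogeneous ones. -/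
lemma ext_homogeneous_induction {P : ExtAlg R I → Prop} (h0 : P 0)
    (hadd : ∀ a b, P a → P b → P (a + b)) (h : ∀ n, ∀ a ∈ ⋀[R]^n (I →₀ R), P a)
    (ω : ExtAlg R I) : P ω :=
  DirectSum.Decomposition.inductionOn (fun i : ℕ => ⋀[R]^i (I →₀ R)) h0
    (fun {n} m => h n m m.2) (fun a b => hadd a b) ω

/-- Contraction lowers the exterior degree by one. This allows arguments with the whole exterior
algebra as a differential module to be brought back to a fixed degree at the end. -/
lemma extProj_contr (φ : Module.Dual R (I →₀ R)) (n : ℕ) (ω : ExtAlg R I) :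
    extProj R I n (contr φ ω) = contr φ (extProj R I (n + 1) ω) := by
  induction ω using ext_homogeneous_induction with
  | h0 => simp
  | hadd a b ha hb => simp only [map_add, ha, hb]
  | h m a ha =>
    cases m with
    | zero => rw [contr_mem_zero _ ha, extProj_ne ha (by omega), map_zero, map_zero]
    | succ m =>
      by_cases hmn : m = n
      · subst hmn
        rw [extProj_same ha, extProj_same (contr_mem_succ _ _ ha)]
      · rw [extProj_ne ha (by omega), extProj_ne (contr_mem_succ _ _ ha) hmn, map_zero]

end ExtAlgTools

/-! ### Comparison of Koszul complexes with quotients -/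

section Cone

variable {R : Type u} [CommRing R] {I : Type} {G : Type v} [AddCommGroup G] [Module R G]

/-- `f` restricts to a quasi-isomorphism from the Koszul complex on the generators in `J` to the
differential module `G / N`. -/
structure IsQuasi (x : I → R) (D : G →ₗ[R] G) (f : ExtAlg R I →ₗ[R] G) (J : Set I)
    (N : Submodule R G) : Prop where
  -- Everything is expressed modulo `N` inside a fixed `G`, so that enlarging `J` and `N` together
  -- changes neither `f` nor `D`, and no tower of quotient modules appears.
  chain : ∀ ω ∈ supp R J, D (f ω) - f (contr (koszulForm x) ω) ∈ N
  inj : ∀ ω ∈ supp R J, contr (koszulForm x) ω = 0 → (∃ g, f ω - D g ∈ N) →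
    ∃ η ∈ supp R J, contr (koszulForm x) η = ω
  surj : ∀ g, D g ∈ N → ∃ ω ∈ supp R J, contr (koszulForm x) ω = 0 ∧ ∃ g', g - f ω - D g' ∈ N

/-- Adding a generator on the left and killing a regular element on the right. -/
theorem IsQuasi.insert {x : I → R} {D : G →ₗ[R] G} {f : ExtAlg R I →ₗ[R] G} {J : Set I}
    {N N' : Submodule R G} (h : IsQuasi x D f J N) (hD : ∀ g, D (D g) = 0)
    (hN : ∀ g ∈ N, D g ∈ N) {c : I} (hc : c ∉ J)
    (hN' : ∀ g, g ∈ N' ↔ ∃ n ∈ N, ∃ v, g = n + x c • v)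
    (hreg : ∀ v, x c • v ∈ N → v ∈ N) (hf : ∀ ω ∈ supp R J, f (gen R c * ω) = 0) :
    IsQuasi x D f (insert c J) N' := by
  have hle : N ≤ N' := fun n hn => (hN' n).2 ⟨n, hn, 0, by simp⟩
  have hx : ∀ v, x c • v ∈ N' := fun v => (hN' _).2 ⟨0, N.zero_mem, v, by simp⟩
  have hJ : supp R J ≤ supp R (Insert.insert c J) := supp_mono (Set.subset_insert c J)
  have hdec : ∀ ω ∈ supp R (Insert.insert c J), ∃ a ∈ supp R J, ∃ b ∈ supp R J,
      ω = a + gen R c * b := fun ω hω =>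
    ⟨_, (contr_coord_mem_supp hω).2, _, (contr_coord_mem_supp hω).1, by abel⟩
  have hgen : ∀ b ∈ supp R J, gen R c * b ∈ supp R (Insert.insert c J) := fun b hb =>
    gen_mul_mem_supp (Set.mem_insert c J) (hJ hb)
  have hd : ∀ b, contr (koszulForm x) (gen R c * b) =
      x c • b - gen R c * contr (koszulForm x) b := fun b => by
    rw [contr_gen_mul, koszulForm_single]
  refine ⟨?_, ?_, ?_⟩
  · intro ω hω
    obtain ⟨a, ha, b, hb, rfl⟩ := hdec ω hω
    have h1 := hle (h.chain a ha)
    have h2 := hx (f b)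
    convert Submodule.sub_mem _ h1 h2 using 1
    simp only [map_add, map_sub, map_smul, hd, hf b hb, hf _ (contr_mem_supp _ hb), map_zero]
    abel
  · rintro ω hω hcyc ⟨g, hg⟩
    obtain ⟨a, ha, b, hb, rfl⟩ := hdec ω hω
    rw [map_add, hd] at hcyc
    -- The cycle condition reads `(d a + x_c b) - e_c (d b) = 0`; its two components vanish
    -- separately.
    have hdb : contr (koszulForm x) b = 0 ∧ contr (koszulForm x) a + x c • b = 0 := by
      have hu : contr (koszulForm x) a + x c • b ∈ supp R J :=
        Submodule.add_mem _ (contr_mem_supp _ ha) (Submodule.smul_mem _ _ hb)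
      have hw := contr_mem_supp (koszulForm x) hb
      have e := congrArg (contr (coordForm R c)) hcyc
      rw [← add_sub_assoc, map_sub, contr_gen_mul, contr_coord_eq_zero hc hu,
        contr_coord_eq_zero hc hw, mul_zero, sub_zero, map_zero, zero_sub, neg_eq_zero] at e
      simp only [coordForm, Finsupp.lapply_apply, Finsupp.single_eq_same, one_smul] at e
      rw [e, mul_zero, sub_zero] at hcyc
      exact ⟨e, hcyc⟩
    obtain ⟨hdb, hda⟩ := hdb
    rw [map_add, hf b hb, add_zero] at hg
    obtain ⟨n, hn, v, hv⟩ := (hN' _).1 hg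
    have e1 : D (f a) = D n + x c • D v := by
      have := congrArg D hv
      rw [map_sub, hD, sub_zero, map_add, map_smul] at this
      exact this
    -- Regularity enters here: `x_c` times this element is in `N`. Hence `f b` is a boundary modulo
    -- `N`, and so `b = d b'`.
    have e2 : f b + D v ∈ N := by
      apply hreg
      have e3 : f (contr (koszulForm x) a) + x c • f b = 0 := by
        rw [← map_smul, ← map_add, hda, map_zero]
      have e4 := Submodule.sub_mem _ (h.chain a ha) (hN n hn)
      convert Submodule.neg_mem _ (Submodule.neg_mem _ e4) using 1
      rw [e1, smul_add, eq_neg_of_add_eq_zero_left e3]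
      abel
    obtain ⟨b', hb', hdb'⟩ := h.inj b hb hdb ⟨-v, by rwa [map_neg, sub_neg_eq_add]⟩
    have e5 : D (v + f b') ∈ N := by
      have := Submodule.add_mem _ e2 (h.chain b' hb')
      rw [hdb'] at this
      convert this using 1
      rw [map_add]; abel
    -- The class of `v + f b'` need not vanish; it is represented by a Koszul cycle `z`, and
    -- subtracting `x_c z` makes the image of the corrected `a` a boundary modulo `N`.
    obtain ⟨z, hz, hdz, g', hg'⟩ := h.surj _ e5
    have e6 : contr (koszulForm x) (a + x c • b' - x c • z) = 0 := by
      rw [map_sub, map_add, map_smul, map_smul, hdb', hdz, smul_zero, sub_zero, hda]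
    obtain ⟨y, hy, hdy⟩ := h.inj (a + x c • b' - x c • z) (Submodule.sub_mem _ (Submodule.add_mem _ ha
      (Submodule.smul_mem _ _ hb')) (Submodule.smul_mem _ _ hz)) e6 ⟨g + x c • g', by
        have := Submodule.add_mem _ hn (Submodule.smul_mem _ (x c) hg')
        convert this using 1
        simp only [map_sub, map_add, map_smul, smul_sub, smul_add]
        rw [show f a = n + x c • v + D g by rw [← hv]; abel]
        abel⟩
    refine ⟨y - gen R c * b' + gen R c * z, Submodule.add_mem _ (Submodule.sub_mem _ (hJ hy)
      (hgen _ hb')) (hgen _ hz), ?_⟩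
    rw [map_add, map_sub, hd, hd, hdb', hdz, hdy, mul_zero]
    abel
  · intro g hg
    obtain ⟨n, hn, v, hv⟩ := (hN' _).1 hg
    -- The connecting homomorphism sends `g` to `v`: since `D (D g) = 0`, cancelling `x_c` shows
    -- that `v` is a cycle modulo `N`.
    have e1 : D v ∈ N := by
      apply hreg
      have := congrArg D hv
      rw [hD, map_add, map_smul] at this
      rw [eq_neg_of_add_eq_zero_right this.symm]
      exact Submodule.neg_mem _ (hN n hn)
    obtain ⟨b, hb, hdb, v', hv'⟩ := h.surj v e1
    obtain ⟨a, ha, hda⟩ := h.inj (x c • b) (Submodule.smul_mem _ _ hb)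
      (by rw [map_smul, hdb, smul_zero]) ⟨g - x c • v', by
        have := Submodule.neg_mem _ (Submodule.add_mem _ hn (Submodule.smul_mem _ (x c) hv'))
        convert this using 1
        rw [map_sub, map_smul, map_smul, hv]
        simp only [smul_sub]
        abel⟩
    have e2 : D (g - x c • v' - f a) ∈ N := by
      have h1 := h.chain a ha
      have := Submodule.sub_mem _ (Submodule.add_mem _ hn (Submodule.smul_mem _ (x c) hv')) h1
      convert this using 1
      rw [map_sub, map_sub, map_smul, hv, hda, map_smul]
      simp only [smul_sub]
      abel
    obtain ⟨a', ha', hda', g', hg'⟩ := h.surj _ e2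
    -- Here `x_c b = d a`, so `a - e_c b` is a cycle; the cycle `a'` corrects for the class of what
    -- remains of `g` after subtracting `f a` and `x_c v'`.
    refine ⟨a + a' - gen R c * b, Submodule.sub_mem _ (hJ (Submodule.add_mem _ ha ha'))
      (hgen _ hb), ?_, g', ?_⟩
    · rw [map_sub, map_add, hda, hda', hd, hdb, mul_zero]; abel
    · have := Submodule.add_mem _ (hle hg') (hx v')
      convert this using 1
      rw [map_sub, hf b hb, map_add]
      abel

/-- The submodule of elements divisible by the members of the family `x` indexed by `s`. -/
def famSub (x : I → R) (G : Type v) [AddCommGroup G] [Module R G] (s : Set I) : Submodule R G :=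
  Ideal.span (x '' s) • ⊤

lemma mem_famSub_insert (x : I → R) (c : I) (s : Set I) (g : G) :
    g ∈ famSub x G (Insert.insert c s) ↔ ∃ n ∈ famSub x G s, ∃ v, g = n + x c • v := by
  unfold famSub
  rw [Set.image_insert_eq, Ideal.span_insert, Submodule.sup_smul, sup_comm, Submodule.mem_sup]
  refine exists_congr fun n => and_congr_right fun _ => ⟨?_, ?_⟩
  · rintro ⟨z, hz, rfl⟩
    rw [Submodule.ideal_span_singleton_smul] at hz
    obtain ⟨v, -, rfl⟩ := Submodule.mem_smul_pointwise_iff_exists _ _ _ |>.1 hz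
    exact ⟨v, rfl⟩
  · rintro ⟨v, rfl⟩
    exact ⟨_, Submodule.smul_mem_smul (Ideal.mem_span_singleton_self _) trivial, rfl⟩

lemma map_mem_famSub {G' : Type w} [AddCommGroup G'] [Module R G'] (x : I → R) (s : Set I)
    (D : G →ₗ[R] G') {g : G} (h : g ∈ famSub x G s) : D g ∈ famSub x G' s := by
  unfold famSub at h ⊢
  induction h using Submodule.smul_induction_on' with
  | smul r hr n _ => rw [map_smul]; exact Submodule.smul_mem_smul hr trivial
  | add a _ b _ ha hb => rw [map_add]; exact Submodule.add_mem _ ha hb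

/-- Successively adding generators on the left and killing a regular sequence on the right. -/
theorem IsQuasi.finset [DecidableEq I] {x : I → R} {D : G →ₗ[R] G} {f : ExtAlg R I →ₗ[R] G} {K : Set I}
    (h : IsQuasi x D f K ⊥) (hD : ∀ g, D (D g) = 0) (Y : Finset I) (rank : I → ℕ)
    (C : Finset I → Prop) (hY : C Y)
    (hC : ∀ a s, a ∉ s → (∀ b ∈ s, rank b ≤ rank a) → C (Insert.insert a s) →
      C s ∧ a ∉ K ∧ (∀ ω, f (gen R a * ω) = 0) ∧
      ∀ v : G, x a • v ∈ famSub x G s → v ∈ famSub x G s) :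
    IsQuasi x D f (K ∪ Y) (famSub x G Y) := by
  -- The element of largest rank is removed, so it is added last and has to be regular only modulo
  -- elements of smaller or equal rank; `C` carries the properties of the set that survive this
  -- removal.
  induction Y using Finset.induction_on_max_value rank with
  | empty => simpa [famSub] using h
  | insert a s ha hs ih =>
    obtain ⟨h1, h2, h3, h4⟩ := hC a s ha hs hY
    have := (ih h1).insert hD (fun g hg => map_mem_famSub x _ D hg) (c := a) (by simp [ha, h2])
      (mem_famSub_insert x a s) h4 (fun ω _ => h3 ω)
    rw [Finset.coe_insert, Set.union_insert]
    exact this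

end Cone

end KhR

namespace KhR

/-! ### Regular elements -/

section Regular

variable {R : Type u} [CommRing R]

lemma mem_ideal_smul_top_iff_repr {G : Type v} [AddCommGroup G] [Module R G] {B : Type w}
    (b : Module.Basis B R G) (J : Ideal R) (g : G) :
    g ∈ (J • ⊤ : Submodule R G) ↔ ∀ i, b.repr g i ∈ J := by
  constructor
  · intro h i
    induction h using Submodule.smul_induction_on' with
    | smul r hr n _ => rw [map_smul, Finsupp.smul_apply]; exact J.mul_mem_right _ hr
    | add x _ y _ hx hy => rw [map_add, Finsupp.add_apply]; exact J.add_mem hx hy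
  · intro h
    rw [← b.linearCombination_repr g, Finsupp.linearCombination_apply]
    exact Submodule.sum_mem _ fun i _ => Submodule.smul_mem_smul (h i) trivial

/-- A nonzerodivisor modulo `J` is a nonzerodivisor on `G / J G` for free modules `G`. -/
lemma mem_smul_top_of_smul_mem {G : Type v} [AddCommGroup G] [Module R G] [Module.Free R G]
    {J : Ideal R} {a : R} (ha : ∀ r, a * r ∈ J → r ∈ J) {g : G}
    (h : a • g ∈ (J • ⊤ : Submodule R G)) : g ∈ (J • ⊤ : Submodule R G) := by
  obtain ⟨B, b⟩ := Module.Free.exists_basis R G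
  rw [mem_ideal_smul_top_iff_repr b] at h ⊢
  intro i
  have := h i
  rw [map_smul, Finsupp.smul_apply] at this
  exact ha _ this

/-- Elements that become monic polynomials in one variable over the quotient are regular. -/
lemma mem_of_mul_mem_of_monic {J : Ideal R} (θ : R →+* Polynomial (R ⧸ J)) (t : R ⧸ J)
    (h1 : ∀ r, (θ r).eval t = Ideal.Quotient.mk J r) (h2 : ∀ r ∈ J, θ r = 0) {a : R}
    (ha : (θ a).Monic ∨ (- θ a).Monic) (r : R) (h : a * r ∈ J) : r ∈ J := by
  -- Evaluation at `t` after `θ` is the quotient map, so `θ` has kernel `J`; multiplication by a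
  -- monic polynomial is injective over any commutative ring.
  have h3 : θ a * θ r = 0 := by rw [← map_mul]; exact h2 _ h
  have h4 : θ r = 0 := by
    rcases ha with ha | ha
    · exact (ha.mul_right_eq_zero_iff).1 h3
    · exact (ha.mul_right_eq_zero_iff).1 (by rw [neg_mul, h3, neg_zero])
  rw [← Ideal.Quotient.eq_zero_iff_mem, ← h1, h4, Polynomial.eval_zero]

variable {k : Type u} [CommRing k] {V : Type}

/-- The homomorphism from polynomials to polynomials in one variable `t` over a quotient, given by
a substitution which becomes the identity when `t` is evaluated. -/
lemma mem_of_mul_mem_of_subst {J : Ideal (MvPolynomial V k)}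
    (g : V → Polynomial (MvPolynomial V k ⧸ J)) (t : MvPolynomial V k ⧸ J)
    (h1 : ∀ v, (g v).eval t = Ideal.Quotient.mk J (MvPolynomial.X v))
    {X : Set (MvPolynomial V k)} (hX : J = Ideal.span X)
    (h2 : ∀ p ∈ X, MvPolynomial.aeval g p = 0) {a : MvPolynomial V k}
    (ha : (MvPolynomial.aeval g a).Monic ∨ (- MvPolynomial.aeval g a).Monic)
    (r : MvPolynomial V k) (h : a * r ∈ J) : r ∈ J := by
  refine mem_of_mul_mem_of_monic (MvPolynomial.aeval (R := k) g).toRingHom t ?_ ?_ ha r h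
  · intro r
    induction r using MvPolynomial.induction_on with
    | C c =>
      change Polynomial.eval t (MvPolynomial.aeval g (MvPolynomial.C c)) = _
      rw [MvPolynomial.aeval_C]
      change Polynomial.eval t (Polynomial.C (algebraMap k (MvPolynomial V k ⧸ J) c)) = _
      rw [Polynomial.eval_C]
      rfl
    | add p q hp hq => rw [map_add, Polynomial.eval_add, hp, hq, map_add]
    | mul_X p v hp =>
      rw [map_mul, Polynomial.eval_mul, hp, map_mul]
      congr 1
      change Polynomial.eval t (MvPolynomial.aeval g (MvPolynomial.X v)) = _
      rw [MvPolynomial.aeval_X, h1]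
  · intro r hr
    have : J ≤ RingHom.ker (MvPolynomial.aeval (R := k) g).toRingHom := by
      exact hX.trans_le (Ideal.span_le.2 h2)
    exact this hr

lemma aeval_eq_C_mk {J : Ideal (MvPolynomial V k)} {g : V → Polynomial (MvPolynomial V k ⧸ J)}
    {W : Set V} (hg : ∀ w ∈ W, g w = Polynomial.C (Ideal.Quotient.mk J (MvPolynomial.X w)))
    {p : MvPolynomial V k} (hp : p ∈ Algebra.adjoin k (MvPolynomial.X '' W)) :
    MvPolynomial.aeval g p = Polynomial.C (Ideal.Quotient.mk J p) := by
  induction hp using Algebra.adjoin_induction with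
  | mem p hp =>
    obtain ⟨w, hw, rfl⟩ := hp
    rw [MvPolynomial.aeval_X, hg w hw]
  | algebraMap c => rw [AlgHom.commutes]; rfl
  | add p q _ _ hp hq => rw [map_add, hp, hq, map_add, map_add]
  | mul p q _ _ hp hq => rw [map_mul, hp, hq, map_mul, map_mul]

/-- If a substitution fixes all variables in the generators of `J`, then it kills them. -/
lemma aeval_eq_zero_of_mem {J : Ideal (MvPolynomial V k)}
    {g : V → Polynomial (MvPolynomial V k ⧸ J)} {W : Set V}
    (hg : ∀ w ∈ W, g w = Polynomial.C (Ideal.Quotient.mk J (MvPolynomial.X w)))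
    {p : MvPolynomial V k} (hp : p ∈ Algebra.adjoin k (MvPolynomial.X '' W)) (hpJ : p ∈ J) :
    MvPolynomial.aeval g p = 0 := by
  rw [aeval_eq_C_mk hg hp, Ideal.Quotient.eq_zero_iff_mem.2 hpJ, map_zero]

open Classical in
/-- Substitution of the variable `v` by the variable of the polynomial ring in one variable. -/
noncomputable def substVar (J : Ideal (MvPolynomial V k)) (v w : V) :
    Polynomial (MvPolynomial V k ⧸ J) :=
  if w = v then Polynomial.X else Polynomial.C (Ideal.Quotient.mk J (MvPolynomial.X w))

/-- If the generators of `J` and `q` do not involve the variable `v`, then `v - q` and `q - v` are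
regular modulo `J`. -/
lemma mem_of_mul_mem_of_linear {J : Ideal (MvPolynomial V k)} (v : V)
    {X : Set (MvPolynomial V k)} (hX : J = Ideal.span X)
    (hXv : ∀ p ∈ X, p ∈ Algebra.adjoin k (MvPolynomial.X '' {v}ᶜ)) {a q : MvPolynomial V k}
    (hq : q ∈ Algebra.adjoin k (MvPolynomial.X '' {v}ᶜ))
    (ha : a = MvPolynomial.X v - q ∨ a = q - MvPolynomial.X v) (r : MvPolynomial V k)
    (h : a * r ∈ J) : r ∈ J := by
  have hg : ∀ w ∈ ({v}ᶜ : Set V),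
      substVar J v w = Polynomial.C (Ideal.Quotient.mk J (MvPolynomial.X w)) :=
    fun w hw => if_neg hw
  refine mem_of_mul_mem_of_subst (substVar J v) (Ideal.Quotient.mk J (MvPolynomial.X v)) ?_ hX
    (fun p hp => aeval_eq_zero_of_mem hg (hXv p hp) (hX ▸ Ideal.subset_span hp)) ?_ r h
  · intro w
    by_cases hw : w = v
    · simp [substVar, hw]
    · simp [substVar, hw]
  · have e : MvPolynomial.aeval (substVar J v) (MvPolynomial.X v - q) =
        Polynomial.X - Polynomial.C (Ideal.Quotient.mk J q) := by
      rw [map_sub, aeval_eq_C_mk hg hq, MvPolynomial.aeval_X, substVar, if_pos rfl]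
    rcases ha with rfl | rfl
    · left; rw [e]; exact Polynomial.monic_X_sub_C _
    · right; rw [← map_neg, neg_sub, e]; exact Polynomial.monic_X_sub_C _

lemma X_mem_adjoin {W : Set V} {w : V} (h : w ∈ W) :
    (MvPolynomial.X w : MvPolynomial V k) ∈ Algebra.adjoin k (MvPolynomial.X '' W) :=
  Algebra.subset_adjoin ⟨w, h, rfl⟩

lemma X_sub_X_mem_adjoin {W : Set V} {v w : V} (hv : v ∈ W) (hw : w ∈ W) :
    (MvPolynomial.X v - MvPolynomial.X w : MvPolynomial V k) ∈
      Algebra.adjoin k (MvPolynomial.X '' W) :=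
  Subalgebra.sub_mem _ (X_mem_adjoin hv) (X_mem_adjoin hw)

open Classical in
/-- Modulo `i + j - a - b`, the element `i j - a b` is regular if the other generators do not
involve `i` and `j`. -/
lemma mem_of_mul_mem_of_quadratic {J : Ideal (MvPolynomial V k)} {i j a b : V} (hij : i ≠ j)
    (ha : a ∈ ({i, j} : Set V)ᶜ) (hb : b ∈ ({i, j} : Set V)ᶜ)
    {X : Set (MvPolynomial V k)} (hX : J = Ideal.span X)
    (hf : MvPolynomial.X i + MvPolynomial.X j - MvPolynomial.X a - MvPolynomial.X b ∈ X)
    (hXv : ∀ p ∈ X, p = MvPolynomial.X i + MvPolynomial.X j - MvPolynomial.X a -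
      MvPolynomial.X b ∨ p ∈ Algebra.adjoin k (MvPolynomial.X '' ({i, j} : Set V)ᶜ))
    (r : MvPolynomial V k)
    (h : (MvPolynomial.X i * MvPolynomial.X j - MvPolynomial.X a * MvPolynomial.X b) * r ∈ J) :
    r ∈ J := by
  set m : V → MvPolynomial V k ⧸ J := fun w => Ideal.Quotient.mk J (MvPolynomial.X w) with hm
  -- The linear relation is used to eliminate `i = a + b - j`. Then `i j - a b` becomes `-(X ^ 2 -
  -- (a + b) X + a b)` in the variable `X` that replaces `j`.
  set g : V → Polynomial (MvPolynomial V k ⧸ J) := fun w =>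
    if w = j then Polynomial.X
    else if w = i then Polynomial.C (m a + m b) - Polynomial.X
    else Polynomial.C (m w) with hgdef
  have hg : ∀ w ∈ ({i, j} : Set V)ᶜ, g w = Polynomial.C (m w) := by
    intro w hw
    simp only [Set.mem_compl_iff, Set.mem_insert_iff, Set.mem_singleton_iff, not_or] at hw
    simp [hgdef, hw.1, hw.2]
  have hgj : g j = Polynomial.X := by simp [hgdef]
  have hgi : g i = Polynomial.C (m a + m b) - Polynomial.X := by simp [hgdef, hij]
  have hrel : m i + m j = m a + m b := by
    have hfJ : (MvPolynomial.X i + MvPolynomial.X j - MvPolynomial.X a - MvPolynomial.X b :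
        MvPolynomial V k) ∈ J := hX ▸ Ideal.subset_span hf
    have := Ideal.Quotient.eq_zero_iff_mem.2 hfJ
    simp only [map_add, map_sub] at this
    linear_combination this
  refine mem_of_mul_mem_of_subst g (m j) ?_ hX ?_ ?_ r h
  · intro w
    by_cases hwj : w = j
    · subst hwj; rw [hgj, Polynomial.eval_X]
    · by_cases hwi : w = i
      · subst hwi
        rw [hgi, Polynomial.eval_sub, Polynomial.eval_C, Polynomial.eval_X]
        linear_combination -hrel
      · rw [hg w (by simp [hwi, hwj]), Polynomial.eval_C]
  · intro p hp
    rcases hXv p hp with rfl | hp'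
    · simp only [map_add, map_sub, MvPolynomial.aeval_X, hgi, hgj, hg a ha, hg b hb]
      ring
    · exact aeval_eq_zero_of_mem hg hp' (hX ▸ Ideal.subset_span hp)
  · right
    have : - MvPolynomial.aeval g ((MvPolynomial.X i * MvPolynomial.X j -
        MvPolynomial.X a * MvPolynomial.X b : MvPolynomial V k)) =
        Polynomial.X ^ 2 - (Polynomial.C (m a + m b) * Polynomial.X - Polynomial.C (m a * m b)) := by
      simp only [map_mul, map_sub, MvPolynomial.aeval_X, hgi, hgj, hg a ha, hg b hb]
      ring
    rw [this]
    nontriviality (MvPolynomial V k ⧸ J)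
    apply Polynomial.monic_X_pow_sub
    refine lt_of_le_of_lt (b := 1) ((Polynomial.degree_sub_le _ _).trans (max_le ?_ ?_))
      (by norm_num)
    · exact (Polynomial.degree_C_mul_X_le _)
    · exact Polynomial.degree_C_le.trans (by norm_num)

end Regular

end KhR

namespace KhR

/-! ### Shuffles and the Hochschild complex -/

section Sums

variable {G : Type v} [AddCommGroup G]

/-- The cancellation behind a simplicial homotopy, with `A i l` the face `i` of the insertion at `l`
and `B i l` the insertion at `l` into the face `i`. Faces away from the inserted entry cancel
against the second sum, the two adjacent ones telescope, and only the two extreme faces remain. -/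
lemma alternating_sum_prism (n : ℕ) (A B : ℕ → ℕ → G)
    (h1 : ∀ i l, i < l → l ≤ n + 1 → A i l = B i (l - 1))
    (h2 : ∀ i l, l + 1 < i → i ≤ n + 2 → A i l = B (i - 1) l)
    (h3 : ∀ l, l ≤ n → A (l + 1) (l + 1) = A (l + 1) l) :
    ∑ l ∈ Finset.range (n + 2), ∑ i ∈ Finset.range (n + 3), (-1 : ℤ) ^ (l + i) • A i l +
      ∑ l ∈ Finset.range (n + 1), ∑ i ∈ Finset.range (n + 2), (-1 : ℤ) ^ (l + i) • B i l =
      A 0 0 - A (n + 2) (n + 1) := by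
  have key : ∀ l ∈ Finset.range (n + 2),
      ∑ i ∈ Finset.range (n + 3), (-1 : ℤ) ^ (l + i) • A i l =
      ∑ i ∈ Finset.range l, (-1 : ℤ) ^ (l + i) • B i (l - 1) + (A l l - A (l + 1) l) -
        ∑ i ∈ Finset.Ico (l + 1) (n + 2), (-1 : ℤ) ^ (l + i) • B i l := by
    intro l hl
    have hl' : l < n + 2 := Finset.mem_range.1 hl
    have e0 : (-1 : ℤ) ^ (l + l) = 1 := (Even.add_self l).neg_one_pow
    rw [Finset.range_eq_Ico, ← Finset.sum_Ico_consecutive _ (Nat.zero_le l) (by omega),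
      Finset.sum_eq_sum_Ico_succ_bot (by omega : l < n + 3),
      Finset.sum_eq_sum_Ico_succ_bot (by omega : l + 1 < n + 3), ← add_assoc l l 1, pow_succ, e0,
      Finset.range_eq_Ico, ← Finset.sum_Ico_add' _ (l + 1) (n + 2) 1, sub_eq_add_neg _ (Finset.sum _ _),
      ← Finset.sum_neg_distrib]
    have e1 : ∀ i ∈ Finset.Ico 0 l, (-1 : ℤ) ^ (l + i) • A i l = (-1 : ℤ) ^ (l + i) • B i (l - 1) :=
      fun i hi => by rw [h1 i l (Finset.mem_Ico.1 hi).2 (by omega)]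
    have e2 : ∀ i ∈ Finset.Ico (l + 1) (n + 2), (-1 : ℤ) ^ (l + (i + 1)) • A (i + 1) l =
        -((-1 : ℤ) ^ (l + i) • B i l) := fun i hi => by
      have := Finset.mem_Ico.1 hi
      rw [h2 (i + 1) l (by omega) (by omega), Nat.add_sub_cancel, ← add_assoc, pow_succ, mul_neg,
        mul_one, neg_smul]
    rw [Finset.sum_congr rfl e1, Finset.sum_congr rfl e2, one_smul, one_mul, neg_smul, one_smul]
    abel
  rw [Finset.sum_congr rfl key, Finset.sum_sub_distrib, Finset.sum_add_distrib,
    Finset.sum_range_succ' (fun l => ∑ i ∈ Finset.range l, (-1 : ℤ) ^ (l + i) • B i (l - 1)),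
    Finset.sum_range_succ (fun l => ∑ i ∈ Finset.Ico (l + 1) (n + 2), (-1 : ℤ) ^ (l + i) • B i l),
    Finset.Ico_self, Finset.sum_empty, Finset.range_zero, Finset.sum_empty, add_zero, add_zero]
  have tel : ∀ m, m ≤ n + 1 → ∑ l ∈ Finset.range (m + 1), (A l l - A (l + 1) l) =
      A 0 0 - A (m + 1) m := by
    intro m hm
    induction m with
    | zero => simp
    | succ m ih =>
      rw [Finset.sum_range_succ, ih (by omega), h3 m (by omega)]
      abel
  rw [tel (n + 1) le_rfl]
  have e3 : ∀ l ∈ Finset.range (n + 1), ∑ i ∈ Finset.range (n + 2), (-1 : ℤ) ^ (l + i) • B i l =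
      ∑ i ∈ Finset.Ico (l + 1) (n + 2), (-1 : ℤ) ^ (l + i) • B i l -
        ∑ i ∈ Finset.range (l + 1), (-1 : ℤ) ^ (l + 1 + i) • B i (l + 1 - 1) := by
    intro l hl
    have hl' : l < n + 1 := Finset.mem_range.1 hl
    rw [Finset.range_eq_Ico, ← Finset.sum_Ico_consecutive _ (Nat.zero_le (l + 1)) (by omega),
      sub_eq_add_neg, ← Finset.sum_neg_distrib, add_comm]
    congr 1
    refine Finset.sum_congr (by rw [Finset.range_eq_Ico]) fun i _ => ?_
    rw [Nat.add_sub_cancel, add_right_comm, pow_succ, mul_neg, mul_one, neg_smul, neg_neg]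
  rw [Finset.sum_congr rfl e3, Finset.sum_sub_distrib]
  abel

/-- Two insertions of the same element can be performed in either order; exchanging them moves one
position by one and reverses the sign, so the terms cancel in pairs. -/
lemma alternating_sum_double {A : Type w} [CommRing A] [Module A G] (n : ℕ) (C : ℕ → ℕ → G)
    (h : ∀ i l, i ≤ l → l ≤ n → C i l = C (l + 1) i) :
    ∑ l ∈ Finset.range (n + 1), ∑ i ∈ Finset.range (n + 2), (-1 : A) ^ (l + i) • C i l = 0 := by
  rw [Finset.sum_sigma']
  refine Finset.sum_involution
    (fun p _ => if p.2 ≤ p.1 then ⟨p.2, p.1 + 1⟩ else ⟨p.2 - 1, p.1⟩) ?_ ?_ ?_ ?_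
  · rintro ⟨l, i⟩ hp
    simp only [Finset.mem_sigma, Finset.mem_range] at hp
    by_cases hij : i ≤ l
    · simp only [hij, if_true]
      rw [h i l hij (by omega), ← add_smul]
      convert zero_smul A _
      rw [← add_assoc, pow_succ, add_comm i l]
      ring
    · obtain ⟨i, rfl⟩ : ∃ i', i = i' + 1 := ⟨i - 1, by omega⟩
      simp only [hij, if_false, Nat.add_sub_cancel]
      rw [h l i (by omega) (by omega), ← add_smul]
      convert zero_smul A _
      rw [← add_assoc, pow_succ, add_comm i l]
      ring
  · rintro ⟨l, i⟩ hp - heq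
    simp only [Finset.mem_sigma, Finset.mem_range] at hp
    by_cases hij : i ≤ l
    · simp only [hij, if_true, Sigma.mk.injEq, heq_eq_eq] at heq
      omega
    · simp only [hij, if_false, Sigma.mk.injEq, heq_eq_eq] at heq
      omega
  · rintro ⟨l, i⟩ hp
    simp only [Finset.mem_sigma, Finset.mem_range] at hp ⊢
    split_ifs with hij
    · simp only; omega
    · simp only; omega
  · rintro ⟨l, i⟩ hp
    simp only [Finset.mem_sigma, Finset.mem_range] at hp
    by_cases hij : i ≤ l
    · have h1 : ¬ (l + 1 ≤ i) := by omega
      simp [hij, h1]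
    · have h1 : l ≤ i - 1 := by omega
      have h2 : i - 1 + 1 = i := by omega
      simp [hij, h1, h2]

lemma neg_one_pow_smul_eq (A : Type w) [CommRing A] [Module A G] (l : ℕ) (x : G) :
    (-1 : A) ^ l • x = (-1 : ℤ) ^ l • x := by
  rcases Nat.even_or_odd l with h | h
  · rw [h.neg_one_pow, h.neg_one_pow, one_smul, one_smul]
  · rw [h.neg_one_pow, h.neg_one_pow, neg_smul, neg_smul, one_smul, one_smul]

end Sums

section Insert

variable {U : Type u} [CommRing U]

/-- Insertion of `c` at the position `l`. -/
def insVec {n : ℕ} (l : ℕ) (c : U) (u : Fin n → U) (j : Fin (n + 1)) : U :=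
  -- The position is a natural number, which keeps the face identities free of casts; a position
  -- beyond `n` means the last one.
  if h : (j : ℕ) < l ∧ (j : ℕ) < n then u ⟨j, h.2⟩
  else if h : l < j then u ⟨j - 1, by omega⟩ else c

lemma insVec_eq {n : ℕ} (l : Fin (n + 1)) (c : U) (u : Fin n → U) :
    insVec l c u = l.insertNth (α := fun _ => U) c u := by
  rw [Fin.eq_insertNth_iff]
  refine ⟨by simp [insVec], ?_⟩
  ext j
  simp only [Fin.removeNth, insVec, Fin.succAbove, Fin.lt_def, Fin.val_castSucc]
  have := j.2
  split_ifs with h1 h2 <;> grind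

lemma insVec_insVec {n : ℕ} (c : U) (u : Fin n → U) {i l : ℕ} (h : i ≤ l) (hl : l ≤ n) :
    insVec i c (insVec l c u) = insVec (l + 1) c (insVec i c u) := by
  ext j
  have := j.2
  simp only [insVec]
  grind

lemma faceVec_insVec_lt {n : ℕ} (c : U) (u : Fin (n + 1) → U) {i l : ℕ} (h : i < l)
    (hl : l ≤ n + 1) : faceVec i (insVec l c u) = insVec (l - 1) c (faceVec i u) := by
  ext j
  have := j.2
  simp only [insVec, faceVec, Fin.val_castSucc, Fin.val_succ, Fin.castSucc_mk, Fin.succ_mk]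
  grind

lemma faceVec_insVec_gt {n : ℕ} (c : U) (u : Fin (n + 1) → U) {i l : ℕ} (h : l + 1 < i)
    (hi : i ≤ n + 2) : faceVec i (insVec l c u) = insVec l c (faceVec (i - 1) u) := by
  ext j
  have := j.2
  simp only [insVec, faceVec, Fin.val_castSucc, Fin.val_succ, Fin.castSucc_mk, Fin.succ_mk]
  grind

/-- Either way `c` is merged with the entry `u l`, once from the right and once from the left;
commutativity of `U` makes the results equal. -/
lemma faceVec_insVec_eq {n : ℕ} (c : U) (u : Fin (n + 1) → U) {l : ℕ} (_ : l ≤ n) :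
    faceVec (l + 1) (insVec (l + 1) c u) = faceVec (l + 1) (insVec l c u) := by
  ext j
  have := j.2
  simp only [insVec, faceVec, Fin.val_castSucc, Fin.val_succ]
  grind

lemma faceVec_insVec_zero {n : ℕ} (c : U) (u : Fin n → U) :
    faceVec 0 (insVec 0 c u) = u := by
  ext j
  simp [insVec, faceVec]

lemma faceVec_insVec_last {n : ℕ} (c : U) (u : Fin n → U) :
    faceVec (n + 1) (insVec n c u) = u := by
  ext j
  simp [insVec, faceVec]

lemma insVec_zero_mul {n : ℕ} (c : U) (u : Fin (n + 1) → U) :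
    faceVec 1 (insVec 0 c u) = insVec 0 (c * u 0) (faceVec 0 u) := by
  ext j
  simp only [insVec, faceVec, Fin.val_castSucc, Fin.val_succ, Fin.castSucc_mk, Fin.succ_mk]
  have := j.2
  have h0 : (0 : Fin (n + 1)) = ⟨0, by omega⟩ := rfl
  grind

end Insert

end KhR

namespace KhR

/-! ### The shuffle with an element as a homotopy between the two actions. -/

section Shuffle

variable (k : Type u) [CommRing k] {U : Type u} [CommRing U] [Algebra k U]
  {R : Type u} [CommRing R] [Algebra k R]
  (M : Type u) [AddCommGroup M] [Module k M] [Module R M] [IsScalarTower k R M]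

section Coeff

variable {k} (lact ract : U →ₐ[k] R)

lemma faceCoeff_mid {n : ℕ} (u : Fin (n + 2) → U) {l : ℕ} (hl : l ≤ n) :
    faceCoeff k lact ract (l + 1) u = 1 := by
  have h1 : l ≠ n + 1 := by omega
  simp [faceCoeff, h1]

lemma faceCoeff_insVec_lt {n : ℕ} (c : U) (u : Fin (n + 1) → U) {i l : ℕ} (h : i < l)
    (hl : l ≤ n + 1) :
    faceCoeff k lact ract i (insVec l c u) = faceCoeff k lact ract i u := by
  rcases Nat.eq_zero_or_pos i with rfl | hi
  · simp [faceCoeff, insVec, h]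
  · have h1 : i ≠ n + 1 := by omega
    have h2 : i ≠ n + 2 := by omega
    simp [faceCoeff, hi.ne', h1, h2]

lemma faceCoeff_insVec_gt {n : ℕ} (c : U) (u : Fin (n + 1) → U) {i l : ℕ} (h : l + 1 < i)
    (hi : i ≤ n + 2) :
    faceCoeff k lact ract i (insVec l c u) = faceCoeff k lact ract (i - 1) u := by
  have h0 : i ≠ 0 := by omega
  have h0' : i - 1 ≠ 0 := by omega
  by_cases h1 : i = n + 2
  · subst h1
    have h2 : l < n + 1 := by omega
    simp [faceCoeff, insVec, h2, Fin.last]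
  · have h2 : i - 1 ≠ n + 1 := by omega
    simp [faceCoeff, h0, h0', h1, h2]

end Coeff

/-- Insertion of an element at the position `l` of a tensor. -/
noncomputable def insTensor (U : Type u) [CommRing U] [Algebra k U] {n : ℕ} (l : Fin (n + 1)) :
    U →ₗ[k] (⨂[k]^n U) →ₗ[k] (⨂[k]^(n + 1) U) :=
  (PiTensorProduct.lift (R := k) (s := fun _ : Fin n => U)).toLinearMap ∘ₗ
    MultilinearMap.curryMid l (PiTensorProduct.tprod k (s := fun _ : Fin (n + 1) => U))

lemma insTensor_tprod {n : ℕ} (l : Fin (n + 1)) (c : U) (u : Fin n → U) :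
    insTensor k U l c (PiTensorProduct.tprod k u) = PiTensorProduct.tprod k (insVec l c u) := by
  rw [insVec_eq]
  simp [insTensor]

/-- The signed sum of all insertions of an element into a tensor. -/
noncomputable def shTensor (U : Type u) [CommRing U] [Algebra k U] (n : ℕ) :
    U →ₗ[k] (⨂[k]^n U) →ₗ[k] (⨂[k]^(n + 1) U) :=
  ∑ l : Fin (n + 1), (-1 : k) ^ (l : ℕ) • insTensor k U l

lemma shTensor_tprod {n : ℕ} (c : U) (u : Fin n → U) :
    shTensor k U n c (PiTensorProduct.tprod k u) =
      ∑ l ∈ Finset.range (n + 1), (-1 : k) ^ l • PiTensorProduct.tprod k (insVec l c u) := by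
  rw [Finset.sum_range, shTensor, LinearMap.sum_apply, LinearMap.sum_apply]
  refine Finset.sum_congr rfl fun l _ => ?_
  rw [LinearMap.smul_apply, LinearMap.smul_apply, insTensor_tprod]

lemma shTensor_shTensor {n : ℕ} (c : U) (z : ⨂[k]^n U) :
    shTensor k U (n + 1) c (shTensor k U n c z) = 0 := by
  induction z using PiTensorProduct.induction_on with
  | add x y hx hy => rw [map_add, map_add, hx, hy, add_zero]
  | smul_tprod r u =>
    have h := alternating_sum_double (A := k) n
      (fun i l => PiTensorProduct.tprod k (insVec i c (insVec l c u)))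
      (fun i l h hl => by rw [insVec_insVec c u h hl])
    have h' : shTensor k U (n + 1) c (shTensor k U n c (PiTensorProduct.tprod k u)) = 0 := by
      rw [← h, shTensor_tprod, map_sum]
      refine Finset.sum_congr rfl fun l _ => ?_
      rw [map_smul, shTensor_tprod, Finset.smul_sum]
      refine Finset.sum_congr rfl fun i _ => ?_
      rw [smul_smul, ← pow_add]
    rw [map_smul, map_smul, h', smul_zero]

/-- The signed shuffle with an element of `U` on the Hochschild complex. -/
noncomputable def sh (n : ℕ) (c : U) : (M ⊗[k] ⨂[k]^n U) →ₗ[R] (M ⊗[k] ⨂[k]^(n + 1) U) :=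
  TensorProduct.AlgebraTensorModule.map LinearMap.id (shTensor k U n c)

variable {M}

lemma sh_tmul (n : ℕ) (c : U) (m : M) (w : ⨂[k]^n U) :
    sh k (R := R) M n c (m ⊗ₜ w) = m ⊗ₜ shTensor k U n c w := rfl

lemma sh_sh (n : ℕ) (c : U) (z : M ⊗[k] ⨂[k]^n U) :
    sh k (R := R) M (n + 1) c (sh k (R := R) M n c z) = 0 := by
  induction z using TensorProduct.induction_on with
  | zero => simp
  | add x y hx hy => rw [map_add, map_add, hx, hy, add_zero]
  | tmul m w => rw [sh_tmul, sh_tmul, shTensor_shTensor, TensorProduct.tmul_zero]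

lemma sh_add (n : ℕ) (c d : U) (z : M ⊗[k] ⨂[k]^n U) :
    sh k (R := R) M n (c + d) z = sh k (R := R) M n c z + sh k (R := R) M n d z := by
  induction z using TensorProduct.induction_on with
  | zero => simp
  | add x y hx hy => simp only [map_add, hx, hy]; abel
  | tmul m w => rw [sh_tmul, sh_tmul, sh_tmul, map_add, LinearMap.add_apply, TensorProduct.tmul_add]

lemma sh_zero (n : ℕ) (z : M ⊗[k] ⨂[k]^n U) : sh k (R := R) M n (0 : U) z = 0 := by
  have := sh_add k (R := R) n (0 : U) 0 z
  rwa [add_zero, left_eq_add] at this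

variable (lact ract : U →ₐ[k] R)

lemma barD_sh_zero (c : U) (z : M ⊗[k] ⨂[k]^0 U) :
    barD k lact ract M 0 (sh k (R := R) M 0 c z) = (ract c - lact c) • z := by
  induction z using TensorProduct.induction_on with
  | zero => simp
  | add x y hx hy => rw [map_add, map_add, hx, hy, smul_add]
  | tmul m w =>
    induction w using PiTensorProduct.induction_on with
    | add x y hx hy => rw [TensorProduct.tmul_add, map_add, map_add, hx, hy, smul_add]
    | smul_tprod r u =>
      have h0 : faceVec 0 (insVec 0 c u) = u := Subsingleton.elim _ _
      have h1 : faceVec 1 (insVec 0 c u) = u := Subsingleton.elim _ _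
      rw [TensorProduct.tmul_smul, TensorProduct.smul_tmul', sh_tmul, shTensor_tprod]
      simp only [zero_add, Finset.range_one, Finset.sum_singleton, pow_zero, one_smul]
      rw [barD_tmul']
      generalize r • m = m
      rw [TensorProduct.smul_tmul', sub_smul, TensorProduct.sub_tmul, sub_eq_add_neg]
      simp [Finset.sum_range_succ, faceCoeff, h0, h1, insVec]

/-- The two faces that do not cancel are face `0` of the insertion in front, where `c` acts by
`ract`, and the last face of the insertion at the end, where it acts by `lact`. The formula is the
relation `d e + e d = x` of a Koszul generator with `x = ract c - lact c`. -/
lemma barD_sh_succ (n : ℕ) (c : U) (z : M ⊗[k] ⨂[k]^(n + 1) U) :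
    barD k lact ract M (n + 1) (sh k (R := R) M (n + 1) c z) + sh k (R := R) M n c (barD k lact ract M n z) =
      (ract c - lact c) • z := by
  induction z using TensorProduct.induction_on with
  | zero => simp
  | add x y hx hy => simp only [map_add, smul_add, ← hx, ← hy]; abel
  | tmul m w =>
    induction w using PiTensorProduct.induction_on with
    | add x y hx hy =>
      simp only [TensorProduct.tmul_add, map_add, smul_add, ← hx, ← hy]; abel
    | smul_tprod r u =>
      rw [TensorProduct.tmul_smul, TensorProduct.smul_tmul']
      generalize r • m = m
      have h := alternating_sum_prism n
        (fun i l => (faceCoeff k lact ract i (insVec l c u) • m) ⊗ₜ[k]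
          PiTensorProduct.tprod k (faceVec i (insVec l c u)))
        (fun i l => (faceCoeff k lact ract i u • m) ⊗ₜ[k]
          PiTensorProduct.tprod k (insVec l c (faceVec i u)))
        (fun i l hil hl => by
          rw [faceVec_insVec_lt c u hil hl, faceCoeff_insVec_lt lact ract c u hil hl])
        (fun i l hil hi => by
          rw [faceVec_insVec_gt c u hil hi, faceCoeff_insVec_gt lact ract c u hil hi])
        (fun l hl => by
          rw [faceVec_insVec_eq c u hl, faceCoeff_mid lact ract _ hl,
            faceCoeff_mid lact ract _ hl])
      rw [faceVec_insVec_zero, faceVec_insVec_last] at h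
      have e1 : barD k lact ract M (n + 1) (sh k (R := R) M (n + 1) c
          (m ⊗ₜ PiTensorProduct.tprod k u)) = ∑ l ∈ Finset.range (n + 2),
          ∑ i ∈ Finset.range (n + 3), (-1 : ℤ) ^ (l + i) •
          ((faceCoeff k lact ract i (insVec l c u) • m) ⊗ₜ[k]
          PiTensorProduct.tprod k (faceVec i (insVec l c u))) := by
        rw [sh_tmul, shTensor_tprod, TensorProduct.tmul_sum, map_sum]
        refine Finset.sum_congr rfl fun l _ => ?_
        rw [TensorProduct.tmul_smul, neg_one_pow_smul_eq k, map_zsmul, barD_tmul', Finset.smul_sum]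
        refine Finset.sum_congr rfl fun i _ => ?_
        rw [smul_smul, ← pow_add]
      have e2 : sh k (R := R) M n c (barD k lact ract M n
          (m ⊗ₜ PiTensorProduct.tprod k u)) = ∑ l ∈ Finset.range (n + 1),
          ∑ i ∈ Finset.range (n + 2), (-1 : ℤ) ^ (l + i) •
          ((faceCoeff k lact ract i u • m) ⊗ₜ[k]
          PiTensorProduct.tprod k (insVec l c (faceVec i u))) := by
        rw [barD_tmul', map_sum, Finset.sum_comm]
        refine Finset.sum_congr rfl fun i _ => ?_
        rw [map_zsmul, sh_tmul, shTensor_tprod, TensorProduct.tmul_sum, Finset.smul_sum]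
        refine Finset.sum_congr rfl fun l _ => ?_
        rw [TensorProduct.tmul_smul, neg_one_pow_smul_eq k, add_comm l i, pow_add, mul_smul]
      rw [e1, e2, h, ← TensorProduct.sub_tmul, ← sub_smul, TensorProduct.smul_tmul']
      simp [faceCoeff, insVec]

end Shuffle

end KhR

namespace KhR

/-! ### The Hochschild complex as a differential module, and antisymmetrisation. -/

section BarTotal

variable (k : Type u) [CommRing k] (U : Type u) [CommRing U] [Algebra k U]
  {R : Type u} [CommRing R] [Algebra k R]
  (M : Type u) [AddCommGroup M] [Module k M] [Module R M] [IsScalarTower k R M]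

/-- The sum of all terms of the Hochschild complex. -/
abbrev BarTot : Type u := DirectSum ℕ fun n => M ⊗[k] ⨂[k]^n U

variable {U} (lact ract : U →ₐ[k] R)

/-- The Hochschild differential on the sum of all terms. -/
noncomputable def barTotD : BarTot k U M →ₗ[R] BarTot k U M :=
  DirectSum.toModule R ℕ _ fun n => match n with
    | 0 => 0
    | n + 1 => DirectSum.lof R ℕ (fun n => M ⊗[k] ⨂[k]^n U) n ∘ₗ barD k lact ract M n

variable {M}

lemma barTotD_lof_zero (z : M ⊗[k] ⨂[k]^0 U) :
    barTotD k M lact ract (DirectSum.lof R ℕ (fun n => M ⊗[k] ⨂[k]^n U) 0 z) = 0 := by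
  rw [barTotD, DirectSum.toModule_lof]
  rfl

lemma barTotD_lof_succ (n : ℕ) (z : M ⊗[k] ⨂[k]^(n + 1) U) :
    barTotD k M lact ract (DirectSum.lof R ℕ (fun n => M ⊗[k] ⨂[k]^n U) (n + 1) z) =
      DirectSum.lof R ℕ (fun n => M ⊗[k] ⨂[k]^n U) n (barD k lact ract M n z) := by
  rw [barTotD, DirectSum.toModule_lof]
  rfl

lemma barTot_induction {P : BarTot k U M → Prop} (h0 : P 0) (hadd : ∀ a b, P a → P b → P (a + b))
    (h : ∀ n z, P (DirectSum.of (fun n => M ⊗[k] ⨂[k]^n U) n z)) (z : BarTot k U M) : P z :=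
  DirectSum.induction_on z h0 h hadd

lemma barTotD_apply (z : BarTot k U M) (n : ℕ) :
    barTotD k M lact ract z n = barD k lact ract M n (z (n + 1)) := by
  induction z using barTot_induction with
  | h0 => simp
  | hadd a b ha hb =>
    rw [map_add, DirectSum.add_apply, ha, hb, DirectSum.add_apply, map_add]
  | h m z =>
    rw [← DirectSum.lof_eq_of R]
    cases m with
    | zero =>
      rw [barTotD_lof_zero, DirectSum.lof_eq_of, DirectSum.of_eq_of_ne _ _ _ (by omega), map_zero]
      rfl
    | succ m =>
      rw [barTotD_lof_succ, DirectSum.lof_eq_of, DirectSum.lof_eq_of]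
      by_cases h : n = m
      · subst h
        rw [DirectSum.of_eq_same, DirectSum.of_eq_same]
      · rw [DirectSum.of_eq_of_ne _ _ _ h, DirectSum.of_eq_of_ne _ _ _ (by omega), map_zero]

lemma barTotD_barTotD (z : BarTot k U M) :
    barTotD k M lact ract (barTotD k M lact ract z) = 0 := by
  refine DFinsupp.ext fun n => ?_
  change barTotD k M lact ract _ n = 0
  rw [barTotD_apply, barTotD_apply, barD_barD]

variable (M)

/-- The shuffle with an element of `U` on the sum of all terms. -/
noncomputable def shTot (R : Type u) [CommRing R] [Algebra k R] [Module R M]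
    [IsScalarTower k R M] (c : U) : BarTot k U M →ₗ[R] BarTot k U M :=
  DirectSum.toModule R ℕ _ fun n =>
    DirectSum.lof R ℕ (fun n => M ⊗[k] ⨂[k]^n U) (n + 1) ∘ₗ sh k M n c

variable {M}

lemma shTot_lof (c : U) (n : ℕ) (z : M ⊗[k] ⨂[k]^n U) :
    shTot k M R c (DirectSum.lof R ℕ (fun n => M ⊗[k] ⨂[k]^n U) n z) =
      DirectSum.lof R ℕ (fun n => M ⊗[k] ⨂[k]^n U) (n + 1) (sh k (R := R) M n c z) := by
  rw [shTot, DirectSum.toModule_lof]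
  rfl

lemma shTot_add (c d : U) : shTot k M R (c + d) = shTot k M R c + shTot k M R d := by
  refine LinearMap.ext fun z => ?_
  induction z using barTot_induction with
  | h0 => simp
  | hadd a b ha hb => rw [map_add, map_add, ha, hb]
  | h n z =>
    rw [← DirectSum.lof_eq_of R]
    rw [LinearMap.add_apply, shTot_lof, shTot_lof, shTot_lof, sh_add, map_add]

lemma shTot_zero : shTot k M R (0 : U) = 0 := by
  refine LinearMap.ext fun z => ?_
  induction z using barTot_induction with
  | h0 => simp
  | hadd a b ha hb => rw [map_add, map_add, ha, hb]
  | h n z =>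
    rw [← DirectSum.lof_eq_of R, shTot_lof, sh_zero, map_zero, LinearMap.zero_apply]

lemma shTot_shTot (c : U) (z : BarTot k U M) : shTot k M R c (shTot k M R c z) = 0 := by
  induction z using barTot_induction with
  | h0 => simp
  | hadd a b ha hb => rw [map_add, map_add, ha, hb, add_zero]
  | h n z =>
    rw [← DirectSum.lof_eq_of R]
    rw [shTot_lof, shTot_lof, sh_sh, map_zero]

lemma shTot_comm (c d : U) (z : BarTot k U M) :
    shTot k M R c (shTot k M R d z) + shTot k M R d (shTot k M R c z) = 0 := by
  -- Anticommutativity is the polarisation of the square being zero.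
  have := shTot_shTot k (R := R) (c + d) z
  simp only [shTot_add, LinearMap.add_apply, map_add, shTot_shTot, zero_add, add_zero] at this
  rw [add_comm]
  exact this

lemma barTotD_shTot (c : U) (z : BarTot k U M) :
    barTotD k M lact ract (shTot k M R c z) =
      (ract c - lact c) • z - shTot k M R c (barTotD k M lact ract z) := by
  induction z using barTot_induction with
  | h0 => simp
  | hadd a b ha hb => simp only [map_add, ha, hb, smul_add]; abel
  | h n z =>
    rw [← DirectSum.lof_eq_of R]
    cases n with
    | zero =>
      rw [shTot_lof, barTotD_lof_succ, barD_sh_zero, barTotD_lof_zero, map_zero, sub_zero, map_smul]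
    | succ n =>
      rw [shTot_lof, barTotD_lof_succ, barTotD_lof_succ, shTot_lof, ← map_smul,
        ← barD_sh_succ k lact ract n c z, map_add, add_sub_cancel_right]

variable {I : Type} (g : I → U)

/-- Shuffle with a combination of elements of `U`. -/
noncomputable def shLin (R : Type u) [CommRing R] [Algebra k R] [Module R M]
    [IsScalarTower k R M] : (I →₀ R) →ₗ[R] BarTot k U M →ₗ[R] BarTot k U M :=
  Finsupp.linearCombination R fun c => shTot k M R (g c)

lemma shLin_single (c : I) (r : R) :
    shLin k g R (M := M) (Finsupp.single c r) = r • shTot k M R (g c) := by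
  simp [shLin]

lemma shLin_comm (v w : I →₀ R) (z : BarTot k U M) :
    shLin k g R v (shLin k g R w z) + shLin k g R w (shLin k g R v z) = 0 := by
  induction v using Finsupp.induction_linear with
  | zero => simp
  | add v v' h h' =>
    simp only [map_add, LinearMap.add_apply]
    rw [add_add_add_comm, h, h', add_zero]
  | single c r =>
    induction w using Finsupp.induction_linear with
    | zero => simp
    | add w w' h h' =>
      simp only [map_add, LinearMap.add_apply]
      rw [add_add_add_comm, h, h', add_zero]
    | single d s =>
      simp only [shLin_single, LinearMap.smul_apply, map_smul]
      rw [smul_comm s r, ← smul_add, ← smul_add, shTot_comm, smul_zero, smul_zero]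

/-- This relation is what the exterior algebra requires for extending `shLin` from vectors to all of
its elements. It has to hold for arbitrary `R`-combinations, hence the mixed terms of `shLin_comm`.
-/
lemma shLin_shLin (v : I →₀ R) (z : BarTot k U M) : shLin k g R v (shLin k g R v z) = 0 := by
  induction v using Finsupp.induction_linear with
  | zero => simp
  | add v w h h' =>
    have := shLin_comm k g v w z
    simp only [map_add, LinearMap.add_apply]
    rw [h, h', zero_add, add_zero, add_comm]
    exact this
  | single c r =>
    simp only [shLin_single, LinearMap.smul_apply, map_smul]
    rw [shTot_shTot, smul_zero, smul_zero]

/-- The comparison map from the exterior algebra to the Hochschild complex with coefficients in the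
ring, given by antisymmetrisation. -/
noncomputable def koszulToBar (R : Type u) [CommRing R] [Algebra k R] :
    ExtAlg R I →ₗ[R] BarTot k U R :=
  CliffordAlgebra.foldr (0 : QuadraticForm R (I →₀ R)) (shLin k g R)
    (fun v z => by rw [shLin_shLin]; simp)
    (DirectSum.lof R ℕ (fun n => R ⊗[k] ⨂[k]^n U) 0 (1 ⊗ₜ PiTensorProduct.tprod k Fin.elim0))

lemma koszulToBar_algebraMap (r : R) : koszulToBar k g R (algebraMap R (ExtAlg R I) r) =
    DirectSum.lof R ℕ (fun n => R ⊗[k] ⨂[k]^n U) 0 (r ⊗ₜ PiTensorProduct.tprod k Fin.elim0) := by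
  refine (CliffordAlgebra.foldr_algebraMap _ _ _ _ r).trans ?_
  rw [← map_smul, TensorProduct.smul_tmul', smul_eq_mul, mul_one]

lemma koszulToBar_ι_mul (v : I →₀ R) (ω : ExtAlg R I) :
    koszulToBar k g R (ExteriorAlgebra.ι R v * ω) = shLin k g R v (koszulToBar k g R ω) := by
  refine (CliffordAlgebra.foldr_mul _ _ _ _ _ _).trans ?_
  exact CliffordAlgebra.foldr_ι _ _ _ _ _

lemma koszulToBar_gen_mul (c : I) (ω : ExtAlg R I) :
    koszulToBar k g R (gen R c * ω) = shTot k R R (g c) (koszulToBar k g R ω) := by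
  rw [gen, koszulToBar_ι_mul, shLin_single, one_smul]

lemma koszulToBar_mem {n : ℕ} {ω : ExtAlg R I} (h : ω ∈ ⋀[R]^n (I →₀ R)) :
    ∃ z, koszulToBar k g R ω = DirectSum.lof R ℕ (fun n => R ⊗[k] ⨂[k]^n U) n z := by
  induction n generalizing ω with
  | zero =>
    rw [ExteriorAlgebra.exteriorPower, pow_zero, Submodule.mem_one] at h
    obtain ⟨r, rfl⟩ := h
    exact ⟨_, koszulToBar_algebraMap k g r⟩
  | succ n ih =>
    rw [ExteriorAlgebra.exteriorPower, pow_succ'] at h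
    induction h using Submodule.mul_induction_on' with
    | mem_mul_mem a ha b hb =>
      obtain ⟨v, rfl⟩ := ha
      obtain ⟨z, hz⟩ := ih hb
      rw [koszulToBar_ι_mul, hz]
      induction v using Finsupp.induction_linear with
      | zero => exact ⟨0, by simp⟩
      | add v w h h' =>
        obtain ⟨y, hy⟩ := h
        obtain ⟨y', hy'⟩ := h'
        exact ⟨y + y', by rw [map_add, LinearMap.add_apply, hy, hy', map_add]⟩
      | single c r =>
        exact ⟨r • sh k R n (g c) z, by
          rw [shLin_single, LinearMap.smul_apply, shTot_lof, map_smul]⟩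
    | add a _ b _ ha hb =>
      obtain ⟨y, hy⟩ := ha
      obtain ⟨y', hy'⟩ := hb
      exact ⟨y + y', by rw [map_add, hy, hy', map_add]⟩

/-- The comparison map is a chain map on generators that are differences of the two actions. -/
lemma barTotD_koszulToBar {x : I → R} {K : Set I} (hx : ∀ c ∈ K, x c = ract (g c) - lact (g c))
    {ω : ExtAlg R I} (h : ω ∈ supp R K) :
    barTotD k R lact ract (koszulToBar k g R ω) =
      koszulToBar k g R (contr (koszulForm x) ω) := by
  induction h using supp_induction with
  | h0 r => rw [koszulToBar_algebraMap, barTotD_lof_zero, contr_algebraMap, map_zero]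
  | hadd a b _ _ ha hb => simp only [map_add, ha, hb]
  | hsmul r a _ ha => simp only [map_smul, ha]
  | hmul c hc a _ ha =>
    rw [koszulToBar_gen_mul, barTotD_shTot, ha, contr_gen_mul, koszulForm_single, map_sub,
      map_smul, koszulToBar_gen_mul, hx c hc]

end BarTotal

end KhR

namespace KhR

/-! ### Exactness of the Hochschild complex with coefficients in the ring. -/

section Contraction

variable (k : Type u) [CommRing k] {U : Type u} [CommRing U] [Algebra k U]
  {R : Type u} [CommRing R] [Algebra k R]

/-- `(a ⊗ c, w) ↦ a ⊗ (c ⊗ w)`. -/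
noncomputable def consTensor (R : Type u) [CommRing R] [Algebra k R] (U : Type u) [CommRing U]
    [Algebra k U] (n : ℕ) : (R ⊗[k] U) →ₗ[k] (⨂[k]^n U) →ₗ[k] (R ⊗[k] ⨂[k]^(n + 1) U) :=
  TensorProduct.lift
    { toFun := fun a => LinearMap.compRight k (TensorProduct.mk k R (⨂[k]^(n + 1) U) a) ∘ₗ
        insTensor k U 0
      map_add' := fun a b => by ext; simp
      map_smul' := fun r a => by ext; simp [TensorProduct.smul_tmul'] }

lemma consTensor_tmul (n : ℕ) (a : R) (c : U) (u : Fin n → U) :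
    consTensor k R U n (a ⊗ₜ c) (PiTensorProduct.tprod k u) =
      a ⊗ₜ PiTensorProduct.tprod k (insVec 0 c u) := by
  have h := insTensor_tprod k (0 : Fin (n + 1)) c u
  rw [Fin.val_zero] at h
  rw [← h]
  rfl

variable (lact ract : U →ₐ[k] R) (sp : R →ₐ[k] R ⊗[k] U)

/-- Face `0` multiplies the prepended entry back into the coefficient. In every other face the
action of `u` can be performed inside `R ⊗ U`: face `1` merges `c` with `u 0`, which is
multiplication by `sp (ract (u 0)) = 1 ⊗ u 0`, and the last face is multiplication by `sp (lact _) =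
lact _ ⊗ 1`. -/
lemma barD_consTensor (hr : ∀ u, sp (ract u) = 1 ⊗ₜ u) (hl : ∀ u, sp (lact u) = lact u ⊗ₜ 1)
    (n : ℕ) (y : R ⊗[k] U) (u : Fin (n + 1) → U) :
    barD k lact ract R (n + 1) (consTensor k R U (n + 1) y (PiTensorProduct.tprod k u)) =
      (Algebra.TensorProduct.lift (AlgHom.id k R) ract (fun _ _ => Commute.all _ _) y) ⊗ₜ
        PiTensorProduct.tprod k u -
      ∑ i ∈ Finset.range (n + 2), (-1 : ℤ) ^ i • consTensor k R U n
        (sp (faceCoeff k lact ract i u) * y) (PiTensorProduct.tprod k (faceVec i u)) := by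
  induction y using TensorProduct.induction_on with
  | zero => simp
  | add y y' h h' =>
    simp only [map_add, LinearMap.add_apply, h, h', TensorProduct.add_tmul, mul_add, smul_add,
      Finset.sum_add_distrib]
    abel
  | tmul a c =>
    rw [consTensor_tmul, barD_tmul', Finset.sum_range_succ', add_comm (∑ _ ∈ _, _), sub_eq_add_neg,
      ← Finset.sum_neg_distrib]
    congr 1
    · rw [pow_zero, one_smul, faceVec_insVec_zero, Algebra.TensorProduct.lift_tmul]
      congr 1
      simp [faceCoeff, insVec, mul_comm]
    · refine Finset.sum_congr rfl fun i hi => ?_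
      rw [Finset.mem_range] at hi
      rw [pow_succ, mul_neg_one, neg_smul]
      congr 2
      rcases Nat.eq_zero_or_pos i with rfl | hi0
      · have h1 : faceCoeff k lact ract 0 u = ract (u 0) := by simp [faceCoeff]
        rw [zero_add, insVec_zero_mul, h1, hr, Algebra.TensorProduct.tmul_mul_tmul, one_mul,
          consTensor_tmul, mul_comm c]
        congr 1
        simp [faceCoeff]
      · rw [faceCoeff_insVec_gt lact ract c u (by omega) (by omega),
          faceVec_insVec_gt c u (by omega) (by omega), Nat.add_sub_cancel]
        have : sp (faceCoeff k lact ract i u) = faceCoeff k lact ract i u ⊗ₜ 1 := by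
          unfold faceCoeff
          rw [if_neg hi0.ne']
          split_ifs
          · exact hl _
          · exact map_one sp
        rw [this, Algebra.TensorProduct.tmul_mul_tmul, one_mul, consTensor_tmul, smul_eq_mul]

/-- The contraction of the Hochschild complex with coefficients in a ring that is free as a right
module. -/
noncomputable def barContraction (n : ℕ) : (R ⊗[k] ⨂[k]^n U) →ₗ[k] (R ⊗[k] ⨂[k]^(n + 1) U) :=
  TensorProduct.lift (consTensor k R U n ∘ₗ sp.toLinearMap)

lemma barContraction_tmul (n : ℕ) (a : R) (w : ⨂[k]^n U) :
    barContraction k sp n (a ⊗ₜ w) = consTensor k R U n (sp a) w := rfl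

/-- A coefficient is split by `sp` and its `U`-part becomes a new first tensor entry; multiplying
back is the identity by `hm`, and the remaining faces cancel because `sp` is multiplicative. The
homotopy is only `k`-linear, which suffices for exactness. -/
lemma barD_barContraction (hr : ∀ u, sp (ract u) = 1 ⊗ₜ u) (hl : ∀ u, sp (lact u) = lact u ⊗ₜ 1)
    (hm : ∀ a, Algebra.TensorProduct.lift (AlgHom.id k R) ract (fun _ _ => Commute.all _ _)
      (sp a) = a) (n : ℕ) (z : R ⊗[k] ⨂[k]^(n + 1) U) :
    barD k lact ract R (n + 1) (barContraction k sp (n + 1) z) =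
      z - barContraction k sp n (barD k lact ract R n z) := by
  induction z using TensorProduct.induction_on with
  | zero => simp
  | add x y hx hy => simp only [map_add, hx, hy]; abel
  | tmul a w =>
    induction w using PiTensorProduct.induction_on with
    | add x y hx hy => simp only [TensorProduct.tmul_add, map_add, hx, hy]; abel
    | smul_tprod r u =>
      rw [TensorProduct.tmul_smul, TensorProduct.smul_tmul', barContraction_tmul,
        barD_consTensor k lact ract sp hr hl, hm, barD_tmul', map_sum]
      congr 1
      refine Finset.sum_congr rfl fun i _ => ?_
      rw [map_zsmul, barContraction_tmul, smul_eq_mul, map_mul sp]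

lemma exists_barD_eq (hr : ∀ u, sp (ract u) = 1 ⊗ₜ u) (hl : ∀ u, sp (lact u) = lact u ⊗ₜ 1)
    (hm : ∀ a, Algebra.TensorProduct.lift (AlgHom.id k R) ract (fun _ _ => Commute.all _ _)
      (sp a) = a) (n : ℕ) (z : R ⊗[k] ⨂[k]^(n + 1) U) (hz : barD k lact ract R n z = 0) :
    ∃ y, barD k lact ract R (n + 1) y = z :=
  ⟨barContraction k sp (n + 1) z, by
    rw [barD_barContraction k lact ract sp hr hl hm, hz, map_zero, sub_zero]⟩

/-- A cycle without component of degree zero is a boundary. -/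
lemma exists_barTotD_eq (hex : ∀ n (z : R ⊗[k] ⨂[k]^(n + 1) U), barD k lact ract R n z = 0 →
      ∃ y, barD k lact ract R (n + 1) y = z)
    (z : BarTot k U R) (hz : barTotD k R lact ract z = 0) (h0 : z 0 = 0) :
    ∃ y, barTotD k R lact ract y = z := by
  classical
  have h : ∀ n, ∃ y : R ⊗[k] ⨂[k]^(n + 1) U, barD k lact ract R n y = z n := by
    intro n
    cases n with
    | zero => exact ⟨0, by rw [map_zero, h0]⟩
    | succ n =>
      refine hex n _ ?_
      rw [← barTotD_apply, hz]
      rfl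
  choose y hy using h
  refine ⟨∑ n ∈ DFinsupp.support z,
    DirectSum.lof R ℕ (fun n => R ⊗[k] ⨂[k]^n U) (n + 1) (y n), ?_⟩
  rw [map_sum]
  conv_rhs => rw [← DirectSum.sum_support_of z]
  refine Finset.sum_congr rfl fun n _ => ?_
  rw [barTotD_lof_succ, hy, DirectSum.lof_eq_of]

/-- The term of degree zero of the Hochschild complex with coefficients in the ring. -/
noncomputable def barZeroEquiv (R : Type u) [CommRing R] [Algebra k R] (U : Type u) [CommRing U]
    [Algebra k U] : (R ⊗[k] ⨂[k]^0 U) ≃ₗ[R] R :=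
  (TensorProduct.AlgebraTensorModule.congr (LinearEquiv.refl R R)
      (PiTensorProduct.isEmptyEquiv (R := k) (s := fun _ : Fin 0 => U) (Fin 0))).trans
    (TensorProduct.AlgebraTensorModule.rid k R R)

/-- The augmentation `BarTot k U R → R`. -/
noncomputable def barAug (R : Type u) [CommRing R] [Algebra k R] (U : Type u) [CommRing U]
    [Algebra k U] : BarTot k U R →ₗ[R] R :=
  (barZeroEquiv k R U).toLinearMap ∘ₗ DirectSum.component R ℕ (fun n => R ⊗[k] ⨂[k]^n U) 0

lemma barAug_lof_zero (r : R) (u : Fin 0 → U) : barAug k R U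
    (DirectSum.lof R ℕ (fun n => R ⊗[k] ⨂[k]^n U) 0 (r ⊗ₜ PiTensorProduct.tprod k u)) = r := by
  simp [barAug, barZeroEquiv, DirectSum.component.lof_self]

lemma barAug_lof_succ (n : ℕ) (z : R ⊗[k] ⨂[k]^(n + 1) U) : barAug k R U
    (DirectSum.lof R ℕ (fun n => R ⊗[k] ⨂[k]^n U) (n + 1) z) = 0 := by
  have : DirectSum.component R ℕ (fun n => R ⊗[k] ⨂[k]^n U) 0
      (DirectSum.lof R ℕ (fun n => R ⊗[k] ⨂[k]^n U) (n + 1) z) = 0 := by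
    rw [DirectSum.component.of, dif_neg (by omega)]
  rw [barAug, LinearMap.comp_apply, this, map_zero]

lemma eq_zero_of_barAug (z : BarTot k U R) (h : barAug k R U z = 0) : z 0 = 0 :=
  (LinearEquiv.map_eq_zero_iff (barZeroEquiv k R U)).1 h

/-- In degree zero the boundary of `a ⊗ u` is `(ract u - lact u) a`; in all other degrees the
augmentation vanishes. -/
lemma barAug_barTotD {J : Ideal R} (hJ : ∀ u, ract u - lact u ∈ J) (z : BarTot k U R) :
    barAug k R U (barTotD k R lact ract z) ∈ J := by
  induction z using barTot_induction with
  | h0 => simp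
  | hadd a b ha hb => rw [map_add, map_add]; exact J.add_mem ha hb
  | h n z =>
    rw [← DirectSum.lof_eq_of R]
    cases n with
    | zero => rw [barTotD_lof_zero, map_zero]; exact J.zero_mem
    | succ n =>
      rw [barTotD_lof_succ]
      cases n with
      | succ n => rw [barAug_lof_succ]; exact J.zero_mem
      | zero =>
        induction z using TensorProduct.induction_on with
        | zero => simp
        | add x y hx hy => simp only [map_add]; exact J.add_mem hx hy
        | tmul a w =>
          induction w using PiTensorProduct.induction_on with
          | add x y hx hy =>
            simp only [TensorProduct.tmul_add, map_add]
            exact J.add_mem hx hy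
          | smul_tprod r u =>
            rw [TensorProduct.tmul_smul, TensorProduct.smul_tmul', barD_tmul]
            simp only [Finset.univ_eq_empty, Finset.sum_empty, add_zero, map_add, map_neg,
              barAug_lof_zero, zero_add, pow_one, neg_smul, one_smul, smul_eq_mul]
            rw [← sub_eq_add_neg, show Fin.last 0 = 0 from rfl, ← sub_mul]
            exact J.mul_mem_right _ (hJ _)

lemma barAug_shTot (c : U) (z : BarTot k U R) : barAug k R U (shTot k R R c z) = 0 := by
  induction z using barTot_induction with
  | h0 => simp
  | hadd a b ha hb => simp only [map_add, ha, hb, add_zero]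
  | h n z => rw [← DirectSum.lof_eq_of R, shTot_lof, barAug_lof_succ]

variable {I : Type} (g : I → U)

/-- Shuffles raise the degree, so both augmentations kill multiples of generators, and they agree on
scalars. This identifies the two complexes in degree zero. -/
lemma barAug_koszulToBar (ω : ExtAlg R I) :
    barAug k R U (koszulToBar k g R ω) = ExteriorAlgebra.algebraMapInv ω := by
  induction ω using ext_gen_induction with
  | h0 r =>
    rw [koszulToBar_algebraMap, barAug_lof_zero]
    exact (ExteriorAlgebra.algebraMap_leftInverse _ r).symm
  | hadd a b ha hb => simp only [map_add, ha, hb]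
  | hsmul r a ha => simp only [map_smul, ha]
  | hmul c a ha =>
    rw [koszulToBar_gen_mul, barAug_shTot, map_mul, gen]
    simp [ExteriorAlgebra.algebraMapInv]

/-- Antisymmetrisation is a quasi-isomorphism from the Koszul complex of the differences of the two
actions to the Hochschild complex. -/
theorem isQuasi_koszulToBar {x : I → R} {K : Set I}
    (hx : ∀ c ∈ K, x c = ract (g c) - lact (g c))
    (hJ : ∀ u, ract u - lact u ∈ Ideal.span (x '' K))
    (hex : ∀ n (z : R ⊗[k] ⨂[k]^(n + 1) U), barD k lact ract R n z = 0 →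
      ∃ y, barD k lact ract R (n + 1) y = z)
    (hK : ∀ ω ∈ supp R K, contr (koszulForm x) ω = 0 →
      ExteriorAlgebra.algebraMapInv ω ∈ Ideal.span (x '' K) →
      ∃ η ∈ supp R K, contr (koszulForm x) η = ω) :
    IsQuasi x (barTotD k R lact ract) (koszulToBar k g R) K ⊥ where
  chain ω h := by
    rw [barTotD_koszulToBar k lact ract g hx h, sub_self]
    exact Submodule.zero_mem _
  inj ω h hd := by
    rintro ⟨z, hz⟩
    rw [Submodule.mem_bot, sub_eq_zero] at hz
    -- A cycle of the resolution bounds as soon as its scalar part is in the ideal, and the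
    -- augmentation of a Hochschild boundary is in that ideal.
    refine hK ω h hd ?_
    rw [← barAug_koszulToBar k g, hz]
    exact barAug_barTotD k lact ract hJ z
  surj z hz := by
    rw [Submodule.mem_bot] at hz
    -- The scalar part of `z` represents its class: the difference is a cycle without component in
    -- degree zero, hence a boundary.
    refine ⟨algebraMap R _ (barAug k R U z), algebraMap_mem_supp _ _, contr_algebraMap _ _, ?_⟩
    obtain ⟨y, hy⟩ := exists_barTotD_eq k lact ract hex
      (z - koszulToBar k g R (algebraMap R _ (barAug k R U z)))
      (by rw [map_sub, hz, koszulToBar_algebraMap, barTotD_lof_zero, sub_zero])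
      (eq_zero_of_barAug k _ (by
        rw [map_sub, koszulToBar_algebraMap, barAug_lof_zero, sub_self]))
    exact ⟨y, by rw [hy, sub_self]; exact Submodule.zero_mem _⟩

end Contraction

end KhR

namespace KhR

/-! ### Acyclic diagrams and the Koszul complex of the arcs. -/

namespace TangleDiagram

variable {b : Boundary} (T : TangleDiagram b)

instance : Finite T.Gen :=
  Finite.of_injective (β := T.Tail ⊕ T.Circ ⊕ T.Xing ⊕ T.Xing)
    (fun c => match c with
      | Gen.edge e => Sum.inl e
      | Gen.circ c => Sum.inr (Sum.inl c)
      | Gen.fst x => Sum.inr (Sum.inr (Sum.inl x))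
      | Gen.snd x => Sum.inr (Sum.inr (Sum.inr x)))
    (by rintro (_ | _ | _ | _) (_ | _ | _ | _) h <;> simp_all)

/-- The vertices of an acyclic diagram can be ranked such that the rank increases along edges. -/
lemma IsAcyclic.exists_rank {T : TangleDiagram b} (h : T.IsAcyclic) :
    ∃ r : T.Vertex → ℕ, ∀ v w, T.Adj v w → r v < r w := by
  classical
  -- The rank of `v` is the number of vertices from which `v` can be reached. Along an edge `v → w`
  -- this set grows, and strictly so: it gains `v`, which cannot be reached from itself.
  refine ⟨fun v => (Finset.univ.filter fun w => Relation.TransGen T.Adj w v).card,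
    fun v w hvw => Finset.card_lt_card ?_⟩
  rw [Finset.ssubset_iff_of_subset]
  · refine ⟨v, ?_, ?_⟩
    · simpa using Relation.TransGen.single hvw
    · simpa using h.2 v
  · intro z hz
    simp only [Finset.mem_filter, Finset.mem_univ, true_and] at hz ⊢
    exact hz.tail hvw

end TangleDiagram

namespace ClosedArcDiagram

open TangleDiagram

variable (k : Type u) [CommRing k] (η : ClosedArcDiagram) (T : ∀ j, TangleDiagram (η.bdry j))

/-- The Koszul generators of all the tangles, and one for each arc. -/
abbrev AllGen : Type := (Σ j, (T j).Gen) ⊕ η.Arc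

/-- The sequences of all the tangles, and for each arc the difference of the two actions. -/
noncomputable def allSeq (s : η.AllXing T → Bool) : η.AllGen T → η.AllPoly k T
  | Sum.inl c => MvPolynomial.rename (Sigma.mk c.1) ((T c.1).seq k (part s c.1) c.2)
  | Sum.inr α => MvPolynomial.X ⟨α.1, Var.head (Sum.inr α.2)⟩ -
      MvPolynomial.X ⟨(η.arcEnd α).1, Var.tail (Sum.inr (η.arcEnd α).2)⟩

/-- The element of `U` attached to a generator. -/
noncomputable def arcElt : η.AllGen T → η.ArcPoly k
  -- Shuffling with zero is zero, so every multiple of a generator of a tangle disappears in the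
  -- Hochschild complex.
  | Sum.inl _ => 0
  | Sum.inr α => MvPolynomial.X α

section Coaction

/-- The splitting of the right action. -/
noncomputable def splitRight : η.AllPoly k T →ₐ[k] η.AllPoly k T ⊗[k] η.ArcPoly k :=
  MvPolynomial.aeval fun v => match v with
    -- These are the variables through which `U` acts from the right. The left action uses variables
    -- at the beginnings of edges, so it is untouched by the splitting.
    | ⟨j, Var.head (Sum.inr p)⟩ => 1 ⊗ₜ MvPolynomial.X ⟨j, p⟩
    | v => MvPolynomial.X v ⊗ₜ 1

lemma splitRight_rightAct (u : η.ArcPoly k) :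
    η.splitRight k T (η.rightAct k T u) = 1 ⊗ₜ u := by
  have : (η.splitRight k T).comp (η.rightAct k T) =
      Algebra.TensorProduct.includeRight := by
    refine MvPolynomial.algHom_ext fun α => ?_
    simp [splitRight, rightAct]
  exact DFunLike.congr_fun this u

lemma splitRight_leftAct (u : η.ArcPoly k) :
    η.splitRight k T (η.leftAct k T u) = η.leftAct k T u ⊗ₜ 1 := by
  have : (η.splitRight k T).comp (η.leftAct k T) =
      (Algebra.TensorProduct.includeLeft (S := k)).comp (η.leftAct k T) := by
    refine MvPolynomial.algHom_ext fun α => ?_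
    simp [splitRight, leftAct]
  exact DFunLike.congr_fun this u

lemma lift_splitRight (a : η.AllPoly k T) :
    Algebra.TensorProduct.lift (AlgHom.id k _) (η.rightAct k T) (fun _ _ => Commute.all _ _)
      (η.splitRight k T a) = a := by
  have : (Algebra.TensorProduct.lift (AlgHom.id k _) (η.rightAct k T)
      (fun _ _ => Commute.all _ _)).comp (η.splitRight k T) = AlgHom.id k _ := by
    refine MvPolynomial.algHom_ext fun v => ?_
    rw [AlgHom.comp_apply, splitRight, MvPolynomial.aeval_X]
    split
    · simp [rightAct]
    · simp
  exact DFunLike.congr_fun this a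

end Coaction

lemma allSeq_inr (s : η.AllXing T → Bool) (α : η.Arc) : η.allSeq k T s (Sum.inr α) =
    η.rightAct k T (η.arcElt k T (Sum.inr α)) - η.leftAct k T (η.arcElt k T (Sum.inr α)) := by
  simp [allSeq, arcElt, rightAct, leftAct]

lemma rightAct_sub_leftAct_mem (s : η.AllXing T → Bool) (u : η.ArcPoly k) :
    η.rightAct k T u - η.leftAct k T u ∈
      Ideal.span (η.allSeq k T s '' Set.range Sum.inr) := by
  induction u using MvPolynomial.induction_on with
  | C r => simp [rightAct, leftAct]
  | add p q hp hq =>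
    rw [map_add, map_add, add_sub_add_comm]
    exact Ideal.add_mem _ hp hq
  | mul_X p α hp =>
    have h : η.rightAct k T (MvPolynomial.X α) - η.leftAct k T (MvPolynomial.X α) ∈
        Ideal.span (η.allSeq k T s '' Set.range Sum.inr) :=
      Ideal.subset_span ⟨Sum.inr α, ⟨α, rfl⟩, η.allSeq_inr k T s α⟩
    rw [map_mul, map_mul]
    convert Ideal.add_mem _ (Ideal.mul_mem_left _ (η.rightAct k T p) h)
      (Ideal.mul_mem_right (η.leftAct k T (MvPolynomial.X α)) _ hp) using 1
    ring

/-- The Koszul complex of the arcs is a resolution. -/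
lemma exists_contr_eq (s : η.AllXing T → Bool) :
    ∀ ω ∈ supp (η.AllPoly k T) (Set.range (Sum.inr : η.Arc → η.AllGen T)),
      contr (koszulForm (η.allSeq k T s)) ω = 0 →
      ExteriorAlgebra.algebraMapInv ω ∈ Ideal.span (η.allSeq k T s '' Set.range Sum.inr) →
      ∃ ζ ∈ supp (η.AllPoly k T) (Set.range (Sum.inr : η.Arc → η.AllGen T)),
        contr (koszulForm (η.allSeq k T s)) ζ = ω := by
  classical
  -- With no generators the Koszul complex is the ring itself, compared here with the ring carrying
  -- the zero differential. Adding the arcs replaces the ring by its quotient, which says that the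
  -- Koszul complex of the arcs is a resolution.
  have base : IsQuasi (G := η.AllPoly k T) (η.allSeq k T s) 0
      (ExteriorAlgebra.algebraMapInv (R := η.AllPoly k T)
        (M := η.AllGen T →₀ η.AllPoly k T)).toLinearMap ∅ ⊥ := by
    refine ⟨fun ω h => ?_, fun ω h _ hg => ?_, fun g _ => ?_⟩
    · obtain ⟨r, rfl⟩ := mem_supp_empty h
      simp [contr_algebraMap]
    · obtain ⟨r, rfl⟩ := mem_supp_empty h
      obtain ⟨g, hg⟩ := hg
      have : r = 0 := by
        simpa [ExteriorAlgebra.algebraMap_leftInverse _ r] using hg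
      exact ⟨0, Submodule.zero_mem _, by rw [this]; simp⟩
    · refine ⟨algebraMap _ _ g, algebraMap_mem_supp _ _, contr_algebraMap _ _, 0, ?_⟩
      simp [ExteriorAlgebra.algebraMap_leftInverse _ g]
  have := base.finset (fun _ => rfl) (Finset.univ.image Sum.inr) (fun _ => 0)
    (fun s => ∀ a ∈ s, ∃ α, a = Sum.inr α)
    (fun a ha => by obtain ⟨α, -, rfl⟩ := Finset.mem_image.1 ha; exact ⟨α, rfl⟩) (by
      intro a s' ha _ hC
      obtain ⟨α, rfl⟩ := hC a (Finset.mem_insert_self _ _)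
      refine ⟨fun b hb => hC b (Finset.mem_insert_of_mem hb), by simp, fun ω => ?_, fun v hv => ?_⟩
      · simp [gen, ExteriorAlgebra.algebraMapInv]
      · simp only [famSub, smul_eq_mul, Ideal.mul_top] at hv ⊢
        -- The element of an arc is linear in the variable where the arc begins, and no other arc
        -- involves that variable.
        refine mem_of_mul_mem_of_linear (⟨α.1, Var.head (Sum.inr α.2)⟩ : Σ j, (T j).Var) rfl
          ?_ (q := MvPolynomial.X ⟨(η.arcEnd α).1, Var.tail (Sum.inr (η.arcEnd α).2)⟩) ?_
          (Or.inl rfl) v hv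
        · rintro _ ⟨b, hb, rfl⟩
          obtain ⟨β, rfl⟩ := hC b (Finset.mem_insert_of_mem hb)
          refine X_sub_X_mem_adjoin ?_ ?_
          · intro h
            apply ha
            obtain ⟨j, p⟩ := α
            obtain ⟨j', p'⟩ := β
            simp only [Set.mem_singleton_iff, Sigma.mk.injEq] at h
            obtain ⟨rfl, h⟩ := h
            simp only [heq_eq_eq, Var.head.injEq, Sum.inr.injEq] at h
            subst h
            exact hb
          · intro h
            simp only [Set.mem_singleton_iff, Sigma.mk.injEq] at h
            obtain ⟨h1, h2⟩ := h
            revert h2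
            generalize (η.arcEnd β) = z at h1
            obtain ⟨z1, z2⟩ := z
            obtain ⟨j, p⟩ := α
            simp only at h1
            subst h1
            simp
        · refine X_mem_adjoin ?_
          intro h
          simp only [Set.mem_singleton_iff, Sigma.mk.injEq] at h
          obtain ⟨h1, h2⟩ := h
          revert h2
          generalize (η.arcEnd α) = z at h1
          obtain ⟨z1, z2⟩ := z
          obtain ⟨j, p⟩ := α
          simp only at h1
          subst h1
          simp)
  rw [Set.empty_union, Finset.coe_image, Finset.coe_univ, Set.image_univ] at this
  intro ω h hd hω
  refine this.inj ω h hd ⟨0, ?_⟩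
  simpa [famSub] using hω

/-- The Koszul complex of the arcs is quasi-isomorphic to the Hochschild complex of the ring. -/
lemma isQuasi_arcs (s : η.AllXing T → Bool) :
    IsQuasi (η.allSeq k T s) (barTotD k (η.AllPoly k T) (η.leftAct k T) (η.rightAct k T))
      (koszulToBar k (η.arcElt k T) (η.AllPoly k T)) (Set.range Sum.inr) ⊥ := by
  refine isQuasi_koszulToBar k _ _ _ ?_ (η.rightAct_sub_leftAct_mem k T s)
    (exists_barD_eq k _ _ (η.splitRight k T) (η.splitRight_rightAct k T) (η.splitRight_leftAct k T)
      (η.lift_splitRight k T)) (η.exists_contr_eq k T s)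
  rintro _ ⟨α, rfl⟩
  exact η.allSeq_inr k T s α

end ClosedArcDiagram

end KhR

/-! ### Regularity of the sequences of acyclic tangles. -/

namespace KhR

instance free_tensorPower (k : Type u) [CommRing k] (U : Type u) [CommRing U] [Algebra k U]
    [Module.Free k U] (n : ℕ) : Module.Free k (⨂[k]^n U) := by
  obtain ⟨B, b⟩ := Module.Free.exists_basis k U
  exact Module.Free.of_basis (Basis.piTensorProduct fun _ : Fin n => b)

/-- Freeness lets regularity modulo an ideal pass from the polynomial ring to all terms of the
Hochschild complex. -/
instance free_barTot (k : Type u) [CommRing k] (U : Type u) [CommRing U] [Algebra k U]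
    [Module.Free k U] (R : Type u) [CommRing R] [Algebra k R] :
    Module.Free R (BarTot k U R) := by
  unfold BarTot
  infer_instance

namespace ClosedArcDiagram

open TangleDiagram

variable (k : Type u) [CommRing k] (η : ClosedArcDiagram) (T : ∀ j, TangleDiagram (η.bdry j))

/-- The variables at a generator of one of the tangles. -/
def genVars : (Σ j, (T j).Gen) → Set (Σ j, (T j).Var)
  | ⟨j, Gen.edge e⟩ => {⟨j, Var.tail e⟩, ⟨j, Var.head ((T j).edge e)⟩}
  | ⟨_, Gen.circ _⟩ => ∅
  | ⟨j, Gen.fst x⟩ => {⟨j, Var.tail (Sum.inl (x, false))⟩, ⟨j, Var.tail (Sum.inl (x, true))⟩,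
      ⟨j, Var.head (Sum.inl (x, false))⟩, ⟨j, Var.head (Sum.inl (x, true))⟩}
  | ⟨j, Gen.snd x⟩ => {⟨j, Var.tail (Sum.inl (x, false))⟩, ⟨j, Var.tail (Sum.inl (x, true))⟩,
      ⟨j, Var.head (Sum.inl (x, false))⟩, ⟨j, Var.head (Sum.inl (x, true))⟩}

lemma allSeq_mem_adjoin (s : η.AllXing T → Bool) (c : Σ j, (T j).Gen)
    {W : Set (Σ j, (T j).Var)} (h : η.genVars T c ⊆ W) :
    η.allSeq k T s (Sum.inl c) ∈ Algebra.adjoin k (MvPolynomial.X '' W) := by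
  have hX : ∀ v, v ∈ η.genVars T c → (MvPolynomial.X v : η.AllPoly k T) ∈
      Algebra.adjoin k (MvPolynomial.X '' W) := fun v hv => X_mem_adjoin (h hv)
  obtain ⟨j, e | c | x | x⟩ := c
  · simp only [allSeq, seq, map_sub, MvPolynomial.rename_X]
    exact Subalgebra.sub_mem _ (hX _ (by simp [genVars])) (hX _ (by simp [genVars]))
  · simp only [allSeq, seq, map_zero]
    exact Subalgebra.zero_mem _
  all_goals
    have h1 := hX ⟨j, Var.tail (Sum.inl (x, false))⟩ (by simp [genVars])
    have h2 := hX ⟨j, Var.tail (Sum.inl (x, true))⟩ (by simp [genVars])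
    have h3 := hX ⟨j, Var.head (Sum.inl (x, false))⟩ (by simp [genVars])
    have h4 := hX ⟨j, Var.head (Sum.inl (x, true))⟩ (by simp [genVars])
    simp only [allSeq, seq, ti, tj, tk, tl]
    split_ifs <;> simp only [map_sub, map_add, map_mul, MvPolynomial.rename_X]
  · exact Subalgebra.sub_mem _ h1 h3
  · exact Subalgebra.sub_mem _ (Subalgebra.sub_mem _ (Subalgebra.add_mem _ h1 h2) h4) h3
  · exact Subalgebra.sub_mem _ h2 h4
  · exact Subalgebra.sub_mem _ (Subalgebra.mul_mem _ h1 h2) (Subalgebra.mul_mem _ h4 h3)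

section

variable {η T} {s : η.AllXing T → Bool} {j : Fin η.holes} {x : (T j).Xing}

lemma allSeq_fst_true (hs : s (toLex ⟨j, x⟩) = true) :
    η.allSeq k T s (Sum.inl ⟨j, Gen.fst x⟩) = MvPolynomial.X ⟨j, Var.tail (Sum.inl (x, false))⟩ -
      MvPolynomial.X ⟨j, Var.head (Sum.inl (x, false))⟩ := by
  simp [allSeq, seq, ti, tl, part, hs]

lemma allSeq_fst_false (hs : s (toLex ⟨j, x⟩) = false) :
    η.allSeq k T s (Sum.inl ⟨j, Gen.fst x⟩) = MvPolynomial.X ⟨j, Var.tail (Sum.inl (x, false))⟩ +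
      MvPolynomial.X ⟨j, Var.tail (Sum.inl (x, true))⟩ -
      MvPolynomial.X ⟨j, Var.head (Sum.inl (x, true))⟩ -
      MvPolynomial.X ⟨j, Var.head (Sum.inl (x, false))⟩ := by
  simp [allSeq, seq, ti, tj, tk, tl, part, hs]

lemma allSeq_snd_true (hs : s (toLex ⟨j, x⟩) = true) :
    η.allSeq k T s (Sum.inl ⟨j, Gen.snd x⟩) = MvPolynomial.X ⟨j, Var.tail (Sum.inl (x, true))⟩ -
      MvPolynomial.X ⟨j, Var.head (Sum.inl (x, true))⟩ := by
  simp [allSeq, seq, tj, tk, part, hs]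

lemma allSeq_snd_false (hs : s (toLex ⟨j, x⟩) = false) :
    η.allSeq k T s (Sum.inl ⟨j, Gen.snd x⟩) = MvPolynomial.X ⟨j, Var.tail (Sum.inl (x, false))⟩ *
      MvPolynomial.X ⟨j, Var.tail (Sum.inl (x, true))⟩ -
      MvPolynomial.X ⟨j, Var.head (Sum.inl (x, true))⟩ *
      MvPolynomial.X ⟨j, Var.head (Sum.inl (x, false))⟩ := by
  simp [allSeq, seq, ti, tj, tk, tl, part, hs]

end

/-- The order in which the generators are added. -/
def genRank (r : ∀ j, (T j).Vertex → ℕ) : (Σ j, (T j).Gen) → ℕ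
  -- The factor `3` leaves room at each vertex for the edges that end there, then the first and then
  -- the second generator of the crossing; edges that leave the vertex come later, because they end
  -- at a vertex of larger rank.
  | ⟨j, Gen.edge e⟩ => 3 * r j ((T j).headVertex ((T j).edge e))
  | ⟨_, Gen.circ _⟩ => 0
  | ⟨j, Gen.fst x⟩ => 3 * r j (Sum.inl x) + 1
  | ⟨j, Gen.snd x⟩ => 3 * r j (Sum.inl x) + 2

variable {η T} {r : ∀ j, (T j).Vertex → ℕ} (hr : ∀ j v w, (T j).Adj v w → r j v < r j w)

section

include hr

lemma lt_of_tail {j : Fin η.holes} {x : (T j).Xing} {c : Bool} {e : (T j).Tail}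
    (h : e = Sum.inl (x, c)) : r j (Sum.inl x) < r j ((T j).headVertex ((T j).edge e)) :=
  hr j _ _ ⟨e, by rw [h]; rfl, rfl⟩

/-- Apart from the edge itself, only the crossing at its end can involve the variable, and the
generators of that crossing have larger rank. -/
lemma head_not_mem_genVars {j : Fin η.holes} {e : (T j).Tail} {c : Σ j, (T j).Gen}
    (hc : c ≠ ⟨j, Gen.edge e⟩) (h : η.genRank T r c ≤ η.genRank T r ⟨j, Gen.edge e⟩) :
    (⟨j, Var.head ((T j).edge e)⟩ : Σ j, (T j).Var) ∉ η.genVars T c := by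
  obtain ⟨i, e' | c | x | x⟩ := c
  · rintro (h | h)
    · rw [Sigma.mk.injEq] at h
      obtain ⟨rfl, h⟩ := h
      simp at h
    · rw [Set.mem_singleton_iff, Sigma.mk.injEq] at h
      obtain ⟨rfl, h⟩ := h
      simp only [heq_eq_eq, Var.head.injEq, EmbeddingLike.apply_eq_iff_eq] at h
      exact hc (by rw [h])
  · simp [genVars]
  all_goals
    intro h'
    simp only [genVars, Set.mem_insert_iff, Set.mem_singleton_iff, Sigma.mk.injEq] at h'
    obtain rfl : j = i := by rcases h' with h | h | h | h <;> exact h.1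
    simp only [genRank] at h
    simp only [heq_eq_eq, true_and, reduceCtorEq, false_or, Var.head.injEq] at h'
    rcases h' with h' | h' <;> rw [h'] at h <;> simp [headVertex] at h

/-- Apart from the generators of the crossing itself, only the edge leaving `x` at this flag
involves the variable. That edge ends at a vertex of larger rank, so it comes later. -/
lemma tail_not_mem_genVars {j : Fin η.holes} {x : (T j).Xing} {b : Bool} {c : Σ j, (T j).Gen}
    (hc1 : c ≠ ⟨j, Gen.fst x⟩) (hc2 : c ≠ ⟨j, Gen.snd x⟩)
    (h : η.genRank T r c ≤ 3 * r j (Sum.inl x) + 2) :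
    (⟨j, Var.tail (Sum.inl (x, b))⟩ : Σ j, (T j).Var) ∉ η.genVars T c := by
  obtain ⟨i, e' | c | y | y⟩ := c
  · rintro (h' | h')
    · rw [Sigma.mk.injEq] at h'
      obtain ⟨rfl, h'⟩ := h'
      simp only [heq_eq_eq, Var.tail.injEq] at h'
      have := lt_of_tail hr h'.symm
      simp only [genRank] at h
      omega
    · rw [Set.mem_singleton_iff, Sigma.mk.injEq] at h'
      obtain ⟨rfl, h'⟩ := h'
      simp at h'
  · simp [genVars]
  all_goals
    intro h'
    simp only [genVars, Set.mem_insert_iff, Set.mem_singleton_iff, Sigma.mk.injEq] at h'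
    obtain rfl : j = i := by rcases h' with h | h | h | h <;> exact h.1
    simp only [heq_eq_eq, true_and, reduceCtorEq, or_false, Var.tail.injEq, Sum.inl.injEq,
      Prod.mk.injEq] at h'
    obtain rfl : x = y := by rcases h' with h | h <;> exact h.1
    simp at hc1 hc2

end

/-- Each generator of the tangles is regular modulo the preceding ones. -/
lemma mem_of_allSeq_mul_mem (hr : ∀ j v w, (T j).Adj v w → r j v < r j w)
    (hcirc : ∀ j, IsEmpty (T j).Circ) (s : η.AllXing T → Bool)
    (c : Σ j, (T j).Gen) (Y : Set (Σ j, (T j).Gen)) (hc : c ∉ Y)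
    (hY : ∀ b ∈ Y, η.genRank T r b ≤ η.genRank T r c)
    (hfst : ∀ j x, c = ⟨j, Gen.snd x⟩ → ⟨j, Gen.fst x⟩ ∈ Y) (p : η.AllPoly k T)
    (hp : η.allSeq k T s (Sum.inl c) * p ∈
      Ideal.span ((fun c => η.allSeq k T s (Sum.inl c)) '' Y)) :
    p ∈ Ideal.span ((fun c => η.allSeq k T s (Sum.inl c)) '' Y) := by
  have hne : ∀ b ∈ Y, b ≠ c := fun b hb h => hc (h ▸ hb)
  obtain ⟨j, e | c | x | x⟩ := c
  · refine mem_of_mul_mem_of_linear (⟨j, Var.head ((T j).edge e)⟩ : Σ j, (T j).Var) rfl ?_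
      (q := MvPolynomial.X ⟨j, Var.tail e⟩) (X_mem_adjoin ?_)
      (Or.inr (by simp [allSeq, seq])) p hp
    · rintro _ ⟨b, hb, rfl⟩
      refine η.allSeq_mem_adjoin k T s b (Set.subset_compl_singleton_iff.2 ?_)
      exact head_not_mem_genVars hr (hne b hb) (hY b hb)
    · simp
  -- A closed component contributes `0`, which is not regular in general; acyclicity excludes it.
  · exact ((hcirc j).false c).elim
  · have hsnd : ∀ b ∈ Y, b ≠ ⟨j, Gen.snd x⟩ := by
      rintro b hb rfl
      have := hY _ hb
      simp [genRank] at this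
    -- For both smoothings the first generator has the form `ti - q` with `q` free of `ti`.
    have hlin : ∀ q : η.AllPoly k T, q ∈ Algebra.adjoin k (MvPolynomial.X ''
          {(⟨j, Var.tail (Sum.inl (x, false))⟩ : Σ j, (T j).Var)}ᶜ) →
        η.allSeq k T s (Sum.inl ⟨j, Gen.fst x⟩) =
          MvPolynomial.X ⟨j, Var.tail (Sum.inl (x, false))⟩ - q →
        p ∈ Ideal.span ((fun c => η.allSeq k T s (Sum.inl c)) '' Y) := by
      intro q hq ha
      refine mem_of_mul_mem_of_linear (⟨j, Var.tail (Sum.inl (x, false))⟩ : Σ j, (T j).Var) rfl ?_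
        hq (Or.inl ha) p hp
      rintro _ ⟨b, hb, rfl⟩
      refine η.allSeq_mem_adjoin k T s b (Set.subset_compl_singleton_iff.2 ?_)
      exact tail_not_mem_genVars hr (hne b hb) (hsnd b hb)
        ((hY b hb).trans (by simp [genRank]))
    cases hs : s (toLex ⟨j, x⟩)
    · refine hlin (MvPolynomial.X ⟨j, Var.head (Sum.inl (x, true))⟩ +
          MvPolynomial.X ⟨j, Var.head (Sum.inl (x, false))⟩ -
          MvPolynomial.X ⟨j, Var.tail (Sum.inl (x, true))⟩) ?_ ?_
      · exact Subalgebra.sub_mem _ (Subalgebra.add_mem _ (X_mem_adjoin (by simp))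
          (X_mem_adjoin (by simp))) (X_mem_adjoin (by simp))
      · rw [allSeq_fst_false k hs]
        ring
    · exact hlin _ (X_mem_adjoin (by simp)) (allSeq_fst_true k hs)
  · have hfst' := hfst j x rfl
    cases hs : s (toLex ⟨j, x⟩)
    -- For the resolution that is not oriented the second generator is regular only by virtue of the
    -- linear relation of the first one, whence the condition that the first generator is already in
    -- `Y`.
    · refine mem_of_mul_mem_of_quadratic (V := Σ j, (T j).Var)
        (i := ⟨j, Var.tail (Sum.inl (x, false))⟩) (j := ⟨j, Var.tail (Sum.inl (x, true))⟩)
        (a := ⟨j, Var.head (Sum.inl (x, true))⟩) (b := ⟨j, Var.head (Sum.inl (x, false))⟩)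
        (X := (fun c => η.allSeq k T s (Sum.inl c)) '' Y)
        (by simp) (by simp) (by simp) rfl ⟨_, hfst', allSeq_fst_false k hs⟩ ?_ p ?_
      · rintro _ ⟨b, hb, rfl⟩
        by_cases hb' : b = ⟨j, Gen.fst x⟩
        · left
          rw [hb']
          exact allSeq_fst_false k hs
        · right
          refine η.allSeq_mem_adjoin k T s b ?_
          rw [Set.subset_compl_comm, Set.insert_subset_iff, Set.singleton_subset_iff]
          have hb2 := (hY b hb)
          exact ⟨tail_not_mem_genVars hr hb' (hne b hb) hb2,
            tail_not_mem_genVars hr hb' (hne b hb) hb2⟩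
      · rw [← allSeq_snd_false k hs]
        exact hp
    · refine mem_of_mul_mem_of_linear (⟨j, Var.tail (Sum.inl (x, true))⟩ : Σ j, (T j).Var) rfl ?_
        (q := MvPolynomial.X ⟨j, Var.head (Sum.inl (x, true))⟩) (X_mem_adjoin (by simp))
        (Or.inl (allSeq_snd_true k hs)) p hp
      · rintro _ ⟨b, hb, rfl⟩
        -- For the oriented resolution the first generator is `ti - tl`, so it is free of `tj` even
        -- though the crossing has `tj` among its variables.
        by_cases hb' : b = ⟨j, Gen.fst x⟩
        · subst hb'
          simp only [allSeq_fst_true k hs]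
          exact X_sub_X_mem_adjoin (by simp) (by simp)
        · refine η.allSeq_mem_adjoin k T s b (Set.subset_compl_singleton_iff.2 ?_)
          exact tail_not_mem_genVars hr hb' (hne b hb) (hY b hb)

variable (η T)

lemma koszulToBar_gen_inl (c : Σ j, (T j).Gen) (ω : ExtAlg (η.AllPoly k T) (η.AllGen T)) :
    koszulToBar k (η.arcElt k T) (η.AllPoly k T) (gen _ (Sum.inl c) * ω) = 0 := by
  rw [koszulToBar_gen_mul]
  change shTot k _ _ 0 _ = 0
  rw [shTot_zero, LinearMap.zero_apply]

/-- The Koszul complex of all the sequences is quasi-isomorphic to the Hochschild complex modulo the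
sequences of the tangles. -/
theorem isQuasi_all (hT : ∀ j, (T j).IsAcyclic) (s : η.AllXing T → Bool) :
    IsQuasi (η.allSeq k T s) (barTotD k (η.AllPoly k T) (η.leftAct k T) (η.rightAct k T))
      (koszulToBar k (η.arcElt k T) (η.AllPoly k T)) Set.univ
      (famSub (η.allSeq k T s) (BarTot k (η.ArcPoly k) (η.AllPoly k T)) (Set.range Sum.inl)) := by
  classical
  have hr : ∀ j, ∃ r : (T j).Vertex → ℕ, ∀ v w, (T j).Adj v w → r v < r w :=
    fun j => (hT j).exists_rank
  choose r hr using hr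
  have : Fintype (Σ j, (T j).Gen) := Fintype.ofFinite _
  have h := (η.isQuasi_arcs k T s).finset (fun z => barTotD_barTotD k _ _ z)
    (Finset.univ.image Sum.inl) (Sum.elim (η.genRank T r) fun _ => 0)
    -- The sets that occur contain only generators of tangles, and with the second generator of a
    -- crossing also the first; removing an element of maximal rank preserves this, since the first
    -- has smaller rank than the second.
    (fun Y => (∀ a ∈ Y, ∃ c, a = Sum.inl c) ∧ ∀ j x, Sum.inl ⟨j, Gen.snd x⟩ ∈ Y →
      Sum.inl ⟨j, Gen.fst x⟩ ∈ Y) ⟨fun a ha => by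
        obtain ⟨c, -, rfl⟩ := Finset.mem_image.1 ha
        exact ⟨c, rfl⟩, fun j x _ => Finset.mem_image.2 ⟨_, Finset.mem_univ _, rfl⟩⟩ (by
      rintro a Y ha hmax ⟨hC1, hC2⟩
      obtain ⟨c, rfl⟩ := hC1 _ (Finset.mem_insert_self _ _)
      refine ⟨⟨fun b hb => hC1 b (Finset.mem_insert_of_mem hb), fun j x hx => ?_⟩, by simp,
        η.koszulToBar_gen_inl k T c, fun v hv => ?_⟩
      · rcases Finset.mem_insert.1 (hC2 j x (Finset.mem_insert_of_mem hx)) with h | h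
        · have := hmax _ hx
          rw [← h] at this
          simp [genRank] at this
        · exact h
      · have himg : η.allSeq k T s '' (Y : Set (η.AllGen T)) =
            (fun c => η.allSeq k T s (Sum.inl c)) '' {c | Sum.inl c ∈ Y} := by
          ext p
          constructor
          · rintro ⟨b, hb, rfl⟩
            obtain ⟨c', rfl⟩ := hC1 b (Finset.mem_insert_of_mem hb)
            exact ⟨c', hb, rfl⟩
          · rintro ⟨c', hc', rfl⟩
            exact ⟨_, hc', rfl⟩
        unfold famSub at hv ⊢
        refine mem_smul_top_of_smul_mem (fun p hp => ?_) hv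
        rw [himg] at hp ⊢
        refine mem_of_allSeq_mul_mem k hr (fun j => (hT j).1) s c _ ha
          (fun b hb => hmax (Sum.inl b) hb) ?_ p hp
        rintro j x rfl
        rcases Finset.mem_insert.1 (hC2 j x (Finset.mem_insert_self _ _)) with h | h
        · simp at h
        · exact h)
  rw [Finset.coe_image, Finset.coe_univ, Set.image_univ, Set.union_comm,
    Set.range_inl_union_range_inr] at h
  exact h

end ClosedArcDiagram

end KhR

namespace KhR

/-! ### Orbits of a permutation cut at stops. -/

section Orbits

variable {A B : Type} [Finite A] [Finite B] (p : Equiv.Perm (A ⊕ B))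

/-- The points of `A`, and one point on each orbit contained in `B`. -/
def IsStop (z : A ⊕ B) : Prop :=
  z.isLeft = true ∨ ∃ o : ClosedOrbit p, z = Sum.inr o.out

lemma ClosedOrbit.isRight (o : ClosedOrbit p) (n : ℕ) :
    ((p ^ n) (Sum.inr o.out)).isRight = true :=
  (Quotient.out o).2 n

/-- Each orbit inside `B` carries exactly one marked point, so meeting a marked point determines the
orbit. -/
lemma ClosedOrbit.ext_of_pow {o o' : ClosedOrbit p} {n : ℕ}
    (h : (p ^ n) (Sum.inr o.out) = Sum.inr o'.out) : o = o' := by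
  rw [← Quotient.out_eq o, ← Quotient.out_eq o']
  refine Quotient.sound ⟨n, ?_⟩
  rw [zpow_natCast]
  exact h

lemma ClosedOrbit.exists_pow {y : B} (h : ∀ n : ℕ, ((p ^ n) (Sum.inr y)).isRight = true) :
    ∃ (n : ℕ) (o : ClosedOrbit p), 0 < n ∧ (p ^ n) (Sum.inr y) = Sum.inr o.out := by
  let o : ClosedOrbit p := Quotient.mk _ ⟨y, h⟩
  have : p.SameCycle (Sum.inr o.out) (Sum.inr y) := Quotient.mk_out
    (s := (Equiv.Perm.SameCycle.setoid p).comap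
      fun y : {y : B // ∀ n : ℕ, ((p ^ n) (Sum.inr y)).isRight = true} => Sum.inr y.1) ⟨y, h⟩
  obtain ⟨n, hn, -, h'⟩ := this.symm.exists_pow_eq''
  exact ⟨n, o, hn, h'⟩

lemma exists_isStop (z : A ⊕ B) : ∃ n, 0 < n ∧ IsStop p ((p ^ n) z) := by
  by_cases h : ∀ n : ℕ, ((p ^ n) z).isRight = true
  · obtain ⟨y, rfl⟩ := Sum.isRight_iff.1 (h 0)
    obtain ⟨n, o, hn, ho⟩ := ClosedOrbit.exists_pow p (y := y) h
    exact ⟨n, hn, Or.inr ⟨o, ho⟩⟩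
  · push Not at h
    obtain ⟨n, hn⟩ := h
    refine ⟨n + orderOf p, by have := orderOf_pos p; omega, Or.inl ?_⟩
    rw [pow_add, pow_orderOf_eq_one, mul_one]
    simpa using hn

open Classical in
/-- The first time at which an orbit meets a stop. -/
noncomputable def stopTime (z : A ⊕ B) : ℕ := Nat.find (exists_isStop p z)

lemma stopTime_pos (z : A ⊕ B) : 0 < stopTime p z := by
  classical exact (Nat.find_spec (exists_isStop p z)).1

lemma isStop_pow_stopTime (z : A ⊕ B) : IsStop p ((p ^ stopTime p z) z) := by
  classical exact (Nat.find_spec (exists_isStop p z)).2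

lemma not_isStop_of_lt {z : A ⊕ B} {n : ℕ} (h0 : 0 < n) (h : n < stopTime p z) :
    ¬ IsStop p ((p ^ n) z) := by
  classical exact fun h' => Nat.find_min (exists_isStop p z) h ⟨h0, h'⟩

lemma stopTime_le {z : A ⊕ B} {n : ℕ} (h0 : 0 < n) (h : IsStop p ((p ^ n) z)) :
    stopTime p z ≤ n := by
  by_contra! hn
  exact not_isStop_of_lt p h0 hn h

lemma stopTime_eq_one {z : A ⊕ B} (h : IsStop p (p z)) : stopTime p z = 1 :=
  le_antisymm (stopTime_le p one_pos (by rwa [pow_one])) (stopTime_pos p z)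

lemma stopTime_apply {z : A ⊕ B} (h : ¬ IsStop p (p z)) :
    stopTime p z = stopTime p (p z) + 1 := by
  have key : ∀ n, (p ^ n) (p z) = (p ^ (n + 1)) z := fun n => by
    rw [pow_succ, Equiv.Perm.mul_apply]
  apply le_antisymm
  · refine stopTime_le p (Nat.succ_pos _) ?_
    rw [← key]
    exact isStop_pow_stopTime p (p z)
  · obtain ⟨n, hn⟩ : ∃ n, stopTime p z = n + 1 := ⟨stopTime p z - 1, by
      have := stopTime_pos p z; omega⟩
    rw [hn, Nat.add_le_add_iff_right]
    have hs := isStop_pow_stopTime p z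
    rw [hn, ← key] at hs
    rcases Nat.eq_zero_or_pos n with rfl | h0
    · exact (h hs).elim
    · exact stopTime_le p h0 hs

lemma pow_stopTime_inr_out (o : ClosedOrbit p) :
    (p ^ stopTime p (Sum.inr o.out)) (Sum.inr o.out) = Sum.inr o.out := by
  rcases isStop_pow_stopTime p (Sum.inr o.out) with h | ⟨o', ho'⟩
  · have := o.isRight p (stopTime p (Sum.inr o.out))
    obtain ⟨a, ha⟩ := Sum.isLeft_iff.1 h
    rw [ha] at this
    simp at this
  · rw [ho', ClosedOrbit.ext_of_pow p ho']

/-- The orbit of a point of `A` cannot run into an orbit contained in `B`: the permutation has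
finite order, so going on from there would lead back to the point of `A`. -/
lemma isLeft_pow_stopTime_inl (a : A) : ((p ^ stopTime p (Sum.inl a)) (Sum.inl a)).isLeft = true := by
  rcases isStop_pow_stopTime p (Sum.inl a) with h | ⟨o, ho⟩
  · exact h
  · have hle : stopTime p (Sum.inl a) ≤ stopTime p (Sum.inl a) * orderOf p :=
      Nat.le_mul_of_pos_right _ (orderOf_pos p)
    have := o.isRight p (stopTime p (Sum.inl a) * orderOf p - stopTime p (Sum.inl a))
    rw [← ho, ← Equiv.Perm.mul_apply, ← pow_add, Nat.sub_add_cancel hle, mul_comm, pow_mul,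
      pow_orderOf_eq_one, one_pow] at this
    simp at this

lemma pow_stopTime_inl (a : A) :
    (p ^ stopTime p (Sum.inl a)) (Sum.inl a) = Sum.inl (firstReturn p a) := by
  rw [inl_firstReturn]
  congr 2
  apply le_antisymm
  · have := Nat.find_spec (exists_return p a)
    exact stopTime_le p this.1 (Or.inl this.2)
  · exact Nat.find_min' (exists_return p a) ⟨stopTime_pos p _, isLeft_pow_stopTime_inl p a⟩

/-- The point as a stop. -/
noncomputable def stopPoint : A ⊕ ClosedOrbit p → A ⊕ B := Sum.map id ClosedOrbit.out

lemma stopPoint_injective : Function.Injective (stopPoint p) := by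
  refine Function.Injective.sumMap Function.injective_id fun o o' h => ?_
  exact ClosedOrbit.ext_of_pow p (n := 0) (by rw [h]; rfl)

lemma exists_stopPoint {z : A ⊕ B} (h : IsStop p z) : ∃ y, stopPoint p y = z := by
  rcases h with h | ⟨o, ho⟩
  · obtain ⟨a, rfl⟩ := Sum.isLeft_iff.1 h
    exact ⟨Sum.inl a, rfl⟩
  · exact ⟨Sum.inr o, ho.symm⟩

/-- The first stop on an orbit. -/
noncomputable def nextStop (z : A ⊕ B) : A ⊕ ClosedOrbit p :=
  (exists_stopPoint p (isStop_pow_stopTime p z)).choose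

lemma stopPoint_nextStop (z : A ⊕ B) : stopPoint p (nextStop p z) = (p ^ stopTime p z) z :=
  (exists_stopPoint p (isStop_pow_stopTime p z)).choose_spec

lemma nextStop_eq {z : A ⊕ B} {y : A ⊕ ClosedOrbit p} (h : (p ^ stopTime p z) z = stopPoint p y) :
    nextStop p z = y :=
  stopPoint_injective p ((stopPoint_nextStop p z).trans h)

lemma nextStop_inl (a : A) : nextStop p (Sum.inl a) = Sum.inl (firstReturn p a) :=
  nextStop_eq p (pow_stopTime_inl p a)

lemma nextStop_inr_out (o : ClosedOrbit p) : nextStop p (Sum.inr o.out) = Sum.inr o :=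
  nextStop_eq p (pow_stopTime_inr_out p o)

lemma nextStop_of_apply_inl {z : A ⊕ B} {a : A} (h : p z = Sum.inl a) :
    nextStop p z = Sum.inl a := by
  refine nextStop_eq p ?_
  rw [stopTime_eq_one p (Or.inl (by rw [h]; rfl)), pow_one, h]
  rfl

/-- The next stop is constant along a strand. This includes the case in which `b` is the marked
point of a closed orbit, because a marked point is its own next stop after one full turn. -/
lemma nextStop_of_apply_inr {z : A ⊕ B} {b : B} (h : p z = Sum.inr b) :
    nextStop p z = nextStop p (Sum.inr b) := by
  by_cases hb : IsStop p (Sum.inr b)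
  · rcases hb with hb | ⟨o, ho⟩
    · simp at hb
    · rw [ho, nextStop_inr_out]
      refine nextStop_eq p ?_
      rw [stopTime_eq_one p (Or.inr ⟨o, h.trans ho⟩), pow_one, h, ho]
      rfl
  · refine nextStop_eq p ?_
    rw [stopPoint_nextStop, stopTime_apply p (by rwa [h]), pow_succ, Equiv.Perm.mul_apply, h]

end Orbits

/-! ### Semilinear maps of exterior algebras. -/

section ExtMap

variable {P : Type u} [CommRing P] {S : Type u} [CommRing S] {J I : Type} (φ : P →+* S)
  (g : J → I →₀ S)

/-- The semilinear map of exterior algebras that sends the generator `c` to `g c`. -/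
noncomputable def extMap : ExtAlg P J →+* ExtAlg S I :=
  letI : Algebra P (ExtAlg S I) := Algebra.compHom _ φ
  (ExteriorAlgebra.lift P (A := ExtAlg S I)
    ⟨Finsupp.linearCombination P fun c => ExteriorAlgebra.ι S (g c), fun v => by
      -- The image of a vector is again a vector, with coefficients moved along `φ`, and therefore
      -- has square zero.
      have key : ∃ w, Finsupp.linearCombination P (fun c => ExteriorAlgebra.ι S (g c)) v =
          ExteriorAlgebra.ι S w := by
        induction v using Finsupp.induction_linear with
        | zero => exact ⟨0, by simp⟩
        | add v v' h h' =>
          obtain ⟨w, hw⟩ := h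
          obtain ⟨w', hw'⟩ := h'
          exact ⟨w + w', by rw [map_add, hw, hw', map_add]⟩
        | single c r =>
          refine ⟨φ r • g c, ?_⟩
          rw [Finsupp.linearCombination_single, map_smul, Algebra.smul_def, Algebra.smul_def]
          rfl
      obtain ⟨w, hw⟩ := key
      rw [hw, ExteriorAlgebra.ι_sq_zero]⟩).toRingHom

lemma extMap_algebraMap (r : P) :
    extMap φ g (algebraMap P _ r) = algebraMap S (ExtAlg S I) (φ r) := by
  let _ : Algebra P (ExtAlg S I) := Algebra.compHom _ φ
  exact AlgHom.commutes (ExteriorAlgebra.lift P (A := ExtAlg S I) _) r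

lemma extMap_gen (c : J) : extMap φ g (gen P c) = ExteriorAlgebra.ι S (g c) := by
  let _ : Algebra P (ExtAlg S I) := Algebra.compHom _ φ
  refine (ExteriorAlgebra.lift_ι_apply P _ _ _).trans ?_
  rw [Finsupp.linearCombination_single, one_smul]

lemma extMap_smul (r : P) (ω : ExtAlg P J) : extMap φ g (r • ω) = φ r • extMap φ g ω := by
  rw [Algebra.smul_def, map_mul, extMap_algebraMap, ← Algebra.smul_def]

lemma extMap_gen_mul (c : J) (ω : ExtAlg P J) :
    extMap φ g (gen P c * ω) = ExteriorAlgebra.ι S (g c) * extMap φ g ω := by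
  rw [map_mul, extMap_gen]

/-- A substitution of generators is a chain map as soon as the two Koszul forms agree on the
generators. -/
lemma contr_extMap {x : I → S} {y : J → P} (h : ∀ c, koszulForm x (g c) = φ (y c))
    (ω : ExtAlg P J) :
    contr (koszulForm x) (extMap φ g ω) = extMap φ g (contr (koszulForm y) ω) := by
  induction ω using ext_gen_induction with
  | h0 r => rw [extMap_algebraMap, contr_algebraMap, contr_algebraMap, map_zero]
  | hadd a b ha hb => simp only [map_add, ha, hb]
  | hsmul r a ha => rw [extMap_smul, map_smul, map_smul, extMap_smul, ha]
  | hmul c a ha =>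
    rw [extMap_gen_mul, contr_ι_mul, contr_gen_mul, map_sub, extMap_smul, extMap_gen_mul, ha,
      koszulForm_single, h]

lemma extMap_mem {n : ℕ} {ω : ExtAlg P J} (h : ω ∈ ⋀[P]^n (J →₀ P)) :
    extMap φ g ω ∈ ⋀[S]^n (I →₀ S) := by
  induction n generalizing ω with
  | zero =>
    rw [ExteriorAlgebra.exteriorPower, pow_zero, Submodule.mem_one] at h ⊢
    obtain ⟨r, rfl⟩ := h
    exact ⟨φ r, (extMap_algebraMap φ g r).symm⟩
  | succ n ih =>
    rw [ExteriorAlgebra.exteriorPower, pow_succ'] at h ⊢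
    induction h using Submodule.mul_induction_on' with
    | mem_mul_mem a ha b hb =>
      obtain ⟨v, rfl⟩ := ha
      rw [map_mul]
      refine Submodule.mul_mem_mul ?_ (ih hb)
      induction v using Finsupp.induction_linear with
      | zero => simp
      | add v w h h' => rw [map_add, map_add]; exact Submodule.add_mem _ h h'
      | single c r =>
        rw [← mul_one r, ← smul_eq_mul, ← Finsupp.smul_single, map_smul, extMap_smul]
        refine Submodule.smul_mem _ _ ?_
        exact ⟨g c, (extMap_gen φ g c).symm⟩
    | add a _ b _ ha hb => rw [map_add]; exact Submodule.add_mem _ ha hb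

end ExtMap

end KhR

/-! ### Elimination of generators and variables. -/

namespace KhR

/-- The well-ordering serves only to produce a basis. Freeness is needed to transport regularity
from the ring to the exterior algebra. -/
instance free_extAlg (R : Type u) [CommRing R] (I : Type) : Module.Free R (ExtAlg R I) := by
  classical
  let : LinearOrder I := linearOrderOfSTO WellOrderingRel
  exact Module.Free.of_basis (Finsupp.basisSingleOne (R := R) (ι := I)).ExteriorAlgebra

section Elimination

variable {P : Type u} [CommRing P] {S : Type u} [CommRing S] {J I : Type}

/-- The basis vector of a generator that is retained, or zero. -/
noncomputable def retVec (R : Type u) [CommRing R] (ret : I → Option J) (c : I) : J →₀ R :=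
  (ret c).elim 0 fun j => Finsupp.single j 1

/-- The linear map that retains some of the generators. -/
noncomputable def retLin (R : Type u) [CommRing R] (ret : I → Option J) : (I →₀ R) →ₗ[R] (J →₀ R) :=
  Finsupp.linearCombination R (retVec R ret)

/-- The map of exterior algebras that retains some of the generators. -/
noncomputable def retExt (R : Type u) [CommRing R] (ret : I → Option J) :
    ExtAlg R I →ₗ[R] ExtAlg R J :=
  (ExteriorAlgebra.map (retLin R ret)).toLinearMap

variable {ret : I → Option J} {sec : J → I}

lemma retExt_algebraMap (r : S) : retExt S ret (algebraMap S _ r) = algebraMap S _ r :=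
  AlgHom.commutes _ r

lemma retExt_ι_mul (v : I →₀ S) (ω : ExtAlg S I) : retExt S ret (ExteriorAlgebra.ι S v * ω) =
    ExteriorAlgebra.ι S (retLin S ret v) * retExt S ret ω := by
  simp [retExt]

lemma retExt_gen_mul (c : I) (ω : ExtAlg S I) : retExt S ret (gen S c * ω) =
    ExteriorAlgebra.ι S (retVec S ret c) * retExt S ret ω := by
  rw [gen, retExt_ι_mul]
  simp [retLin]

lemma retExt_gen_mul_none {c : I} (h : ret c = none) (ω : ExtAlg S I) :
    retExt S ret (gen S c * ω) = 0 := by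
  rw [retExt_gen_mul, retVec, h]
  simp

/-- The generators that are retained give a quasi-isomorphism. -/
lemma isQuasi_retExt (hsec : ∀ j, ret (sec j) = some j) (hret : ∀ c j, ret c = some j → c = sec j)
    (x : I → S) :
    IsQuasi x (contr (koszulForm fun j => x (sec j))) (retExt S ret) {c | ret c ≠ none} ⊥ := by
  set D : ExtAlg S J →ₗ[S] ExtAlg S J := contr (koszulForm fun j => x (sec j)) with hDdef
  -- The inverse of `retExt` on the part supported on retained generators, so the base case is an
  -- isomorphism of complexes.
  set m : ExtAlg S J →+* ExtAlg S I :=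
    extMap (RingHom.id S) fun j => Finsupp.single (sec j) 1 with hm
  have hgen : ∀ j ω, m (gen S j * ω) = gen S (sec j) * m ω := fun j ω => extMap_gen_mul _ _ j ω
  have hchain : ∀ ω ∈ supp S {c | ret c ≠ none},
      D (retExt S ret ω) = retExt S ret (contr (koszulForm x) ω) := by
    intro ω h
    induction h using supp_induction with
    | h0 r => rw [retExt_algebraMap, contr_algebraMap, contr_algebraMap, map_zero]
    | hadd a b _ _ ha hb => simp only [map_add, ha, hb]
    | hsmul r a _ ha => simp only [map_smul, ha]
    | hmul c hc a _ ha =>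
      obtain ⟨j, hj⟩ := Option.ne_none_iff_exists'.1 hc
      obtain rfl := hret c j hj
      have h1 : ∀ a, retExt S ret (gen S (sec j) * a) = gen S j * retExt S ret a := fun a => by
        rw [retExt_gen_mul, retVec, hj]; rfl
      rw [h1, contr_gen_mul, contr_gen_mul, map_sub, map_smul, h1, ha, koszulForm_single,
        koszulForm_single]
  have hm_ret : ∀ ω ∈ supp S {c | ret c ≠ none}, m (retExt S ret ω) = ω := by
    intro ω h
    induction h using supp_induction with
    | h0 r => rw [retExt_algebraMap, extMap_algebraMap]; rfl
    | hadd a b _ _ ha hb => rw [map_add, map_add, ha, hb]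
    | hsmul r a _ ha => rw [map_smul, extMap_smul, ha]; rfl
    | hmul c hc a _ ha =>
      obtain ⟨j, hj⟩ := Option.ne_none_iff_exists'.1 hc
      obtain rfl := hret c j hj
      rw [retExt_gen_mul, retVec, hj]
      change m (gen S j * _) = _
      rw [hgen, ha]
  have hret_m : ∀ ω, retExt S ret (m ω) = ω := by
    intro ω
    induction ω using ext_gen_induction with
    | h0 r => rw [extMap_algebraMap, retExt_algebraMap]; rfl
    | hadd a b ha hb => rw [map_add, map_add, ha, hb]
    | hsmul r a ha => rw [extMap_smul, map_smul, ha]; rfl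
    | hmul c a ha => rw [hgen, retExt_gen_mul, ha, retVec, hsec]; rfl
  have hm_mem : ∀ ω, m ω ∈ supp S {c | ret c ≠ none} := by
    intro ω
    induction ω using ext_gen_induction with
    | h0 r => rw [extMap_algebraMap]; exact algebraMap_mem_supp _ _
    | hadd a b ha hb => rw [map_add]; exact Submodule.add_mem _ ha hb
    | hsmul r a ha => rw [extMap_smul]; exact Submodule.smul_mem _ _ ha
    | hmul c a ha =>
      rw [hgen]
      exact gen_mul_mem_supp (by simp [hsec]) ha
  have hm_chain : ∀ ω, contr (koszulForm x) (m ω) = m (D ω) := fun ω =>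
    contr_extMap _ _ (fun c => by simp [koszulForm]) ω
  refine ⟨fun ω h => ?_, fun ω h hd => ?_, fun g hg => ?_⟩
  · rw [hchain ω h, sub_self]; exact Submodule.zero_mem _
  · rintro ⟨g, hg⟩
    rw [Submodule.mem_bot, sub_eq_zero] at hg
    refine ⟨m g, hm_mem g, ?_⟩
    rw [hm_chain, ← hg, hm_ret ω h]
  · rw [Submodule.mem_bot] at hg
    refine ⟨m g, hm_mem g, ?_, 0, ?_⟩
    · rw [hm_chain, hg, map_zero]
    · rw [hret_m, map_zero, sub_self, sub_zero]; exact Submodule.zero_mem _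

/-- A cycle whose retained part is divisible by the eliminated elements is a boundary. -/
lemma exists_contr_eq_of_retExt_mem [Finite I] (hsec : ∀ j, ret (sec j) = some j)
    (hret : ∀ c j, ret c = some j → c = sec j) (x : I → S) (rank : I → ℕ)
    (hreg : ∀ c (Y : Set I), ret c = none → (∀ b ∈ Y, ret b = none) → c ∉ Y →
      (∀ b ∈ Y, rank b ≤ rank c) →
      ∀ r, x c * r ∈ Ideal.span (x '' Y) → r ∈ Ideal.span (x '' Y))
    (ω : ExtAlg S I) (hω : contr (koszulForm x) ω = 0)
    (h : retExt S ret ω ∈ famSub x (ExtAlg S J) {c | ret c = none}) :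
    ∃ ζ, contr (koszulForm x) ζ = ω := by
  classical
  have : Fintype I := Fintype.ofFinite I
  -- Starting from the retained generators, the eliminated ones are added one by one; on the other
  -- side their elements are killed. Each multiple of an eliminated generator is sent to zero by
  -- `retExt`.
  have hq := (isQuasi_retExt hsec hret x).finset (fun g => contr_contr _ g)
    (Finset.univ.filter fun c => ret c = none) rank (fun Y => ∀ b ∈ Y, ret b = none)
    (by simp) (by
      intro a Y ha hmax hC
      have hn := hC a (Finset.mem_insert_self _ _)
      refine ⟨fun b hb => hC b (Finset.mem_insert_of_mem hb), by simp [hn],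
        retExt_gen_mul_none hn, fun v hv => ?_⟩
      refine mem_smul_top_of_smul_mem (fun r hr => ?_) hv
      exact hreg a Y hn (fun b hb => hC b (Finset.mem_insert_of_mem hb)) ha hmax r hr)
  rw [show ((Finset.univ.filter fun c => ret c = none : Finset I) : Set I) = {c | ret c = none} by
    ext; simp, show {c | ret c ≠ none} ∪ {c | ret c = none} = Set.univ by
      ext c; simpa using ne_or_eq _ _] at hq
  obtain ⟨ζ, -, hζ⟩ := hq.inj ω (mem_supp_univ ω) hω ⟨0, by rwa [map_zero, sub_zero]⟩
  exact ⟨ζ, hζ⟩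

variable {φ : P →+* S} {ρ : S →+* P} {x : I → S} {y : J → P} {v : J → I →₀ S}

/-- The projection to the retained generators commutes with the differentials. -/
lemma contr_extMap_retVec (h2 : ∀ c, ρ (x c) = (ret c).elim 0 y) (ω : ExtAlg S I) :
    contr (koszulForm y) (extMap ρ (retVec P ret) ω) =
      extMap ρ (retVec P ret) (contr (koszulForm x) ω) := by
  refine contr_extMap _ _ (fun c => ?_) ω
  rw [h2, retVec]
  cases ret c <;> simp [koszulForm]

/-- The vector `v j` is the retained generator `j` up to eliminated ones, so forgetting those and
retracting the coefficients undoes the inclusion. -/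
lemma extMap_retVec_extMap (h3 : ∀ j, retLin S ret (v j) = Finsupp.single j 1)
    (h5 : ∀ p, ρ (φ p) = p) (ω : ExtAlg P J) :
    extMap ρ (retVec P ret) (extMap φ v ω) = ω := by
  have key : ∀ u : I →₀ S, extMap ρ (retVec P ret) (ExteriorAlgebra.ι S u) =
      extMap ρ (fun j => Finsupp.single j 1) (ExteriorAlgebra.ι S (retLin S ret u)) := by
    intro u
    induction u using Finsupp.induction_linear with
    | zero => simp
    | add u u' h h' => simp only [map_add, h, h']
    | single c r =>
      rw [← mul_one r, ← smul_eq_mul, ← Finsupp.smul_single]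
      simp only [map_smul, extMap_smul]
      congr 1
      refine (extMap_gen ρ (retVec P ret) c).trans ?_
      rw [retLin, Finsupp.linearCombination_single, one_smul, retVec, retVec]
      cases ret c with
      | none => simp
      | some j => exact (extMap_gen ρ (fun j => Finsupp.single j (1 : P)) j).symm
  induction ω using ext_gen_induction with
  | h0 r => rw [extMap_algebraMap, extMap_algebraMap, h5]
  | hadd a b ha hb => rw [map_add, map_add, ha, hb]
  | hsmul r a ha => rw [extMap_smul, extMap_smul, ha, h5]
  | hmul c a ha =>
    rw [extMap_gen_mul, map_mul, ha, key, h3]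
    congr 1
    exact extMap_gen ρ (fun j => Finsupp.single j (1 : P)) c

/-- Injectivity on homology comes from a chain map that is a left inverse; regularity plays no part.
-/
lemma exists_of_extMap_eq_contr (h2 : ∀ c, ρ (x c) = (ret c).elim 0 y)
    (h3 : ∀ j, retLin S ret (v j) = Finsupp.single j 1) (h5 : ∀ p, ρ (φ p) = p)
    (ω : ExtAlg P J) {ζ : ExtAlg S I} (h : extMap φ v ω = contr (koszulForm x) ζ) :
    ∃ ξ, ω = contr (koszulForm y) ξ :=
  ⟨extMap ρ (retVec P ret) ζ, by
    rw [contr_extMap_retVec h2, ← h, extMap_retVec_extMap h3 h5]⟩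

/-- Modulo the eliminated elements every coefficient in `S` comes from `P`. -/
lemma sub_extMap_mem (h4 : ∀ s, s - φ (ρ s) ∈ Ideal.span (x '' {c | ret c = none}))
    (g : ExtAlg S J) :
    g - extMap φ (fun j => Finsupp.single j 1) (extMap ρ (fun j => Finsupp.single j 1) g) ∈
      famSub x (ExtAlg S J) {c | ret c = none} := by
  have hs : ∀ (s : S) (g : ExtAlg S J), (s - φ (ρ s)) • g ∈
      famSub x (ExtAlg S J) {c | ret c = none} := fun s g =>
    Submodule.smul_mem_smul (h4 s) trivial
  induction g using ext_gen_induction with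
  | h0 r =>
    rw [extMap_algebraMap, extMap_algebraMap, ← map_sub, Algebra.algebraMap_eq_smul_one]
    exact hs r 1
  | hadd a b ha hb =>
    rw [map_add, map_add, add_sub_add_comm]
    exact Submodule.add_mem _ ha hb
  | hsmul r a ha =>
    rw [extMap_smul, extMap_smul]
    convert Submodule.add_mem _ (hs r a) (Submodule.smul_mem _ (φ (ρ r)) ha) using 1
    module
  | hmul c a ha =>
    rw [extMap_gen_mul]
    change _ - extMap _ _ (gen P c * _) ∈ _
    rw [extMap_gen_mul]
    change gen S c * a - gen S c * _ ∈ _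
    rw [← mul_sub]
    exact map_mem_famSub x _ (LinearMap.mulLeft S (gen S c)) ha

/-- Every cycle is homologous to one that comes from the ring with fewer variables. -/
theorem exists_sub_extMap_eq_contr [Finite I] (hsec : ∀ j, ret (sec j) = some j)
    (hret : ∀ c j, ret c = some j → c = sec j) (rank : I → ℕ)
    (hreg : ∀ c (Y : Set I), ret c = none → (∀ b ∈ Y, ret b = none) → c ∉ Y →
      (∀ b ∈ Y, rank b ≤ rank c) →
      ∀ r, x c * r ∈ Ideal.span (x '' Y) → r ∈ Ideal.span (x '' Y))
    (h1 : ∀ c, koszulForm x (v c) = φ (y c)) (h2 : ∀ c, ρ (x c) = (ret c).elim 0 y)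
    (h3 : ∀ j, retLin S ret (v j) = Finsupp.single j 1)
    (h4 : ∀ s, s - φ (ρ s) ∈ Ideal.span (x '' {c | ret c = none}))
    (ω : ExtAlg S I) (hω : contr (koszulForm x) ω = 0) :
    ∃ ξ : ExtAlg P J, contr (koszulForm y) ξ = 0 ∧
      ∃ ζ, ω - extMap φ v ξ = contr (koszulForm x) ζ := by
  have hd : contr (koszulForm y) (extMap ρ (retVec P ret) ω) = 0 := by
    rw [contr_extMap_retVec h2, hω, map_zero]
  refine ⟨extMap ρ (retVec P ret) ω, hd, ?_⟩
  have e1 : ∀ ω, extMap ρ (retVec P ret) ω =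
      extMap ρ (fun j => Finsupp.single j 1) (retExt S ret ω) := by
    intro ω
    induction ω using ext_gen_induction with
    | h0 r => rw [retExt_algebraMap, extMap_algebraMap, extMap_algebraMap]
    | hadd a b ha hb => simp only [map_add, ha, hb]
    | hsmul r a ha => rw [map_smul (retExt S ret), extMap_smul, extMap_smul, ha]
    | hmul c a ha =>
      rw [extMap_gen_mul, retExt_gen_mul, map_mul, ha]
      congr 1
      rw [retVec, retVec]
      cases ret c with
      | none => simp
      | some j => exact (extMap_gen ρ (fun j => Finsupp.single j (1 : P)) j).symm
  have e2 : ∀ ω, retExt S ret (extMap φ v ω) = extMap φ (fun j => Finsupp.single j 1) ω := by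
    intro ω
    induction ω using ext_gen_induction with
    | h0 r => rw [extMap_algebraMap, extMap_algebraMap, retExt_algebraMap]
    | hadd a b ha hb => simp only [map_add, ha, hb]
    | hsmul r a ha => rw [extMap_smul, extMap_smul, map_smul (retExt S ret), ha]
    | hmul c a ha => rw [extMap_gen_mul, extMap_gen_mul, retExt_ι_mul, h3, ha]
  -- The candidate is the projection of `ω`. Its difference from `ω` is a cycle whose retained part
  -- vanishes modulo the eliminated elements, hence a boundary.
  obtain ⟨ζ, hζ⟩ := exists_contr_eq_of_retExt_mem hsec hret x rank hreg
    (ω - extMap φ v (extMap ρ (retVec P ret) ω)) (by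
      rw [map_sub, hω, contr_extMap φ v h1, hd, map_zero, sub_zero]) (by
      rw [map_sub, e2, e1]
      exact sub_extMap_mem h4 _)
  exact ⟨ζ, hζ.symm⟩

end Elimination

end KhR

namespace KhR

namespace TangleDiagram

variable (k : Type u) [CommRing k] {b : Boundary} (T : TangleDiagram b) {s : T.Xing → Bool}
  {x : T.Xing}

lemma seq_fst_true (hs : s x = true) : T.seq k s (Gen.fst x) = T.ti k x - T.tl k x := by
  simp [seq, hs]

lemma seq_fst_false (hs : s x = false) :
    T.seq k s (Gen.fst x) = T.ti k x + T.tj k x - T.tk k x - T.tl k x := by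
  simp [seq, hs]

lemma seq_snd_true (hs : s x = true) : T.seq k s (Gen.snd x) = T.tj k x - T.tk k x := by
  simp [seq, hs]

lemma seq_snd_false (hs : s x = false) :
    T.seq k s (Gen.snd x) = T.ti k x * T.tj k x - T.tk k x * T.tl k x := by
  simp [seq, hs]

end TangleDiagram

/-! ### The strands of the pasted diagram in terms of edges and arcs. -/

namespace ClosedArcDiagram

open TangleDiagram

variable (k : Type u) [CommRing k] (η : ClosedArcDiagram) (T : ∀ j, TangleDiagram (η.bdry j))

/-- The edge that is followed from a state. -/
def edgeOf : (η.AllXing T × Bool) ⊕ η.Arc → Σ j, (T j).Tail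
  | Sum.inl (x, c) => ⟨(ofLex x).1, Sum.inl ((ofLex x).2, c)⟩
  | Sum.inr α => ⟨(η.arcEnd α).1, Sum.inr (η.arcEnd α).2⟩

/-- The variable at which a state is entered. -/
def arriveVar : (η.AllXing T × Bool) ⊕ η.Arc → Σ j, (T j).Var
  | Sum.inl (x, c) => ⟨(ofLex x).1, Var.head (Sum.inl ((ofLex x).2, c))⟩
  | Sum.inr α => ⟨α.1, Var.head (Sum.inr α.2)⟩

/-- The variable at which a state is left. -/
def departVar : (η.AllXing T × Bool) ⊕ η.Arc → Σ j, (T j).Var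
  | Sum.inl (x, c) => ⟨(ofLex x).1, Var.tail (Sum.inl ((ofLex x).2, c))⟩
  | Sum.inr α => ⟨α.1, Var.head (Sum.inr α.2)⟩

/-- The variable at the beginning of the edge that is followed from a state. -/
def tailVar (z : (η.AllXing T × Bool) ⊕ η.Arc) : Σ j, (T j).Var :=
  ⟨(η.edgeOf T z).1, Var.tail (η.edgeOf T z).2⟩

/-- The generator of the edge that is followed from a state. -/
def edgeGen (z : (η.AllXing T × Bool) ⊕ η.Arc) : η.AllGen T :=
  Sum.inl ⟨(η.edgeOf T z).1, Gen.edge (η.edgeOf T z).2⟩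

lemma follow_eq (z : (η.AllXing T × Bool) ⊕ η.Arc) : η.follow T z =
    η.regroup T (fun j => (η.bdry j).Out) ⟨(η.edgeOf T z).1, (T _).edge (η.edgeOf T z).2⟩ := by
  rcases z with ⟨x, c⟩ | α <;> rfl

lemma arriveVar_follow (z : (η.AllXing T × Bool) ⊕ η.Arc) : η.arriveVar T (η.follow T z) =
    ⟨(η.edgeOf T z).1, Var.head ((T _).edge (η.edgeOf T z).2)⟩ := by
  rw [follow_eq]
  rcases (T (η.edgeOf T z).1).edge (η.edgeOf T z).2 with ⟨x, c⟩ | p <;> rfl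

lemma allSeq_edgeGen (s : η.AllXing T → Bool) (z : (η.AllXing T × Bool) ⊕ η.Arc) :
    η.allSeq k T s (η.edgeGen T z) =
      MvPolynomial.X (η.tailVar T z) - MvPolynomial.X (η.arriveVar T (η.follow T z)) := by
  rw [arriveVar_follow]
  simp [allSeq, edgeGen, seq, tailVar]

lemma allSeq_arc (s : η.AllXing T → Bool) (α : η.Arc) : η.allSeq k T s (Sum.inr α) =
    MvPolynomial.X (η.arriveVar T (Sum.inr α)) - MvPolynomial.X (η.tailVar T (Sum.inr α)) := rfl

/-- The combination of generators for one step along a strand. -/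
noncomputable def stateVec (z : (η.AllXing T × Bool) ⊕ η.Arc) : η.AllGen T →₀ η.AllPoly k T :=
  Finsupp.single (η.edgeGen T z) 1 + z.elim (fun _ => 0) fun α => Finsupp.single (Sum.inr α) 1

/-- From an arc the step consists of the arc followed by the edge at its end, and the variable where
they meet cancels; from a crossing it is the edge alone. -/
lemma koszulForm_stateVec (s : η.AllXing T → Bool) (z : (η.AllXing T × Bool) ⊕ η.Arc) :
    koszulForm (η.allSeq k T s) (η.stateVec k T z) =
      MvPolynomial.X (η.departVar T z) - MvPolynomial.X (η.arriveVar T (η.follow T z)) := by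
  rw [stateVec, map_add, koszulForm_single, allSeq_edgeGen]
  rcases z with ⟨x, c⟩ | α
  · simp only [Sum.elim_inl, map_zero, add_zero]
    rfl
  · simp only [Sum.elim_inr, koszulForm_single, allSeq_arc]
    rw [add_comm, sub_add_sub_cancel]
    rfl

/-- The combination of generators for the part of a strand up to the next stop. -/
noncomputable def strandVec (z : (η.AllXing T × Bool) ⊕ η.Arc) : η.AllGen T →₀ η.AllPoly k T :=
  ∑ l ∈ Finset.range (stopTime (η.follow T) z), η.stateVec k T ((η.follow T ^ l) z)

lemma departVar_eq_arriveVar {z : (η.AllXing T × Bool) ⊕ η.Arc} (h : ¬ IsStop (η.follow T) z) :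
    η.departVar T z = η.arriveVar T z := by
  rcases z with a | α
  · exact (h (Or.inl rfl)).elim
  · rfl

/-- The sum telescopes because at a state which is not a stop the variable of arrival is the
variable of departure. -/
lemma koszulForm_strandVec (s : η.AllXing T → Bool) (z : (η.AllXing T × Bool) ⊕ η.Arc) :
    koszulForm (η.allSeq k T s) (η.strandVec k T z) = MvPolynomial.X (η.departVar T z) -
      MvPolynomial.X (η.arriveVar T ((η.follow T ^ stopTime (η.follow T) z) z)) := by
  have key : ∀ n, n + 1 ≤ stopTime (η.follow T) z → koszulForm (η.allSeq k T s)
      (∑ l ∈ Finset.range (n + 1), η.stateVec k T ((η.follow T ^ l) z)) =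
      MvPolynomial.X (η.departVar T z) -
        MvPolynomial.X (η.arriveVar T ((η.follow T ^ (n + 1)) z)) := by
    intro n
    induction n with
    | zero =>
      intro _
      rw [zero_add, Finset.sum_range_one, pow_zero, pow_one, Equiv.Perm.one_apply,
        koszulForm_stateVec]
    | succ n ih =>
      intro hn
      rw [Finset.sum_range_succ, map_add, ih (by omega), koszulForm_stateVec,
        η.departVar_eq_arriveVar T (not_isStop_of_lt _ (Nat.succ_pos n) (by omega)),
        sub_add_sub_cancel, ← Equiv.Perm.mul_apply, ← pow_succ']
  have hpos := stopTime_pos (η.follow T) z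
  obtain ⟨n, hn⟩ : ∃ n, stopTime (η.follow T) z = n + 1 := ⟨_, (Nat.sub_add_cancel hpos).symm⟩
  rw [strandVec, hn]
  exact key n hn.ge

open Classical in
/-- The generators of the pasted diagram among those of the tangles and arcs. -/
noncomputable def pasteRet : η.AllGen T → Option (η.paste T).Gen
  | Sum.inl ⟨j, Gen.edge (Sum.inl (x, c))⟩ => some (Gen.edge (Sum.inl (toLex ⟨j, x⟩, c)))
  | Sum.inl ⟨_, Gen.edge (Sum.inr _)⟩ => none
  | Sum.inl ⟨j, Gen.circ c⟩ => some (Gen.circ (Sum.inl ⟨j, c⟩))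
  | Sum.inl ⟨j, Gen.fst x⟩ => some (Gen.fst (toLex (⟨j, x⟩ : Σ j, (T j).Xing)))
  | Sum.inl ⟨j, Gen.snd x⟩ => some (Gen.snd (toLex (⟨j, x⟩ : Σ j, (T j).Xing)))
  -- An arc is retained only if it is the marked arc of a strand that closes up without crossings;
  -- it then stands for the circle.
  | Sum.inr α => if h : ∃ o : ClosedOrbit (η.follow T), o.out = α then
      some (Gen.circ (Sum.inr h.choose)) else none

/-- The inclusion of the generators of the pasted diagram. -/
noncomputable def pasteSec : (η.paste T).Gen → η.AllGen T
  | Gen.edge (Sum.inl (x, c)) =>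
      Sum.inl ⟨(ofLex (x : η.AllXing T)).1, Gen.edge (Sum.inl ((ofLex (x : η.AllXing T)).2, c))⟩
  | Gen.edge (Sum.inr p) => p.1.elim0
  | Gen.circ (Sum.inl c) => Sum.inl ⟨c.1, Gen.circ c.2⟩
  | Gen.circ (Sum.inr o) => Sum.inr (ClosedOrbit.out o)
  | Gen.fst x => Sum.inl ⟨(ofLex (x : η.AllXing T)).1, Gen.fst (ofLex (x : η.AllXing T)).2⟩
  | Gen.snd x => Sum.inl ⟨(ofLex (x : η.AllXing T)).1, Gen.snd (ofLex (x : η.AllXing T)).2⟩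

lemma pasteRet_inr_out (o : ClosedOrbit (η.follow T)) :
    η.pasteRet T (Sum.inr o.out) = some (Gen.circ (Sum.inr o)) := by
  have h : ∃ o' : ClosedOrbit (η.follow T), o'.out = o.out := ⟨o, rfl⟩
  have h' : h.choose = o :=
    ClosedOrbit.ext_of_pow (η.follow T) (n := 0) (by rw [h.choose_spec]; rfl)
  simp only [pasteRet]
  rw [dif_pos h, h']

lemma pasteRet_inr_of_not_isStop {α : η.Arc} (h : ¬ IsStop (η.follow T) (Sum.inr α)) :
    η.pasteRet T (Sum.inr α) = none := by
  simp only [pasteRet]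
  rw [dif_neg]
  rintro ⟨o, rfl⟩
  exact h (Or.inr ⟨o, rfl⟩)

lemma pasteRet_pasteSec (c : (η.paste T).Gen) : η.pasteRet T (η.pasteSec T c) = some c := by
  rcases c with (⟨x, c⟩ | p) | (c | o) | x | x
  · rfl
  · exact p.1.elim0
  · rfl
  · exact η.pasteRet_inr_out T o
  · rfl
  · rfl

lemma eq_pasteSec (c : η.AllGen T) (d : (η.paste T).Gen) (h : η.pasteRet T c = some d) :
    c = η.pasteSec T d := by
  rcases c with ⟨j, (⟨x, c⟩ | p) | c | x | x⟩ | α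
  · obtain rfl := Option.some.inj h; rfl
  · simp [pasteRet] at h
  · obtain rfl := Option.some.inj h; rfl
  · obtain rfl := Option.some.inj h; rfl
  · obtain rfl := Option.some.inj h; rfl
  · by_cases ho : ∃ o : ClosedOrbit (η.follow T), o.out = α
    · obtain ⟨o, rfl⟩ := ho
      rw [pasteRet_inr_out] at h
      obtain rfl := Option.some.inj h
      rfl
    · simp only [pasteRet] at h
      rw [dif_neg ho] at h
      simp at h

/-- The variable of the pasted diagram at a stop. -/
def endVar : (η.AllXing T × Bool) ⊕ ClosedOrbit (η.follow T) → (η.paste T).Var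
  | Sum.inl a => Var.head (Sum.inl a)
  | Sum.inr o => Var.circ (Sum.inr o)

/-- Each variable is identified with a variable of the pasted diagram. -/
noncomputable def retrVar : (Σ j, (T j).Var) → (η.paste T).Var
  | ⟨j, Var.tail (Sum.inl (x, c))⟩ => Var.tail (Sum.inl (toLex ⟨j, x⟩, c))
  | ⟨j, Var.tail (Sum.inr p)⟩ =>
      -- A flag at the boundary of a hole is sent to the variable at the next stop of its strand; a
      -- beginning of a strand is first traced back to the arc that ends there.
      η.endVar T (nextStop (η.follow T) (Sum.inr (η.arcEnd.symm ⟨j, p⟩)))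
  | ⟨j, Var.head (Sum.inl (x, c))⟩ => Var.head (Sum.inl (toLex ⟨j, x⟩, c))
  | ⟨j, Var.head (Sum.inr p)⟩ => η.endVar T (nextStop (η.follow T) (Sum.inr ⟨j, p⟩))
  | ⟨j, Var.circ c⟩ => Var.circ (Sum.inl ⟨j, c⟩)

lemma retrVar_pasteVar (v : (η.paste T).Var) : η.retrVar T (η.pasteVar T v) = v := by
  rcases v with (⟨x, c⟩ | p) | (⟨x, c⟩ | p) | (c | o)
  · rfl
  · exact p.1.elim0
  · rfl
  · exact p.1.elim0
  · rfl
  · change η.endVar T (nextStop (η.follow T) (Sum.inr o.out)) = _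
    rw [nextStop_inr_out]
    rfl

lemma retrVar_arriveVar_follow (z : (η.AllXing T × Bool) ⊕ η.Arc) :
    η.retrVar T (η.arriveVar T (η.follow T z)) = η.endVar T (nextStop (η.follow T) z) := by
  rcases h : η.follow T z with ⟨x, c⟩ | α
  · rw [nextStop_of_apply_inl _ h]; rfl
  · rw [nextStop_of_apply_inr _ h]; rfl

lemma retrVar_tailVar_inr (α : η.Arc) : η.retrVar T (η.tailVar T (Sum.inr α)) =
    η.endVar T (nextStop (η.follow T) (Sum.inr α)) := by
  change η.endVar T (nextStop (η.follow T) (Sum.inr (η.arcEnd.symm (η.arcEnd α)))) = _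
  rw [Equiv.symm_apply_apply]

/-- The retraction onto the polynomial ring of the pasted diagram. -/
noncomputable def pasteRetr : η.AllPoly k T →ₐ[k] (η.paste T).Poly k :=
  MvPolynomial.rename (η.retrVar T)

lemma pasteRetr_pasteHom (p : (η.paste T).Poly k) : η.pasteRetr k T (η.pasteHom k T p) = p := by
  rw [pasteRetr, pasteHom, MvPolynomial.rename_rename,
    show η.retrVar T ∘ η.pasteVar T = id from funext (η.retrVar_pasteVar T), MvPolynomial.rename_id]
  rfl

lemma exists_edgeGen (j : Fin η.holes) (p : (η.bdry j).In) :
    ∃ α, (Sum.inl ⟨j, Gen.edge (Sum.inr p)⟩ : η.AllGen T) = η.edgeGen T (Sum.inr α) := by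
  obtain ⟨α, hα⟩ := η.arcEnd.surjective ⟨j, p⟩
  refine ⟨α, ?_⟩
  change _ = (Sum.inl ⟨(η.arcEnd α).1, Gen.edge (Sum.inr (η.arcEnd α).2)⟩ : η.AllGen T)
  rw [hα]

/-- All variables met along a strand become the variable of its next stop. Hence the eliminated
elements vanish, an edge that leaves a crossing becomes the edge of the pasted diagram, and the
marked arc of a closed strand becomes `0`, the entry of a circle. -/
lemma pasteRetr_allSeq (s : η.AllXing T → Bool) (c : η.AllGen T) :
    η.pasteRetr k T (η.allSeq k T s c) = (η.pasteRet T c).elim 0 ((η.paste T).seq k s) := by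
  rcases c with ⟨j, (⟨x, c⟩ | p) | c | x | x⟩ | α
  · change η.pasteRetr k T (η.allSeq k T s (η.edgeGen T (Sum.inl (toLex ⟨j, x⟩, c)))) = _
    rw [allSeq_edgeGen, map_sub, pasteRetr, MvPolynomial.rename_X, MvPolynomial.rename_X,
      retrVar_arriveVar_follow, nextStop_inl]
    rfl
  · obtain ⟨α, hα⟩ := η.exists_edgeGen T j p
    rw [hα, allSeq_edgeGen, map_sub, pasteRetr, MvPolynomial.rename_X, MvPolynomial.rename_X,
      retrVar_arriveVar_follow, retrVar_tailVar_inr, sub_self, ← hα]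
    rfl
  · simp [allSeq, seq, pasteRet]
  · cases hs : s (toLex ⟨j, x⟩)
    · rw [allSeq_fst_false k hs]
      refine Eq.trans ?_ ((η.paste T).seq_fst_false k (x := toLex ⟨j, x⟩) hs).symm
      simp only [map_sub, map_add, pasteRetr, MvPolynomial.rename_X]
      rfl
    · rw [allSeq_fst_true k hs]
      refine Eq.trans ?_ ((η.paste T).seq_fst_true k (x := toLex ⟨j, x⟩) hs).symm
      simp only [map_sub, pasteRetr, MvPolynomial.rename_X]
      rfl
  · cases hs : s (toLex ⟨j, x⟩)
    · rw [allSeq_snd_false k hs]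
      refine Eq.trans ?_ ((η.paste T).seq_snd_false k (x := toLex ⟨j, x⟩) hs).symm
      simp only [map_sub, map_mul, pasteRetr, MvPolynomial.rename_X]
      rfl
    · rw [allSeq_snd_true k hs]
      refine Eq.trans ?_ ((η.paste T).seq_snd_true k (x := toLex ⟨j, x⟩) hs).symm
      simp only [map_sub, pasteRetr, MvPolynomial.rename_X]
      rfl
  · rw [allSeq_arc, map_sub, pasteRetr, MvPolynomial.rename_X, MvPolynomial.rename_X,
      retrVar_tailVar_inr]
    have : η.retrVar T (η.arriveVar T (Sum.inr α)) =
        η.endVar T (nextStop (η.follow T) (Sum.inr α)) := rfl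
    rw [this, sub_self]
    simp only [pasteRet]
    split_ifs <;> rfl

/-- The generators of the Koszul complex of the pasted diagram as combinations of generators of the
tangles and arcs. -/
noncomputable def pasteVec : (η.paste T).Gen → η.AllGen T →₀ η.AllPoly k T
  | Gen.edge (Sum.inl a) => η.strandVec k T (Sum.inl a)
  | Gen.edge (Sum.inr p) => p.1.elim0
  | Gen.circ (Sum.inl c) => Finsupp.single (η.pasteSec T (Gen.circ (Sum.inl c))) 1
  | Gen.circ (Sum.inr o) => η.strandVec k T (Sum.inr (ClosedOrbit.out o))
  | Gen.fst x => Finsupp.single (η.pasteSec T (Gen.fst x)) 1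
  | Gen.snd x => Finsupp.single (η.pasteSec T (Gen.snd x)) 1

/-- For an edge the telescoped sum is the difference of the variables at its two ends; for a closed
strand the walk returns to its marked arc and the sum is `0`. -/
lemma koszulForm_pasteVec (s : η.AllXing T → Bool) (c : (η.paste T).Gen) :
    koszulForm (η.allSeq k T s) (η.pasteVec k T c) = η.pasteHom k T ((η.paste T).seq k s c) := by
  rcases c with (a | p) | (c | o) | x | x
  · have key : ∀ a : η.AllXing T × Bool, koszulForm (η.allSeq k T s)
        (η.strandVec k T (Sum.inl a)) = MvPolynomial.X (η.departVar T (Sum.inl a)) -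
          MvPolynomial.X (η.arriveVar T (Sum.inl (firstReturn (η.follow T) a))) := fun a => by
      rw [koszulForm_strandVec, pow_stopTime_inl]
    refine (key a).trans ?_
    simp only [seq, map_sub, pasteHom, MvPolynomial.rename_X]
    rfl
  · exact p.1.elim0
  · simp [pasteVec, pasteSec, koszulForm_single, allSeq, seq]
  · simp only [pasteVec]
    rw [koszulForm_strandVec, pow_stopTime_inr_out]
    simp only [seq, map_zero]
    exact sub_self _
  · simp only [pasteVec, koszulForm_single, pasteSec]
    cases hs : s x
    · rw [(η.paste T).seq_fst_false k hs]
      refine (allSeq_fst_false k hs).trans ?_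
      simp only [ti, tj, tk, tl, map_sub, map_add, pasteHom, MvPolynomial.rename_X]
      rfl
    · rw [(η.paste T).seq_fst_true k hs]
      refine (allSeq_fst_true k hs).trans ?_
      simp only [ti, tl, map_sub, pasteHom, MvPolynomial.rename_X]
      rfl
  · simp only [pasteVec, koszulForm_single, pasteSec]
    cases hs : s x
    · rw [(η.paste T).seq_snd_false k hs]
      refine (allSeq_snd_false k hs).trans ?_
      simp only [ti, tj, tk, tl, map_sub, map_mul, pasteHom, MvPolynomial.rename_X]
      rfl
    · rw [(η.paste T).seq_snd_true k hs]
      refine (allSeq_snd_true k hs).trans ?_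
      simp only [tj, tk, map_sub, pasteHom, MvPolynomial.rename_X]
      rfl

lemma retLin_single (c : η.AllGen T) : retLin (η.AllPoly k T) (η.pasteRet T) (Finsupp.single c 1) =
    retVec (η.AllPoly k T) (η.pasteRet T) c := by
  simp [retLin]

lemma retLin_stateVec_of_not_isStop {z : (η.AllXing T × Bool) ⊕ η.Arc}
    (h : ¬ IsStop (η.follow T) z) :
    retLin (η.AllPoly k T) (η.pasteRet T) (η.stateVec k T z) = 0 := by
  rcases z with a | α
  · exact (h (Or.inl rfl)).elim
  · simp only [stateVec, Sum.elim_inr]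
    rw [map_add, retLin_single, retLin_single, retVec, retVec, pasteRet_inr_of_not_isStop η T h]
    exact add_zero _

/-- After the first state no stop is met, so all later generators of the strand are eliminated ones.
-/
lemma retLin_strandVec (z : (η.AllXing T × Bool) ⊕ η.Arc) :
    retLin (η.AllPoly k T) (η.pasteRet T) (η.strandVec k T z) =
      retLin (η.AllPoly k T) (η.pasteRet T) (η.stateVec k T z) := by
  have hpos := stopTime_pos (η.follow T) z
  obtain ⟨n, hn⟩ : ∃ n, stopTime (η.follow T) z = n + 1 := ⟨_, (Nat.sub_add_cancel hpos).symm⟩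
  rw [strandVec, hn, Finset.sum_range_succ', map_add, map_sum, Finset.sum_eq_zero, zero_add]
  · rfl
  · intro l hl
    rw [Finset.mem_range] at hl
    exact η.retLin_stateVec_of_not_isStop k T (not_isStop_of_lt _ (Nat.succ_pos l) (by omega))

lemma retLin_pasteVec (c : (η.paste T).Gen) :
    retLin (η.AllPoly k T) (η.pasteRet T) (η.pasteVec k T c) = Finsupp.single c 1 := by
  have hsec : ∀ c, retLin (η.AllPoly k T) (η.pasteRet T) (Finsupp.single (η.pasteSec T c) 1) =
      Finsupp.single c 1 := fun c => by
    rw [retLin_single, retVec, pasteRet_pasteSec]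
    rfl
  rcases c with (a | p) | (c | o) | x | x
  · have key : ∀ a : η.AllXing T × Bool, retLin (η.AllPoly k T) (η.pasteRet T)
        (η.strandVec k T (Sum.inl a)) = retLin (η.AllPoly k T) (η.pasteRet T)
          (Finsupp.single (η.edgeGen T (Sum.inl a)) 1) := fun a => by
      rw [retLin_strandVec, stateVec, Sum.elim_inl, add_zero]
    exact (key a).trans (hsec (Gen.edge (Sum.inl a)))
  · exact p.1.elim0
  · exact hsec _
  · simp only [pasteVec]
    rw [retLin_strandVec, stateVec, Sum.elim_inr, map_add, retLin_single, retLin_single, retVec,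
      retVec, pasteRet_inr_out]
    exact zero_add _
  · exact hsec _
  · exact hsec _

end ClosedArcDiagram

end KhR

/-! ### Elimination of the variables along the strands. -/

namespace KhR

namespace ClosedArcDiagram

open TangleDiagram

variable (k : Type u) [CommRing k] (η : ClosedArcDiagram) (T : ∀ j, TangleDiagram (η.bdry j))

lemma eq_of_pasteRet_eq_none (c : η.AllGen T) (h : η.pasteRet T c = none) :
    (∃ α, c = η.edgeGen T (Sum.inr α)) ∨
      ∃ α, c = Sum.inr α ∧ ¬ IsStop (η.follow T) (Sum.inr α) := by
  rcases c with ⟨j, (⟨x, c⟩ | p) | c | x | x⟩ | α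
  · simp [pasteRet] at h
  · exact Or.inl (η.exists_edgeGen T j p)
  · simp [pasteRet] at h
  · simp [pasteRet] at h
  · simp [pasteRet] at h
  · refine Or.inr ⟨α, rfl, ?_⟩
    rintro (h' | ⟨o, ho⟩)
    · simp at h'
    · rw [Sum.inr.inj ho, pasteRet_inr_out] at h
      simp at h

lemma pasteRet_edgeGen_inr (α : η.Arc) : η.pasteRet T (η.edgeGen T (Sum.inr α)) = none := rfl

/-- Every variable is congruent to the variable of the pasted diagram with which it is identified. -/
lemma X_arriveVar_sub_mem (s : η.AllXing T → Bool) (z : (η.AllXing T × Bool) ⊕ η.Arc) :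
    (MvPolynomial.X (η.arriveVar T z) -
      MvPolynomial.X (η.pasteVar T (η.retrVar T (η.arriveVar T z))) : η.AllPoly k T) ∈
      Ideal.span (η.allSeq k T s '' {c | η.pasteRet T c = none}) := by
  -- Induction on the time to the next stop. A stop has the pasted variable itself; otherwise the
  -- arc and the edge after it, both eliminated, relate the variable to that of the next state.
  induction hn : stopTime (η.follow T) z using Nat.strong_induction_on generalizing z with
  | _ n ih =>
    by_cases hz : IsStop (η.follow T) z
    · have : η.pasteVar T (η.retrVar T (η.arriveVar T z)) = η.arriveVar T z := by
        rcases hz with hz | ⟨o, rfl⟩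
        · obtain ⟨⟨x, c⟩, rfl⟩ := Sum.isLeft_iff.1 hz
          rfl
        · change η.pasteVar T (η.endVar T (nextStop (η.follow T) (Sum.inr o.out))) = _
          rw [nextStop_inr_out]
          rfl
      rw [this, sub_self]
      exact Ideal.zero_mem _
    · rcases z with a | α
      · exact (hz (Or.inl rfl)).elim
      · have h1 : η.allSeq k T s (Sum.inr α) ∈
            Ideal.span (η.allSeq k T s '' {c | η.pasteRet T c = none}) :=
          Ideal.subset_span ⟨_, η.pasteRet_inr_of_not_isStop T hz, rfl⟩
        have h2 : η.allSeq k T s (η.edgeGen T (Sum.inr α)) ∈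
            Ideal.span (η.allSeq k T s '' {c | η.pasteRet T c = none}) :=
          Ideal.subset_span ⟨_, η.pasteRet_edgeGen_inr T α, rfl⟩
        have h3 : (MvPolynomial.X (η.arriveVar T (η.follow T (Sum.inr α))) - MvPolynomial.X
            (η.pasteVar T (η.retrVar T (η.arriveVar T (Sum.inr α)))) : η.AllPoly k T) ∈
            Ideal.span (η.allSeq k T s '' {c | η.pasteRet T c = none}) := by
          have h4 : η.retrVar T (η.arriveVar T (Sum.inr α)) =
              η.retrVar T (η.arriveVar T (η.follow T (Sum.inr α))) := by
            rw [retrVar_arriveVar_follow]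
            rfl
          rw [h4]
          by_cases hf : IsStop (η.follow T) (η.follow T (Sum.inr α))
          · have : η.pasteVar T (η.retrVar T (η.arriveVar T (η.follow T (Sum.inr α)))) =
                η.arriveVar T (η.follow T (Sum.inr α)) := by
              rcases hf with hf | ⟨o, ho⟩
              · obtain ⟨⟨x, c⟩, hf⟩ := Sum.isLeft_iff.1 hf
                rw [hf]
                rfl
              · rw [ho]
                change η.pasteVar T (η.endVar T (nextStop (η.follow T) (Sum.inr o.out))) = _
                rw [nextStop_inr_out]
                rfl
            rw [this, sub_self]
            exact Ideal.zero_mem _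
          · refine ih _ ?_ _ rfl
            rw [← hn, stopTime_apply _ hf]
            exact Nat.lt_succ_self _
        rw [allSeq_arc] at h1
        rw [allSeq_edgeGen] at h2
        have := Ideal.add_mem _ (Ideal.add_mem _ h1 h2) h3
        rwa [sub_add_sub_cancel, sub_add_sub_cancel] at this

lemma X_sub_X_pasteVar_mem (s : η.AllXing T → Bool) (v : Σ j, (T j).Var) :
    (MvPolynomial.X v - MvPolynomial.X (η.pasteVar T (η.retrVar T v)) : η.AllPoly k T) ∈
      Ideal.span (η.allSeq k T s '' {c | η.pasteRet T c = none}) := by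
  have h0 : ∀ v : Σ j, (T j).Var, η.pasteVar T (η.retrVar T v) = v →
      (MvPolynomial.X v - MvPolynomial.X (η.pasteVar T (η.retrVar T v)) : η.AllPoly k T) ∈
      Ideal.span (η.allSeq k T s '' {c | η.pasteRet T c = none}) := fun v hv => by
    rw [hv, sub_self]
    exact Ideal.zero_mem _
  obtain ⟨j, (⟨x, c⟩ | p) | (⟨x, c⟩ | p) | c⟩ := v
  · exact h0 _ rfl
  · obtain ⟨α, hα⟩ : ∃ α, (⟨j, Var.tail (Sum.inr p)⟩ : Σ j, (T j).Var) =
        η.tailVar T (Sum.inr α) := by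
      obtain ⟨α, hα⟩ := η.arcEnd.surjective ⟨j, p⟩
      refine ⟨α, ?_⟩
      change _ = (⟨(η.arcEnd α).1, Var.tail (Sum.inr (η.arcEnd α).2)⟩ : Σ j, (T j).Var)
      rw [hα]
    rw [hα]
    have h1 : η.allSeq k T s (η.edgeGen T (Sum.inr α)) ∈
        Ideal.span (η.allSeq k T s '' {c | η.pasteRet T c = none}) :=
      Ideal.subset_span ⟨_, η.pasteRet_edgeGen_inr T α, rfl⟩
    have h2 := η.X_arriveVar_sub_mem k T s (η.follow T (Sum.inr α))
    rw [retrVar_arriveVar_follow, ← retrVar_tailVar_inr] at h2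
    rw [allSeq_edgeGen] at h1
    have := Ideal.add_mem _ h1 h2
    rwa [sub_add_sub_cancel] at this
  · exact h0 _ rfl
  · exact η.X_arriveVar_sub_mem k T s (Sum.inr ⟨j, p⟩)
  · exact h0 _ rfl

lemma sub_pasteHom_mem (s : η.AllXing T → Bool) (p : η.AllPoly k T) :
    p - η.pasteHom k T (η.pasteRetr k T p) ∈
      Ideal.span (η.allSeq k T s '' {c | η.pasteRet T c = none}) := by
  induction p using MvPolynomial.induction_on with
  | C r => simp [pasteHom, pasteRetr]
  | add p q hp hq =>
    rw [map_add, map_add, add_sub_add_comm]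
    exact Ideal.add_mem _ hp hq
  | mul_X p v hp =>
    have hv := η.X_sub_X_pasteVar_mem k T s v
    rw [map_mul, map_mul]
    have e : η.pasteHom k T (η.pasteRetr k T (MvPolynomial.X v)) =
        MvPolynomial.X (η.pasteVar T (η.retrVar T v)) := by
      rw [pasteRetr, pasteHom, MvPolynomial.rename_X, MvPolynomial.rename_X]
    rw [e]
    convert Ideal.add_mem _ (Ideal.mul_mem_left _ p hv) (Ideal.mul_mem_right
      (MvPolynomial.X (η.pasteVar T (η.retrVar T v))) _ hp) using 1
    ring

/-- The order in which generators are eliminated. -/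
noncomputable def elimRank : η.AllGen T → ℕ
  -- Strands are eliminated backwards from their stops: the closer to the next stop the earlier, and
  -- the edge that follows an arc just before that arc.
  | Sum.inl ⟨j, Gen.edge (Sum.inr p)⟩ =>
      2 * stopTime (η.follow T) (Sum.inr (η.arcEnd.symm ⟨j, p⟩))
  | Sum.inl _ => 0
  | Sum.inr α => 2 * stopTime (η.follow T) (Sum.inr α) + 1

lemma elimRank_edgeGen (α : η.Arc) : η.elimRank T (η.edgeGen T (Sum.inr α)) =
    2 * stopTime (η.follow T) (Sum.inr α) := by
  change 2 * stopTime (η.follow T) (Sum.inr (η.arcEnd.symm (η.arcEnd α))) = _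
  rw [Equiv.symm_apply_apply]

lemma tailVar_inr_injective {α β : η.Arc}
    (h : η.tailVar T (Sum.inr α) = η.tailVar T (Sum.inr β)) : α = β := by
  apply η.arcEnd.injective
  change (⟨(η.arcEnd α).1, Var.tail (Sum.inr (η.arcEnd α).2)⟩ : Σ j, (T j).Var) =
    ⟨(η.arcEnd β).1, Var.tail (Sum.inr (η.arcEnd β).2)⟩ at h
  revert h
  generalize η.arcEnd α = a
  generalize η.arcEnd β = b
  obtain ⟨i, p⟩ := a
  obtain ⟨j, q⟩ := b
  intro h
  rw [Sigma.mk.injEq] at h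
  obtain ⟨rfl, h⟩ := h
  simp only [heq_eq_eq, Var.tail.injEq, Sum.inr.injEq] at h
  rw [h]

/-- Besides the arc itself, only the edge that leads to it can involve this variable, since distinct
states have distinct arrival variables of this kind. -/
lemma arriveVar_inr {z : (η.AllXing T × Bool) ⊕ η.Arc} {α : η.Arc}
    (h : η.arriveVar T z = η.arriveVar T (Sum.inr α)) : z = Sum.inr α := by
  rcases z with ⟨x, c⟩ | ⟨i, p⟩
  · obtain ⟨j, q⟩ := α
    obtain ⟨i, x, rfl⟩ : ∃ i y, x = toLex (⟨i, y⟩ : Σ j, (T j).Xing) :=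
      ⟨(ofLex x).1, (ofLex x).2, rfl⟩
    change (⟨i, Var.head (Sum.inl (x, c))⟩ : Σ j, (T j).Var) = ⟨j, Var.head (Sum.inr q)⟩ at h
    rw [Sigma.mk.injEq] at h
    obtain ⟨rfl, h⟩ := h
    simp at h
  · obtain ⟨j, q⟩ := α
    change (⟨i, Var.head (Sum.inr p)⟩ : Σ j, (T j).Var) = ⟨j, Var.head (Sum.inr q)⟩ at h
    rw [Sigma.mk.injEq] at h
    obtain ⟨rfl, h⟩ := h
    simp only [heq_eq_eq, Var.head.injEq, Sum.inr.injEq] at h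
    rw [h]

lemma arriveVar_ne_tailVar (z : (η.AllXing T × Bool) ⊕ η.Arc) (α : η.Arc) :
    η.arriveVar T z ≠ η.tailVar T (Sum.inr α) := by
  have key : ∀ {i j : Fin η.holes} (a : (T i).Head) (b : (T j).Tail),
      (⟨i, Var.head a⟩ : Σ j, (T j).Var) ≠ ⟨j, Var.tail b⟩ := by
    intro i j a b h
    rw [Sigma.mk.injEq] at h
    obtain ⟨rfl, h⟩ := h
    simp at h
  rcases z with ⟨x, c⟩ | β
  · exact key _ _
  · exact key _ _

/-- The eliminated generators form a regular sequence. -/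
lemma mem_of_elim_mul_mem (s : η.AllXing T → Bool) (c : η.AllGen T) (Y : Set (η.AllGen T))
    (hc : η.pasteRet T c = none) (hY : ∀ b ∈ Y, η.pasteRet T b = none) (hcY : c ∉ Y)
    (hrank : ∀ b ∈ Y, η.elimRank T b ≤ η.elimRank T c) (p : η.AllPoly k T)
    (hp : η.allSeq k T s c * p ∈ Ideal.span (η.allSeq k T s '' Y)) :
    p ∈ Ideal.span (η.allSeq k T s '' Y) := by
  rcases η.eq_of_pasteRet_eq_none T c hc with ⟨α, rfl⟩ | ⟨α, rfl, hα⟩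
  -- The edge is linear in the variable at its beginning. The only other element with this variable
  -- is that of the arc leading to it, whose rank is larger by one.
  · refine mem_of_mul_mem_of_linear (η.tailVar T (Sum.inr α)) rfl ?_
      (X_mem_adjoin (η.arriveVar_ne_tailVar T (η.follow T (Sum.inr α)) α))
      (Or.inl (η.allSeq_edgeGen k T s _)) p hp
    rintro _ ⟨b, hb, rfl⟩
    rcases η.eq_of_pasteRet_eq_none T b (hY b hb) with ⟨β, rfl⟩ | ⟨β, rfl, hβ⟩
    · rw [allSeq_edgeGen]
      refine X_sub_X_mem_adjoin (fun h => hcY ?_) (η.arriveVar_ne_tailVar T _ α)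
      rwa [← η.tailVar_inr_injective T h]
    · rw [allSeq_arc]
      refine X_sub_X_mem_adjoin (η.arriveVar_ne_tailVar T _ α) (fun h => ?_)
      obtain rfl := η.tailVar_inr_injective T h
      have := hrank _ hb
      rw [elimRank_edgeGen] at this
      simp [elimRank] at this
  -- The arc is linear in the variable at its beginning. The only other element with this variable
  -- is that of the preceding edge; as `α` is not a stop, that edge is one step further from the
  -- next stop and has larger rank.
  · refine mem_of_mul_mem_of_linear (η.arriveVar T (Sum.inr α)) rfl ?_
      (X_mem_adjoin (η.arriveVar_ne_tailVar T (Sum.inr α) α).symm)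
      (Or.inl (η.allSeq_arc k T s _)) p hp
    rintro _ ⟨b, hb, rfl⟩
    rcases η.eq_of_pasteRet_eq_none T b (hY b hb) with ⟨β, rfl⟩ | ⟨β, rfl, hβ⟩
    · rw [allSeq_edgeGen]
      refine X_sub_X_mem_adjoin (η.arriveVar_ne_tailVar T _ β).symm (fun h => ?_)
      have h' := η.arriveVar_inr T h
      have := hrank _ hb
      rw [elimRank_edgeGen, stopTime_apply _ (by rwa [h']), h'] at this
      simp only [elimRank] at this
      omega
    · rw [allSeq_arc]
      refine X_sub_X_mem_adjoin (fun h => hcY ?_) (η.arriveVar_ne_tailVar T _ β).symm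
      rwa [← Sum.inr.inj (η.arriveVar_inr T h)]

/-- The inclusion of the Koszul complex of the pasted diagram. -/
noncomputable def pasteExt : ExtAlg ((η.paste T).Poly k) (η.paste T).Gen →+*
    ExtAlg (η.AllPoly k T) (η.AllGen T) :=
  extMap (η.pasteHom k T).toRingHom (η.pasteVec k T)

lemma contr_pasteExt (s : η.AllXing T → Bool)
    (ω : ExtAlg ((η.paste T).Poly k) (η.paste T).Gen) :
    contr (koszulForm (η.allSeq k T s)) (η.pasteExt k T ω) =
      η.pasteExt k T (contr (koszulForm ((η.paste T).seq k s)) ω) :=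
  contr_extMap _ _ (η.koszulForm_pasteVec k T s) ω

/-- The map from the Koszul complex of the pasted diagram to the Hochschild complex. -/
noncomputable def pasteToBar : ExtAlg ((η.paste T).Poly k) (η.paste T).Gen →+
    BarTot k (η.ArcPoly k) (η.AllPoly k T) :=
  (koszulToBar k (η.arcElt k T) (η.AllPoly k T)).toAddMonoidHom.comp
    (η.pasteExt k T).toAddMonoidHom

lemma pasteToBar_apply (ω : ExtAlg ((η.paste T).Poly k) (η.paste T).Gen) :
    η.pasteToBar k T ω = koszulToBar k (η.arcElt k T) (η.AllPoly k T) (η.pasteExt k T ω) := rfl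

lemma pasteToBar_smul (r : (η.paste T).Poly k)
    (ω : ExtAlg ((η.paste T).Poly k) (η.paste T).Gen) :
    η.pasteToBar k T (r • ω) = η.pasteHom k T r • η.pasteToBar k T ω := by
  rw [pasteToBar_apply, pasteToBar_apply, pasteExt, extMap_smul]
  exact map_smul (koszulToBar k (η.arcElt k T) (η.AllPoly k T)) _ _

variable {T} (hT : ∀ j, (T j).IsAcyclic) (s : η.AllXing T → Bool)

include hT

lemma barTotD_pasteToBar (ω : ExtAlg ((η.paste T).Poly k) (η.paste T).Gen) :
    barTotD k _ (η.leftAct k T) (η.rightAct k T) (η.pasteToBar k T ω) -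
      η.pasteToBar k T (contr (koszulForm ((η.paste T).seq k s)) ω) ∈
      famSub (η.allSeq k T s) (BarTot k (η.ArcPoly k) (η.AllPoly k T)) (Set.range Sum.inl) := by
  rw [pasteToBar_apply, pasteToBar_apply, ← contr_pasteExt]
  exact (η.isQuasi_all k T hT s).chain _ (mem_supp_univ _)

/-- Injectivity on homology: `isQuasi_all` gives a boundary over the large ring, and the retraction
turns it into one over the ring of the pasted diagram. -/
lemma exists_contr_eq_of_pasteToBar (ω : ExtAlg ((η.paste T).Poly k) (η.paste T).Gen)
    (hω : contr (koszulForm ((η.paste T).seq k s)) ω = 0)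
    (h : ∃ g, η.pasteToBar k T ω - barTotD k _ (η.leftAct k T) (η.rightAct k T) g ∈
      famSub (η.allSeq k T s) (BarTot k (η.ArcPoly k) (η.AllPoly k T)) (Set.range Sum.inl)) :
    ∃ ξ, contr (koszulForm ((η.paste T).seq k s)) ξ = ω := by
  obtain ⟨ζ, -, hζ⟩ := (η.isQuasi_all k T hT s).inj (η.pasteExt k T ω) (mem_supp_univ _)
    (by rw [contr_pasteExt, hω, map_zero]) h
  obtain ⟨ξ, hξ⟩ := exists_of_extMap_eq_contr (ρ := (η.pasteRetr k T).toRingHom)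
    (ret := η.pasteRet T) (y := (η.paste T).seq k s) (η.pasteRetr_allSeq k T s)
    (η.retLin_pasteVec k T) (η.pasteRetr_pasteHom k T) ω hζ.symm
  exact ⟨ξ, hξ.symm⟩

lemma exists_sub_pasteToBar_mem (g : BarTot k (η.ArcPoly k) (η.AllPoly k T))
    (hg : barTotD k _ (η.leftAct k T) (η.rightAct k T) g ∈
      famSub (η.allSeq k T s) (BarTot k (η.ArcPoly k) (η.AllPoly k T)) (Set.range Sum.inl)) :
    ∃ ω, contr (koszulForm ((η.paste T).seq k s)) ω = 0 ∧ ∃ g',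
      g - η.pasteToBar k T ω - barTotD k _ (η.leftAct k T) (η.rightAct k T) g' ∈
      famSub (η.allSeq k T s) (BarTot k (η.ArcPoly k) (η.AllPoly k T)) (Set.range Sum.inl) := by
  obtain ⟨ω, -, hω, g', hg'⟩ := (η.isQuasi_all k T hT s).surj g hg
  obtain ⟨ξ, hξ, ζ, hζ⟩ := exists_sub_extMap_eq_contr (φ := (η.pasteHom k T).toRingHom)
    (ρ := (η.pasteRetr k T).toRingHom) (ret := η.pasteRet T) (y := (η.paste T).seq k s)
    (η.pasteRet_pasteSec T) (η.eq_pasteSec T) (η.elimRank T) (η.mem_of_elim_mul_mem k T s)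
    (η.koszulForm_pasteVec k T s) (η.pasteRetr_allSeq k T s)
    (η.retLin_pasteVec k T) (η.sub_pasteHom_mem k T s) ω hω
  -- Replacing the cycle over the large ring by one from the pasted diagram costs the Koszul
  -- boundary of `ζ`, whose image is the Hochschild boundary of the image of `ζ` modulo the tangle
  -- sequences.
  refine ⟨ξ, hξ, g' + koszulToBar k (η.arcElt k T) (η.AllPoly k T) ζ, ?_⟩
  have h1 := (η.isQuasi_all k T hT s).chain ζ (mem_supp_univ _)
  rw [← hζ, map_sub] at h1
  convert Submodule.sub_mem _ hg' h1 using 1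
  rw [map_add, pasteToBar_apply]
  simp only [pasteExt]
  abel

end ClosedArcDiagram

end KhR

/-! ### Passing from the ring to the naive terms as coefficients. -/

namespace KhR

section BarTotMap

variable (k : Type u) [CommRing k] (U : Type u) [CommRing U] [Algebra k U]
  {R : Type u} [CommRing R] [Algebra k R]
  {M : Type u} [AddCommGroup M] [Module k M] [Module R M] [IsScalarTower k R M]
  {N : Type u} [AddCommGroup N] [Module k N] [Module R N] [IsScalarTower k R N]

/-- The map of Hochschild complexes induced by a map of bimodules, on all terms. -/
noncomputable def barTotMap (f : M →ₗ[R] N) : BarTot k U M →ₗ[R] BarTot k U N :=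
  DirectSum.toModule R ℕ _ fun n => DirectSum.lof R ℕ (fun n => N ⊗[k] ⨂[k]^n U) n ∘ₗ
    TensorProduct.AlgebraTensorModule.map f LinearMap.id

variable {U}

lemma barTotMap_lof (f : M →ₗ[R] N) (n : ℕ) (z : M ⊗[k] ⨂[k]^n U) :
    barTotMap k U f (DirectSum.lof R ℕ (fun n => M ⊗[k] ⨂[k]^n U) n z) =
      DirectSum.lof R ℕ (fun n => N ⊗[k] ⨂[k]^n U) n
        (TensorProduct.AlgebraTensorModule.map f LinearMap.id z) := by
  rw [barTotMap, DirectSum.toModule_lof]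
  rfl

lemma barTotMap_apply (f : M →ₗ[R] N) (z : BarTot k U M) (n : ℕ) :
    barTotMap k U f z n = TensorProduct.AlgebraTensorModule.map f LinearMap.id (z n) := by
  induction z using barTot_induction with
  | h0 => simp
  | hadd a b ha hb =>
    rw [map_add, DirectSum.add_apply, ha, hb, DirectSum.add_apply, map_add]
  | h m z =>
    rw [← DirectSum.lof_eq_of R, barTotMap_lof, DirectSum.lof_eq_of, DirectSum.lof_eq_of]
    by_cases h : n = m
    · subst h
      rw [DirectSum.of_eq_same, DirectSum.of_eq_same]
    · rw [DirectSum.of_eq_of_ne _ _ _ h, DirectSum.of_eq_of_ne _ _ _ h, map_zero]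

lemma barD_map (lact ract : U →ₐ[k] R) (f : M →ₗ[R] N) (n : ℕ) (z : M ⊗[k] ⨂[k]^(n + 1) U) :
    barD k lact ract N n (TensorProduct.AlgebraTensorModule.map f LinearMap.id z) =
      TensorProduct.AlgebraTensorModule.map f LinearMap.id (barD k lact ract M n z) := by
  induction z using TensorProduct.induction_on with
  | zero => simp
  | add x y hx hy => simp only [map_add, hx, hy]
  | tmul m w =>
    induction w using PiTensorProduct.induction_on with
    | add x y hx hy => simp only [TensorProduct.tmul_add, map_add, hx, hy]
    | smul_tprod r u =>
      rw [TensorProduct.tmul_smul, TensorProduct.smul_tmul']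
      simp only [TensorProduct.AlgebraTensorModule.map_tmul, LinearMap.id_apply, barD_tmul',
        map_sum, map_zsmul, map_smul]

lemma barTotD_barTotMap (lact ract : U →ₐ[k] R) (f : M →ₗ[R] N) (z : BarTot k U M) :
    barTotD k N lact ract (barTotMap k U f z) = barTotMap k U f (barTotD k M lact ract z) := by
  refine DFinsupp.ext fun n => ?_
  change barTotD k N lact ract (barTotMap k U f z) n =
    barTotMap k U f (barTotD k M lact ract z) n
  rw [barTotD_apply, barTotMap_apply, barTotMap_apply, barTotD_apply, barD_map]

lemma barTotMap_surjective (f : M →ₗ[R] N) (hf : Function.Surjective f) :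
    Function.Surjective (barTotMap k U f) := by
  intro z
  induction z using barTot_induction with
  | h0 => exact ⟨0, map_zero _⟩
  | hadd a b ha hb =>
    obtain ⟨a', rfl⟩ := ha
    obtain ⟨b', rfl⟩ := hb
    exact ⟨a' + b', map_add _ _ _⟩
  | h n z =>
    obtain ⟨y, rfl⟩ := LinearMap.rTensor_surjective (⨂[k]^n U) (g := f.restrictScalars k) hf z
    exact ⟨DirectSum.lof R ℕ (fun n => M ⊗[k] ⨂[k]^n U) n y, barTotMap_lof k f n y⟩

/-- Right exactness of the tensor product: changing coefficients from `R` to `R / J` divides the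
Hochschild complex by `J` times itself. Statements modulo a submodule thus become statements about
the complex of the quotient. -/
lemma barTotMap_eq_zero_iff (f : R →ₗ[R] N) (hf : Function.Surjective f) (J : Ideal R)
    (hJ : ∀ r, f r = 0 ↔ r ∈ J) (z : BarTot k U R) :
    barTotMap k U f z = 0 ↔ z ∈ (J • ⊤ : Submodule R (BarTot k U R)) := by
  constructor
  · intro h
    classical
    have key : ∀ n (y : R ⊗[k] ⨂[k]^n U),
        TensorProduct.AlgebraTensorModule.map f LinearMap.id y = 0 →
        DirectSum.lof R ℕ (fun n => R ⊗[k] ⨂[k]^n U) n y ∈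
          (J • ⊤ : Submodule R (BarTot k U R)) := by
      intro n y hy
      have hex : Function.Exact ((J.subtype).restrictScalars k) (f.restrictScalars k) := by
        intro r
        constructor
        · intro hr
          exact ⟨⟨r, (hJ r).1 hr⟩, rfl⟩
        · rintro ⟨r, rfl⟩
          exact (hJ _).2 r.2
      obtain ⟨x, rfl⟩ := (rTensor_exact (⨂[k]^n U) hex hf y).1 hy
      induction x using TensorProduct.induction_on with
      | zero => simp
      | add a b ha hb =>
        have h1 : ∀ c, TensorProduct.AlgebraTensorModule.map f LinearMap.id
            (LinearMap.rTensor (⨂[k]^n U) ((J.subtype).restrictScalars k) c) = 0 :=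
          fun c => (rTensor_exact (⨂[k]^n U) hex hf _).2 ⟨c, rfl⟩
        rw [map_add, map_add]
        exact Submodule.add_mem _ (ha (h1 a)) (hb (h1 b))
      | tmul a w =>
        have : LinearMap.rTensor (⨂[k]^n U) ((J.subtype).restrictScalars k) (a ⊗ₜ w) =
            (a : R) • ((1 : R) ⊗ₜ[k] w) := by
          rw [TensorProduct.smul_tmul', smul_eq_mul, mul_one]
          rfl
        rw [this, map_smul]
        exact Submodule.smul_mem_smul a.2 trivial
    rw [← DirectSum.sum_support_of z]
    refine Submodule.sum_mem _ fun n _ => ?_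
    refine key n _ ?_
    rw [← barTotMap_apply, h]
    rfl
  · intro h
    induction h using Submodule.smul_induction_on' with
    | smul r hr n hn =>
      clear hn
      induction n using barTot_induction with
      | h0 => simp
      | hadd a b ha hb => rw [smul_add, map_add, ha, hb, add_zero]
      | h n y =>
        rw [← DirectSum.lof_eq_of R, ← map_smul, barTotMap_lof]
        induction y using TensorProduct.induction_on with
        | zero => simp
        | add a b ha hb => rw [smul_add, map_add, map_add, ha, hb, add_zero]
        | tmul a w =>
          rw [TensorProduct.smul_tmul', TensorProduct.AlgebraTensorModule.map_tmul,
            smul_eq_mul, (hJ _).2 (J.mul_mem_right a hr), TensorProduct.zero_tmul, map_zero]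
    | add x _ y _ hx hy => rw [map_add, hx, hy, add_zero]

end BarTotMap

/-- The homomorphism from a tensor product of commutative algebras given by homomorphisms on the
factors. -/
noncomputable def piTensorLift {k : Type u} [CommRing k] {ι : Type} [Fintype ι] {A : ι → Type u}
    [∀ j, CommRing (A j)] [∀ j, Algebra k (A j)] {B : Type u} [CommRing B] [Algebra k B]
    (f : ∀ j, A j →ₐ[k] B) : (⨂[k] j, A j) →ₐ[k] B :=
  PiTensorProduct.liftAlgHom
    ((MultilinearMap.mkPiAlgebra k ι B).compLinearMap fun j => (f j).toLinearMap)
    (by simp) (fun x y => by simp [Finset.prod_mul_distrib])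

lemma piTensorLift_tprod {k : Type u} [CommRing k] {ι : Type} [Fintype ι] {A : ι → Type u}
    [∀ j, CommRing (A j)] [∀ j, Algebra k (A j)] {B : Type u} [CommRing B] [Algebra k B]
    (f : ∀ j, A j →ₐ[k] B) (z : ∀ j, A j) :
    piTensorLift f (PiTensorProduct.tprod k z) = ∏ j, f j (z j) := by
  refine (PiTensorProduct.lift.tprod _).trans ?_
  simp

namespace ClosedArcDiagram

open TangleDiagram

variable (k : Type u) [CommRing k] (η : ClosedArcDiagram) (T : ∀ j, TangleDiagram (η.bdry j))
  (s : η.AllXing T → Bool)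

lemma actHom_rename (j : Fin η.holes) (p : (T j).Poly k) :
    η.actHom k T s (MvPolynomial.rename (Sigma.mk j) p) =
      η.single k T s j (Ideal.Quotient.mk _ p) := by
  have : (η.actHom k T s).comp (MvPolynomial.rename (Sigma.mk j)) =
      (η.single k T s j).comp (Ideal.Quotient.mkₐ k _) := by
    refine MvPolynomial.algHom_ext fun v => ?_
    simp [actHom]
  exact DFunLike.congr_fun this p

lemma pure_eq_prod (z : ∀ j, (T j).Naive k (part s j)) :
    pure k s z = ∏ j, η.single k T s j (z j) := by
  conv_lhs => rw [← Finset.univ_prod_mulSingle z]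
  exact PiTensorProduct.tprod_prod (R := k) (A := fun j => (T j).Naive k (part s j)) _ _

lemma actHom_surjective : Function.Surjective (η.actHom k T s) := by
  intro z
  induction z using η.pure_induction k T with
  | hadd x y hx hy =>
    obtain ⟨a, rfl⟩ := hx
    obtain ⟨b, rfl⟩ := hy
    exact ⟨a + b, map_add _ _ _⟩
  | h r z =>
    choose p hp using fun j => Ideal.Quotient.mk_surjective (z j)
    refine ⟨r • ∏ j, MvPolynomial.rename (Sigma.mk j) (p j), ?_⟩
    rw [map_smul, map_prod, pure_eq_prod]
    congr 1
    refine Finset.prod_congr rfl fun j _ => ?_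
    rw [actHom_rename, hp]

lemma rename_mem (j : Fin η.holes) {p : (T j).Poly k} (hp : p ∈ (T j).ideal k (part s j)) :
    MvPolynomial.rename (Sigma.mk j) p ∈ Ideal.span (η.allSeq k T s '' Set.range Sum.inl) := by
  induction hp using Submodule.span_induction with
  | zero => rw [map_zero]; exact Ideal.zero_mem _
  | add a b _ _ ha hb => rw [map_add]; exact Ideal.add_mem _ ha hb
  | smul r a _ ha => rw [smul_eq_mul, map_mul]; exact Ideal.mul_mem_left _ _ ha
  | mem a ha =>
    obtain ⟨c, rfl⟩ := ha
    exact Ideal.subset_span ⟨Sum.inl ⟨j, c⟩, ⟨_, rfl⟩, rfl⟩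

/-- The inclusion of the polynomial ring of one tangle. -/
noncomputable abbrev inclPoly (j : Fin η.holes) : (T j).Poly k →ₐ[k] η.AllPoly k T :=
  MvPolynomial.rename fun v => ⟨j, v⟩

/-- The map from one tensor factor to the quotient by all the sequences. -/
noncomputable def naiveToQuot (j : Fin η.holes) : (T j).Naive k (part s j) →ₐ[k]
    η.AllPoly k T ⧸ Ideal.span (η.allSeq k T s '' Set.range Sum.inl) :=
  Ideal.Quotient.liftₐ ((T j).ideal k (part s j))
    ((Ideal.Quotient.mkₐ k (Ideal.span (η.allSeq k T s '' Set.range Sum.inl))).comp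
      (η.inclPoly k T j))
    fun _ ha => (Ideal.Quotient.eq_zero_iff_mem (I := Ideal.span
      (η.allSeq k T s '' Set.range Sum.inl))).2 (η.rename_mem k T s j ha)

lemma naiveToQuot_mk (j : Fin η.holes) (p : (T j).Poly k) :
    η.naiveToQuot k T s j (Ideal.Quotient.mk _ p) =
      Ideal.Quotient.mk _ (η.inclPoly k T j p) := rfl

/-- The tensor product over `k` of the quotients of the polynomial rings of the tangles is the
quotient of the joint polynomial ring. The map `ψ` obtained from the universal property recovers the
class of `p` from its image. -/
lemma actHom_eq_zero_iff (p : η.AllPoly k T) :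
    η.actHom k T s p = 0 ↔ p ∈ Ideal.span (η.allSeq k T s '' Set.range Sum.inl) := by
  set 𝔞 := Ideal.span (η.allSeq k T s '' Set.range Sum.inl) with h𝔞
  constructor
  · intro h
    let ψ : η.NaiveTensor k T s →ₐ[k] η.AllPoly k T ⧸ 𝔞 := piTensorLift (η.naiveToQuot k T s)
    have hψ : ψ.comp (η.actHom k T s) = Ideal.Quotient.mkₐ k 𝔞 := by
      refine MvPolynomial.algHom_ext fun v => ?_
      rw [AlgHom.comp_apply, actHom_X]
      refine (piTensorLift_tprod (η.naiveToQuot k T s) _).trans ?_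
      rw [Finset.prod_eq_single v.1]
      · rw [Pi.mulSingle_eq_same, naiveToQuot_mk, inclPoly, MvPolynomial.rename_X]
        rfl
      · intro j _ hj
        rw [Pi.mulSingle_eq_of_ne hj]
        exact map_one (η.naiveToQuot k T s j)
      · simp
    have := DFunLike.congr_fun hψ p
    rw [AlgHom.comp_apply, h, map_zero] at this
    exact Ideal.Quotient.eq_zero_iff_mem.1 this.symm
  · intro h
    have hle : 𝔞 ≤ RingHom.ker (η.actHom k T s) := by
      rw [h𝔞, Ideal.span_le]
      rintro _ ⟨_, ⟨c, rfl⟩, rfl⟩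
      change η.actHom k T s (MvPolynomial.rename (Sigma.mk c.1) ((T c.1).seq k (part s c.1) c.2)) = 0
      rw [actHom_rename, Ideal.Quotient.eq_zero_iff_mem.2, map_zero]
      exact Ideal.subset_span ⟨c.2, rfl⟩
    exact hle h

/-- The projection onto the term of a smoothing. -/
noncomputable def naiveProj : η.AllPoly k T →ₗ[η.AllPoly k T] (η.naiveCube k T).obj s where
  toFun := η.actHom k T s
  map_add' := map_add _
  map_smul' r p := map_mul (η.actHom k T s) r p

end ClosedArcDiagram

end KhR

/-! ### Compatibility with the structure maps of the crossings. -/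

namespace KhR

section BarTotMap

variable (k : Type u) [CommRing k] {U : Type u} [CommRing U] [Algebra k U]
  {R : Type u} [CommRing R] [Algebra k R]
  {M : Type u} [AddCommGroup M] [Module k M] [Module R M] [IsScalarTower k R M]
  {N : Type u} [AddCommGroup N] [Module k N] [Module R N] [IsScalarTower k R N]
  {Q : Type u} [AddCommGroup Q] [Module k Q] [Module R Q] [IsScalarTower k R Q]

lemma barTotMap_comp (g : N →ₗ[R] Q) (f : M →ₗ[R] N) (z : BarTot k U M) :
    barTotMap k U (g ∘ₗ f) z = barTotMap k U g (barTotMap k U f z) := by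
  induction z using barTot_induction with
  | h0 => simp
  | hadd a b ha hb => simp only [map_add, ha, hb]
  | h n z =>
    rw [← DirectSum.lof_eq_of R, barTotMap_lof, barTotMap_lof, barTotMap_lof]
    congr 1
    induction z using TensorProduct.induction_on with
    | zero => simp
    | add a b ha hb => simp only [map_add, ha, hb]
    | tmul a w => rfl

lemma barTotMap_smul (c : R) (f : M →ₗ[R] N) (z : BarTot k U M) :
    barTotMap k U (c • f) z = c • barTotMap k U f z := by
  induction z using barTot_induction with
  | h0 => simp
  | hadd a b ha hb => simp only [map_add, ha, hb, smul_add]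
  | h n z =>
    rw [← DirectSum.lof_eq_of R, barTotMap_lof, barTotMap_lof, ← map_smul]
    congr 1
    induction z using TensorProduct.induction_on with
    | zero => simp
    | add a b ha hb => simp only [map_add, ha, hb, smul_add]
    | tmul a w => rfl

end BarTotMap

namespace ClosedArcDiagram

open TangleDiagram

variable (k : Type u) [CommRing k] (η : ClosedArcDiagram) (T : ∀ j, TangleDiagram (η.bdry j))

section Rho

variable {η T}

/-- The two generators of a crossing are generators of a tangle, and these are shuffled with zero.
-/
lemma pasteToBar_ι_mul_of_fst_snd (x : η.AllXing T) (r r' : (η.paste T).Poly k)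
    (ω : ExtAlg ((η.paste T).Poly k) (η.paste T).Gen) :
    η.pasteToBar k T (ExteriorAlgebra.ι _ (Finsupp.single (Gen.fst x) r +
      Finsupp.single (Gen.snd x) r') * ω) = 0 := by
  have h1 : ∀ c : (η.paste T).Gen, (∃ d, η.pasteVec k T c = Finsupp.single (Sum.inl d) 1) →
      ∀ r : (η.paste T).Poly k,
        η.pasteToBar k T (ExteriorAlgebra.ι _ (Finsupp.single c r) * ω) = 0 := by
    rintro c ⟨d, hd⟩ r
    have e : Finsupp.single c r = r • Finsupp.single c (1 : (η.paste T).Poly k) := by simp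
    rw [e, map_smul, smul_mul_assoc, pasteToBar_smul, pasteToBar_apply, pasteExt]
    change _ • koszulToBar k (η.arcElt k T) (η.AllPoly k T) (extMap _ _ (gen _ c * ω)) = _
    rw [extMap_gen_mul, hd]
    exact (congrArg _ (η.koszulToBar_gen_inl k T d _)).trans (smul_zero _)
  rw [map_add, add_mul, map_add, h1 _ ⟨_, rfl⟩, h1 _ ⟨_, rfl⟩, add_zero]

/-- A map of exterior algebras that only changes the generators of one crossing is not seen by the
Hochschild complex. -/
lemma pasteToBar_map (x : η.AllXing T)
    (f : ((η.paste T).Gen →₀ (η.paste T).Poly k) →ₗ[(η.paste T).Poly k]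
      ((η.paste T).Gen →₀ (η.paste T).Poly k))
    (h1 : ∃ r r', f (Finsupp.single (Gen.fst x) 1) = Finsupp.single (Gen.fst x) r +
      Finsupp.single (Gen.snd x) r')
    (h2 : ∃ r r', f (Finsupp.single (Gen.snd x) 1) = Finsupp.single (Gen.fst x) r +
      Finsupp.single (Gen.snd x) r')
    (h3 : ∀ c, c ≠ Gen.fst x → c ≠ Gen.snd x →
      f (Finsupp.single c 1) = Finsupp.single c 1)
    (ω : ExtAlg ((η.paste T).Poly k) (η.paste T).Gen) :
    η.pasteToBar k T (ExteriorAlgebra.map f ω) = η.pasteToBar k T ω := by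
  induction ω using ext_gen_induction with
  | h0 r => rw [AlgHom.commutes]
  | hadd a b ha hb => simp only [map_add, ha, hb]
  | hsmul r a ha => rw [map_smul, pasteToBar_smul, ha, pasteToBar_smul]
  | hmul c a ha =>
    rw [map_mul, gen, ExteriorAlgebra.map_apply_ι]
    by_cases hc1 : c = Gen.fst x
    · obtain ⟨r, r', h⟩ := h1
      have := pasteToBar_ι_mul_of_fst_snd k x 1 0 a
      rw [Finsupp.single_zero, add_zero] at this
      rw [hc1, h, pasteToBar_ι_mul_of_fst_snd]
      exact this.symm
    · by_cases hc2 : c = Gen.snd x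
      · obtain ⟨r, r', h⟩ := h2
        have := pasteToBar_ι_mul_of_fst_snd k x 0 1 a
        rw [Finsupp.single_zero, zero_add] at this
        rw [hc2, h, pasteToBar_ι_mul_of_fst_snd]
        exact this.symm
      · rw [h3 c hc1 hc2]
        change η.pasteToBar k T (gen _ c * _) = η.pasteToBar k T (gen _ c * _)
        rw [pasteToBar_apply, pasteToBar_apply, pasteExt, extMap_gen_mul, extMap_gen_mul,
          koszulToBar_ι_mul, koszulToBar_ι_mul]
        exact congrArg _ ha

/-- Both lifts preserve the span of the two generators of the crossing and fix all others, so only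
their effect away from these two survives. For a positive crossing that is the identity. For a
negative one it is the factor `ti - tk` in `negScale`, whose second summand is a multiple of a
crossing generator. -/
lemma pasteToBar_rho (x : η.AllXing T) (ω : ExtAlg ((η.paste T).Poly k) (η.paste T).Gen) :
    η.pasteToBar k T ((η.paste T).rho k x ω) =
      η.pasteHom k T ((η.paste T).naiveCoeff k x) • η.pasteToBar k T ω := by
  have hne : (Gen.fst x : (η.paste T).Gen) ≠ Gen.snd x := by simp
  unfold rho naiveCoeff
  split_ifs
  · rw [map_one, one_smul]
    refine pasteToBar_map k x _ ⟨1, 1, ?_⟩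
      ⟨(η.paste T).tj k x, (η.paste T).tl k x, ?_⟩ (fun c h1 h2 => ?_) ω
    · simp [posVec]
    · simp only [posVec, Finsupp.linearCombination_single, one_smul, if_neg hne.symm, if_true]
    · simp [posVec, h1, h2]
  · have hmap : ∀ ω, η.pasteToBar k T (ExteriorAlgebra.map
        (negVec (Gen.fst x) (Gen.snd x) ((η.paste T).ti k x)) ω) = η.pasteToBar k T ω := by
      refine pasteToBar_map k x _ ⟨(η.paste T).ti k x, -1, ?_⟩ ⟨1 - (η.paste T).ti k x, 1, ?_⟩
        (fun c h1 h2 => ?_)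
      · simp [negVec, sub_eq_add_neg]
      · simp [negVec, hne.symm]
      · simp [negVec, h1, h2]
    rw [rhoNeg_apply, hmap, negScale_apply, map_add, pasteToBar_smul, pasteToBar_smul]
    have := pasteToBar_ι_mul_of_fst_snd k x 1 0
      (contr (negForm (Gen.fst x) (Gen.snd x)) ω)
    rw [Finsupp.single_zero, add_zero] at this
    rw [this, smul_zero, add_zero]

end Rho

lemma pasteHom_naiveCoeff (x : η.AllXing T) : η.pasteHom k T ((η.paste T).naiveCoeff k x) =
    η.inclPoly k T (ofLex x).1 ((T (ofLex x).1).naiveCoeff k (ofLex x).2) := by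
  have : (η.paste T).positive x = (T (ofLex x).1).positive (ofLex x).2 := rfl
  unfold naiveCoeff
  rw [this]
  split_ifs
  · rw [map_one, map_one]
  · simp only [map_sub, ti, tk, pasteHom, inclPoly, MvPolynomial.rename_X]
    rfl

lemma naiveCube_map_one {x : η.AllXing T} {s s' : η.AllXing T → Bool}
    (h : Step (η.allPositive T) x s s') :
    ((η.naiveCube k T).map h).hom (η.naiveProj k T s 1) =
      η.naiveProj k T s' (η.pasteHom k T ((η.paste T).naiveCoeff k x)) := by
  have h1 : η.naiveProj k T s 1 = (1 : η.NaiveTensor k T s) := map_one (η.actHom k T s)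
  rw [h1]
  change η.tensorMapAux k T _ (pure k s 1) = η.actHom k T s' _
  rw [tensorMapAux_pure, pure_eq_prod, pasteHom_naiveCoeff, Finset.prod_eq_single (ofLex x).1]
  · refine Eq.trans ?_ (η.actHom_rename k T s' _ _).symm
    congr 1
    change Ideal.Quotient.mk _ (η.factorCoeff k T x (ofLex x).1 * 1) = _
    simp [factorCoeff]
  · intro j _ hj
    refine Eq.trans ?_ (map_one (η.single k T s' j))
    congr 1
    change Ideal.Quotient.mk _ (η.factorCoeff k T x j * 1) = _
    simp [factorCoeff, hj.symm]
  · simp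

/-- A linear map out of the ring is determined by its value at `1`, so the structure map of the
naive cube lifts to multiplication by one element of the ring. -/
lemma naiveCube_map_naiveProj {x : η.AllXing T} {s s' : η.AllXing T → Bool}
    (h : Step (η.allPositive T) x s s') :
    ((η.naiveCube k T).map h).hom ∘ₗ η.naiveProj k T s =
      η.pasteHom k T ((η.paste T).naiveCoeff k x) • η.naiveProj k T s' := by
  refine LinearMap.ext_ring ?_
  rw [LinearMap.comp_apply, naiveCube_map_one, LinearMap.smul_apply, ← map_smul, smul_eq_mul,
    mul_one]

attribute [local instance] baseModule baseModule_tower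

/-- The map from the Koszul complex of the pasted diagram to the Hochschild complex of the term of a
smoothing, on all terms. -/
noncomputable def toBar (s : η.AllXing T → Bool) :
    ExtAlg ((η.paste T).Poly k) (η.paste T).Gen →+
      BarTot k (η.ArcPoly k) ((η.naiveCube k T).obj s) :=
  (barTotMap k (η.ArcPoly k) (η.naiveProj k T s)).toAddMonoidHom.comp (η.pasteToBar k T)

lemma toBar_apply (s : η.AllXing T → Bool)
    (ω : ExtAlg ((η.paste T).Poly k) (η.paste T).Gen) :
    η.toBar k T s ω = barTotMap k (η.ArcPoly k) (η.naiveProj k T s) (η.pasteToBar k T ω) := rfl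

lemma toBar_smul (s : η.AllXing T → Bool) (r : (η.paste T).Poly k)
    (ω : ExtAlg ((η.paste T).Poly k) (η.paste T).Gen) :
    η.toBar k T s (r • ω) = η.pasteHom k T r • η.toBar k T s ω := by
  rw [toBar_apply, toBar_apply, pasteToBar_smul, map_smul]

lemma toBar_rho {x : η.AllXing T} {s s' : η.AllXing T → Bool}
    (h : Step (η.allPositive T) x s s') (ω : ExtAlg ((η.paste T).Poly k) (η.paste T).Gen) :
    η.toBar k T s' ((η.paste T).rho k x ω) =
      barTotMap k (η.ArcPoly k) ((η.naiveCube k T).map h).hom (η.toBar k T s ω) := by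
  rw [toBar_apply, toBar_apply, pasteToBar_rho, ← barTotMap_comp, naiveCube_map_naiveProj,
    barTotMap_smul, map_smul]

lemma barTotMap_naiveProj_eq_zero_iff (s : η.AllXing T → Bool)
    (z : BarTot k (η.ArcPoly k) (η.AllPoly k T)) :
    barTotMap k (η.ArcPoly k) (η.naiveProj k T s) z = 0 ↔
      z ∈ famSub (η.allSeq k T s) (BarTot k (η.ArcPoly k) (η.AllPoly k T)) (Set.range Sum.inl) :=
  barTotMap_eq_zero_iff k (η.naiveProj k T s) (η.actHom_surjective k T s) _
    (η.actHom_eq_zero_iff k T s) z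

lemma barTotMap_naiveProj_surjective (s : η.AllXing T → Bool) :
    Function.Surjective (barTotMap k (η.ArcPoly k) (η.naiveProj k T s)) :=
  barTotMap_surjective k (η.naiveProj k T s) (η.actHom_surjective k T s)

variable {T} (hT : ∀ j, (T j).IsAcyclic) (s : η.AllXing T → Bool)

include hT

lemma barTotD_toBar (ω : ExtAlg ((η.paste T).Poly k) (η.paste T).Gen) :
    barTotD k _ (η.leftAct k T) (η.rightAct k T) (η.toBar k T s ω) =
      η.toBar k T s (contr (koszulForm ((η.paste T).seq k s)) ω) := by
  rw [toBar_apply, toBar_apply, barTotD_barTotMap, ← sub_eq_zero, ← map_sub,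
    barTotMap_naiveProj_eq_zero_iff]
  exact η.barTotD_pasteToBar k hT s ω

lemma exists_contr_eq_of_toBar (ω : ExtAlg ((η.paste T).Poly k) (η.paste T).Gen)
    (hω : contr (koszulForm ((η.paste T).seq k s)) ω = 0)
    (g : BarTot k (η.ArcPoly k) ((η.naiveCube k T).obj s))
    (h : η.toBar k T s ω = barTotD k _ (η.leftAct k T) (η.rightAct k T) g) :
    ∃ ξ, contr (koszulForm ((η.paste T).seq k s)) ξ = ω := by
  obtain ⟨g, rfl⟩ := η.barTotMap_naiveProj_surjective k T s g
  refine η.exists_contr_eq_of_pasteToBar k hT s ω hω ⟨g, ?_⟩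
  rw [← barTotMap_naiveProj_eq_zero_iff, map_sub, ← barTotD_barTotMap, ← h, toBar_apply, sub_self]

lemma exists_toBar_eq (g : BarTot k (η.ArcPoly k) ((η.naiveCube k T).obj s))
    (hg : barTotD k _ (η.leftAct k T) (η.rightAct k T) g = 0) :
    ∃ ω, contr (koszulForm ((η.paste T).seq k s)) ω = 0 ∧ ∃ g',
      η.toBar k T s ω = g - barTotD k _ (η.leftAct k T) (η.rightAct k T) g' := by
  obtain ⟨g, rfl⟩ := η.barTotMap_naiveProj_surjective k T s g
  rw [barTotD_barTotMap, barTotMap_naiveProj_eq_zero_iff] at hg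
  obtain ⟨ω, hω, g', hg'⟩ := η.exists_sub_pasteToBar_mem k hT s g hg
  refine ⟨ω, hω, barTotMap k (η.ArcPoly k) (η.naiveProj k T s) g', ?_⟩
  rw [← barTotMap_naiveProj_eq_zero_iff, map_sub, map_sub, ← barTotD_barTotMap, sub_eq_zero] at hg'
  rw [← hg', toBar_apply, sub_sub_cancel]

end ClosedArcDiagram

end KhR

/-! ### Homology of complexes of modules in terms of elements. -/

namespace KhR

section HomologyElements

variable {R : Type u} [CommRing R] (K : ChainComplex (ModuleCat.{u} R) ℕ) (i : ℕ)

lemma homologyπ_surjective : Function.Surjective (K.homologyπ i).hom :=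
  (ModuleCat.epi_iff_surjective _).1 inferInstance

lemma iCycles_injective : Function.Injective (K.iCycles i).hom :=
  (ModuleCat.mono_iff_injective _).1 inferInstance

lemma d_iCycles (j : ℕ) (c : K.cycles i) : (K.d i j).hom ((K.iCycles i).hom c) = 0 := by
  rw [← LinearMap.comp_apply, ← ModuleCat.hom_comp, K.iCycles_d, ModuleCat.hom_zero,
    LinearMap.zero_apply]

lemma exists_iCycles_eq (x : K.X i) (hx : ∀ j, (K.d i j).hom x = 0) :
    ∃ c, (K.iCycles i).hom c = x := by
  let f : ModuleCat.of R (LinearMap.ker (K.d i ((ComplexShape.down ℕ).next i)).hom) ⟶ K.X i :=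
    ModuleCat.ofHom (Submodule.subtype _)
  have hf : f ≫ K.d i ((ComplexShape.down ℕ).next i) = 0 :=
    ModuleCat.hom_ext (LinearMap.ext fun y => y.2)
  refine ⟨(K.liftCycles f _ rfl hf).hom ⟨x, hx _⟩, ?_⟩
  rw [← LinearMap.comp_apply, ← ModuleCat.hom_comp, K.liftCycles_i]
  rfl

lemma homologyπ_eq_zero_iff (c : K.cycles i) :
    (K.homologyπ i).hom c = 0 ↔ ∃ y, (K.d (i + 1) i).hom y = (K.iCycles i).hom c := by
  have hi : (ComplexShape.down ℕ).prev i = i + 1 := ChainComplex.prev ℕ i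
  have hex := (ShortComplex.moduleCat_exact_iff _).1 (ShortComplex.exact_of_g_is_cokernel
    (ShortComplex.mk (K.toCycles (i + 1) i) (K.homologyπ i) (by simp))
    (K.homologyIsCokernel (i + 1) i hi))
  constructor
  · intro h
    obtain ⟨y, hy⟩ := hex c h
    refine ⟨y, ?_⟩
    have hy' : (K.toCycles (i + 1) i).hom y = c := hy
    rw [← hy', ← LinearMap.comp_apply, ← ModuleCat.hom_comp, K.toCycles_i]
  · rintro ⟨y, hy⟩
    have : (K.toCycles (i + 1) i).hom y = c := by
      apply iCycles_injective K i
      rw [← hy, ← LinearMap.comp_apply, ← ModuleCat.hom_comp, K.toCycles_i]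
    rw [← this, ← LinearMap.comp_apply, ← ModuleCat.hom_comp]
    simp

variable {K i} {L : ChainComplex (ModuleCat.{u} R) ℕ}

lemma homologyMap_homologyπ (f : K ⟶ L) (c : K.cycles i) (c' : L.cycles i)
    (h : (L.iCycles i).hom c' = (f.f i).hom ((K.iCycles i).hom c)) :
    (HomologicalComplex.homologyMap f i).hom ((K.homologyπ i).hom c) = (L.homologyπ i).hom c' := by
  have : c' = (HomologicalComplex.cyclesMap f i).hom c := by
    apply iCycles_injective L i
    rw [h, ← LinearMap.comp_apply, ← ModuleCat.hom_comp, ← LinearMap.comp_apply,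
      ← ModuleCat.hom_comp, HomologicalComplex.cyclesMap_i]
  rw [this, ← LinearMap.comp_apply, ← ModuleCat.hom_comp, ← LinearMap.comp_apply,
      ← ModuleCat.hom_comp, HomologicalComplex.homologyπ_naturality]

end HomologyElements

/-- A semilinear chain map that is a quasi-isomorphism in degree `i` induces an isomorphism on the
`i`-th homology. -/
lemma exists_homology_iso {P S : Type u} [CommRing P] [CommRing S] (φ : P →+* S)
    (K : ChainComplex (ModuleCat.{u} P) ℕ) (L : ChainComplex (ModuleCat.{u} S) ℕ)
    (f : ∀ n, K.X n →+ L.X n) (hsmul : ∀ n r x, f n (r • x) = φ r • f n x)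
    (hd : ∀ n x, (L.d (n + 1) n).hom (f (n + 1) x) = f n ((K.d (n + 1) n).hom x)) (i : ℕ)
    (hinj : ∀ x : K.X i, (∀ j, (K.d i j).hom x = 0) →
      (∃ y, f i x = (L.d (i + 1) i).hom y) → ∃ z, (K.d (i + 1) i).hom z = x)
    (hsurj : ∀ y : L.X i, (∀ j, (L.d i j).hom y = 0) → ∃ x : K.X i, (∀ j, (K.d i j).hom x = 0) ∧
      ∃ z, f i x = y - (L.d (i + 1) i).hom z) :
    ∃ e : K.homology i ≅ (ModuleCat.restrictScalars φ).obj (L.homology i),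
      ∀ (c : K.cycles i) (c' : L.cycles i), (L.iCycles i).hom c' = f i ((K.iCycles i).hom c) →
        e.hom.hom ((K.homologyπ i).hom c) = (L.homologyπ i).hom c' := by
  have hcyc : ∀ x : K.X i, (∀ j, (K.d i j).hom x = 0) → ∀ j, (L.d i j).hom (f i x) = 0 := by
    intro x hx j
    by_cases hj : j + 1 = i
    · subst hj
      rw [hd, hx, map_zero]
    · rw [L.shape _ _ hj]
      rfl
  have hex : ∀ c : K.cycles i, ∃ c' : L.cycles i, (L.iCycles i).hom c' = f i ((K.iCycles i).hom c) :=
    fun c => exists_iCycles_eq L i _ (hcyc _ fun j => d_iCycles K i j c)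
  -- The choice is forced, because a cycle is determined by its underlying chain (`hguniq`); this
  -- makes `g` compatible with sums and scalars.
  choose g hg using hex
  have hguniq : ∀ c c', (L.iCycles i).hom c' = f i ((K.iCycles i).hom c) → g c = c' := by
    intro c c' h
    exact iCycles_injective L i ((hg c).trans h.symm)
  let ψ : K.cycles i →ₗ[P] (ModuleCat.restrictScalars φ).obj (L.homology i) :=
    { toFun := fun c => (L.homologyπ i).hom (g c)
      map_add' := fun a b => by
        rw [hguniq (a + b) (g a + g b) (by rw [map_add, map_add, map_add, hg, hg])]
        exact map_add _ _ _
      map_smul' := fun r a => by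
        rw [hguniq (r • a) (φ r • g a) (by rw [map_smul, map_smul, hsmul, hg])]
        exact map_smul (L.homologyπ i).hom _ _ }
  have hψ : Function.Surjective ψ := by
    intro h
    obtain ⟨c', hc'⟩ := homologyπ_surjective L i h
    obtain ⟨x, hx, z, hz⟩ := hsurj _ fun j => d_iCycles L i j c'
    obtain ⟨c, rfl⟩ := exists_iCycles_eq K i x hx
    refine ⟨c, Eq.trans (?_ : (L.homologyπ i).hom (g c) = (L.homologyπ i).hom c') hc'⟩
    rw [eq_comm, ← sub_eq_zero]
    refine (map_sub (L.homologyπ i).hom c' (g c)).symm.trans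
      ((homologyπ_eq_zero_iff L i _).2 ⟨z, ?_⟩)
    rw [map_sub, hg, hz, sub_sub_cancel]
  -- Both maps out of the cycles are surjective and have the same kernel, which yields the
  -- isomorphism of their images.
  have hker : LinearMap.ker (K.homologyπ i).hom = LinearMap.ker ψ := by
    ext c
    rw [LinearMap.mem_ker, LinearMap.mem_ker, homologyπ_eq_zero_iff]
    refine Iff.trans ?_ (homologyπ_eq_zero_iff L i (g c)).symm
    rw [hg]
    constructor
    · rintro ⟨y, hy⟩
      exact ⟨f (i + 1) y, by rw [hd, hy]⟩
    · rintro ⟨y, hy⟩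
      exact hinj _ (fun j => d_iCycles K i j c) ⟨y, hy.symm⟩
  let E : K.homology i ≃ₗ[P] (ModuleCat.restrictScalars φ).obj (L.homology i) :=
    ((LinearMap.quotKerEquivOfSurjective _ (homologyπ_surjective K i)).symm.trans
      (Submodule.quotEquivOfEq _ _ hker)).trans (LinearMap.quotKerEquivOfSurjective ψ hψ)
  refine ⟨E.toModuleIso, fun c c' h => ?_⟩
  have h1 : (LinearMap.quotKerEquivOfSurjective _ (homologyπ_surjective K i)).symm
      ((K.homologyπ i).hom c) = Submodule.Quotient.mk c := by
    rw [LinearEquiv.symm_apply_eq]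
    rfl
  change E _ = _
  simp only [E, LinearEquiv.trans_apply]
  rw [h1, ← hguniq c c' h]
  rfl

/-! ### From the terms of a cube to its total complex. -/

section TotalIso

variable {C : Type} [Fintype C] [LinearOrder C] {pos : C → Bool}
  {V : Type*} [Category V] [Preadditive V] [HasFiniteBiproducts V]
  {V' : Type*} [Category V'] [Preadditive V'] [HasFiniteBiproducts V']
  {W : Type*} [Category W] [Preadditive W] [HasFiniteBiproducts W]

/-- An additive functor preserves finite biproducts, so the images of the projections are jointly
monic. -/
lemma map_biproduct_hom_ext {J : Type} [Finite J] (F : V ⥤ W) [F.Additive] (X : J → V) {A : W}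
    (f g : A ⟶ F.obj (⨁ X))
    (h : ∀ j, f ≫ F.map (biproduct.π X j) = g ≫ F.map (biproduct.π X j)) : f = g := by
  rw [← cancel_mono (F.mapBiproduct X).hom]
  refine biproduct.hom_ext _ _ fun j => ?_
  have h3 : (F.mapBiproduct X).hom ≫ biproduct.π (F.obj ∘ X) j = F.map (biproduct.π X j) := by
    rw [Functor.mapBiproduct_hom]
    exact biproduct.lift_π _ j
  rw [Category.assoc, Category.assoc, h3, h]

lemma exists_map_biproduct_iso {J : Type} [Finite J] (F : V ⥤ W) [F.Additive] (G : V' ⥤ W)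
    [G.Additive] (X : J → V) (Y : J → V') (e : ∀ j, F.obj (X j) ≅ G.obj (Y j)) :
    ∃ E : F.obj (⨁ X) ≅ G.obj (⨁ Y),
      ∀ j, E.hom ≫ G.map (biproduct.π Y j) = F.map (biproduct.π X j) ≫ (e j).hom := by
  refine ⟨F.mapBiproduct X ≪≫ biproduct.mapIso (f := F.obj ∘ X) (g := G.obj ∘ Y) e ≪≫
    (G.mapBiproduct Y).symm, fun j => ?_⟩
  have h1 : (G.mapBiproduct Y).inv ≫ G.map (biproduct.π Y j) = biproduct.π (G.obj ∘ Y) j := by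
    rw [Iso.inv_comp_eq, Functor.mapBiproduct_hom]
    exact (biproduct.lift_π (fun j => G.map (biproduct.π Y j)) j).symm
  have h2 : (F.mapBiproduct X).hom ≫ biproduct.π (F.obj ∘ X) j = F.map (biproduct.π X j) := by
    rw [Functor.mapBiproduct_hom]
    exact biproduct.lift_π _ j
  simp only [Iso.trans_hom, Iso.symm_hom, Category.assoc, h1]
  rw [← h2, Category.assoc]
  congr 1
  exact biproduct.map_π (fun j => (e j).hom) j

lemma Cube.total_d_proj (K : Cube pos V) (j : ℤ)
    (s : {s : C → Bool // vdeg pos s = j + 1}) :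
    K.total.d j (j + 1) ≫ K.proj s =
      ∑ t : {t : C → Bool // vdeg pos t = j}, K.proj t ≫ K.entry t.1 s.1 := by
  have h : K.total.d j (j + 1) = biproduct.matrix
      fun (s : {s : C → Bool // vdeg pos s = j}) (s' : {s : C → Bool // vdeg pos s = j + 1}) =>
        K.entry s.1 s'.1 :=
    CochainComplex.of_d (fun j => ⨁ fun s : {s : C → Bool // vdeg pos s = j} => K.obj s.1)
      (fun _ => biproduct.matrix fun s s' => K.entry s.1 s'.1) j
  refine (congrArg (· ≫ K.proj s) h).trans ((biproduct.matrix_π _ s).trans ?_)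
  exact biproduct.desc_eq

/-- Isomorphisms of the terms of two cubes that commute with the structure maps give an isomorphism
of the total complexes. -/
lemma exists_total_iso (F : V ⥤ W) [F.Additive] (G : V' ⥤ W) [G.Additive] (K : Cube pos V)
    (N : Cube pos V') (e : ∀ s, F.obj (K.obj s) ≅ G.obj (N.obj s))
    (he : ∀ (x : C) (s s' : C → Bool) (h : Step pos x s s'),
      (e s).hom ≫ G.map (N.map h) = F.map (K.map h) ≫ (e s').hom) :
    ∃ Φ : (F.mapHomologicalComplex _).obj K.total ≅ (G.mapHomologicalComplex _).obj N.total,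
      ∀ (j : ℤ) (s : {s : C → Bool // vdeg pos s = j}),
        Φ.hom.f j ≫ G.map (N.proj s) = F.map (K.proj s) ≫ (e s.1).hom := by
  -- The signs depend only on the smoothing and the crossing, so they are the same in both cubes.
  have hentry : ∀ s s', (e s).hom ≫ G.map (N.entry s s') = F.map (K.entry s s') ≫ (e s').hom := by
    intro s s'
    by_cases h : ∃ x, Step pos x s s'
    · obtain ⟨x, h⟩ := h
      rw [K.entry_eq_of_step h, N.entry_eq_of_step h, G.map_zsmul, F.map_zsmul,
        Preadditive.comp_zsmul, Preadditive.zsmul_comp, he]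
    · rw [K.entry_eq_zero (fun x hx => h ⟨x, hx⟩), N.entry_eq_zero (fun x hx => h ⟨x, hx⟩)]
      simp
  have hE : ∀ j : ℤ, ∃ E : F.obj (K.total.X j) ≅ G.obj (N.total.X j),
      ∀ s : {s : C → Bool // vdeg pos s = j},
        E.hom ≫ G.map (N.proj s) = F.map (K.proj s) ≫ (e s.1).hom := fun j =>
    exists_map_biproduct_iso F G (fun s : {s : C → Bool // vdeg pos s = j} => K.obj s.1)
      (fun s => N.obj s.1) fun s => e s.1
  choose E hproj using hE
  have hext : ∀ (j : ℤ) (A : W) (f g : A ⟶ G.obj (N.total.X j)),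
      (∀ s : {s : C → Bool // vdeg pos s = j}, f ≫ G.map (N.proj s) = g ≫ G.map (N.proj s)) →
      f = g := fun j A f g h =>
    map_biproduct_hom_ext G (fun s : {s : C → Bool // vdeg pos s = j} => N.obj s.1) f g h
  have hcomm : ∀ j : ℤ, (E j).hom ≫ G.map (N.total.d j (j + 1)) =
      F.map (K.total.d j (j + 1)) ≫ (E (j + 1)).hom := by
    intro j
    refine hext _ _ _ _ fun s => ?_
    rw [Category.assoc, Category.assoc, hproj, ← F.map_comp_assoc, ← G.map_comp, K.total_d_proj,
      N.total_d_proj, F.map_sum, G.map_sum, Preadditive.comp_sum, Preadditive.sum_comp]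
    refine Finset.sum_congr rfl fun t _ => ?_
    rw [G.map_comp, F.map_comp, ← Category.assoc, hproj, Category.assoc, hentry, Category.assoc]
  refine ⟨HomologicalComplex.Hom.isoOfComponents E ?_, hproj⟩
  rintro j _ rfl
  exact hcomm j

end TotalIso

end KhR

/-! ### The isomorphism for each smoothing and its naturality. -/

namespace KhR

namespace ClosedArcDiagram

open TangleDiagram

variable (k : Type u) [CommRing k] (η : ClosedArcDiagram) (T : ∀ j, TangleDiagram (η.bdry j))

attribute [local instance] baseModule baseModule_tower

/-- The comparison map sends exterior degree `n` to tensor degree `n`, since the inclusion preserves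
the degree and each generator adds one tensor factor. -/
lemma toBar_eq_lof (s : η.AllXing T → Bool) {n : ℕ}
    {ω : ExtAlg ((η.paste T).Poly k) (η.paste T).Gen}
    (h : ω ∈ ⋀[(η.paste T).Poly k]^n ((η.paste T).Gen →₀ (η.paste T).Poly k)) :
    η.toBar k T s ω = DirectSum.lof (η.AllPoly k T) ℕ
      (fun n => (η.naiveCube k T).obj s ⊗[k] ⨂[k]^n (η.ArcPoly k)) n (η.toBar k T s ω n) := by
  obtain ⟨z, hz⟩ := koszulToBar_mem k (η.arcElt k T)
    (extMap_mem (φ := (η.pasteHom k T).toRingHom) (g := η.pasteVec k T) h)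
  have h1 : η.pasteToBar k T ω = DirectSum.lof (η.AllPoly k T) ℕ
      (fun n => (η.AllPoly k T) ⊗[k] ⨂[k]^n (η.ArcPoly k)) n z := hz
  rw [toBar_apply, h1, barTotMap_lof, DirectSum.lof_eq_of, DirectSum.of_eq_same]
  rfl

lemma toBar_extProj (s : η.AllXing T → Bool) (n : ℕ)
    (ω : ExtAlg ((η.paste T).Poly k) (η.paste T).Gen) :
    η.toBar k T s (extProj _ _ n ω) n = η.toBar k T s ω n := by
  induction ω using ext_homogeneous_induction with
  | h0 => simp
  | hadd a b ha hb => rw [map_add, map_add, map_add, DirectSum.add_apply, DirectSum.add_apply, ha, hb]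
  | h m a ha =>
    by_cases hmn : m = n
    · subst hmn
      rw [extProj_same ha]
    · rw [extProj_ne ha hmn, map_zero, toBar_eq_lof k η T s ha, DirectSum.lof_eq_of,
        DirectSum.of_eq_of_ne _ _ _ (Ne.symm hmn)]
      rfl

/-- The component of `toBar` in degree `n`. -/
noncomputable def toBarX (s : η.AllXing T → Bool) (n : ℕ) :
    ⋀[(η.paste T).Poly k]^n ((η.paste T).Gen →₀ (η.paste T).Poly k) →+
      (η.naiveCube k T).obj s ⊗[k] ⨂[k]^n (η.ArcPoly k) where
  toFun ω := η.toBar k T s ω n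
  map_zero' := by rw [ZeroMemClass.coe_zero, map_zero]; rfl
  map_add' a b := by rw [AddMemClass.coe_add, map_add]; rfl

lemma toBarX_apply (s : η.AllXing T → Bool) (n : ℕ)
    (ω : ⋀[(η.paste T).Poly k]^n ((η.paste T).Gen →₀ (η.paste T).Poly k)) :
    η.toBarX k T s n ω = η.toBar k T s ω n := rfl

lemma toBarX_smul (s : η.AllXing T → Bool) (n : ℕ) (r : (η.paste T).Poly k)
    (ω : ⋀[(η.paste T).Poly k]^n ((η.paste T).Gen →₀ (η.paste T).Poly k)) :
    η.toBarX k T s n (r • ω) = η.pasteHom k T r • η.toBarX k T s n ω := by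
  rw [toBarX_apply, Submodule.coe_smul, toBar_smul]
  rfl

variable {T} (hT : ∀ j, (T j).IsAcyclic) (s : η.AllXing T → Bool)

include hT

lemma barD_toBarX (n : ℕ)
    (ω : ⋀[(η.paste T).Poly k]^(n + 1) ((η.paste T).Gen →₀ (η.paste T).Poly k)) :
    barD k (η.leftAct k T) (η.rightAct k T) _ n (η.toBarX k T s (n + 1) ω) =
      η.toBarX k T s n (koszulD ((η.paste T).seq k s) n ω) := by
  rw [toBarX_apply, toBarX_apply, ← barTotD_apply, barTotD_toBar k η hT]
  rfl

lemma exists_koszulD_eq_of_toBarX (n : ℕ)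
    (ω : ⋀[(η.paste T).Poly k]^n ((η.paste T).Gen →₀ (η.paste T).Poly k))
    (hω : contr (koszulForm ((η.paste T).seq k s)) ω.1 = 0)
    (g : (η.naiveCube k T).obj s ⊗[k] ⨂[k]^(n + 1) (η.ArcPoly k))
    (h : η.toBarX k T s n ω = barD k (η.leftAct k T) (η.rightAct k T) _ n g) :
    ∃ ξ, koszulD ((η.paste T).seq k s) n ξ = ω := by
  obtain ⟨ξ, hξ⟩ := η.exists_contr_eq_of_toBar k hT s ω.1 hω (DirectSum.lof (η.AllPoly k T) ℕ
      (fun n => (η.naiveCube k T).obj s ⊗[k] ⨂[k]^n (η.ArcPoly k)) (n + 1) g) (by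
    rw [barTotD_lof_succ, toBar_eq_lof k η T s ω.2, ← h]
    rfl)
  -- The preimage found in the whole exterior algebra may be inhomogeneous; its component of degree
  -- `n + 1` already has boundary `ω`.
  refine ⟨⟨extProj _ _ (n + 1) ξ, extProj_mem _ _⟩, Subtype.ext ?_⟩
  change contr _ (extProj _ _ (n + 1) ξ) = _
  rw [← extProj_contr, hξ, extProj_same ω.2]

lemma exists_toBarX_eq (n : ℕ)
    (g : (η.naiveCube k T).obj s ⊗[k] ⨂[k]^n (η.ArcPoly k))
    (hg : barTotD k _ (η.leftAct k T) (η.rightAct k T) (DirectSum.lof (η.AllPoly k T) ℕ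
      (fun n => (η.naiveCube k T).obj s ⊗[k] ⨂[k]^n (η.ArcPoly k)) n g) = 0) :
    ∃ ω : ⋀[(η.paste T).Poly k]^n ((η.paste T).Gen →₀ (η.paste T).Poly k),
      contr (koszulForm ((η.paste T).seq k s)) ω.1 = 0 ∧ ∃ g',
        η.toBarX k T s n ω = g - barD k (η.leftAct k T) (η.rightAct k T) _ n g' := by
  obtain ⟨ω, hω, g', h⟩ := η.exists_toBar_eq k hT s _ hg
  refine ⟨⟨extProj _ _ n ω, extProj_mem _ _⟩, ?_, g' (n + 1), ?_⟩
  · cases n with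
    | zero => exact contr_mem_zero _ (extProj_mem _ _)
    | succ n =>
      change contr _ (extProj _ _ (n + 1) ω) = _
      rw [← extProj_contr, hω, map_zero]
  · rw [toBarX_apply]
    change η.toBar k T s (extProj _ _ n ω) n = _
    rw [toBar_extProj, h, DirectSum.sub_apply, barTotD_apply, DirectSum.lof_eq_of,
      DirectSum.of_eq_same]

omit hT in
lemma krCube_d (n : ℕ) : (((η.paste T).krCube k).obj s).d (n + 1) n =
    ModuleCat.ofHom (koszulD ((η.paste T).seq k s) n) :=
  ChainComplex.of_d (fun n => ModuleCat.of ((η.paste T).Poly k)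
    (⋀[(η.paste T).Poly k]^n ((η.paste T).Gen →₀ (η.paste T).Poly k)))
    (fun n => ModuleCat.ofHom (koszulD ((η.paste T).seq k s) n)) n

omit hT in
lemma barComplex_d (n : ℕ) :
    (barComplex k (η.leftAct k T) (η.rightAct k T) ((η.naiveCube k T).obj s)).d (n + 1) n =
      ModuleCat.ofHom (barD k (η.leftAct k T) (η.rightAct k T) ((η.naiveCube k T).obj s) n) :=
  ChainComplex.of_d (fun n => ModuleCat.of (η.AllPoly k T)
    ((η.naiveCube k T).obj s ⊗[k] ⨂[k]^n (η.ArcPoly k)))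
    (fun n => ModuleCat.ofHom
      (barD k (η.leftAct k T) (η.rightAct k T) ((η.naiveCube k T).obj s) n)) n

/-- The Koszul complex of the term of a smoothing. -/
noncomputable abbrev termKoszul (η : ClosedArcDiagram) {T : ∀ j, TangleDiagram (η.bdry j)}
    (s : η.AllXing T → Bool) : ChainComplex (ModuleCat.{u} ((η.paste T).Poly k)) ℕ :=
  ((η.paste T).krCube k).obj s

/-- The Hochschild complex of the term of a smoothing. -/
noncomputable abbrev termBar (η : ClosedArcDiagram) {T : ∀ j, TangleDiagram (η.bdry j)}
    (s : η.AllXing T → Bool) : ChainComplex (ModuleCat.{u} (η.AllPoly k T)) ℕ :=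
  barComplex k (η.leftAct k T) (η.rightAct k T) ((η.naiveCube k T).obj s)

/-- The Koszul homology of the term of a smoothing is its Hochschild homology. -/
lemma exists_termHomology_iso (i : ℕ) : ∃ e : (η.paste T).termHomology k i s ≅ η.termHH k T i s,
    ∀ (c : (η.termKoszul k s).cycles i) (c' : (η.termBar k s).cycles i),
      ((η.termBar k s).iCycles i).hom c' =
        η.toBarX k T s i (((η.termKoszul k s).iCycles i).hom c) →
      e.hom.hom (((η.termKoszul k s).homologyπ i).hom c) =
        ((η.termBar k s).homologyπ i).hom c' := by
  refine exists_homology_iso (η.pasteHom k T).toRingHom (η.termKoszul k s) (η.termBar k s)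
    (fun n => η.toBarX k T s n) (fun n r x => toBarX_smul k η T s n r x) (fun n x => ?_) i
    (fun x hx hy => ?_) (fun y hy => ?_)
  · rw [krCube_d, barComplex_d]
    exact barD_toBarX k η hT s n x
  · obtain ⟨y, hy⟩ := hy
    rw [barComplex_d] at hy
    rw [krCube_d]
    refine exists_koszulD_eq_of_toBarX k η hT s i x ?_ y hy
    cases i with
    | zero => exact contr_mem_zero _ x.2
    -- The hypothesis covers the differentials to all indices; only the one that lowers the degree
    -- by one is informative, and in degree zero none is.
    | succ i =>
      have := hx i
      rw [krCube_d] at this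
      exact congrArg Subtype.val this
  · obtain ⟨x, hx, z, hz⟩ := exists_toBarX_eq k η hT s i y (by
      cases i with
      | zero => exact barTotD_lof_zero _ _ _ _
      | succ i =>
        have := hy i
        rw [barComplex_d] at this
        exact (barTotD_lof_succ _ _ _ _ _).trans ((congrArg _ this).trans (map_zero _)))
    refine ⟨x, fun j => ?_, z, ?_⟩
    · by_cases hj : j + 1 = i
      · subst hj
        rw [krCube_d]
        exact Subtype.ext hx
      · rw [HomologicalComplex.shape _ _ _ hj]
        rfl
    · rw [barComplex_d]
      exact hz

lemma exists_cycle_toBarX (i : ℕ) (c : (η.termKoszul k s).cycles i) :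
    ∃ c' : (η.termBar k s).cycles i, ((η.termBar k s).iCycles i).hom c' =
      η.toBarX k T s i (((η.termKoszul k s).iCycles i).hom c) := by
  refine exists_iCycles_eq (η.termBar k s) i _ fun j => ?_
  by_cases hj : j + 1 = i
  · subst hj
    have h := d_iCycles (η.termKoszul k s) (j + 1) j c
    rw [krCube_d] at h
    rw [barComplex_d]
    refine (barD_toBarX k η hT s j _).trans ?_
    exact (congrArg (η.toBarX k T s j) h).trans (map_zero _)
  · rw [(η.termBar k s).shape _ _ hj]
    rfl

omit hT in
/-- The map of Koszul complexes of a crossing. -/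
noncomputable abbrev termKoszulMap {x : η.AllXing T} {s s' : η.AllXing T → Bool}
    (h : Step (η.allPositive T) x s s') : η.termKoszul k s ⟶ η.termKoszul k s' :=
  ((η.paste T).krCube k).map h

omit hT in
/-- The map of Hochschild complexes of a crossing. -/
noncomputable abbrev termBarMap {x : η.AllXing T} {s s' : η.AllXing T → Bool}
    (h : Step (η.allPositive T) x s s') : η.termBar k s ⟶ η.termBar k s' :=
  (barFunctor k (η.leftAct k T) (η.rightAct k T)).map ((η.naiveCube k T).map h)

omit hT in
lemma toBarX_termKoszulMap {x : η.AllXing T} {s s' : η.AllXing T → Bool}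
    (h : Step (η.allPositive T) x s s') (i : ℕ) (ω : (η.termKoszul k s).X i) :
    η.toBarX k T s' i (((termKoszulMap k η h).f i).hom ω) =
      ((termBarMap k η h).f i).hom (η.toBarX k T s i ω) :=
  (congrArg (fun z => z i) (η.toBar_rho k T h ω.1)).trans (barTotMap_apply _ _ _ _)

/-- The square commutes on chains, and the isomorphisms are described on representing cycles by the
hypotheses `he` and `he'`, so it is enough to follow one cycle around it. -/
lemma termHomology_iso_naturality (i : ℕ) {x : η.AllXing T} {s s' : η.AllXing T → Bool}
    (h : Step (η.allPositive T) x s s')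
    (e : (η.paste T).termHomology k i s ≅ η.termHH k T i s)
    (e' : (η.paste T).termHomology k i s' ≅ η.termHH k T i s')
    (he : ∀ (c : (η.termKoszul k s).cycles i) (c' : (η.termBar k s).cycles i),
      ((η.termBar k s).iCycles i).hom c' =
        η.toBarX k T s i (((η.termKoszul k s).iCycles i).hom c) →
      e.hom.hom (((η.termKoszul k s).homologyπ i).hom c) = ((η.termBar k s).homologyπ i).hom c')
    (he' : ∀ (c : (η.termKoszul k s').cycles i) (c' : (η.termBar k s').cycles i),
      ((η.termBar k s').iCycles i).hom c' =
        η.toBarX k T s' i (((η.termKoszul k s').iCycles i).hom c) →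
      e'.hom.hom (((η.termKoszul k s').homologyπ i).hom c) =
        ((η.termBar k s').homologyπ i).hom c') :
    e.hom ≫ (η.HH k T i ⋙ η.restrict k T).map ((η.naiveCube k T).map h) =
      (HomologicalComplex.homologyFunctor _ _ i).map (((η.paste T).krCube k).map h) ≫ e'.hom := by
  refine ModuleCat.hom_ext (LinearMap.ext fun z => ?_)
  obtain ⟨c, rfl⟩ := homologyπ_surjective (η.termKoszul k s) i z
  obtain ⟨c1, h1⟩ := exists_cycle_toBarX k η hT s i c
  obtain ⟨c3, h3⟩ : ∃ c3 : (η.termKoszul k s').cycles i,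
      ((η.termKoszul k s').iCycles i).hom c3 =
        ((termKoszulMap k η h).f i).hom (((η.termKoszul k s).iCycles i).hom c) :=
    ⟨(HomologicalComplex.cyclesMap (termKoszulMap k η h) i).hom c, by
      rw [← LinearMap.comp_apply, ← ModuleCat.hom_comp, HomologicalComplex.cyclesMap_i]
      rfl⟩
  obtain ⟨c4, h4⟩ := exists_cycle_toBarX k η hT s' i c3
  have hβ := homologyMap_homologyπ (termBarMap k η h) c1 c4 (by
    rw [h1, h4, h3]
    exact toBarX_termKoszulMap k η h i _)
  have hκ := homologyMap_homologyπ (termKoszulMap k η h) c c3 h3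
  have e1 := he _ _ h1
  have e4 := he' _ _ h4
  refine Eq.trans (?_ : _ = (HomologicalComplex.homologyMap (termBarMap k η h) i).hom
    (((η.termBar k s).homologyπ i).hom c1)) ?_
  · exact congrArg (HomologicalComplex.homologyMap (termBarMap k η h) i).hom e1
  · rw [hβ, ← e4, ← hκ]
    rfl

end ClosedArcDiagram

end KhR

namespace KhR

/-! ### Families of homogeneous parts and their independence. -/

section GradedParts

variable {A B : Type*} [AddCommGroup A] [AddCommGroup B]

/-- The sum of a finitely supported family. -/
noncomputable def totalSum (A : Type*) [AddCommGroup A] : (ℤ →₀ A) →+ A :=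
  Finsupp.liftAddHom fun _ => AddMonoidHom.id A

@[simp]
lemma totalSum_single (d : ℤ) (a : A) : totalSum A (Finsupp.single d a) = a := by
  simp [totalSum]

lemma totalSum_mapRange (f : A →+ B) (F : ℤ →₀ A) :
    totalSum B (Finsupp.mapRange.addMonoidHom f F) = f (totalSum A F) := by
  induction F using Finsupp.induction_linear with
  | zero => simp
  | add F G hF hG => simp only [map_add, hF, hG]
  | single d a => simp

/-- A family of subgroups is separated if the summands of a vanishing sum vanish. -/
def IsSeparated (G : ℤ → AddSubgroup A) : Prop :=
  ∀ F : ℤ →₀ A, (∀ d, F d ∈ G d) → totalSum A F = 0 → F = 0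

lemma exists_totalSum_eq {G : ℤ → AddSubgroup A} {x : A} (h : x ∈ ⨆ d, G d) :
    ∃ F : ℤ →₀ A, (∀ d, F d ∈ G d) ∧ totalSum A F = x := by
  induction h using AddSubgroup.iSup_induction' with
  | hp d x hx =>
    refine ⟨Finsupp.single d x, fun e => ?_, totalSum_single d x⟩
    by_cases h : d = e
    · subst h
      rwa [Finsupp.single_eq_same]
    · rw [Finsupp.single_eq_of_ne (Ne.symm h)]
      exact zero_mem _
  | h1 => exact ⟨0, fun d => zero_mem _, map_zero _⟩
  | hadd x y _ _ hx hy =>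
    obtain ⟨F, hF, rfl⟩ := hx
    obtain ⟨F', hF', rfl⟩ := hy
    exact ⟨F + F', fun d => add_mem (hF d) (hF' d), map_add _ _ _⟩

/-- The operator `Q d` acts as the projection to `G d` on the span of all parts, so applied to a
vanishing sum it isolates the summand of degree `d`. -/
lemma isSeparated_of_operators {G : ℤ → AddSubgroup A} (Q : ℤ → A →+ A)
    (hQ : ∀ d d' : ℤ, ∀ z ∈ G d', Q d z = if d = d' then z else 0) : IsSeparated G := by
  intro F hF h
  ext d
  have h1 : ∀ F : ℤ →₀ A, (∀ d, F d ∈ G d) → Q d (totalSum A F) = F d := by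
    intro F hF
    rw [totalSum, Finsupp.liftAddHom_apply, map_finsuppSum, Finsupp.sum]
    simp only [AddMonoidHom.id_apply]
    rw [Finset.sum_congr rfl fun e _ => hQ d e _ (hF e), Finset.sum_ite_eq]
    split_ifs with hd
    · rfl
    · exact (Finsupp.notMem_support_iff.1 hd).symm
  rw [← h1 F hF, h, map_zero, Finsupp.zero_apply]

lemma IsSeparated.shift {G : ℤ → AddSubgroup A} (h : IsSeparated G) (c : ℤ) :
    IsSeparated fun d => G (d + c) := by
  intro F hF h0
  have h1 : ∀ F : ℤ →₀ A,
      totalSum A (Finsupp.equivMapDomain (Equiv.addRight c) F) = totalSum A F := by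
    intro F
    induction F using Finsupp.induction_linear with
    | zero => simp
    | add F F' hF hF' =>
      rw [map_add, ← hF, ← hF', ← map_add]
      congr 1
      ext e
      simp
    | single d a => simp
  have h2 := h (Finsupp.equivMapDomain (Equiv.addRight c) F) (fun d => by
    rw [Finsupp.equivMapDomain_apply]
    have := hF ((Equiv.addRight c).symm d)
    simpa using this) ((h1 F).trans h0)
  ext d
  have := DFunLike.congr_fun h2 (d + c)
  rw [Finsupp.equivMapDomain_apply] at this
  simpa using this

lemma iSup_shift (G : ℤ → AddSubgroup A) (c : ℤ) : ⨆ d, G (d + c) = ⨆ d, G d :=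
  (Equiv.addRight c).iSup_comp

end GradedParts

section ExtPart

variable {k : Type u} [CommRing k] {σ I : Type} (wt : I → ℤ) (sh : ℤ)

/-- The elements of internal degree `d` of the `n`-th exterior power of a free module over a polynomial
ring, for given degrees `wt` of the generators and a shift `sh`. -/
noncomputable def extPart (k : Type u) [CommRing k] (σ : Type) {I : Type} (wt : I → ℤ)
    (sh : ℤ) (n : ℕ) (d : ℤ) :
    AddSubgroup (ExtAlg (MvPolynomial σ k) I) :=
  AddSubgroup.closure {ω | ∃ (p : MvPolynomial σ k) (e : ℕ) (a : Fin n → I), p.IsHomogeneous e ∧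
    2 * (e : ℤ) + ∑ l, wt (a l) + sh = d ∧
    ω = p • ExteriorAlgebra.ιMulti (MvPolynomial σ k) n
      fun l => Finsupp.single (a l) (1 : MvPolynomial σ k)}

variable {wt sh}

lemma gen_mul_mem_extPart (c : I) {n : ℕ} {d : ℤ} {ω : ExtAlg (MvPolynomial σ k) I}
    (h : ω ∈ extPart k σ wt sh n d) :
    gen _ c * ω ∈ extPart k σ wt sh (n + 1) (d + wt c) := by
  induction h using AddSubgroup.closure_induction with
  | mem ω h =>
    obtain ⟨p, e, a, hp, hd, rfl⟩ := h
    refine AddSubgroup.subset_closure ⟨p, e, Fin.cons c a, hp, ?_, ?_⟩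
    · rw [Fin.sum_univ_succ]
      simp only [Fin.cons_zero, Fin.cons_succ]
      rw [← hd]
      ring
    · rw [ExteriorAlgebra.ιMulti_succ_apply, mul_smul_comm]
      rfl
  | zero => rw [mul_zero]; exact zero_mem _
  | add a b _ _ ha hb => rw [mul_add]; exact add_mem ha hb
  | neg a _ ha => rw [mul_neg]; exact neg_mem ha

lemma smul_mem_extPart {p : MvPolynomial σ k} {e : ℕ} (hp : p.IsHomogeneous e) {n : ℕ} {d : ℤ}
    {ω : ExtAlg (MvPolynomial σ k) I} (h : ω ∈ extPart k σ wt sh n d) :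
    p • ω ∈ extPart k σ wt sh n (d + 2 * e) := by
  induction h using AddSubgroup.closure_induction with
  | mem ω h =>
    obtain ⟨q, e', a, hq, hd, rfl⟩ := h
    refine AddSubgroup.subset_closure ⟨p * q, e + e', a, hp.mul hq, ?_, (smul_smul _ _ _)⟩
    rw [← hd]
    push_cast
    ring
  | zero => rw [smul_zero]; exact zero_mem _
  | add a b _ _ ha hb => rw [smul_add]; exact add_mem ha hb
  | neg a _ ha => rw [smul_neg]; exact neg_mem ha

/-- The number `δ` is the internal degree of the contraction: `2` for the Koszul differential, and
minus the weight of the generator for a coordinate form. -/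
lemma contr_mem_extPart {φ : Module.Dual (MvPolynomial σ k) (I →₀ MvPolynomial σ k)} {δ : ℤ}
    (hφ : ∀ c, φ (Finsupp.single c 1) = 0 ∨
      ∃ e : ℕ, (φ (Finsupp.single c 1)).IsHomogeneous e ∧ 2 * (e : ℤ) = wt c + δ) (n : ℕ) {d : ℤ}
    {ω : ExtAlg (MvPolynomial σ k) I} (h : ω ∈ extPart k σ wt sh (n + 1) d) :
    contr φ ω ∈ extPart k σ wt sh n (d + δ) := by
  induction n generalizing d ω with
  | zero =>
    induction h using AddSubgroup.closure_induction with
    | mem ω h =>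
      obtain ⟨p, e, a, hp, hd, rfl⟩ := h
      rw [map_smul, ExteriorAlgebra.ιMulti_succ_apply, contr_ι_mul,
        ExteriorAlgebra.ιMulti_zero_apply,
        ← map_one (algebraMap (MvPolynomial σ k) (ExtAlg (MvPolynomial σ k) I)),
        contr_algebraMap, mul_zero, sub_zero, smul_smul]
      rcases hφ (a 0) with h | ⟨e', he', h⟩
      · rw [h, mul_zero, zero_smul]
        exact zero_mem _
      · refine AddSubgroup.subset_closure ⟨_, e + e', Fin.elim0, hp.mul he', ?_, ?_⟩
        · simp only [Fin.sum_univ_succ, Finset.univ_eq_empty, Finset.sum_empty] at hd ⊢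
          push_cast
          linarith
        · rw [ExteriorAlgebra.ιMulti_zero_apply, map_one]
    | zero => rw [map_zero]; exact zero_mem _
    | add a b _ _ ha hb => rw [map_add]; exact add_mem ha hb
    | neg a _ ha => rw [map_neg]; exact neg_mem ha
  | succ n ih =>
    induction h using AddSubgroup.closure_induction with
    | mem ω h =>
      obtain ⟨p, e, a, hp, hd, rfl⟩ := h
      have htail : ExteriorAlgebra.ιMulti (MvPolynomial σ k) (n + 1)
          (fun l => Finsupp.single (a (Fin.succ l)) (1 : MvPolynomial σ k)) ∈
          extPart k σ wt sh (n + 1) (∑ l, wt (a (Fin.succ l)) + sh) :=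
        AddSubgroup.subset_closure ⟨1, 0, fun l => a (Fin.succ l), MvPolynomial.isHomogeneous_one _ _,
          by simp, (one_smul _ _).symm⟩
      rw [Fin.sum_univ_succ] at hd
      rw [map_smul, ExteriorAlgebra.ιMulti_succ_apply, contr_ι_mul, smul_sub, smul_smul]
      refine sub_mem ?_ ?_
      · rcases hφ (a 0) with h | ⟨e', he', h⟩
        · rw [h, mul_zero, zero_smul]
          exact zero_mem _
        · convert smul_mem_extPart (hp.mul he') htail using 2
          · push_cast
            linarith
          · rfl
      · convert smul_mem_extPart hp (gen_mul_mem_extPart (a 0) (ih htail)) using 2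
        · linarith
        · rfl
    | zero => rw [map_zero]; exact zero_mem _
    | add a b _ _ ha hb => rw [map_add]; exact add_mem ha hb
    | neg a _ ha => rw [map_neg]; exact neg_mem ha

lemma mem_iSup_extPart (n : ℕ) {ω : ExtAlg (MvPolynomial σ k) I}
    (h : ω ∈ ⋀[MvPolynomial σ k]^n (I →₀ MvPolynomial σ k)) :
    ω ∈ ⨆ d, extPart k σ wt sh n d := by
  have hsmul : ∀ (n : ℕ) (p : MvPolynomial σ k) (ω : ExtAlg (MvPolynomial σ k) I),
      ω ∈ ⨆ d, extPart k σ wt sh n d → p • ω ∈ ⨆ d, extPart k σ wt sh n d := by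
    intro n p ω h
    rw [← MvPolynomial.sum_homogeneousComponent p, Finset.sum_smul]
    refine sum_mem fun e _ => ?_
    induction h using AddSubgroup.iSup_induction' with
    | hp d x hx =>
      exact AddSubgroup.mem_iSup_of_mem _
        (smul_mem_extPart (MvPolynomial.homogeneousComponent_isHomogeneous e p) hx)
    | h1 => rw [smul_zero]; exact zero_mem _
    | hadd x y _ _ hx hy => rw [smul_add]; exact add_mem hx hy
  induction n generalizing ω with
  | zero =>
    rw [ExteriorAlgebra.exteriorPower, pow_zero, Submodule.mem_one] at h
    obtain ⟨r, rfl⟩ := h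
    rw [Algebra.algebraMap_eq_smul_one]
    refine hsmul _ _ _ (AddSubgroup.mem_iSup_of_mem sh (AddSubgroup.subset_closure
      ⟨1, 0, Fin.elim0, MvPolynomial.isHomogeneous_one _ _, by simp, ?_⟩))
    rw [ExteriorAlgebra.ιMulti_zero_apply, one_smul]
  | succ n ih =>
    rw [ExteriorAlgebra.exteriorPower, pow_succ'] at h
    induction h using Submodule.mul_induction_on' with
    | mem_mul_mem a ha b hb =>
      obtain ⟨v, rfl⟩ := ha
      induction v using Finsupp.induction_linear with
      | zero => rw [map_zero, zero_mul]; exact zero_mem _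
      | add v w hv hw => rw [map_add, add_mul]; exact add_mem hv hw
      | single c r =>
        have e : Finsupp.single c r = r • Finsupp.single c (1 : MvPolynomial σ k) := by simp
        rw [e, map_smul, smul_mul_assoc]
        refine hsmul _ _ _ ?_
        have hb' := ih hb
        clear hb
        induction hb' using AddSubgroup.iSup_induction' with
        | hp d x hx => exact AddSubgroup.mem_iSup_of_mem _ (gen_mul_mem_extPart c hx)
        | h1 => rw [mul_zero]; exact zero_mem _
        | hadd x y _ _ hx hy => rw [mul_add]; exact add_mem hx hy
    | add a _ b _ ha hb => exact add_mem ha hb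

lemma extPart_le (n : ℕ) (d : ℤ) {ω : ExtAlg (MvPolynomial σ k) I}
    (h : ω ∈ extPart k σ wt sh n d) : ω ∈ ⋀[MvPolynomial σ k]^n (I →₀ MvPolynomial σ k) := by
  induction h using AddSubgroup.closure_induction with
  | mem ω h =>
    obtain ⟨p, e, a, hp, hd, rfl⟩ := h
    exact Submodule.smul_mem _ _ (ExteriorAlgebra.ιMulti_range _ n (Set.mem_range_self _))
  | zero => exact zero_mem _
  | add a b _ _ ha hb => exact add_mem ha hb
  | neg a _ ha => exact neg_mem ha

end ExtPart

/-- An element involves only finitely many generators, which allows induction on them for an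
arbitrary index set. -/
lemma exists_finset_mem_supp {R : Type u} [CommRing R] {I : Type} (ω : ExtAlg R I) :
    ∃ J : Finset I, ω ∈ supp R (J : Set I) := by
  classical
  induction ω using ext_gen_induction with
  | h0 r => exact ⟨∅, algebraMap_mem_supp _ r⟩
  | hadd a b ha hb =>
    obtain ⟨J, hJ⟩ := ha
    obtain ⟨J', hJ'⟩ := hb
    exact ⟨J ∪ J', add_mem (supp_mono (by simp) hJ) (supp_mono (by simp) hJ')⟩
  | hsmul r a ha =>
    obtain ⟨J, hJ⟩ := ha
    exact ⟨J, Submodule.smul_mem _ r hJ⟩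
  | hmul c a ha =>
    obtain ⟨J, hJ⟩ := ha
    exact ⟨insert c J, gen_mul_mem_supp (by simp) (supp_mono (by simp) hJ)⟩

/-- An element of positive degree with vanishing contractions vanishes. -/
lemma eq_zero_of_contr_coordForm {R : Type u} [CommRing R] {I : Type} {n : ℕ} {ω : ExtAlg R I}
    (hω : ω ∈ ⋀[R]^(n + 1) (I →₀ R)) (h : ∀ c, contr (coordForm R c) ω = 0) : ω = 0 := by
  classical
  obtain ⟨J, hJ⟩ := exists_finset_mem_supp ω
  induction J using Finset.induction_on with
  | empty =>
    obtain ⟨r, rfl⟩ := mem_supp_empty (by simpa using hJ)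
    rw [← extProj_same hω]
    refine extProj_ne (m := 0) ?_ (by omega)
    rw [ExteriorAlgebra.exteriorPower, pow_zero, Submodule.mem_one]
    exact ⟨r, rfl⟩
  | insert c J _ ih =>
    rw [Finset.coe_insert] at hJ
    have := (contr_coord_mem_supp hJ).2
    rw [h, mul_zero, sub_zero] at this
    exact ih this

/-- Induction on the exterior degree: an element of positive exterior degree is detected by its
contractions with the coordinates, and these are homogeneous of lower exterior degree. In exterior
degree zero it is the grading of the polynomial ring. -/
lemma isSeparated_extPart {k : Type u} [CommRing k] {σ I : Type} (wt : I → ℤ) (sh : ℤ) (n : ℕ) :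
    IsSeparated (extPart k σ wt sh n) := by
  induction n with
  | zero =>
    have hinv : ∀ p : MvPolynomial σ k, ExteriorAlgebra.algebraMapInv (R := MvPolynomial σ k)
        (M := I →₀ MvPolynomial σ k) (algebraMap _ _ p) = p := fun p =>
      ExteriorAlgebra.algebraMap_leftInverse (R := MvPolynomial σ k) (I →₀ MvPolynomial σ k) p
    -- Polynomials of degree `e` lie in internal degree `2 * e + sh`. The test discards those `d`
    -- for which `(d - sh) / 2` is rounded or negative, where the part is zero.
    refine isSeparated_of_operators (fun d => if 2 * (((d - sh) / 2).toNat : ℤ) + sh = d then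
      (Algebra.linearMap (MvPolynomial σ k) (ExtAlg (MvPolynomial σ k) I)).toAddMonoidHom.comp
      ((MvPolynomial.homogeneousComponent ((d - sh) / 2).toNat).toAddMonoidHom.comp
        (ExteriorAlgebra.algebraMapInv (R := MvPolynomial σ k)
          (M := I →₀ MvPolynomial σ k)).toLinearMap.toAddMonoidHom) else 0) fun d d' z hz => ?_
    induction hz using AddSubgroup.closure_induction with
    | mem ω h =>
      obtain ⟨p, e, a, hp, hd, rfl⟩ := h
      rw [ExteriorAlgebra.ιMulti_zero_apply,
        ← Algebra.algebraMap_eq_smul_one (A := ExtAlg (MvPolynomial σ k) I)]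
      simp only [Finset.univ_eq_empty, Finset.sum_empty, add_zero] at hd
      by_cases h1 : 2 * (((d - sh) / 2).toNat : ℤ) + sh = d
      · rw [if_pos h1]
        change algebraMap _ (ExtAlg (MvPolynomial σ k) I) (MvPolynomial.homogeneousComponent ((d - sh) / 2).toNat
          (ExteriorAlgebra.algebraMapInv (R := MvPolynomial σ k) (M := I →₀ MvPolynomial σ k)
            (algebraMap _ _ p))) = _
        rw [hinv, MvPolynomial.homogeneousComponent_of_mem hp]
        by_cases hdd : d = d'
        · rw [if_pos hdd, if_pos (by omega)]
        · rw [if_neg hdd, if_neg (by omega), map_zero]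
      · rw [if_neg h1, if_neg (by omega)]
        rfl
    | zero => simp
    | add a b _ _ ha hb => rw [map_add, ha, hb]; split_ifs <;> simp
    | neg a _ ha => rw [map_neg, ha]; split_ifs <;> simp
  | succ n ih =>
    intro F hF h
    ext d
    rw [Finsupp.zero_apply]
    refine eq_zero_of_contr_coordForm (extPart_le n.succ d (hF d)) fun c => ?_
    have h1 := ih.shift (-wt c)
      (Finsupp.mapRange.addMonoidHom (contr (coordForm (MvPolynomial σ k) c)).toAddMonoidHom F)
      (fun d => ?_) ?_
    · exact DFunLike.congr_fun h1 d
    · refine contr_mem_extPart (fun c' => ?_) n (hF d)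
      by_cases hc : c' = c
      · subst hc
        right
        refine ⟨0, ?_, by simp⟩
        simpa [coordForm] using MvPolynomial.isHomogeneous_one σ k
      · left
        simp [coordForm, hc]
    · rw [totalSum_mapRange, h, map_zero]

end KhR

namespace KhR

lemma sum_contractNth {n : ℕ} (j : Fin n) (e : Fin (n + 1) → ℕ) :
    ∑ l, Fin.contractNth j.castSucc (· + ·) e l = ∑ l, e l := by
  have h := congrFun (Fin.partialSum_contractNth e j.castSucc) (Fin.last n)
  have h1 : ∀ {m : ℕ} (f : Fin m → ℕ), Fin.partialSum f (Fin.last m) = ∑ l, f l := by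
    intro m f
    rw [Fin.partialSum, Fin.val_last, List.take_of_length_le (by simp), List.sum_ofFn]
  rw [h1, Function.comp_apply] at h
  rw [h, Fin.succAbove_of_lt_succ _ _ (by simp [Fin.lt_def, j.2]), Fin.succ_last, h1]

/-! ### The internal grading of the Hochschild complex. -/

section GradedBar

variable (k : Type u) [CommRing k] {τ σ : Type}

/-- The elements of internal degree `d` of `M ⊗ k[τ]^{⊗ n}`, for given homogeneous parts of `M`. -/
noncomputable def gradedBar {M : Type u} [AddCommGroup M] [Module k M] (τ : Type)
    (G : ℤ → AddSubgroup M) (n : ℕ) (d : ℤ) : AddSubgroup (M ⊗[k] ⨂[k]^n (MvPolynomial τ k)) :=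
  AddSubgroup.closure {z | ∃ (m : M) (a : ℤ) (u : Fin n → MvPolynomial τ k) (e : Fin n → ℕ),
    m ∈ G a ∧ (∀ l, (u l).IsHomogeneous (e l)) ∧ a + ∑ l, 2 * (e l : ℤ) = d ∧
    z = m ⊗ₜ[k] PiTensorProduct.tprod k u}

section Module

variable {k} {M : Type u} [AddCommGroup M] [Module k M] {G : ℤ → AddSubgroup M}

lemma tmul_mem_gradedBar {n : ℕ} {d a : ℤ} {m : M} {u : Fin n → MvPolynomial τ k} {e : Fin n → ℕ}
    (hm : m ∈ G a) (hu : ∀ l, (u l).IsHomogeneous (e l)) (hd : a + ∑ l, 2 * (e l : ℤ) = d) :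
    m ⊗ₜ[k] PiTensorProduct.tprod k u ∈ gradedBar k τ G n d :=
  AddSubgroup.subset_closure ⟨m, a, u, e, hm, hu, hd, rfl⟩

lemma mem_gradedBar_of_map {N : Type u} [AddCommGroup N] [Module k N] {H : ℤ → AddSubgroup N}
    {n n' : ℕ} {d d' : ℤ} (f : M ⊗[k] ⨂[k]^n (MvPolynomial τ k) →+
      N ⊗[k] ⨂[k]^n' (MvPolynomial τ k))
    (hf : ∀ (m : M) (a : ℤ) (u : Fin n → MvPolynomial τ k) (e : Fin n → ℕ), m ∈ G a →
      (∀ l, (u l).IsHomogeneous (e l)) → a + ∑ l, 2 * (e l : ℤ) = d →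
      f (m ⊗ₜ[k] PiTensorProduct.tprod k u) ∈ gradedBar k τ H n' d')
    {z : M ⊗[k] ⨂[k]^n (MvPolynomial τ k)} (h : z ∈ gradedBar k τ G n d) :
    f z ∈ gradedBar k τ H n' d' := by
  induction h using AddSubgroup.closure_induction with
  | mem z h =>
    obtain ⟨m, a, u, e, hm, hu, hd, rfl⟩ := h
    exact hf m a u e hm hu hd
  | zero => rw [map_zero]; exact zero_mem _
  | add a b _ _ ha hb => rw [map_add]; exact add_mem ha hb
  | neg a _ ha => rw [map_neg]; exact neg_mem ha

lemma mem_iSup_gradedBar (hG : ∀ m : M, m ∈ ⨆ d, G d) (n : ℕ)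
    (z : M ⊗[k] ⨂[k]^n (MvPolynomial τ k)) : z ∈ ⨆ d, gradedBar k τ G n d := by
  have hpure : ∀ (m : M) (u : Fin n → MvPolynomial τ k),
      m ⊗ₜ[k] PiTensorProduct.tprod k u ∈ ⨆ d, gradedBar k τ G n d := by
    intro m u
    have hu : PiTensorProduct.tprod k u =
        ∑ e ∈ Fintype.piFinset fun l => Finset.range ((u l).totalDegree + 1),
          PiTensorProduct.tprod k fun l => MvPolynomial.homogeneousComponent (e l) (u l) := by
      refine Eq.trans ?_ (MultilinearMap.map_sum_finset (PiTensorProduct.tprod k)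
        (fun l e => MvPolynomial.homogeneousComponent e (u l)) _)
      congr 1
      ext1 l
      exact (MvPolynomial.sum_homogeneousComponent (u l)).symm
    rw [hu, TensorProduct.tmul_sum]
    refine sum_mem fun e _ => ?_
    have hm := hG m
    induction hm using AddSubgroup.iSup_induction' with
    | hp a m hm =>
      exact AddSubgroup.mem_iSup_of_mem _ (tmul_mem_gradedBar hm
        (fun l => MvPolynomial.homogeneousComponent_isHomogeneous (e l) (u l)) rfl)
    | h1 => rw [TensorProduct.zero_tmul]; exact zero_mem _
    | hadd x y _ _ hx hy => rw [TensorProduct.add_tmul]; exact add_mem hx hy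
  induction z using TensorProduct.induction_on with
  | zero => exact zero_mem _
  | add x y hx hy => exact add_mem hx hy
  | tmul m w =>
    induction w using PiTensorProduct.induction_on with
    | add x y hx hy => rw [TensorProduct.tmul_add]; exact add_mem hx hy
    | smul_tprod r u =>
      rw [TensorProduct.tmul_smul, TensorProduct.smul_tmul']
      exact hpure _ _

/-- The projection of a tensor power of a polynomial ring to its part of degree `b`. -/
noncomputable def tensorComponent (k : Type u) [CommRing k] (τ : Type) (n b : ℕ) :
    ⨂[k]^n (MvPolynomial τ k) →ₗ[k] ⨂[k]^n (MvPolynomial τ k) :=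
  ∑ e ∈ Finset.piAntidiag (Finset.univ : Finset (Fin n)) b,
    PiTensorProduct.map fun l => MvPolynomial.homogeneousComponent (e l)

lemma tensorComponent_tprod {n : ℕ} (b : ℕ) {u : Fin n → MvPolynomial τ k} {e : Fin n → ℕ}
    (hu : ∀ l, (u l).IsHomogeneous (e l)) :
    tensorComponent k τ n b (PiTensorProduct.tprod k u) =
      if ∑ l, e l = b then PiTensorProduct.tprod k u else 0 := by
  have h1 : ∀ e' : Fin n → ℕ, PiTensorProduct.map
      (fun l => MvPolynomial.homogeneousComponent (R := k) (σ := τ) (e' l))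
      (PiTensorProduct.tprod k u) = if e' = e then PiTensorProduct.tprod k u else 0 := by
    intro e'
    rw [PiTensorProduct.map_tprod]
    split_ifs with h
    · subst h
      congr 1
      ext1 l
      rw [MvPolynomial.homogeneousComponent_of_mem (hu l), if_pos rfl]
    · obtain ⟨l, hl⟩ := Function.ne_iff.1 h
      refine MultilinearMap.map_coord_zero _ l ?_
      rw [MvPolynomial.homogeneousComponent_of_mem (hu l), if_neg hl]
  rw [tensorComponent, LinearMap.sum_apply, Finset.sum_congr rfl fun e' _ => h1 e',
    Finset.sum_ite_eq']
  simp

/-- The projection of `M ⊗ k[τ]^{⊗ n}` to a homogeneous part, for given projections of `M`. -/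
noncomputable def barComponent (p : ℕ → M →ₗ[k] M) (n E : ℕ) :
    M ⊗[k] ⨂[k]^n (MvPolynomial τ k) →ₗ[k] M ⊗[k] ⨂[k]^n (MvPolynomial τ k) :=
  ∑ a ∈ Finset.HasAntidiagonal.antidiagonal E, TensorProduct.map (p a.1) (tensorComponent k τ n a.2)

lemma barComponent_tmul (p : ℕ → M →ₗ[k] M) {n : ℕ} (E : ℕ) {u : Fin n → MvPolynomial τ k}
    {e : Fin n → ℕ} (hu : ∀ l, (u l).IsHomogeneous (e l)) {m : M} {a : ℕ}
    (hm : ∀ a', p a' m = if a' = a then m else 0) :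
    barComponent p n E (m ⊗ₜ[k] PiTensorProduct.tprod k u) =
      if a + ∑ l, e l = E then m ⊗ₜ[k] PiTensorProduct.tprod k u else 0 := by
  have h1 : ∀ x : ℕ × ℕ, TensorProduct.map (p x.1) (tensorComponent k τ n x.2)
      (m ⊗ₜ[k] PiTensorProduct.tprod k u) =
      if x = (a, ∑ l, e l) then m ⊗ₜ[k] PiTensorProduct.tprod k u else 0 := by
    rintro ⟨a', b⟩
    rw [TensorProduct.map_tmul, hm, tensorComponent_tprod b hu]
    by_cases h1 : a' = a
    · by_cases h2 : ∑ l, e l = b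
      · simp [h1, h2]
      · simp [h1, h2, Ne.symm h2]
    · simp [h1]
  rw [barComponent, LinearMap.sum_apply, Finset.sum_congr rfl fun x _ => h1 x, Finset.sum_ite_eq']
  simp

/-- The homogeneous projections of the coefficients and of the polynomial tensor factors combine to
projections of the tensor product. Those of the coefficients have to be assumed, since `G` is only a
family of subgroups. -/
lemma isSeparated_gradedBar (p : ℕ → M →ₗ[k] M) (sh : ℤ)
    (hp : ∀ a : ℤ, ∀ m ∈ G a, m = 0 ∨ ∃ e : ℕ, 2 * (e : ℤ) + sh = a ∧
      ∀ e', p e' m = if e' = e then m else 0) (n : ℕ) :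
    IsSeparated (gradedBar k τ G n) := by
  refine isSeparated_of_operators (fun d => if 2 * (((d - sh) / 2).toNat : ℤ) + sh = d then
    (barComponent p n ((d - sh) / 2).toNat).toAddMonoidHom else 0) fun d d' z hz => ?_
  induction hz using AddSubgroup.closure_induction with
  | mem z h =>
    obtain ⟨m, a, u, e, hm, hu, hd, rfl⟩ := h
    rcases hp a m hm with rfl | ⟨a', ha', hm'⟩
    · rw [TensorProduct.zero_tmul, map_zero, ite_self]
    rw [← Finset.mul_sum, ← Nat.cast_sum] at hd
    by_cases h1 : 2 * (((d - sh) / 2).toNat : ℤ) + sh = d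
    · rw [if_pos h1]
      refine (barComponent_tmul p _ hu hm').trans ?_
      by_cases hdd : d = d'
      · rw [if_pos hdd, if_pos (by omega)]
      · rw [if_neg hdd, if_neg (by omega)]
    · rw [if_neg h1, if_neg (by omega)]
      rfl
  | zero => simp
  | add a b _ _ ha hb => rw [map_add, ha, hb]; split_ifs <;> simp
  | neg a _ ha => rw [map_neg, ha]; split_ifs <;> simp

end Module

section Ring

variable {k} {M : Type u} [AddCommGroup M] [Module k M] [Module (MvPolynomial σ k) M]
  [IsScalarTower k (MvPolynomial σ k) M] {G : ℤ → AddSubgroup M}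

lemma smul_mem_gradedBar (hG : ∀ (r : MvPolynomial σ k) (e : ℕ) (m : M) (a : ℤ), r.IsHomogeneous e →
    m ∈ G a → r • m ∈ G (a + 2 * e)) {n : ℕ} {d : ℤ} {r : MvPolynomial σ k} {e : ℕ}
    (hr : r.IsHomogeneous e) {z : M ⊗[k] ⨂[k]^n (MvPolynomial τ k)} (h : z ∈ gradedBar k τ G n d) :
    r • z ∈ gradedBar k τ G n (d + 2 * e) := by
  refine mem_gradedBar_of_map (DistribSMul.toAddMonoidHom _ r) (fun m a u e' hm hu hd => ?_) h
  change r • (m ⊗ₜ[k] PiTensorProduct.tprod k u) ∈ gradedBar k τ G n (d + 2 * e)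
  rw [TensorProduct.smul_tmul']
  exact tmul_mem_gradedBar (hG r e m a hr hm) hu (by rw [← hd]; ring)

/-- Every face only multiplies homogeneous factors together, so the Hochschild differential has
internal degree `0`. -/
lemma barD_mem_gradedBar (hG : ∀ (r : MvPolynomial σ k) (e : ℕ) (m : M) (a : ℤ), r.IsHomogeneous e →
    m ∈ G a → r • m ∈ G (a + 2 * e)) {lact ract : MvPolynomial τ k →ₐ[k] MvPolynomial σ k}
    (hl : ∀ u (e : ℕ), u.IsHomogeneous e → (lact u).IsHomogeneous e)
    (hr : ∀ u (e : ℕ), u.IsHomogeneous e → (ract u).IsHomogeneous e) {n : ℕ} {d : ℤ}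
    {z : M ⊗[k] ⨂[k]^(n + 1) (MvPolynomial τ k)} (h : z ∈ gradedBar k τ G (n + 1) d) :
    barD k lact ract M n z ∈ gradedBar k τ G n d := by
  refine mem_gradedBar_of_map (barD k lact ract M n).toAddMonoidHom (fun m a u e hm hu hd => ?_) h
  change barD k lact ract M n (m ⊗ₜ[k] PiTensorProduct.tprod k u) ∈ gradedBar k τ G n d
  rw [barD_tmul]
  refine add_mem (add_mem ?_ (sum_mem fun j _ => zsmul_mem ?_ _)) (zsmul_mem ?_ _)
  · refine tmul_mem_gradedBar (hG _ (e 0) m a (hr _ _ (hu 0)) hm) (e := Fin.tail e)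
      (fun l => hu l.succ) ?_
    rw [← hd, Fin.sum_univ_succ]
    simp only [Fin.tail]
    ring
  · refine tmul_mem_gradedBar hm (e := Fin.contractNth j.castSucc (· + ·) e) (fun l => ?_) ?_
    · unfold Fin.contractNth
      split_ifs
      · exact hu _
      · exact (hu _).mul (hu _)
      · exact hu _
    · rw [← hd, ← Finset.mul_sum, ← Finset.mul_sum, ← Nat.cast_sum, ← Nat.cast_sum, sum_contractNth]
  · refine tmul_mem_gradedBar (hG _ (e (Fin.last n)) m a (hl _ _ (hu _)) hm) (e := Fin.init e)
      (fun l => hu l.castSucc) ?_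
    rw [← hd, Fin.sum_univ_castSucc]
    simp only [Fin.init]
    ring

/-- Inserting an element of polynomial degree `e₀` raises the internal degree by `2 * e₀`; for a
variable this is the shift by `2` per tensor factor. -/
lemma sh_mem_gradedBar {c : MvPolynomial τ k} {e₀ : ℕ} (hc : c.IsHomogeneous e₀) {n : ℕ} {d : ℤ}
    {z : M ⊗[k] ⨂[k]^n (MvPolynomial τ k)} (h : z ∈ gradedBar k τ G n d) :
    sh k (R := MvPolynomial σ k) M n c z ∈ gradedBar k τ G (n + 1) (d + 2 * e₀) := by
  refine mem_gradedBar_of_map (sh k (R := MvPolynomial σ k) M n c).toAddMonoidHom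
    (fun m a u e hm hu hd => ?_) h
  change sh k (R := MvPolynomial σ k) M n c (m ⊗ₜ[k] PiTensorProduct.tprod k u) ∈
    gradedBar k τ G (n + 1) (d + 2 * e₀)
  rw [sh_tmul, shTensor_tprod, TensorProduct.tmul_sum]
  refine sum_mem fun l hl => ?_
  have hl' : l < n + 1 := Finset.mem_range.1 hl
  suffices hins : m ⊗ₜ[k] PiTensorProduct.tprod k (insVec l c u) ∈
      gradedBar k τ G (n + 1) (d + 2 * e₀) by
    rcases Nat.even_or_odd l with h | h
    · rwa [h.neg_one_pow, one_smul]
    · rw [h.neg_one_pow, neg_smul, one_smul, TensorProduct.tmul_neg]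
      exact neg_mem hins
  refine tmul_mem_gradedBar hm
    (e := Fin.insertNth (α := fun _ => ℕ) ⟨l, hl'⟩ e₀ e) (fun j => ?_) ?_
  · have := insVec_eq ⟨l, hl'⟩ c u
    simp only at this
    rw [this]
    refine Fin.succAboveCases ⟨l, hl'⟩ ?_ (fun j => ?_) j
    · simpa using hc
    · simpa using hu j
  · rw [Fin.sum_univ_succAbove _ ⟨l, hl'⟩]
    simp only [Fin.insertNth_apply_same, Fin.insertNth_apply_succAbove]
    rw [← hd]
    ring

end Ring

end GradedBar

end KhR

/-! ### Internal degrees of the naive terms. -/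

namespace KhR

/-- The degrees of the generators are chosen such that the Koszul differential has internal degree
`2`; the zero entry of a circle counts as homogeneous of degree one. -/
lemma isHomogeneous_seq {b : Boundary} (k : Type u) [CommRing k] (T : TangleDiagram b)
    (s : T.Xing → Bool) (c : T.Gen) :
    ∃ e : ℕ, (T.seq k s c).IsHomogeneous e ∧ 2 * (e : ℤ) = T.genDeg s c + 2 := by
  have hX : ∀ v : T.Var, (MvPolynomial.X v : T.Poly k).IsHomogeneous 1 :=
    fun v => MvPolynomial.isHomogeneous_X k v
  cases c with
  | edge e => exact ⟨1, (hX _).sub (hX _), rfl⟩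
  | circ c => exact ⟨1, MvPolynomial.isHomogeneous_zero _ _ _, rfl⟩
  | fst x =>
    refine ⟨1, ?_, rfl⟩
    simp only [TangleDiagram.seq]
    split_ifs
    · exact (hX _).sub (hX _)
    · exact (((hX _).add (hX _)).sub (hX _)).sub (hX _)
  | snd x =>
    simp only [TangleDiagram.seq, TangleDiagram.genDeg]
    split_ifs
    · exact ⟨1, (hX _).sub (hX _), rfl⟩
    · exact ⟨2, ((hX _).mul (hX _)).sub ((hX _).mul (hX _)), rfl⟩

namespace ClosedArcDiagram

open TangleDiagram

variable (k : Type u) [CommRing k] (η : ClosedArcDiagram) (T : ∀ j, TangleDiagram (η.bdry j))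
  (s : η.AllXing T → Bool)

/-- The internal shift of the term of a smoothing of the naive complex. -/
def totalShift : ℤ := ∑ j, (T j).shift (part s j)

lemma shift_paste : (η.paste T).shift s = η.totalShift T s := by
  unfold shift totalShift
  exact (Fintype.sum_equiv ofLex _ (fun x : Σ j, (T j).Xing =>
    if (T x.1).positive x.2 = false ∧ part s x.1 x.2 = false then (-2 : ℤ) else 0)
    (fun x => rfl)).trans (Fintype.sum_sigma _)

variable {s}

lemma C_smul_mem_naivePart (c : k) {a : ℤ} {m : η.NaiveTensor k T s}
    (hm : m ∈ η.naivePart k T s a) :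
    (MvPolynomial.C c : η.AllPoly k T) • m ∈ η.naivePart k T s a := by
  induction hm using AddSubgroup.closure_induction with
  | mem m h =>
    obtain ⟨c', p, e, hp, hd, rfl⟩ := h
    refine AddSubgroup.subset_closure ⟨c * c', p, e, hp, hd, ?_⟩
    rw [smul_eq, ← MvPolynomial.algebraMap_eq, AlgHom.commutes, ← Algebra.smul_def, smul_smul]
  | zero => rw [smul_zero]; exact zero_mem _
  | add a b _ _ ha hb => rw [smul_add]; exact add_mem ha hb
  | neg a _ ha => rw [smul_neg]; exact neg_mem ha

lemma X_smul_mem_naivePart (v : Σ j, (T j).Var) {a : ℤ} {m : η.NaiveTensor k T s}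
    (hm : m ∈ η.naivePart k T s a) :
    (MvPolynomial.X v : η.AllPoly k T) • m ∈ η.naivePart k T s (a + 2) := by
  induction hm using AddSubgroup.closure_induction with
  | mem m h =>
    obtain ⟨c, p, e, hp, hd, rfl⟩ := h
    obtain ⟨i, v⟩ := v
    refine AddSubgroup.subset_closure
      ⟨c, Function.update p i (MvPolynomial.X v * p i), Function.update e i (1 + e i), ?_, ?_, ?_⟩
    · intro j
      by_cases hj : j = i
      · subst hj
        rw [Function.update_self, Function.update_self]
        exact (MvPolynomial.isHomogeneous_X k v).mul (hp j)
      · rw [Function.update_of_ne hj, Function.update_of_ne hj]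
        exact hp j
    · rw [← hd, ← Finset.add_sum_erase _ _ (Finset.mem_univ i),
        ← Finset.add_sum_erase _ (fun j => 2 * (e j : ℤ) + (T j).shift (part s j))
          (Finset.mem_univ i), Function.update_self]
      rw [Finset.sum_congr rfl fun j hj => by rw [Function.update_of_ne (Finset.ne_of_mem_erase hj)]]
      push_cast
      ring
    · rw [smul_eq, mul_smul_comm, actHom_X, pure_mul]
      congr 2
      ext j
      by_cases hj : j = i
      · subst hj
        rw [Pi.mul_apply, Pi.mulSingle_eq_same, Function.update_self, map_mul]
      · rw [Pi.mul_apply, Pi.mulSingle_eq_of_ne hj, one_mul, Function.update_of_ne hj]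
  | zero => rw [smul_zero]; exact zero_mem _
  | add a b _ _ ha hb => rw [smul_add]; exact add_mem ha hb
  | neg a _ ha => rw [smul_neg]; exact neg_mem ha

lemma monomial_smul_mem_naivePart (f : (Σ j, (T j).Var) →₀ ℕ) (c : k) {a : ℤ}
    {m : η.NaiveTensor k T s} (hm : m ∈ η.naivePart k T s a) :
    (MvPolynomial.monomial f c : η.AllPoly k T) • m ∈ η.naivePart k T s (a + 2 * f.degree) := by
  induction f using Finsupp.induction_linear generalizing c a m with
  | zero => simpa using η.C_smul_mem_naivePart k T c hm
  | add f g hf hg =>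
    have h : (MvPolynomial.monomial (f + g) c : η.AllPoly k T) =
        MvPolynomial.monomial f c * MvPolynomial.monomial g 1 := by
      rw [MvPolynomial.monomial_mul, mul_one]
    rw [h, mul_smul]
    convert hf c (hg 1 hm) using 2
    rw [map_add]
    push_cast
    ring
  | single v n =>
    induction n with
    | zero => simpa using η.C_smul_mem_naivePart k T c hm
    | succ n ih =>
      have h : (MvPolynomial.monomial (Finsupp.single v (n + 1)) c : η.AllPoly k T) =
          MvPolynomial.X v * MvPolynomial.monomial (Finsupp.single v n) c := by
        rw [MvPolynomial.X, MvPolynomial.monomial_mul, one_mul, ← Finsupp.single_add, add_comm]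
      rw [h, mul_smul]
      convert η.X_smul_mem_naivePart k T v ih using 2
      simp only [Finsupp.degree_single]
      push_cast
      ring

lemma smul_mem_naivePart (r : η.AllPoly k T) (e : ℕ) (m : η.NaiveTensor k T s) (a : ℤ)
    (hr : r.IsHomogeneous e) (hm : m ∈ η.naivePart k T s a) :
    r • m ∈ η.naivePart k T s (a + 2 * e) := by
  rw [r.as_sum, Finset.sum_smul]
  refine sum_mem fun f hf => ?_
  have h := η.monomial_smul_mem_naivePart k T f (MvPolynomial.coeff f r) hm
  have hfe : f.degree = e := by
    rw [Finsupp.degree_eq_weight_one]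
    exact hr (MvPolynomial.mem_support_iff.1 hf)
  rwa [hfe] at h

variable (s)

lemma one_mem_naivePart : (1 : η.NaiveTensor k T s) ∈ η.naivePart k T s (η.totalShift T s) := by
  refine AddSubgroup.subset_closure ⟨1, fun _ => 1, fun _ => 0,
    fun j => MvPolynomial.isHomogeneous_one _ _, by simp [totalShift], ?_⟩
  rw [one_smul]
  simp only [map_one]
  rfl

lemma mem_iSup_naivePart (m : η.NaiveTensor k T s) : m ∈ ⨆ a, η.naivePart k T s a := by
  obtain ⟨r, rfl⟩ := η.actHom_surjective k T s m
  have h : η.actHom k T s r = r • (1 : η.NaiveTensor k T s) := by rw [smul_eq, mul_one]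
  rw [h, ← MvPolynomial.sum_homogeneousComponent r, Finset.sum_smul]
  exact sum_mem fun e _ => AddSubgroup.mem_iSup_of_mem _ (η.smul_mem_naivePart k T _ e _ _
    (MvPolynomial.homogeneousComponent_isHomogeneous e r) (η.one_mem_naivePart k T s))

/-- Lifting to homogeneous polynomials reduces the grading of the naive term to that of the ring.
Zero is listed separately because it also lies in parts whose degree is not of the form `2 * e` plus
the shift. -/
lemma exists_homogeneous_of_mem_naivePart {a : ℤ} {m : η.NaiveTensor k T s}
    (hm : m ∈ η.naivePart k T s a) : m = 0 ∨ ∃ (e : ℕ) (r : η.AllPoly k T), r.IsHomogeneous e ∧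
      2 * (e : ℤ) + η.totalShift T s = a ∧ η.actHom k T s r = m := by
  induction hm using AddSubgroup.closure_induction with
  | mem m h =>
    obtain ⟨c, p, e, hp, hd, rfl⟩ := h
    right
    refine ⟨∑ j, e j, MvPolynomial.C c * ∏ j, MvPolynomial.rename (Sigma.mk j) (p j), ?_, ?_, ?_⟩
    · have := (MvPolynomial.isHomogeneous_C (Σ j, (T j).Var) c).mul
        (MvPolynomial.IsHomogeneous.prod Finset.univ
          (fun j => MvPolynomial.rename (Sigma.mk j) (p j)) e
          fun j _ => (hp j).rename_isHomogeneous)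
      rwa [zero_add] at this
    · rw [← hd, Finset.sum_add_distrib, ← Finset.mul_sum, totalShift]
      push_cast
      rfl
    · rw [map_mul, ← MvPolynomial.algebraMap_eq, AlgHom.commutes, ← Algebra.smul_def, map_prod,
        pure_eq_prod]
      congr 1
      exact Finset.prod_congr rfl fun j _ => actHom_rename k η T s j (p j)
  | zero => exact Or.inl rfl
  | add x y _ _ hx hy =>
    rcases hx with rfl | ⟨e, r, hr, he, rfl⟩
    · rw [zero_add]
      exact hy
    · rcases hy with rfl | ⟨e', r', hr', he', rfl⟩
      · rw [add_zero]
        exact Or.inr ⟨e, r, hr, he, rfl⟩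
      · obtain rfl : e = e' := by omega
        exact Or.inr ⟨e, r + r', hr.add hr', he, map_add _ _ _⟩
  | neg x _ hx =>
    rcases hx with rfl | ⟨e, r, hr, he, rfl⟩
    · rw [neg_zero]
      exact Or.inl rfl
    · exact Or.inr ⟨e, -r, hr.neg, he, map_neg _ _⟩

-- The kernel is generated by homogeneous elements, so it contains the components of each of its
-- members. Taking components therefore descends to the naive term.
attribute [local instance] MvPolynomial.gradedAlgebra in
lemma actHom_homogeneousComponent_eq_zero (e : ℕ) {r : η.AllPoly k T}
    (hr : η.actHom k T s r = 0) :
    η.actHom k T s (MvPolynomial.homogeneousComponent e r) = 0 := by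
  rw [actHom_eq_zero_iff] at hr ⊢
  have hI : (Ideal.span (η.allSeq k T s '' Set.range Sum.inl)).IsHomogeneous
      (MvPolynomial.homogeneousSubmodule (Σ j, (T j).Var) k) := by
    refine Ideal.homogeneous_span _ _ ?_
    rintro _ ⟨_, ⟨c, rfl⟩, rfl⟩
    obtain ⟨e, he, -⟩ := isHomogeneous_seq k (T c.1) (part s c.1) c.2
    exact ⟨e, he.rename_isHomogeneous⟩
  have h := hI e hr
  rwa [← MvPolynomial.decomposition.decompose'_apply]

attribute [local instance] baseModule baseModule_tower

/-- The projections of the terms of the naive complex to their homogeneous parts. -/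
lemma exists_naiveComponent (e : ℕ) :
    ∃ p : (η.naiveCube k T).obj s →ₗ[k] (η.naiveCube k T).obj s, ∀ r : η.AllPoly k T,
      p (η.naiveProj k T s r) = η.naiveProj k T s (MvPolynomial.homogeneousComponent e r) := by
  let π := (η.naiveProj k T s).restrictScalars k
  have hπ : Function.Surjective π := η.actHom_surjective k T s
  have hker : LinearMap.ker π ≤
      LinearMap.ker (π ∘ₗ MvPolynomial.homogeneousComponent e) := fun r hr =>
    η.actHom_homogeneousComponent_eq_zero k T s e hr
  refine ⟨(Submodule.liftQ _ _ hker) ∘ₗ (LinearMap.quotKerEquivOfSurjective π hπ).symm.toLinearMap,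
    fun r => ?_⟩
  have h1 : (LinearMap.quotKerEquivOfSurjective π hπ).symm (π r) = Submodule.Quotient.mk r := by
    rw [LinearEquiv.symm_apply_eq]
    rfl
  change Submodule.liftQ _ _ hker ((LinearMap.quotKerEquivOfSurjective π hπ).symm (π r)) = _
  rw [h1]
  rfl

lemma barPart_eq (n : ℕ) (d : ℤ) : η.barPart k T s n d =
    gradedBar k η.Arc (M := (η.naiveCube k T).obj s) (η.naivePart k T s) n d := rfl

lemma isSeparated_barPart (n : ℕ) : IsSeparated (η.barPart k T s n) := by
  choose p hp using η.exists_naiveComponent k T s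
  refine isSeparated_gradedBar (M := (η.naiveCube k T).obj s) p (η.totalShift T s)
    (fun a m hm => ?_) n
  rcases η.exists_homogeneous_of_mem_naivePart k T s hm with h | ⟨e, r, hr, he, h⟩
  · exact Or.inl h
  · refine Or.inr ⟨e, he, fun e' => ?_⟩
    have h' : η.naiveProj k T s r = m := h
    rw [← h', hp, MvPolynomial.homogeneousComponent_of_mem hr]
    split_ifs
    · rfl
    · exact map_zero _

lemma mem_iSup_barPart (n : ℕ)
    (z : (η.naiveCube k T).obj s ⊗[k] ⨂[k]^n (η.ArcPoly k)) : z ∈ ⨆ d, η.barPart k T s n d :=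
  mem_iSup_gradedBar (M := (η.naiveCube k T).obj s) (η.mem_iSup_naivePart k T s) n z

lemma barD_mem_barPart {n : ℕ} {d : ℤ}
    {z : (η.naiveCube k T).obj s ⊗[k] ⨂[k]^(n + 1) (η.ArcPoly k)}
    (hz : z ∈ η.barPart k T s (n + 1) d) :
    barD k (η.leftAct k T) (η.rightAct k T) _ n z ∈ η.barPart k T s n d :=
  barD_mem_gradedBar (M := (η.naiveCube k T).obj s) (η.smul_mem_naivePart k T)
    (fun _ _ hu => hu.rename_isHomogeneous) (fun _ _ hu => hu.rename_isHomogeneous) hz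

end ClosedArcDiagram

end KhR

namespace KhR

/-! ### The comparison map and the internal degree. -/

section KoszulPart

open TangleDiagram

variable {b : Boundary} (k : Type u) [CommRing k] (T : TangleDiagram b) (s : T.Xing → Bool)

lemma mem_koszulPart_iff {n : ℕ} {d : ℤ} {ω : ⋀[T.Poly k]^n (T.Gen →₀ T.Poly k)} :
    ω ∈ T.koszulPart k s n d ↔ ω.1 ∈ extPart k T.Var (T.genDeg s) (T.shift s) n d := by
  have h : (T.koszulPart k s n d).map (Submodule.subtype _).toAddMonoidHom =
      extPart k T.Var (T.genDeg s) (T.shift s) n d := by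
    rw [koszulPart, AddMonoidHom.map_closure, extPart]
    congr 1
    ext z
    constructor
    · rintro ⟨_, ⟨p, e, a, hp, hd, rfl⟩, rfl⟩
      exact ⟨p, e, a, hp, hd, rfl⟩
    · rintro ⟨p, e, a, hp, hd, rfl⟩
      exact ⟨_, ⟨p, e, a, hp, hd, rfl⟩, rfl⟩
  rw [← h]
  constructor
  · intro hω
    exact ⟨ω, hω, rfl⟩
  · rintro ⟨ω', h', h''⟩
    rwa [← Subtype.ext (a1 := ω') (a2 := ω) h'']

lemma isSeparated_koszulPart (n : ℕ) : IsSeparated (T.koszulPart k s n) := by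
  intro F hF h
  have h1 := isSeparated_extPart (k := k) (σ := T.Var) (T.genDeg s) (T.shift s) n
    (Finsupp.mapRange.addMonoidHom (Submodule.subtype _).toAddMonoidHom F)
    (fun d => (mem_koszulPart_iff k T s).1 (hF d)) (by
      rw [totalSum_mapRange, h, map_zero])
  ext1 d
  exact Subtype.ext (DFunLike.congr_fun h1 d)

lemma mem_iSup_koszulPart {n : ℕ} (ω : ⋀[T.Poly k]^n (T.Gen →₀ T.Poly k)) :
    ω ∈ ⨆ d, T.koszulPart k s n d := by
  obtain ⟨F, hF, h⟩ := exists_totalSum_eq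
    (mem_iSup_extPart (k := k) (wt := T.genDeg s) (sh := T.shift s) n ω.2)
  have hω : ω = F.sum fun d _ => ⟨F d, extPart_le n d (hF d)⟩ := by
    refine Subtype.ext ?_
    rw [← h, totalSum, Finsupp.liftAddHom_apply, Finsupp.sum, Finsupp.sum,
      AddSubmonoidClass.coe_finsetSum]
    rfl
  rw [hω]
  exact sum_mem fun d _ => AddSubgroup.mem_iSup_of_mem d ((mem_koszulPart_iff k T s).2 (hF d))

lemma koszulD_mem_koszulPart {n : ℕ} {d : ℤ}
    {ω : ⋀[T.Poly k]^(n + 1) (T.Gen →₀ T.Poly k)} (h : ω ∈ T.koszulPart k s (n + 1) d) :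
    koszulD (T.seq k s) n ω ∈ T.koszulPart k s n (d + 2) := by
  rw [mem_koszulPart_iff] at h ⊢
  refine contr_mem_extPart (φ := koszulForm (T.seq k s)) (fun c => Or.inr ?_) n h
  rw [koszulForm_single]
  exact isHomogeneous_seq k T s c

end KoszulPart

lemma shTot_apply_succ {k : Type u} [CommRing k] {U R M : Type u} [CommRing U] [Algebra k U]
    [CommRing R] [Algebra k R] [AddCommGroup M] [Module k M] [Module R M] [IsScalarTower k R M]
    (c : U) (z : BarTot k U M) (n : ℕ) :
    shTot k M R c z (n + 1) = sh k (R := R) M n c (z n) := by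
  induction z using barTot_induction with
  | h0 => simp
  | hadd a b ha hb => rw [map_add, DirectSum.add_apply, ha, hb, DirectSum.add_apply, map_add]
  | h m z =>
    rw [← DirectSum.lof_eq_of R, shTot_lof, DirectSum.lof_eq_of, DirectSum.lof_eq_of]
    by_cases h : n = m
    · subst h
      rw [DirectSum.of_eq_same, DirectSum.of_eq_same]
    · rw [DirectSum.of_eq_of_ne _ _ _ (by omega), DirectSum.of_eq_of_ne _ _ _ h, map_zero]

namespace ClosedArcDiagram

open TangleDiagram

variable (k : Type u) [CommRing k] (η : ClosedArcDiagram) (T : ∀ j, TangleDiagram (η.bdry j))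
  (s : η.AllXing T → Bool)

lemma isHomogeneous_arcElt (c : η.AllGen T) : (η.arcElt k T c).IsHomogeneous 1 := by
  cases c with
  | inl c => exact MvPolynomial.isHomogeneous_zero _ _ _
  | inr α => exact MvPolynomial.isHomogeneous_X k α

/-- The generators of the pasted diagram are combinations with integral coefficients, so the
substitution of generators does not change internal degrees. -/
lemma strandVec_mem_closure (z : (η.AllXing T × Bool) ⊕ η.Arc) : η.strandVec k T z ∈
    AddSubgroup.closure (Set.range fun c : η.AllGen T => Finsupp.single c (1 : η.AllPoly k T)) := by
  refine sum_mem fun l _ => add_mem (AddSubgroup.subset_closure ⟨_, rfl⟩) ?_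
  rcases (η.follow T ^ l) z with x | α
  · exact zero_mem _
  · exact AddSubgroup.subset_closure ⟨_, rfl⟩

lemma pasteVec_mem_closure (c : (η.paste T).Gen) : η.pasteVec k T c ∈
    AddSubgroup.closure (Set.range fun c : η.AllGen T => Finsupp.single c (1 : η.AllPoly k T)) := by
  rcases c with (a | p) | (c | o) | x | x
  · exact η.strandVec_mem_closure k T _
  · exact p.1.elim0
  · exact AddSubgroup.subset_closure ⟨_, rfl⟩
  · exact η.strandVec_mem_closure k T _
  · exact AddSubgroup.subset_closure ⟨_, rfl⟩
  · exact AddSubgroup.subset_closure ⟨_, rfl⟩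

/-- The polynomials whose image in the term of a smoothing has a given internal degree. -/
noncomputable def polyPart (d : ℤ) : AddSubgroup (η.AllPoly k T) :=
  (η.naivePart k T s d).comap (η.naiveProj k T s).toAddMonoidHom

lemma smul_mem_polyPart (r : η.AllPoly k T) (e : ℕ) (m : η.AllPoly k T) (a : ℤ)
    (hr : r.IsHomogeneous e) (hm : m ∈ η.polyPart k T s a) :
    r • m ∈ η.polyPart k T s (a + 2 * e) := by
  have h := η.smul_mem_naivePart k T r e (η.naiveProj k T s m) a hr hm
  have h' : η.naiveProj k T s (r • m) = r • η.naiveProj k T s m := map_smul _ _ _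
  exact (congrArg (fun z => z ∈ η.naivePart k T s (a + 2 * e)) h').mpr h

lemma shLin_mem_gradedBar {v : η.AllGen T →₀ η.AllPoly k T} (hv : v ∈ AddSubgroup.closure
      (Set.range fun c : η.AllGen T => Finsupp.single c (1 : η.AllPoly k T)))
    {z : BarTot k (η.ArcPoly k) (η.AllPoly k T)} {n : ℕ} {d : ℤ}
    (hz : z n ∈ gradedBar k η.Arc (η.polyPart k T s) n d) :
    shLin k (η.arcElt k T) (η.AllPoly k T) v z (n + 1) ∈
      gradedBar k η.Arc (η.polyPart k T s) (n + 1) (d + 2) := by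
  induction hv using AddSubgroup.closure_induction with
  | mem v h =>
    obtain ⟨c, rfl⟩ := h
    rw [shLin_single, one_smul, shTot_apply_succ]
    exact sh_mem_gradedBar (η.isHomogeneous_arcElt k T c) hz
  | zero => rw [map_zero]; exact zero_mem _
  | add a b _ _ ha hb =>
    rw [map_add, LinearMap.add_apply, DirectSum.add_apply]
    exact add_mem ha hb
  | neg a _ ha =>
    rw [map_neg, LinearMap.neg_apply]
    exact neg_mem ha

/-- A generator of internal degree `0` turns into shuffles with elements of internal degree `2`,
whence the extra `2`. The second generator of a crossing may have degree `2`, but its multiples are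
sent to zero. -/
lemma pasteToBar_gen_mul_mem (c : (η.paste T).Gen)
    {ω : ExtAlg ((η.paste T).Poly k) (η.paste T).Gen} {n : ℕ} {d : ℤ}
    (hω : η.pasteToBar k T ω n ∈ gradedBar k η.Arc (η.polyPart k T s) n d) :
    η.pasteToBar k T (gen _ c * ω) (n + 1) ∈
      gradedBar k η.Arc (η.polyPart k T s) (n + 1) (d + (η.paste T).genDeg s c + 2) := by
  have h : ∀ c, (η.paste T).genDeg s c = 0 → η.pasteToBar k T (gen _ c * ω) (n + 1) ∈
      gradedBar k η.Arc (η.polyPart k T s) (n + 1) (d + (η.paste T).genDeg s c + 2) := by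
    intro c hc
    rw [hc, add_zero, pasteToBar_apply, pasteExt, extMap_gen_mul, koszulToBar_ι_mul]
    exact η.shLin_mem_gradedBar k T s (η.pasteVec_mem_closure k T c) hω
  rcases c with e | c | x | x
  · exact h _ rfl
  · exact h _ rfl
  · exact h _ rfl
  · have := pasteToBar_ι_mul_of_fst_snd (η := η) (T := T) k x 0 1 ω
    rw [Finsupp.single_zero, zero_add] at this
    rw [gen, this]
    exact zero_mem _

lemma pasteToBar_ιMulti_mem {n : ℕ} (a : Fin n → (η.paste T).Gen) :
    η.pasteToBar k T (ExteriorAlgebra.ιMulti ((η.paste T).Poly k) n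
      fun l => Finsupp.single (a l) (1 : (η.paste T).Poly k)) n ∈
      gradedBar k η.Arc (η.polyPart k T s) n
        (∑ l, (η.paste T).genDeg s (a l) + (η.paste T).shift s + 2 * n) := by
  induction n with
  | zero =>
    rw [ExteriorAlgebra.ιMulti_zero_apply, pasteToBar_apply, map_one, ← map_one (algebraMap (η.AllPoly k T) _),
      koszulToBar_algebraMap, DirectSum.lof_eq_of, DirectSum.of_eq_same]
    refine tmul_mem_gradedBar (a := η.totalShift T s) (e := Fin.elim0) ?_ (fun l => l.elim0) ?_
    · have h := η.one_mem_naivePart k T s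
      have h' : η.naiveProj k T s 1 = (1 : η.NaiveTensor k T s) := map_one (η.actHom k T s)
      rw [← h'] at h
      exact h
    · rw [shift_paste]
      simp
  | succ n ih =>
    rw [ExteriorAlgebra.ιMulti_succ_apply]
    have := η.pasteToBar_gen_mul_mem k T s (a 0) (ih fun l => a l.succ)
    rw [show ∑ l, (η.paste T).genDeg s (a l) + (η.paste T).shift s + 2 * ((n + 1 : ℕ) : ℤ) =
        ∑ l : Fin n, (η.paste T).genDeg s (a l.succ) + (η.paste T).shift s + 2 * n +
          (η.paste T).genDeg s (a 0) + 2 by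
      rw [Fin.sum_univ_succ]
      push_cast
      ring]
    exact this

attribute [local instance] baseModule baseModule_tower

lemma toBarX_mem_barPart {n : ℕ} {d : ℤ}
    {ω : ⋀[(η.paste T).Poly k]^n ((η.paste T).Gen →₀ (η.paste T).Poly k)}
    (h : ω ∈ (η.paste T).koszulPart k s n d) :
    η.toBarX k T s n ω ∈ η.barPart k T s n (d + 2 * n) := by
  induction h using AddSubgroup.closure_induction with
  | mem ω h =>
    obtain ⟨p, e, a, hp, hd, rfl⟩ := h
    have h1 := smul_mem_gradedBar (η.smul_mem_polyPart k T s)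
      (hp.rename_isHomogeneous (f := η.pasteVar T)) (η.pasteToBar_ιMulti_mem k T s a)
    have h2 : η.toBarX k T s n (p • exteriorPower.ιMulti ((η.paste T).Poly k) n
        fun l => Finsupp.single (a l) (1 : (η.paste T).Poly k)) =
        TensorProduct.AlgebraTensorModule.map (η.naiveProj k T s) LinearMap.id
          (η.pasteHom k T p • η.pasteToBar k T (ExteriorAlgebra.ιMulti ((η.paste T).Poly k) n
            fun l => Finsupp.single (a l) (1 : (η.paste T).Poly k)) n) := by
      rw [toBarX_apply, toBar_apply, barTotMap_apply]
      congr 1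
      exact congrArg (fun z => z n) (pasteToBar_smul k η T p _)
    rw [h2, barPart_eq]
    rw [show d + 2 * (n : ℤ) = ∑ l, (η.paste T).genDeg s (a l) + (η.paste T).shift s + 2 * n +
      2 * e by rw [← hd]; ring]
    exact mem_gradedBar_of_map (TensorProduct.AlgebraTensorModule.map (η.naiveProj k T s)
      (LinearMap.id (R := k) (M := ⨂[k]^n (η.ArcPoly k)))).toAddMonoidHom
      (fun m a u e hm hu hd => tmul_mem_gradedBar hm hu hd) h1
  | zero => rw [map_zero]; exact zero_mem _
  | add a b _ _ ha hb => rw [map_add]; exact add_mem ha hb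
  | neg a _ ha => rw [map_neg]; exact neg_mem ha

end ClosedArcDiagram

end KhR

/-! ### Homogeneous homology classes. -/

namespace KhR

section Homogeneous

variable {A A' B B' : Type*} [AddCommGroup A] [AddCommGroup A'] [AddCommGroup B] [AddCommGroup B']
  {GA : ℤ → AddSubgroup A} {GA' : ℤ → AddSubgroup A'} {GB : ℤ → AddSubgroup B}
  {GB' : ℤ → AddSubgroup B'}

/-- If a cycle is mapped to a homogeneous element up to a boundary, so is a homogeneous cycle. -/
lemma exists_homogeneous_cycle (hA : ∀ x, x ∈ ⨆ d, GA d) (hA' : IsSeparated GA')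
    (hB : IsSeparated GB) (hB' : ∀ x, x ∈ ⨆ d, GB' d) (δ : A →+ A')
    (hδ : ∀ d, ∀ x ∈ GA d, δ x ∈ GA' d) (f : A →+ B) (hf : ∀ d, ∀ x ∈ GA d, f x ∈ GB d)
    (D : B' →+ B) (hD : ∀ d, ∀ x ∈ GB' d, D x ∈ GB d) {x : A} (hx : δ x = 0) {d : ℤ} {y : B}
    (hy : y ∈ GB d) {g : B'} (h : f x = y + D g) :
    ∃ x' ∈ GA d, δ x' = 0 ∧ ∃ g', f x' = y + D g' := by
  obtain ⟨F, hF, rfl⟩ := exists_totalSum_eq (hA x)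
  obtain ⟨F', hF', rfl⟩ := exists_totalSum_eq (hB' g)
  -- Both relations, `δ x = 0` and `f x - y - D g = 0`, are vanishing sums of homogeneous terms.
  -- Since the parts are separated, each holds in degree `d` alone, where `y` is present.
  have h1 := hA' (Finsupp.mapRange.addMonoidHom δ F) (fun e => hδ e _ (hF e)) (by
    rw [totalSum_mapRange, hx])
  have h2 := hB (Finsupp.mapRange.addMonoidHom f F - Finsupp.single d y -
    Finsupp.mapRange.addMonoidHom D F') (fun e => by
      refine sub_mem (sub_mem (hf e _ (hF e)) ?_) (hD e _ (hF' e))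
      by_cases hde : d = e
      · subst hde
        rwa [Finsupp.single_eq_same]
      · rw [Finsupp.single_eq_of_ne (Ne.symm hde)]
        exact zero_mem _) (by
    rw [map_sub, map_sub, totalSum_mapRange, totalSum_mapRange, totalSum_single, h]
    abel)
  refine ⟨F d, hF d, DFunLike.congr_fun h1 d, F' d, ?_⟩
  have h3 := DFunLike.congr_fun h2 d
  have h4 : f (F d) - y - D (F' d) = 0 := by
    rw [Finsupp.sub_apply, Finsupp.sub_apply, Finsupp.single_eq_same] at h3
    exact h3
  rw [sub_sub, sub_eq_zero] at h4
  exact h4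

end Homogeneous

namespace ClosedArcDiagram

open TangleDiagram

variable (k : Type u) [CommRing k] (η : ClosedArcDiagram) {T : ∀ j, TangleDiagram (η.bdry j)}
  (hT : ∀ j, (T j).IsAcyclic) (s : η.AllXing T → Bool)

attribute [local instance] baseModule baseModule_tower

lemma exists_mem_koszulPart_toBarX_eq (i : ℕ) (x : (η.termKoszul k s).X i)
    (hx : ∀ j, ((η.termKoszul k s).d i j).hom x = 0) {d : ℤ} {y : (η.termBar k s).X i}
    (hy : y ∈ η.barPart k T s i (d + 2 * i)) {g : (η.termBar k s).X (i + 1)}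
    (h : η.toBarX k T s i x = y + ((η.termBar k s).d (i + 1) i).hom g) :
    ∃ x' : (η.termKoszul k s).X i, x' ∈ (η.paste T).koszulPart k s i d ∧
      (∀ j, ((η.termKoszul k s).d i j).hom x' = 0) ∧
      ∃ g', η.toBarX k T s i x' = y + ((η.termBar k s).d (i + 1) i).hom g' := by
  have hD : ∀ d : ℤ, ∀ g ∈ η.barPart k T s (i + 1) (d + 2 * i),
      ((η.termBar k s).d (i + 1) i).hom.toAddMonoidHom g ∈ η.barPart k T s i (d + 2 * i) := by
    intro d g hg
    rw [barComplex_d]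
    exact η.barD_mem_barPart k T s hg
  have hA := mem_iSup_koszulPart k (η.paste T) s (n := i)
  have hB := (η.isSeparated_barPart k T s i).shift (2 * i)
  have hB' : ∀ g, g ∈ ⨆ d : ℤ, η.barPart k T s (i + 1) (d + 2 * i) := by
    intro g
    rw [iSup_shift]
    exact η.mem_iSup_barPart k T s (i + 1) g
  have hf : ∀ d : ℤ, ∀ x ∈ (η.paste T).koszulPart k s i d,
      η.toBarX k T s i x ∈ η.barPart k T s i (d + 2 * i) := fun d x hx =>
    η.toBarX_mem_barPart k T s hx
  cases i with
  | zero =>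
    -- In degree zero every chain is a cycle, so the zero map takes the place of the differential.
    obtain ⟨x', hx', -, g', hg'⟩ := exists_homogeneous_cycle hA
      (isSeparated_koszulPart k (η.paste T) s 0) hB hB' 0 (fun d x _ => zero_mem _)
      (η.toBarX k T s 0) hf ((η.termBar k s).d 1 0).hom.toAddMonoidHom hD
      (AddMonoidHom.zero_apply x) hy h
    refine ⟨x', hx', fun j => ?_, g', hg'⟩
    rw [(η.termKoszul k s).shape _ _ (by simp)]
    rfl
  | succ i =>
    obtain ⟨x', hx', h0, g', hg'⟩ := exists_homogeneous_cycle hA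
      ((isSeparated_koszulPart k (η.paste T) s i).shift 2) hB hB'
      ((η.termKoszul k s).d (i + 1) i).hom.toAddMonoidHom (fun d x hx => by
        rw [krCube_d]
        exact koszulD_mem_koszulPart k (η.paste T) s hx)
      (η.toBarX k T s (i + 1)) hf ((η.termBar k s).d (i + 2) (i + 1)).hom.toAddMonoidHom hD
      (hx i) hy h
    refine ⟨x', hx', fun j => ?_, g', hg'⟩
    by_cases hj : j = i
    · subst hj
      exact h0
    · rw [(η.termKoszul k s).shape _ _ (fun h => hj (by simpa using h))]
      rfl

include hT

/-- An isomorphism of the Koszul homology of the term of a smoothing with its Hochschild homology that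
is induced by `toBarX` respects the internal degree. -/
lemma mem_termHomologyPart_iff (i : ℕ) (e : (η.paste T).termHomology k i s ≅ η.termHH k T i s)
    (he : ∀ (c : (η.termKoszul k s).cycles i) (c' : (η.termBar k s).cycles i),
      ((η.termBar k s).iCycles i).hom c' =
        η.toBarX k T s i (((η.termKoszul k s).iCycles i).hom c) →
      e.hom.hom (((η.termKoszul k s).homologyπ i).hom c) = ((η.termBar k s).homologyπ i).hom c')
    (d : ℤ) (z : (η.paste T).termHomology k i s) :
    z ∈ (η.paste T).termHomologyPart k i s d ↔ e.hom z ∈ η.termHHPart k T i s (d + 2 * i) := by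
  constructor
  · rintro ⟨c, hc, rfl⟩
    obtain ⟨c', hc'⟩ := exists_cycle_toBarX k η hT s i c
    have h := he c c' hc'
    refine ⟨c', ?_, h.symm⟩
    have h2 := η.toBarX_mem_barPart k T s hc
    exact (congrArg (fun y => y ∈ η.barPart k T s i (d + 2 * i)) hc').mpr h2
  · rintro ⟨c', hc', h⟩
    obtain ⟨c, rfl⟩ := homologyπ_surjective (η.termKoszul k s) i z
    obtain ⟨c₁, hc₁⟩ := exists_cycle_toBarX k η hT s i c
    have h1 := he c c₁ hc₁
    have h2 : ((η.termBar k s).homologyπ i).hom (c₁ - c') = 0 := by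
      rw [map_sub, sub_eq_zero]
      exact h1.symm.trans h.symm
    obtain ⟨g, hg⟩ := (homologyπ_eq_zero_iff (η.termBar k s) i _).1 h2
    rw [map_sub, hc₁] at hg
    -- A representative of `z` is mapped to the homogeneous cycle `c'` up to a boundary; its
    -- component of degree `d` is again a cycle with this property, and by injectivity of `e` it
    -- represents `z`.
    obtain ⟨x, hx, hx0, g', hg'⟩ := η.exists_mem_koszulPart_toBarX_eq k s i _
      (fun j => d_iCycles (η.termKoszul k s) i j c) hc'
      (sub_eq_iff_eq_add'.1 hg.symm)
    obtain ⟨c₂, rfl⟩ := exists_iCycles_eq (η.termKoszul k s) i x hx0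
    obtain ⟨c₃, hc₃⟩ := exists_cycle_toBarX k η hT s i c₂
    refine ⟨c₂, hx, ?_⟩
    have h3 : ((η.termBar k s).homologyπ i).hom (c₃ - c') = 0 := by
      refine (homologyπ_eq_zero_iff (η.termBar k s) i _).2 ⟨g', ?_⟩
      rw [map_sub, hc₃, hg']
      exact (add_sub_cancel_left _ _).symm
    have hinj : Function.Injective e.hom.hom :=
      (ModuleCat.mono_iff_injective e.hom).1 inferInstance
    apply hinj
    refine (he c₂ c₃ hc₃).trans ?_
    rw [map_sub, sub_eq_zero] at h3
    exact h3.trans h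

end ClosedArcDiagram

end KhR

theorem proposition3p2 {k : Type u} [CommRing k] (η : ClosedArcDiagram)
    (T : ∀ j, TangleDiagram (η.bdry j)) (hT : ∀ j, (T j).IsAcyclic) (i : ℕ) :
    ∃ (e : ∀ s : η.AllXing T → Bool, (η.paste T).termHomology k i s ≅ η.termHH k T i s)
      (Φ : (η.paste T).horizontalHomology k i ≅ η.hochschildComplex k T i),
      (∀ (j : ℤ) (s : {s : η.AllXing T → Bool // vdeg (η.allPositive T) s = j}),
        Φ.hom.f j ≫ (η.HH k T i ⋙ η.restrict k T).map ((η.naiveCube k T).proj s) =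
          (HomologicalComplex.homologyFunctor _ _ i).map (((η.paste T).krCube k).proj s) ≫
            (e s.1).hom) ∧
      (∀ (x : η.AllXing T) (s s' : η.AllXing T → Bool) (h : Step (η.allPositive T) x s s'),
        (e s).hom ≫ (η.HH k T i ⋙ η.restrict k T).map ((η.naiveCube k T).map h) =
          (HomologicalComplex.homologyFunctor _ _ i).map (((η.paste T).krCube k).map h) ≫
            (e s').hom) ∧
      (∀ (s : η.AllXing T → Bool) (d : ℤ) (z : (η.paste T).termHomology k i s),
        z ∈ (η.paste T).termHomologyPart k i s d ↔
          (e s).hom z ∈ η.termHHPart k T i s (d + 2 * i)) := by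
  -- The description `he` on representing cycles is kept along with the isomorphisms: naturality and
  -- the statement on degrees are both derived from it.
  choose e he using fun s => ClosedArcDiagram.exists_termHomology_iso k η hT s i
  have hnat : ∀ (x : η.AllXing T) (s s' : η.AllXing T → Bool) (h : Step (η.allPositive T) x s s'),
      (e s).hom ≫ (η.HH k T i ⋙ η.restrict k T).map ((η.naiveCube k T).map h) =
        (HomologicalComplex.homologyFunctor _ _ i).map (((η.paste T).krCube k).map h) ≫
          (e s').hom := fun x s s' h =>
    ClosedArcDiagram.termHomology_iso_naturality k η hT i h (e s) (e s') (he s) (he s')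
  obtain ⟨Φ, hΦ⟩ := exists_total_iso (C := η.AllXing T) (pos := η.allPositive T)
    (HomologicalComplex.homologyFunctor (ModuleCat.{u} ((η.paste T).Poly k)) (ComplexShape.down ℕ) i)
    (η.HH k T i ⋙ η.restrict k T) ((η.paste T).krCube k) (η.naiveCube k T) e hnat
  exact ⟨e, Φ, hΦ, hnat, fun s =>
    ClosedArcDiagram.mem_termHomologyPart_iff k η hT s i (e s) (he s)⟩
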